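/- **Setting.** Let $G=(A\cup B,E)$ be a finite bipartite graph with $n$ vertices and $m$ edges. Each vertex has a linearly ordered list of disjoint nonempty ties that contains exactly its neighbours. Call the vertices in $A$ men and those in $B$ women. Write $x\succ_v y$, $x=_v y$, $x\succeq_v y$ for strict preference, indifference and weak preference of $v$. A matching $M$ is super-stable if no edge $(x,y)\in E\setminus M$ is such that each of $x,y$ is unmatched in $M$ or weakly prefers the other to its partner. For matchings $M,N$ write $M\succeq N$ if every man weakly prefers his situation in $M$ (being matched is better than being unmatched), and $M\succ N$ if moreover some man strictly prefers $M$. Let $\mathcal M_G$ be the set of super-stable matchings. For $M,N\in\mathcal M_G$, $N$ is a strict successor of $M$ if $M\succ N$ and there is no $P\in\mathcal M_G$ with $M\succ P\succ N$. A maximal sequence is a sequence $M_0,\dots,M_z$ in $\mathcal M_G$ in which $M_0$ is man-optimal, $M_z$ is woman-optimal, and each $M_{i+1}$ is a strict successor of $M_i$. A rotation is a symmetric difference $\rho=M\oplus N$, where $N$ is a strict successor of $M\in\mathcal M_G$. Let $D(\mathcal M_G)$ be the set of rotations. For $\rho',\rho\in D(\mathcal M_G)$ let $\rho'\prec\rho$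 if $\rho'$ appears before $\rho$ (as a difference of consecutive members) on every maximal sequence. A set $S\subseteq D(\mathcal M_G)$ is closed if $\rho\in S$ and $\rho'\prec\rho$ imply $\rho'\in S$. A rotation $\rho$ moves $a\in A$ from $b$ down to $b'$ if $(a,b),(a,b')\in\rho$ and $b\succ_a b'$. It moves $b\in B$ from $a$ up to $a'$ if $(a,b),(a',b)\in\rho$ and $a'\succ_b a$. The rotation digraph on $D(\mathcal M_G)$ has an edge $(\rho',\rho)$ in the following two cases. * (Type 1) For some $a\in A$ and $b\in B$, $\rho'$ moves $a$ down to $b$ and $\rho$ moves $a$ down from $b$. * (Type 2) $\rho'\ne\rho$, and for some edge $(a,b)\in E$, $\rho$ moves $a$ from some $b_1\succeq_a b$ down to some $b_2\preceq_a b$ with $b_2\neq b$, and $\rho'$ moves $b$ from some $a_1\preceq_b a$ up to some $a_2\succ_b a$. **Theorem (rotation poset in $O(mn)$).** 1. For every such $G$: * If $\mathcal M_G\neq\emptyset$, there is a maximal sequence, and every maximal sequence contains each rotation exactly once. * The relation $\prec$ is a strict partial order on $D(\mathcal M_G)$. * If $M_0$ is a man-optimal super-stable matching, then $S\mapsto M_0\oplus\bigoplus_{\rho\in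 S}\rho$ is a bijection from the closed subsets of $D(\mathcal M_G)$ onto $\mathcal M_G$. For closed $S,S'$, the matching of $S$ dominates ($\succeq$) the matching of $S'$ if and only if $S\subseteq S'$. * The transitive closure of the rotation digraph is $\prec$. 2. There is a program for a word RAM (unit-cost operations on words of $O(\log(m+n))$ bits) which, given the preference lists of any such $G$ preceded by $|A|$, $|B|$ and $m$, halts after at most $C\,(mn+1)$ steps, with a constant $C$ independent of $G$. If $\mathcal M_G=\emptyset$, it reports this. Otherwise it outputs * the man-optimal super-stable matching $M_0$; * a list $\rho_1,\dots,\rho_z$ that contains every rotation of $G$ exactly once, such that $M_i=M_{i-1}\oplus\rho_i$ ($1\le i\le z$) defines a maximal sequence $M_0,\dots,M_z$; * a list of exactly the edges of the rotation digraph, whose transitive closure is $\prec$. -/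

import Mathlib

open scoped symmDiff

namespace SuperStable

/-! ## Instances -/

/-- A bipartite graph with incomplete preference lists and ties.  The adjacency list of each vertex
is a list of ties, best tie first; ties are nonempty and disjoint, and a vertex `b` is on the list
of `a` exactly if `a` is on the list of `b`.  The side `A` are the men, the side `B` the women. -/
structure Instance (A B : Type*) where
  prefA : A → List (List B)
  prefB : B → List (List A)
  nonemptyA : ∀ a, [] ∉ prefA a
  nonemptyB : ∀ b, [] ∉ prefB b
  nodupA : ∀ a, (prefA a).flatten.Nodup
  nodupB : ∀ b, (prefB b).flatten.Nodup
  mutual_adj : ∀ a b, b ∈ (prefA a).flatten ↔ a ∈ (prefB b).flatten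

section Matchings

variable {A B : Type*} [Fintype A] [Fintype B] [DecidableEq A] [DecidableEq B]

/-- The edge set of the bipartite graph. -/
def Instance.edges (G : Instance A B) : Finset (A × B) :=
  Finset.univ.filter fun e => e.2 ∈ (G.prefA e.1).flatten

/-- The position of the tie that contains `b` on the list of `a` (smaller is better). -/
def Instance.rankA (G : Instance A B) (a : A) (b : B) : ℕ :=
  (G.prefA a).findIdx fun tie => decide (b ∈ tie)

/-- The position of the tie that contains `a` on the list of `b` (smaller is better). -/
def Instance.rankB (G : Instance A B) (b : B) (a : A) : ℕ :=
  (G.prefB b).findIdx fun tie => decide (a ∈ tie)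

/-- A matching is a set of pairwise disjoint edges. -/
def IsMatching (G : Instance A B) (M : Finset (A × B)) : Prop :=
  M ⊆ G.edges ∧ ∀ e ∈ M, ∀ f ∈ M, e.1 = f.1 ∨ e.2 = f.2 → e = f

/-- The edge `(a, b)` outside `M` blocks `M` if each of `a`, `b` is unmatched or weakly prefers the
other one to its partner. -/
def Blocks (G : Instance A B) (M : Finset (A × B)) (a : A) (b : B) : Prop :=
  (a, b) ∈ G.edges ∧ (a, b) ∉ M ∧
    (∀ b', (a, b') ∈ M → G.rankA a b ≤ G.rankA a b') ∧
    (∀ a', (a', b) ∈ M → G.rankB b a ≤ G.rankB b a')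

def IsSuperStable (G : Instance A B) (M : Finset (A × B)) : Prop :=
  IsMatching G M ∧ ∀ a b, ¬ Blocks G M a b

/-- `M` dominates `N`: each man weakly prefers his situation in `M` to the one in `N`
(being matched is better than being unmatched). -/
def Dominates (G : Instance A B) (M N : Finset (A × B)) : Prop :=
  ∀ a b', (a, b') ∈ N → ∃ b, (a, b) ∈ M ∧ G.rankA a b ≤ G.rankA a b'

/-- `M` strictly dominates `N`, i.e. `N` is a successor of `M`: moreover some man strictly prefers
`M` to `N`. -/
def StrictlyDominates (G : Instance A B) (M N : Finset (A × B)) : Prop :=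
  Dominates G M N ∧
    ∃ a b, (a, b) ∈ M ∧ ∀ b', (a, b') ∈ N → G.rankA a b < G.rankA a b'

/-- A super-stable matching that dominates all super-stable matchings. -/
def IsManOptimal (G : Instance A B) (M : Finset (A × B)) : Prop :=
  IsSuperStable G M ∧ ∀ N, IsSuperStable G N → Dominates G M N

/-- A super-stable matching that every woman weakly prefers to all super-stable matchings. -/
def IsWomanOptimal (G : Instance A B) (M : Finset (A × B)) : Prop :=
  IsSuperStable G M ∧ ∀ N, IsSuperStable G N →
    ∀ b a', (a', b) ∈ N → ∃ a, (a, b) ∈ M ∧ G.rankB b a ≤ G.rankB b a'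

/-- `N` is a strict successor of `M`: both are super-stable, `M` strictly dominates `N`, and there
is no super-stable matching strictly between them. -/
def IsStrictSuccessor (G : Instance A B) (M N : Finset (A × B)) : Prop :=
  IsSuperStable G M ∧ IsSuperStable G N ∧ StrictlyDominates G M N ∧
    ¬ ∃ P, IsSuperStable G P ∧ StrictlyDominates G M P ∧ StrictlyDominates G P N

/-- A maximal sequence of super-stable matchings: it starts with a man-optimal one, ends with a
woman-optimal one, and each member is a strict successor of the previous one. -/
def IsMaximalSequence (G : Instance A B) (L : List (Finset (A × B))) : Prop :=
  (∃ M ∈ L.head?, IsManOptimal G M) ∧ (∃ M ∈ L.getLast?, IsWomanOptimal G M) ∧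
    L.IsChain (IsStrictSuccessor G)

/-! ## Rotations and their order -/

/-- A rotation is the symmetric difference of a super-stable matching and one of its strict
successors. -/
def IsRotation (G : Instance A B) (ρ : Finset (A × B)) : Prop :=
  ∃ M N, IsStrictSuccessor G M N ∧ ρ = M ∆ N

/-- The symmetric differences of consecutive members of a sequence, in order. -/
def differences (L : List (Finset (A × B))) : List (Finset (A × B)) :=
  List.zipWith (· ∆ ·) L L.tail

/-- The precedence relation on rotations: `ρ'` appears before `ρ` on every maximal sequence. -/
def Precedes (G : Instance A B) (ρ' ρ : Finset (A × B)) : Prop :=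
  IsRotation G ρ' ∧ IsRotation G ρ ∧
    ∀ L, IsMaximalSequence G L → List.Sublist [ρ', ρ] (differences L)

/-- A closed set of rotations: with a rotation it contains all rotations that precede it. -/
def IsClosedSet (G : Instance A B) (S : Finset (Finset (A × B))) : Prop :=
  (∀ ρ ∈ S, IsRotation G ρ) ∧ ∀ ρ ∈ S, ∀ ρ', Precedes G ρ' ρ → ρ' ∈ S

/-- Elimination of a set of rotations from `M`: the symmetric difference of `M` and all members
of `S`. -/
def eliminate (M : Finset (A × B)) (S : Finset (Finset (A × B))) : Finset (A × B) :=
  S.fold (· ∆ ·) M id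

/-- `ρ` moves the man `a` from `b` down to `b'`. -/
def MovesDown (G : Instance A B) (ρ : Finset (A × B)) (a : A) (b b' : B) : Prop :=
  (a, b) ∈ ρ ∧ (a, b') ∈ ρ ∧ G.rankA a b < G.rankA a b'

/-- `ρ` moves the woman `b` from `a` up to `a'`. -/
def MovesUp (G : Instance A B) (ρ : Finset (A × B)) (b : B) (a a' : A) : Prop :=
  (a, b) ∈ ρ ∧ (a', b) ∈ ρ ∧ G.rankB b a' < G.rankB b a

/-- `ρ` moves `a` past `b`: it moves `a` from a woman at least as good as `b` to a woman other than
`b` that is not better than `b`. -/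
def MovesPast (G : Instance A B) (ρ : Finset (A × B)) (a : A) (b : B) : Prop :=
  ∃ b₁ b₂, MovesDown G ρ a b₁ b₂ ∧ b₂ ≠ b ∧ G.rankA a b₁ ≤ G.rankA a b ∧ G.rankA a b ≤ G.rankA a b₂

/-- `ρ` moves `b` above `a`: it moves `b` from a man not better than `a` to a man strictly better
than `a`. -/
def MovesAbove (G : Instance A B) (ρ : Finset (A × B)) (b : B) (a : A) : Prop :=
  ∃ a₁ a₂, MovesUp G ρ b a₁ a₂ ∧ G.rankB b a₂ < G.rankB b a ∧ G.rankB b a ≤ G.rankB b a₁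

/-- Type 1: `ρ'` moves some man down to the woman from whom `ρ` moves him away. -/
def TypeOne (G : Instance A B) (ρ' ρ : Finset (A × B)) : Prop :=
  ∃ a b₁ b b₂, MovesDown G ρ' a b₁ b ∧ MovesDown G ρ a b b₂

/-- Type 2: for some edge `(a, b)`, `ρ` moves `a` past `b` and another rotation `ρ'` moves `b`
above `a`. -/
def TypeTwo (G : Instance A B) (ρ' ρ : Finset (A × B)) : Prop :=
  ρ' ≠ ρ ∧ ∃ a b, (a, b) ∈ G.edges ∧ MovesPast G ρ a b ∧ MovesAbove G ρ' b a

/-- The edges of the rotation digraph. -/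
def LabelEdge (G : Instance A B) (ρ' ρ : Finset (A × B)) : Prop :=
  IsRotation G ρ' ∧ IsRotation G ρ ∧ (TypeOne G ρ' ρ ∨ TypeTwo G ρ' ρ)

end Matchings

/-! ## Word RAM programs with a step count -/

inductive Op where
  | add | sub | mul | lt | eq

/-- Subtraction is truncated; comparisons yield `1` or `0`. -/
def Op.eval : Op → ℕ → ℕ → ℕ
  | .add, x, y => x + y
  | .sub, x, y => x - y
  | .mul, x, y => x * y
  | .lt, x, y => if x < y then 1 else 0
  | .eq, x, y => if x = y then 1 else 0

/-- A memory state: registers and arrays of words, both indexed by natural numbers. A program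
mentions only finitely many registers and arrays. -/
structure State where
  reg : ℕ → ℕ
  arr : ℕ → ℕ → ℕ

/-- Expressions: constants, registers, indirect reads `arr k [e]`, and operations. -/
inductive Exp where
  | const (c : ℕ)
  | reg (r : ℕ)
  | read (k : ℕ) (e : Exp)
  | op (o : Op) (e₁ e₂ : Exp)

def Exp.eval (s : State) : Exp → ℕ
  | .const c => c
  | .reg r => s.reg r
  | .read k e => s.arr k (e.eval s)
  | .op o e₁ e₂ => o.eval (e₁.eval s) (e₂.eval s)

/-- The number of elementary operations in the evaluation of an expression. -/
def Exp.size : Exp → ℕ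
  | .const _ => 1
  | .reg _ => 1
  | .read _ e => e.size + 1
  | .op _ e₁ e₂ => e₁.size + e₂.size + 1

/-- All values that occur in the evaluation, addresses included, are words, i.e. below `W`. -/
def Exp.Fits (W : ℕ) (s : State) : Exp → Prop
  | .const c => c < W
  | .reg r => s.reg r < W
  | .read k e => e.Fits W s ∧ s.arr k (e.eval s) < W
  | .op o e₁ e₂ => e₁.Fits W s ∧ e₂.Fits W s ∧ o.eval (e₁.eval s) (e₂.eval s) < W

inductive Cmd where
  | skip
  | assign (r : ℕ) (e : Exp)
  | store (k : ℕ) (i e : Exp)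
  | seq (c₁ c₂ : Cmd)
  | cond (e : Exp) (c₁ c₂ : Cmd)
  | loop (e : Exp) (c : Cmd)

def State.setReg (s : State) (r v : ℕ) : State :=
  { s with reg := Function.update s.reg r v }

def State.setArr (s : State) (k i v : ℕ) : State :=
  { s with arr := Function.update s.arr k (Function.update (s.arr k) i v) }

/-- `Exec W c s t s'`: started in the state `s`, the program `c` halts after exactly `t` steps in
the state `s'`, and every value and address that occurs is a word below `W`. A test is true if its
value is nonzero. -/
inductive Exec (W : ℕ) : Cmd → State → ℕ → State → Prop
  | skip (s : State) : Exec W .skip s 1 s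
  | assign (s : State) (r : ℕ) (e : Exp) (he : e.Fits W s) :
      Exec W (.assign r e) s (e.size + 1) (s.setReg r (e.eval s))
  | store (s : State) (k : ℕ) (i e : Exp) (hi : i.Fits W s) (he : e.Fits W s) :
      Exec W (.store k i e) s (i.size + e.size + 1) (s.setArr k (i.eval s) (e.eval s))
  | seq (c₁ c₂ : Cmd) (s s₁ s₂ : State) (t₁ t₂ : ℕ)
      (h₁ : Exec W c₁ s t₁ s₁) (h₂ : Exec W c₂ s₁ t₂ s₂) :
      Exec W (.seq c₁ c₂) s (t₁ + t₂) s₂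
  | condTrue (e : Exp) (c₁ c₂ : Cmd) (s s' : State) (t : ℕ) (he : e.Fits W s)
      (hv : e.eval s ≠ 0) (h : Exec W c₁ s t s') :
      Exec W (.cond e c₁ c₂) s (e.size + 1 + t) s'
  | condFalse (e : Exp) (c₁ c₂ : Cmd) (s s' : State) (t : ℕ) (he : e.Fits W s)
      (hv : e.eval s = 0) (h : Exec W c₂ s t s') :
      Exec W (.cond e c₁ c₂) s (e.size + 1 + t) s'
  | loopDone (e : Exp) (c : Cmd) (s : State) (he : e.Fits W s) (hv : e.eval s = 0) :
      Exec W (.loop e c) s (e.size + 1) s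
  | loopStep (e : Exp) (c : Cmd) (s s₁ s₂ : State) (t₁ t₂ : ℕ) (he : e.Fits W s)
      (hv : e.eval s ≠ 0) (h₁ : Exec W c s t₁ s₁) (h₂ : Exec W (.loop e c) s₁ t₂ s₂) :
      Exec W (.loop e c) s (e.size + 1 + t₁ + t₂) s₂

/-- The initial state: array `0` holds the input, everything else is `0`. -/
def initialState (input : List ℕ) : State where
  reg := fun _ => 0
  arr := fun k i => if k = 0 then input.getD i 0 else 0

/-- The output is written to array `1`, from address `0` on. -/
def HasOutput (s : State) (out : List ℕ) : Prop :=
  ∀ i (hi : i < out.length), s.arr 1 i = out[i]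

/-! ## Input and output formats -/

/-- A preference list: the number of ties, then each tie as its length and its members. -/
def encodeTies {c : ℕ} (L : List (List (Fin c))) : List ℕ :=
  L.length :: L.flatMap fun tie => tie.length :: tie.map Fin.val

/-- An instance: the numbers of men, women and edges, then all preference lists. -/
def encodeInstance {a b : ℕ} (G : Instance (Fin a) (Fin b)) : List ℕ :=
  [a, b, G.edges.card] ++ (List.finRange a).flatMap (fun x => encodeTies (G.prefA x)) ++
    (List.finRange b).flatMap (fun y => encodeTies (G.prefB y))

/-- A list of pairs: its length, then the pairs. -/
def encodePairs (L : List (ℕ × ℕ)) : List ℕ :=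
  L.length :: L.flatMap fun p => [p.1, p.2]

/-- The result of the construction: a matching, a list of rotations, and a digraph on the positions
of that list. -/
structure RotationPoset (a b : ℕ) where
  start : List (Fin a × Fin b)
  rotations : List (List (Fin a × Fin b))
  arcs : List (ℕ × ℕ)

/-- The given matching, then the number of rotations and all rotations, then all arcs. -/
def RotationPoset.encode {a b : ℕ} (R : RotationPoset a b) : List ℕ :=
  encodePairs (R.start.map fun p => (p.1.val, p.2.val)) ++
    R.rotations.length ::
      (R.rotations.flatMap fun ρ => encodePairs (ρ.map fun p => (p.1.val, p.2.val))) ++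
    encodePairs R.arcs

/-- The rotations in the output, as sets of edges. -/
def RotationPoset.rotationSets {a b : ℕ} (R : RotationPoset a b) : List (Finset (Fin a × Fin b)) :=
  R.rotations.map List.toFinset

/-- The output is right for `G`: the given matching is man-optimal, eliminating the listed rotations
one after the other gives a maximal sequence of super-stable matchings, the list contains every
rotation of `G` exactly once, and the arcs are exactly the edges of the rotation digraph.
(Each list of edges is free of repetitions.) -/
def RotationPoset.IsCorrect {a b : ℕ} (R : RotationPoset a b) (G : Instance (Fin a) (Fin b)) :
    Prop :=
  R.start.Nodup ∧ (∀ ρ ∈ R.rotations, ρ.Nodup) ∧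
    IsManOptimal G R.start.toFinset ∧
    IsMaximalSequence G (R.rotationSets.scanl (· ∆ ·) R.start.toFinset) ∧
    R.rotationSets.Nodup ∧ (∀ ρ, ρ ∈ R.rotationSets ↔ IsRotation G ρ) ∧
    ∀ i j, (i, j) ∈ R.arcs ↔
      ∃ ρ' ∈ R.rotationSets[i]?, ∃ ρ ∈ R.rotationSets[j]?, LabelEdge G ρ' ρ

end SuperStable

open SuperStable

/-! Structure. Let M and N be super-stable. An edge of one that is missing from the other has an end
that strictly gains in the other matching. Counting these ends in both directions turns every
estimate into an equality (`sdiff_structure`): both matchings cover the same vertices, nobody is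
indifferent between two different partners, and the two ends of a differing edge have opposite
interests. Hence a super-stable matching is determined by its height vector, the ranks of the men's
partners; dominance is the pointwise order of heights, and pointwise minima and maxima of heights
are again heights of super-stable matchings (`height_join`, `height_meet`). The super-stable
matchings thus form a distributive lattice of integer vectors.

If Q is a strict successor of P and R is super-stable, then the matching with heights max(P, min(R,
Q)) is P or Q. So R lies on one side of all moves of the rotation at once
(`IsStrictSuccessor.dichotomy`), and it makes sense to say that R has passed the rotation. Each step
to a strict successor passes exactly one new rotation (`passedSet_eq_insert`). Therefore R arises
from the man-optimal matching by eliminating its passed rotations, and precedence means: passed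
whenever the other one is passed.

For the digraph, a label of either type forces precedence. Conversely, if M has passed all label
predecessors of a rotation but not the rotation itself, then carrying out its moves in M yields a
strict successor of M (`isSuperStable_exchange`). Every label-closed set of rotations is thus
reached greedily (`exists_passedSet_eq`), and the transitive closure of the labels is precedence.

Algorithm. Men propose to whole ties at a time; a woman whose best proposals tie rejects all of
them. The invariant is a bound on the partner of each woman in every matching of a target set
(`Target`). When nobody is active, the held edges form a super-stable matching or the target set is
empty, by a counting argument (`succeeds_of_target`). If the woman of a man x then rejects him and
the proposals continue, the result is the best super-stable matching in which x is worse off.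
Repeating this gives at most one matching per edge of x. The proposal pointers only advance, so one
man costs O(m) proposals and O(n) for each matching written down; over all men this is O(mn).

From the current matching, a scan over the next stored matchings of the men finds a minimal one, and
its meet with the current matching is a strict successor (`isStrictSuccessor_meet`). Each rotation
costs O(n), and there are at most m of them, because each uses up an edge. Finally every edge (x, y)
is inspected in O(n): at most one rotation moves y above x, and a scan over the women finds those
that move x past y. The programs are verified with weakest preconditions that carry time credits, so
that correctness, running time and word size are proved together. -/

set_option linter.unusedSectionVars false

namespace SuperStable

/-! ### Comparison of super-stable matchings and their lattice -/

section Lattice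

variable {A B : Type*} [Fintype A] [Fintype B] [DecidableEq A] [DecidableEq B]
  {G : Instance A B} {M N P Q : Finset (A × B)}

theorem Instance.mem_edges {a : A} {b : B} : (a, b) ∈ G.edges ↔ b ∈ (G.prefA a).flatten := by
  simp [Instance.edges]

theorem IsMatching.right_unique (hM : IsMatching G M) {a : A} {b b' : B}
    (h : (a, b) ∈ M) (h' : (a, b') ∈ M) : b = b' :=
  congrArg Prod.snd (hM.2 _ h _ h' (Or.inl rfl))

theorem IsMatching.left_unique (hM : IsMatching G M) {a a' : A} {b : B}
    (h : (a, b) ∈ M) (h' : (a', b) ∈ M) : a = a' :=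
  congrArg Prod.fst (hM.2 _ h _ h' (Or.inr rfl))

/-! ### Exchanging the two sides -/

/-- The instance in which men and women exchange their roles. -/
def Instance.swap (G : Instance A B) : Instance B A where
  prefA := G.prefB
  prefB := G.prefA
  nonemptyA := G.nonemptyB
  nonemptyB := G.nonemptyA
  nodupA := G.nodupB
  nodupB := G.nodupA
  mutual_adj := fun b a => (G.mutual_adj a b).symm

/-- The matching with its pairs reversed. -/
def flip (M : Finset (A × B)) : Finset (B × A) := M.map (Equiv.prodComm A B).toEmbedding

@[simp] theorem mem_flip {a : A} {b : B} : (b, a) ∈ flip M ↔ (a, b) ∈ M := by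
  simp [flip]

@[simp] theorem card_flip : (flip M).card = M.card := by simp [flip]

theorem flip_sdiff : flip (M \ N) = flip M \ flip N := by
  ext ⟨b, a⟩; simp

theorem mem_edges_swap {a : A} {b : B} : (b, a) ∈ G.swap.edges ↔ (a, b) ∈ G.edges := by
  simp only [Instance.mem_edges]; exact (G.mutual_adj a b).symm

theorem IsMatching.flip (hM : IsMatching G M) : IsMatching G.swap (flip M) := by
  constructor
  · rintro ⟨b, a⟩ h
    exact mem_edges_swap.2 (hM.1 (mem_flip.1 h))
  · rintro ⟨b, a⟩ h ⟨b', a'⟩ h' hh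
    have := hM.2 _ (mem_flip.1 h) _ (mem_flip.1 h') hh.symm
    simp only [Prod.mk.injEq] at this ⊢
    exact this.symm

theorem IsSuperStable.flip (hM : IsSuperStable G M) : IsSuperStable G.swap (flip M) := by
  refine ⟨hM.1.flip, fun b a h => hM.2 a b ⟨mem_edges_swap.1 h.1, fun h' => h.2.1 (mem_flip.2 h'),
    fun b' hb' => h.2.2.2 b' (mem_flip.2 hb'), fun a' ha' => h.2.2.1 a' (mem_flip.2 ha')⟩⟩

/-! ### Comparison of two super-stable matchings -/

/-- An edge outside a super-stable matching has an endpoint with a strictly better partner. -/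
theorem IsSuperStable.cover (hN : IsSuperStable G N) {a : A} {b : B} (he : (a, b) ∈ G.edges)
    (h : (a, b) ∉ N) : (∃ b', (a, b') ∈ N ∧ G.rankA a b' < G.rankA a b) ∨
      ∃ a', (a', b) ∈ N ∧ G.rankB b a' < G.rankB b a := by
  by_contra! hc
  exact hN.2 a b ⟨he, h, hc.1, hc.2⟩

/-- The men that strictly prefer `N` to their partner in `M`. -/
def prefers (G : Instance A B) (M N : Finset (A × B)) : Finset A :=
  Finset.univ.filter fun a => ∃ b b', (a, b) ∈ M ∧ (a, b') ∈ N ∧ G.rankA a b' < G.rankA a b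

theorem mem_prefers {a : A} : a ∈ prefers G M N ↔
    ∃ b b', (a, b) ∈ M ∧ (a, b') ∈ N ∧ G.rankA a b' < G.rankA a b := by
  simp [prefers]

theorem disjoint_prefers (hM : IsMatching G M) (hN : IsMatching G N) :
    Disjoint (prefers G M N) (prefers G N M) := by
  rw [Finset.disjoint_left]
  intro a h h'
  obtain ⟨b, b', h1, h2, h3⟩ := mem_prefers.1 h
  obtain ⟨c', c, h4, h5, h6⟩ := mem_prefers.1 h'
  obtain rfl := hM.right_unique h1 h5
  obtain rfl := hN.right_unique h2 h4
  omega

theorem prefers_union_subset (hN : IsMatching G N) :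
    prefers G M N ∪ prefers G N M ⊆ (M \ N).image Prod.fst := by
  intro a h
  have : ∃ b b', (a, b) ∈ M ∧ (a, b') ∈ N ∧ G.rankA a b ≠ G.rankA a b' := by
    rcases Finset.mem_union.1 h with h | h
    · obtain ⟨b, b', h1, h2, h3⟩ := mem_prefers.1 h
      exact ⟨b, b', h1, h2, h3.ne'⟩
    · obtain ⟨b', b, h1, h2, h3⟩ := mem_prefers.1 h
      exact ⟨b, b', h2, h1, h3.ne⟩
  obtain ⟨b, b', h1, h2, h3⟩ := this
  refine Finset.mem_image.2 ⟨(a, b), Finset.mem_sdiff.2 ⟨h1, fun h4 => h3 ?_⟩, rfl⟩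
  rw [hN.right_unique h2 h4]

theorem card_image_fst (hM : IsMatching G M) (S : Finset (A × B)) (hS : S ⊆ M) :
    (S.image Prod.fst).card = S.card :=
  Finset.card_image_of_injOn fun e he f hf hef => hM.2 e (hS he) f (hS hf) (Or.inl hef)

/-- The men who gain and those who lose are disjoint sets, and all of them have an edge in M \ N,
which for each man is unique. -/
theorem card_prefers_le (hM : IsMatching G M) (hN : IsMatching G N) :
    (prefers G M N).card + (prefers G N M).card ≤ (M \ N).card := by
  rw [← Finset.card_union_of_disjoint (disjoint_prefers hM hN),
    ← card_image_fst hM _ Finset.sdiff_subset]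
  exact Finset.card_le_card (prefers_union_subset hN)

theorem card_filter_fst_le (hM : IsMatching G M) (S : Finset A) (T : Finset (A × B)) (hT : T ⊆ M) :
    (T.filter fun e => e.1 ∈ S).card ≤ S.card := by
  rw [← card_image_fst hM _ ((Finset.filter_subset _ _).trans hT)]
  refine Finset.card_le_card fun a ha => ?_
  obtain ⟨e, he, rfl⟩ := Finset.mem_image.1 ha
  exact (Finset.mem_filter.1 he).2

theorem card_filter_snd_le (hM : IsMatching G M) (S : Finset B) (T : Finset (A × B)) (hT : T ⊆ M) :
    (T.filter fun e => e.2 ∈ S).card ≤ S.card := by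
  have hinj : Set.InjOn Prod.snd (T.filter fun e => e.2 ∈ S : Set (A × B)) := fun e he f hf hef =>
    hM.2 e (hT (Finset.mem_filter.1 he).1) f (hT (Finset.mem_filter.1 hf).1) (Or.inr hef)
  rw [← Finset.card_image_of_injOn hinj]
  refine Finset.card_le_card fun a ha => ?_
  obtain ⟨e, he, rfl⟩ := Finset.mem_image.1 ha
  exact (Finset.mem_filter.1 he).2

theorem filter_union_eq (hM : IsSuperStable G M) (hN : IsSuperStable G N) :
    ((M \ N).filter fun e => e.1 ∈ prefers G M N) ∪
      ((M \ N).filter fun e => e.2 ∈ prefers G.swap (flip M) (flip N)) = M \ N := by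
  ext ⟨a, b⟩
  simp only [Finset.mem_union, Finset.mem_filter, Finset.mem_sdiff, ← and_or_left, and_iff_left_iff_imp,
    mem_prefers, mem_flip]
  rintro ⟨h1, h2⟩
  rcases hN.cover (hM.1.1 h1) h2 with ⟨b', h3, h4⟩ | ⟨a', h3, h4⟩
  · exact Or.inl ⟨b, b', h1, h3, h4⟩
  · exact Or.inr ⟨a, a', h1, h3, h4⟩

/-- Super-stability of N charges each edge of M \ N to an end that strictly gains in N. The
intersection consists of the edges that are charged twice. -/
theorem card_sdiff_le (hM : IsSuperStable G M) (hN : IsSuperStable G N) :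
    (M \ N).card + (((M \ N).filter fun e => e.1 ∈ prefers G M N) ∩
      ((M \ N).filter fun e => e.2 ∈ prefers G.swap (flip M) (flip N))).card ≤
      (prefers G M N).card + (prefers G.swap (flip M) (flip N)).card := by
  have h := Finset.card_union_add_card_inter ((M \ N).filter fun e => e.1 ∈ prefers G M N)
    ((M \ N).filter fun e => e.2 ∈ prefers G.swap (flip M) (flip N))
  rw [filter_union_eq hM hN] at h
  have h1 := card_filter_fst_le hM.1 (prefers G M N) (M \ N) Finset.sdiff_subset
  have h2 := card_filter_snd_le hM.1 (prefers G.swap (flip M) (flip N)) (M \ N) Finset.sdiff_subset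
  omega

/-- The partners of both ends of an edge in which two super-stable matchings differ are strictly
comparable, and at most one of the ends profits. -/
theorem sdiff_structure (hM : IsSuperStable G M) (hN : IsSuperStable G N) {a : A} {b : B}
    (h : (a, b) ∈ M) (h' : (a, b) ∉ N) :
    (a ∈ prefers G M N ∨ a ∈ prefers G N M) ∧
    (b ∈ prefers G.swap (flip M) (flip N) ∨ b ∈ prefers G.swap (flip N) (flip M)) ∧
    ¬ (a ∈ prefers G M N ∧ b ∈ prefers G.swap (flip M) (flip N)) := by
  -- Let p and q be the numbers of men and of women who are strictly affected. Then e1 and e2 give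
  -- |M \ N| + |N \ M| ≤ p + q, while e3 to e6 bound p and q by each of |M \ N| and |N \ M|. So all
  -- these numbers are equal, and no edge is charged twice.
  have e1 := card_sdiff_le hM hN
  have e2 := card_sdiff_le hN hM
  have e3 := card_prefers_le hM.1 hN.1
  have e4 := card_prefers_le hN.1 hM.1
  have e5 := card_prefers_le hM.1.flip hN.1.flip
  have e6 := card_prefers_le hN.1.flip hM.1.flip
  rw [← flip_sdiff, card_flip] at e5 e6
  have hmem : (a, b) ∈ M \ N := Finset.mem_sdiff.2 ⟨h, h'⟩
  refine ⟨?_, ?_, ?_⟩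
  · have hh := Finset.eq_of_subset_of_card_le (prefers_union_subset hN.1) (by
      rw [card_image_fst hM.1 _ Finset.sdiff_subset,
        Finset.card_union_of_disjoint (disjoint_prefers hM.1 hN.1)]; omega)
    rw [← Finset.mem_union, hh]
    exact Finset.mem_image.2 ⟨_, hmem, rfl⟩
  · have hh := Finset.eq_of_subset_of_card_le (prefers_union_subset hN.1.flip) (by
      rw [card_image_fst hM.1.flip _ Finset.sdiff_subset,
        Finset.card_union_of_disjoint (disjoint_prefers hM.1.flip hN.1.flip),
        ← flip_sdiff, card_flip]; omega)
    rw [← Finset.mem_union, hh]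
    exact Finset.mem_image.2 ⟨(b, a), by simpa using ⟨h, h'⟩, rfl⟩
  · rintro ⟨h1, h2⟩
    have h0 : (((M \ N).filter fun e => e.1 ∈ prefers G M N) ∩
      ((M \ N).filter fun e => e.2 ∈ prefers G.swap (flip M) (flip N))).card = 0 := by omega
    rw [Finset.card_eq_zero] at h0
    have : (a, b) ∈ (∅ : Finset (A × B)) := by
      rw [← h0]
      simp only [Finset.mem_inter, Finset.mem_filter]
      exact ⟨⟨hmem, h1⟩, hmem, h2⟩
    simp at this

/-- The analogue of the rural hospitals theorem: a strictly affected vertex is matched on both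
sides, so all super-stable matchings cover the same vertices. -/
theorem exists_partnerA (hM : IsSuperStable G M) (hN : IsSuperStable G N) {a : A} {b : B}
    (h : (a, b) ∈ M) : ∃ b', (a, b') ∈ N := by
  by_cases h' : (a, b) ∈ N
  · exact ⟨b, h'⟩
  rcases (sdiff_structure hM hN h h').1 with h1 | h1
  · obtain ⟨_, b', _, h2, _⟩ := mem_prefers.1 h1
    exact ⟨b', h2⟩
  · obtain ⟨b', _, h2, _⟩ := mem_prefers.1 h1
    exact ⟨b', h2⟩

theorem exists_partnerB (hM : IsSuperStable G M) (hN : IsSuperStable G N) {a : A} {b : B}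
    (h : (a, b) ∈ M) : ∃ a', (a', b) ∈ N := by
  obtain ⟨a', ha⟩ := exists_partnerA hM.flip hN.flip (mem_flip.2 h)
  exact ⟨a', mem_flip.1 ha⟩

/-- Super-stable partners between whom a man is indifferent are equal. -/
theorem eq_of_rankA_eq (hM : IsSuperStable G M) (hN : IsSuperStable G N) {a : A} {b b' : B}
    (h : (a, b) ∈ M) (h' : (a, b') ∈ N) (hr : G.rankA a b = G.rankA a b') : b = b' := by
  by_cases hn : (a, b) ∈ N
  · exact hN.1.right_unique hn h'
  exfalso
  rcases (sdiff_structure hM hN h hn).1 with h1 | h1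
  · obtain ⟨c, c', h2, h3, h4⟩ := mem_prefers.1 h1
    obtain rfl := hM.1.right_unique h h2
    obtain rfl := hN.1.right_unique h' h3
    omega
  · obtain ⟨c', c, h2, h3, h4⟩ := mem_prefers.1 h1
    obtain rfl := hM.1.right_unique h h3
    obtain rfl := hN.1.right_unique h' h2
    omega

theorem eq_of_rankB_eq (hM : IsSuperStable G M) (hN : IsSuperStable G N) {a a' : A} {b : B}
    (h : (a, b) ∈ M) (h' : (a', b) ∈ N) (hrank : G.rankB b a = G.rankB b a') : a = a' :=
  eq_of_rankA_eq hM.flip hN.flip (mem_flip.2 h) (mem_flip.2 h') hrank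

/-- If a man prefers `M`, then his partner in `M` prefers `N`. -/
theorem rankB_lt_of_rankA_lt (hM : IsSuperStable G M) (hN : IsSuperStable G N) {a : A} {b b' : B}
    (h : (a, b) ∈ M) (h' : (a, b') ∈ N) (hr : G.rankA a b < G.rankA a b') :
    ∃ a', (a', b) ∈ N ∧ G.rankB b a' < G.rankB b a := by
  have hn : (a, b) ∉ N := fun hn => by
    obtain rfl := hN.1.right_unique hn h'
    omega
  rcases hN.cover (hM.1.1 h) hn with ⟨c, h1, h2⟩ | h1
  · obtain rfl := hN.1.right_unique h' h1
    omega
  · exact h1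

/-- If a man prefers `M`, then his partner in `N` prefers `N`. -/
theorem rankB_lt_of_rankA_lt' (hM : IsSuperStable G M) (hN : IsSuperStable G N) {a : A} {b b' : B}
    (h : (a, b) ∈ M) (h' : (a, b') ∈ N) (hr : G.rankA a b < G.rankA a b') :
    ∃ a', (a', b') ∈ M ∧ G.rankB b' a < G.rankB b' a' := by
  have hn : (a, b') ∉ M := fun hn => by
    obtain rfl := hM.1.right_unique hn h
    omega
  obtain ⟨-, h1, h2⟩ := sdiff_structure hN hM h' hn
  have h3 : a ∈ prefers G N M := mem_prefers.2 ⟨b', b, h', h, hr⟩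
  rcases h1 with h1 | h1
  · exact absurd ⟨h3, h1⟩ h2
  · obtain ⟨c, c', h4, h5, h6⟩ := mem_prefers.1 h1
    rw [mem_flip] at h4 h5
    obtain rfl := hN.1.left_unique h5 h'
    exact ⟨c, h4, h6⟩

/-! ### Rank functions and the lattice operations -/

/-- The rank of the partner of `a` (`0` for unmatched men). -/
def height (G : Instance A B) (M : Finset (A × B)) (a : A) : ℕ :=
  ∑ b, if (a, b) ∈ M then G.rankA a b else 0

/-- The rank of the partner of `b` (`0` for unmatched women). -/
def heightB (G : Instance A B) (M : Finset (A × B)) (b : B) : ℕ := height G.swap (flip M) b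

theorem height_eq (hM : IsMatching G M) {a : A} {b : B} (h : (a, b) ∈ M) :
    height G M a = G.rankA a b := by
  rw [height, Finset.sum_eq_single b, if_pos h]
  · intro c _ hc
    exact if_neg fun h' => hc (hM.right_unique h' h)
  · simp

theorem heightB_eq (hM : IsMatching G M) {a : A} {b : B} (h : (a, b) ∈ M) :
    heightB G M b = G.rankB b a :=
  height_eq hM.flip (mem_flip.2 h)

theorem height_eq_zero {a : A} (h : ∀ b, (a, b) ∉ M) : height G M a = 0 := by
  simp [height, h]

theorem exists_mem_of_height_lt (hM : IsSuperStable G M) (hN : IsSuperStable G N) {a : A}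
    (h : height G M a ≠ height G N a) : ∃ b b', (a, b) ∈ M ∧ (a, b') ∈ N := by
  by_cases h' : ∃ b, (a, b) ∈ M
  · obtain ⟨b, hb⟩ := h'
    obtain ⟨b', hb'⟩ := exists_partnerA hM hN hb
    exact ⟨b, b', hb, hb'⟩
  · push Not at h'
    have h2 : ∀ b, (a, b) ∉ N := fun b hb =>
      (exists_partnerA hN hM hb).elim fun c hc => h' c hc
    exact absurd ((height_eq_zero h').trans (height_eq_zero h2).symm) h

/-- The height 0 of a free man is also the rank of a first tie. This ambiguity is harmless, because
a man is free in all super-stable matchings or in none, and equal ranks mean equal partners. -/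
theorem mem_iff_of_height_eq (hM : IsSuperStable G M) (hN : IsSuperStable G N) {a : A}
    (h : height G M a = height G N a) (b : B) : (a, b) ∈ M ↔ (a, b) ∈ N := by
  suffices H : ∀ {M N : Finset (A × B)}, IsSuperStable G M → IsSuperStable G N →
      height G M a = height G N a → (a, b) ∈ M → (a, b) ∈ N from ⟨H hM hN h, H hN hM h.symm⟩
  intro M N hM hN h hb
  obtain ⟨b', hb'⟩ := exists_partnerA hM hN hb
  rw [height_eq hM.1 hb, height_eq hN.1 hb'] at h
  rwa [eq_of_rankA_eq hM hN hb hb' h]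

theorem eq_of_height_eq (hM : IsSuperStable G M) (hN : IsSuperStable G N)
    (h : height G M = height G N) : M = N := by
  ext ⟨a, b⟩
  exact mem_iff_of_height_eq hM hN (congrFun h a) b

theorem dominates_iff (hM : IsSuperStable G M) (hN : IsSuperStable G N) :
    Dominates G M N ↔ height G M ≤ height G N := by
  constructor
  · intro h a
    by_cases h' : ∃ b, (a, b) ∈ N
    · obtain ⟨b', hb'⟩ := h'
      obtain ⟨b, hb, hr⟩ := h a b' hb'
      rwa [height_eq hM.1 hb, height_eq hN.1 hb']
    · rw [height_eq_zero (M := M)]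
      · exact Nat.zero_le _
      · exact fun b hb => h' (exists_partnerA hM hN hb)
  · intro h a b' hb'
    obtain ⟨b, hb⟩ := exists_partnerA hN hM hb'
    have := h a
    rw [height_eq hM.1 hb, height_eq hN.1 hb'] at this
    exact ⟨b, hb, this⟩

theorem strictlyDominates_iff (hM : IsSuperStable G M) (hN : IsSuperStable G N) :
    StrictlyDominates G M N ↔ height G M < height G N := by
  rw [StrictlyDominates, dominates_iff hM hN, Pi.lt_def]
  refine and_congr_right fun h => ⟨?_, ?_⟩
  · rintro ⟨a, b, hb, hr⟩
    obtain ⟨b', hb'⟩ := exists_partnerA hM hN hb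
    refine ⟨a, ?_⟩
    rw [height_eq hM.1 hb, height_eq hN.1 hb']
    exact hr b' hb'
  · rintro ⟨a, ha⟩
    obtain ⟨b, b', hb, hb'⟩ := exists_mem_of_height_lt hM hN ha.ne
    refine ⟨a, b, hb, fun c hc => ?_⟩
    rwa [height_eq hM.1 hb, height_eq hN.1 hc] at ha

/-- If `a` is weakly better off in `M`, his partner in `M` is weakly better off in `N`. -/
theorem heightB_le_of_height_le (hM : IsSuperStable G M) (hN : IsSuperStable G N) {a : A} {b : B}
    (h : (a, b) ∈ M) (hr : height G M a ≤ height G N a) : heightB G N b ≤ heightB G M b := by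
  rcases hr.eq_or_lt with hr | hr
  · have := (mem_iff_of_height_eq hM hN hr b).1 h
    rw [heightB_eq hM.1 h, heightB_eq hN.1 this]
  · obtain ⟨b', hb'⟩ := exists_partnerA hM hN h
    rw [height_eq hM.1 h, height_eq hN.1 hb'] at hr
    obtain ⟨a', h1, h2⟩ := rankB_lt_of_rankA_lt hM hN h hb' hr
    rw [heightB_eq hM.1 h, heightB_eq hN.1 h1]
    exact h2.le

/-- Opposition of interests, applied edge by edge; a woman who is free in M is free in N as well and
has height 0 in both. -/
theorem heightB_antitone (hM : IsSuperStable G M) (hN : IsSuperStable G N)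
    (h : height G M ≤ height G N) : heightB G N ≤ heightB G M := by
  intro b
  by_cases h' : ∃ a, (a, b) ∈ M
  · obtain ⟨a, ha⟩ := h'
    exact heightB_le_of_height_le hM hN ha (h a)
  · refine le_of_eq_of_le (height_eq_zero fun a ha => h' ?_) (Nat.zero_le _)
    exact exists_partnerB hN hM (mem_flip.1 ha)

/-- Each man gets the better one of his partners in `M` and `N`. -/
def join (G : Instance A B) (M N : Finset (A × B)) : Finset (A × B) :=
  (M ∪ N).filter fun e => G.rankA e.1 e.2 ≤ min (height G M e.1) (height G N e.1)

theorem mem_join (hM : IsSuperStable G M) (hN : IsSuperStable G N) {a : A} {b : B} :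
    (a, b) ∈ join G M N ↔ ((a, b) ∈ M ∧ height G M a ≤ height G N a) ∨
      ((a, b) ∈ N ∧ height G N a ≤ height G M a) := by
  rw [join, Finset.mem_filter, Finset.mem_union]
  constructor
  · rintro ⟨h | h, hr⟩
    · have := height_eq hM.1 h
      exact Or.inl ⟨h, by simp only [le_min_iff] at hr; omega⟩
    · have := height_eq hN.1 h
      exact Or.inr ⟨h, by simp only [le_min_iff] at hr; omega⟩
  · rintro (⟨h, hr⟩ | ⟨h, hr⟩)
    · have := height_eq hM.1 h
      exact ⟨Or.inl h, by simp only [le_min_iff]; omega⟩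
    · have := height_eq hN.1 h
      exact ⟨Or.inr h, by simp only [le_min_iff]; omega⟩

theorem join_comm (G : Instance A B) (M N : Finset (A × B)) : join G M N = join G N M := by
  ext e
  simp only [join, Finset.mem_filter, Finset.mem_union, min_comm, or_comm]

theorem join_mem_of_le (hM : IsSuperStable G M) (hN : IsSuperStable G N) {a : A} {b : B}
    (hr : height G M a ≤ height G N a) : (a, b) ∈ join G M N ↔ (a, b) ∈ M := by
  rw [mem_join hM hN]
  constructor
  · rintro (h | h)
    · exact h.1
    · exact (mem_iff_of_height_eq hM hN (le_antisymm hr h.2) b).2 h.1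
  · exact fun h => Or.inl ⟨h, hr⟩

/-- Suppose that two men bring the same woman into the join, one from M and one from N. Each is
weakly better off where he comes from, so by opposition of interests the woman ranks both equally,
and they coincide. -/
theorem isMatching_join (hM : IsSuperStable G M) (hN : IsSuperStable G N) :
    IsMatching G (join G M N) := by
  have key : ∀ {M N : Finset (A × B)}, IsSuperStable G M → IsSuperStable G N → ∀ {a a' : A} {b : B},
      (a, b) ∈ M → height G M a ≤ height G N a → (a', b) ∈ N → height G N a' ≤ height G M a' →
      a = a' := by
    intro M N hM hN a a' b h1 h2 h3 h4
    have h5 := heightB_le_of_height_le hM hN h1 h2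
    have h6 := heightB_le_of_height_le hN hM h3 h4
    refine eq_of_rankB_eq hM hN h1 h3 ?_
    rw [← heightB_eq hM.1 h1, ← heightB_eq hN.1 h3]
    omega
  constructor
  · intro e he
    rcases Finset.mem_union.1 (Finset.mem_filter.1 he).1 with h | h
    exacts [hM.1.1 h, hN.1.1 h]
  · rintro ⟨a, b⟩ h ⟨a', b'⟩ h' hh
    dsimp only at hh
    rcases hh with rfl | rfl
    · rcases le_total (height G M a) (height G N a) with hle | hle
      · rw [join_mem_of_le hM hN hle] at h h'
        rw [hM.1.right_unique h h']
      · rw [join_comm, join_mem_of_le hN hM hle] at h h'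
        rw [hN.1.right_unique h h']
    · rw [mem_join hM hN] at h h'
      rcases h with ⟨h1, h2⟩ | ⟨h1, h2⟩ <;> rcases h' with ⟨h3, h4⟩ | ⟨h3, h4⟩
      · rw [hM.1.left_unique h1 h3]
      · rw [key hM hN h1 h2 h3 h4]
      · rw [key hN hM h1 h2 h3 h4]
      · rw [hN.1.left_unique h1 h3]

/-- If neither partner of b kept her in the join, both men would strictly prefer the other matching.
Then b would strictly prefer M to N because of the one and N to M because of the other. -/
theorem join_partnerB (hM : IsSuperStable G M) (hN : IsSuperStable G N) {a₁ a₂ : A} {b : B}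
    (h₁ : (a₁, b) ∈ M) (h₂ : (a₂, b) ∈ N) : (a₁, b) ∈ join G M N ∨ (a₂, b) ∈ join G M N := by
  rcases le_total (height G M a₁) (height G N a₁) with hle | hle
  · exact Or.inl ((mem_join hM hN).2 (Or.inl ⟨h₁, hle⟩))
  rcases le_total (height G N a₂) (height G M a₂) with hle' | hle'
  · exact Or.inr ((mem_join hM hN).2 (Or.inr ⟨h₂, hle'⟩))
  have h : (a₁, b) ∈ N := by
    rcases hle.eq_or_lt with h | h
    · exact (mem_iff_of_height_eq hM hN h.symm b).1 h₁
    exfalso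
    obtain ⟨b', hb'⟩ := exists_partnerA hM hN h₁
    have h3 := heightB_le_of_height_le hN hM hb' hle
    have h4 := h
    rw [height_eq hM.1 h₁, height_eq hN.1 hb'] at h4
    obtain ⟨a', h5, h6⟩ := rankB_lt_of_rankA_lt' hN hM hb' h₁ h4
    obtain rfl := hN.1.left_unique h5 h₂
    rcases hle'.eq_or_lt with h7 | h7
    · have := (mem_iff_of_height_eq hM hN h7 b).2 h₂
      obtain rfl := hM.1.left_unique this h₁
      omega
    obtain ⟨b'', hb''⟩ := exists_partnerA hN hM h₂
    rw [height_eq hM.1 hb'', height_eq hN.1 h₂] at h7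
    obtain ⟨c, h8, h9⟩ := rankB_lt_of_rankA_lt' hM hN hb'' h₂ h7
    obtain rfl := hM.1.left_unique h8 h₁
    omega
  obtain rfl := hN.1.left_unique h h₂
  exact Or.inr ((mem_join hM hN).2 (Or.inr ⟨h₂, hle⟩))

/-- If an edge blocks the join, its man is content with it compared with his partners in both M and
N. Super-stability of M and of N then gives the woman strictly better partners in both, and one of
these is her partner in the join. -/
theorem isSuperStable_join (hM : IsSuperStable G M) (hN : IsSuperStable G N) :
    IsSuperStable G (join G M N) := by
  refine ⟨isMatching_join hM hN, ?_⟩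
  rintro a b ⟨he, hn, h1, h2⟩
  have key : ∀ {M N : Finset (A × B)}, IsSuperStable G M → IsSuperStable G N →
      (a, b) ∉ join G M N → (∀ b', (a, b') ∈ join G M N → G.rankA a b ≤ G.rankA a b') →
      ∃ a', (a', b) ∈ M ∧ G.rankB b a' < G.rankB b a := by
    intro M N hM hN hn h1
    have h3 : ∀ b', (a, b') ∈ M → G.rankA a b ≤ G.rankA a b' := by
      intro b' hb'
      rcases le_total (height G M a) (height G N a) with hle | hle
      · exact h1 b' ((join_mem_of_le hM hN hle).2 hb')
      · obtain ⟨c, hc⟩ := exists_partnerA hM hN hb'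
        have h4 := h1 c (by rw [join_comm]; exact (join_mem_of_le hN hM hle).2 hc)
        rw [height_eq hM.1 hb', height_eq hN.1 hc] at hle
        omega
    have h4 : (a, b) ∉ M := by
      intro hb
      rcases le_total (height G M a) (height G N a) with hle | hle
      · exact hn ((join_mem_of_le hM hN hle).2 hb)
      · obtain ⟨c, hc⟩ := exists_partnerA hM hN hb
        have hc' : (a, c) ∈ join G M N := by
          rw [join_comm]; exact (join_mem_of_le hN hM hle).2 hc
        have h4 := h1 c hc'
        rw [height_eq hM.1 hb, height_eq hN.1 hc] at hle
        obtain rfl := eq_of_rankA_eq hM hN hb hc (by omega)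
        exact hn hc'
    rcases hM.cover he h4 with ⟨b', h5, h6⟩ | h5
    · have := h3 b' h5
      omega
    · exact h5
  obtain ⟨a₁, h3, h4⟩ := key hM hN hn h1
  obtain ⟨a₂, h5, h6⟩ := key hN hM (by rwa [join_comm]) (by rwa [join_comm])
  rcases join_partnerB hM hN h3 h5 with h7 | h7
  · have := h2 _ h7; omega
  · have := h2 _ h7; omega

theorem height_join (hM : IsSuperStable G M) (hN : IsSuperStable G N) (a : A) :
    height G (join G M N) a = min (height G M a) (height G N a) := by
  rcases le_total (height G M a) (height G N a) with hle | hle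
  · rw [min_eq_left hle]
    simp only [height, join_mem_of_le hM hN hle]
  · rw [min_eq_right hle, join_comm]
    simp only [height, join_mem_of_le hN hM hle]

/-- Each man gets the worse one of his partners in `M` and `N`. -/
def meet (G : Instance A B) (M N : Finset (A × B)) : Finset (A × B) :=
  flip (join G.swap (flip M) (flip N))

theorem isSuperStable_meet (hM : IsSuperStable G M) (hN : IsSuperStable G N) :
    IsSuperStable G (meet G M N) :=
  (isSuperStable_join hM.flip hN.flip).flip

/-- The meet is the join for the women. What is better for the partner of a man is worse for him, so
he ends up with the larger of his two heights. -/
theorem height_meet (hM : IsSuperStable G M) (hN : IsSuperStable G N) (a : A) :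
    height G (meet G M N) a = max (height G M a) (height G N a) := by
  have key : ∀ {M N : Finset (A × B)}, IsSuperStable G M → IsSuperStable G N →
      height G M a ≤ height G N a → ∀ b, (a, b) ∈ N → (a, b) ∈ meet G M N := by
    intro M N hM hN h b hb
    rw [meet, mem_flip, join_comm, join_mem_of_le hN.flip hM.flip]
    · exact mem_flip.2 hb
    change heightB G N b ≤ heightB G M b
    rcases h.eq_or_lt with h1 | h1
    · exact heightB_le_of_height_le hM hN ((mem_iff_of_height_eq hM hN h1 b).2 hb) h
    · obtain ⟨b', hb'⟩ := exists_partnerA hN hM hb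
      rw [height_eq hM.1 hb', height_eq hN.1 hb] at h1
      obtain ⟨c, h2, h3⟩ := rankB_lt_of_rankA_lt' hM hN hb' hb h1
      rw [heightB_eq hM.1 h2, heightB_eq hN.1 hb]
      omega
  have main : ∀ {M N : Finset (A × B)}, IsSuperStable G M → IsSuperStable G N →
      height G M a ≤ height G N a → height G (meet G M N) a = height G N a := by
    intro M N hM hN h
    have hMN := isSuperStable_meet hM hN
    by_cases hb : ∃ b, (a, b) ∈ N
    · obtain ⟨b, hb⟩ := hb
      rw [height_eq hMN.1 (key hM hN h b hb), height_eq hN.1 hb]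
    · rw [height_eq_zero, height_eq_zero (M := N)]
      · exact fun b h' => hb ⟨b, h'⟩
      · exact fun b h' => hb (exists_partnerA hMN hN h')
  rcases le_total (height G M a) (height G N a) with h | h
  · rw [max_eq_right h, main hM hN h]
  · rw [max_eq_left h, ← main hN hM h, meet, meet, join_comm]

end Lattice

end SuperStable

namespace SuperStable

/-! ### Rotations, their passage by matchings, and the two types of labels -/

section Rotations

variable {A B : Type*} [Fintype A] [Fintype B] [DecidableEq A] [DecidableEq B]
  {G : Instance A B} {M N P Q R : Finset (A × B)} {ρ ρ' σ : Finset (A × B)}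

/-- The companion for the woman whom the man has in the matching that is worse for him. -/
theorem heightB_le_of_height_le' (hM : IsSuperStable G M) (hN : IsSuperStable G N) {a : A} {b : B}
    (h : (a, b) ∈ N) (hr : height G M a ≤ height G N a) : heightB G N b ≤ heightB G M b := by
  rcases hr.eq_or_lt with hr | hr
  · have := (mem_iff_of_height_eq hM hN hr b).2 h
    rw [heightB_eq hM.1 this, heightB_eq hN.1 h]
  · obtain ⟨b', hb'⟩ := exists_partnerA hN hM h
    rw [height_eq hM.1 hb', height_eq hN.1 h] at hr
    obtain ⟨a', h1, h2⟩ := rankB_lt_of_rankA_lt' hM hN hb' h hr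
    rw [heightB_eq hM.1 h1, heightB_eq hN.1 h]
    exact h2.le

/-! ### Strict successors -/

theorem IsStrictSuccessor.lt (h : IsStrictSuccessor G P Q) : height G P < height G Q :=
  (strictlyDominates_iff h.1 h.2.1).1 h.2.2.1

theorem IsStrictSuccessor.le (h : IsStrictSuccessor G P Q) (a : A) :
    height G P a ≤ height G Q a := h.lt.le a

theorem IsStrictSuccessor.exists_lt (h : IsStrictSuccessor G P Q) :
    ∃ a, height G P a < height G Q a := (Pi.lt_def.1 h.lt).2

theorem IsStrictSuccessor.eq_or_eq (h : IsStrictSuccessor G P Q) (hR : IsSuperStable G R)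
    (h₁ : height G P ≤ height G R) (h₂ : height G R ≤ height G Q) : R = P ∨ R = Q := by
  by_contra! hc
  refine h.2.2.2 ⟨R, hR, (strictlyDominates_iff h.1 hR).2 (lt_of_le_of_ne h₁ fun he => hc.1 ?_),
    (strictlyDominates_iff hR h.2.1).2 (lt_of_le_of_ne h₂ fun he => hc.2 ?_)⟩
  · exact (eq_of_height_eq h.1 hR he).symm
  · exact eq_of_height_eq hR h.2.1 he

theorem isStrictSuccessor_of (hP : IsSuperStable G P) (hQ : IsSuperStable G Q)
    (hlt : height G P < height G Q) (h : ∀ R, IsSuperStable G R → height G P ≤ height G R →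
      height G R ≤ height G Q → R = P ∨ R = Q) : IsStrictSuccessor G P Q := by
  refine ⟨hP, hQ, (strictlyDominates_iff hP hQ).2 hlt, ?_⟩
  rintro ⟨R, hR, h1, h2⟩
  rw [strictlyDominates_iff hP hR] at h1
  rw [strictlyDominates_iff hR hQ] at h2
  rcases h R hR h1.le h2.le with rfl | rfl
  · exact lt_irrefl _ h1
  · exact lt_irrefl _ h2

/-- A super-stable matching is on one side of all moves of a rotation. -/
theorem IsStrictSuccessor.dichotomy (h : IsStrictSuccessor G P Q) (hR : IsSuperStable G R) :
    (∀ a, height G P a < height G Q a → height G R a ≤ height G P a) ∨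
      ∀ a, height G P a < height G Q a → height G Q a ≤ height G R a := by
  -- The matching with heights max(P, min(R, Q)) lies between P and Q, hence equals one of them. At
  -- a man with P < Q, the first case means R ≤ P and the second Q ≤ R.
  have hJ := isSuperStable_join hR h.2.1
  have hX := isSuperStable_meet h.1 hJ
  have hh : ∀ a, height G (meet G P (join G R Q)) a =
      max (height G P a) (min (height G R a) (height G Q a)) := fun a => by
    rw [height_meet h.1 hJ, height_join hR h.2.1]
  rcases h.eq_or_eq hX (fun a => by rw [hh]; exact le_max_left _ _)
    (fun a => by rw [hh]; exact max_le (h.le a) (min_le_right _ _)) with he | he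
  · left
    intro a ha
    have := hh a
    rw [he] at this
    omega
  · right
    intro a ha
    have := hh a
    rw [he] at this
    omega

/-- The step from M to N crosses the height of P at the man a. Four uses of the dichotomy, for M and
N against the step from P to Q and for P and Q against the step from M to N, leave no room: the
steps agree at every man moved by either. -/
theorem crossing (h : IsStrictSuccessor G P Q) (h' : IsStrictSuccessor G M N) {a : A}
    (h1 : height G M a ≤ height G P a) (h2 : height G P a < height G N a)
    (h3 : height G P a < height G Q a) (x : A)
    (hx : height G P x < height G Q x ∨ height G M x < height G N x) :
    height G M x = height G P x ∧ height G N x = height G Q x := by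
  have e1 := h.dichotomy h'.1
  have e2 := h.dichotomy h'.2.1
  have e3 := h'.dichotomy h.1
  have e4 := h'.dichotomy h.2.1
  replace e1 := e1.resolve_right fun e => by have := e a h3; omega
  replace e2 := e2.resolve_left fun e => by have := e a h3; omega
  replace e3 := e3.resolve_right fun e => by have := e a (by omega); omega
  have e5 := e2 a h3
  replace e4 := e4.resolve_left fun e => by have := e a (by omega); omega
  rcases hx with hx | hx
  · have i1 := e1 x hx
    have i2 := e2 x hx
    have i3 := e3 x (by omega)
    have i4 := e4 x (by omega)
    omega
  · have i3 := e3 x hx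
    have i4 := e4 x hx
    have i1 := e1 x (by omega)
    have i2 := e2 x (by omega)
    omega

theorem mem_symmDiff' {e : A × B} : e ∈ M ∆ N ↔ e ∈ M ∧ e ∉ N ∨ e ∈ N ∧ e ∉ M :=
  Finset.mem_symmDiff

theorem symmDiff_congr (hM : IsSuperStable G M) (hN : IsSuperStable G N) (hP : IsSuperStable G P)
    (hQ : IsSuperStable G Q) (h : ∀ x, (height G M x = height G P x ∧ height G N x = height G Q x) ∨
      (height G M x = height G N x ∧ height G P x = height G Q x)) : M ∆ N = P ∆ Q := by
  ext ⟨x, y⟩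
  rw [mem_symmDiff', mem_symmDiff']
  rcases h x with ⟨h1, h2⟩ | ⟨h1, h2⟩
  · rw [mem_iff_of_height_eq hM hP h1, mem_iff_of_height_eq hN hQ h2]
  · rw [mem_iff_of_height_eq hM hN h1, mem_iff_of_height_eq hP hQ h2]
    tauto

theorem symmDiff_eq_of_crossing (h : IsStrictSuccessor G P Q) (h' : IsStrictSuccessor G M N) {a : A}
    (h1 : height G M a ≤ height G P a) (h2 : height G P a < height G N a)
    (h3 : height G P a < height G Q a) : M ∆ N = P ∆ Q := by
  refine symmDiff_congr h'.1 h'.2.1 h.1 h.2.1 fun x => ?_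
  have := crossing h h' h1 h2 h3 x
  have := h.le x
  have := h'.le x
  omega

/-- Men only move down in a step, so of the two edges of a man in the difference the better one
belongs to M. -/
theorem movesDown_iff (h : IsStrictSuccessor G M N) {a : A} {b b' : B} :
    MovesDown G (M ∆ N) a b b' ↔ (a, b) ∈ M ∧ (a, b') ∈ N ∧ G.rankA a b < G.rankA a b' := by
  have hle := h.le a
  rw [MovesDown, mem_symmDiff', mem_symmDiff']
  constructor
  · rintro ⟨h1 | h1, h2 | h2, h3⟩
    · obtain rfl := h.1.1.right_unique h1.1 h2.1
      omega
    · exact ⟨h1.1, h2.1, h3⟩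
    · rw [height_eq h.1.1 h2.1, height_eq h.2.1.1 h1.1] at hle
      omega
    · obtain rfl := h.2.1.1.right_unique h1.1 h2.1
      omega
  · rintro ⟨h1, h2, h3⟩
    refine ⟨Or.inl ⟨h1, fun h4 => ?_⟩, Or.inr ⟨h2, fun h4 => ?_⟩, h3⟩
    · obtain rfl := h.2.1.1.right_unique h2 h4
      omega
    · obtain rfl := h.1.1.right_unique h1 h4
      omega

theorem movesUp_iff (h : IsStrictSuccessor G M N) {b : B} {a a' : A} :
    MovesUp G (M ∆ N) b a a' ↔ (a, b) ∈ M ∧ (a', b) ∈ N ∧ G.rankB b a' < G.rankB b a := by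
  have hle : heightB G N b ≤ heightB G M b := heightB_antitone h.1 h.2.1 h.lt.le b
  rw [MovesUp, mem_symmDiff', mem_symmDiff']
  constructor
  · rintro ⟨h1 | h1, h2 | h2, h3⟩
    · obtain rfl := h.1.1.left_unique h1.1 h2.1
      omega
    · exact ⟨h1.1, h2.1, h3⟩
    · rw [heightB_eq h.1.1 h2.1, heightB_eq h.2.1.1 h1.1] at hle
      omega
    · obtain rfl := h.2.1.1.left_unique h1.1 h2.1
      omega
  · rintro ⟨h1, h2, h3⟩
    refine ⟨Or.inl ⟨h1, fun h4 => ?_⟩, Or.inr ⟨h2, fun h4 => ?_⟩, h3⟩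
    · obtain rfl := h.2.1.1.left_unique h2 h4
      omega
    · obtain rfl := h.1.1.left_unique h1 h4
      omega

theorem exists_movesDown (h : IsStrictSuccessor G M N) {a : A}
    (ha : height G M a < height G N a) :
    ∃ b b', (a, b) ∈ M ∧ (a, b') ∈ N ∧ G.rankA a b < G.rankA a b' := by
  obtain ⟨b, b', h1, h2⟩ := exists_mem_of_height_lt h.1 h.2.1 ha.ne
  rw [height_eq h.1.1 h1, height_eq h.2.1.1 h2] at ha
  exact ⟨b, b', h1, h2, ha⟩

theorem height_lt_of_movesDown (h : IsStrictSuccessor G M N) {a : A} {b b' : B}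
    (hm : MovesDown G (M ∆ N) a b b') : height G M a < height G N a := by
  obtain ⟨h1, h2, h3⟩ := (movesDown_iff h).1 hm
  rwa [height_eq h.1.1 h1, height_eq h.2.1.1 h2]

/-! ### The rotations above a matching -/

/-- Some man is at least as far down in `M` as `ρ` moves him. -/
def Passed (G : Instance A B) (ρ M : Finset (A × B)) : Prop :=
  ∃ a b b', MovesDown G ρ a b b' ∧ G.rankA a b' ≤ height G M a

/-- By the dichotomy one witness suffices for all moved men. Since passage is defined through the
edge set alone, it does not depend on the pair of matchings that produces the rotation. -/
theorem passed_iff (h : IsStrictSuccessor G P Q) (hR : IsSuperStable G R) :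
    Passed G (P ∆ Q) R ↔ ∀ a, height G P a < height G Q a → height G Q a ≤ height G R a := by
  constructor
  · rintro ⟨a, b, b', h1, h2⟩
    refine (h.dichotomy hR).resolve_left fun h3 => ?_
    have h4 := height_lt_of_movesDown h h1
    have h5 := h3 a h4
    rw [movesDown_iff h] at h1
    rw [height_eq h.2.1.1 h1.2.1] at h4
    omega
  · intro h1
    obtain ⟨a, ha⟩ := h.exists_lt
    obtain ⟨b, b', h2, h3, h4⟩ := exists_movesDown h ha
    refine ⟨a, b, b', (movesDown_iff h).2 ⟨h2, h3, h4⟩, ?_⟩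
    rw [← height_eq h.2.1.1 h3]
    exact h1 a ha

theorem not_passed_iff (h : IsStrictSuccessor G P Q) (hR : IsSuperStable G R) :
    ¬ Passed G (P ∆ Q) R ↔ ∀ a, height G P a < height G Q a → height G R a ≤ height G P a := by
  rw [passed_iff h hR]
  constructor
  · exact fun h1 => (h.dichotomy hR).resolve_right h1
  · intro h1 h2
    obtain ⟨a, ha⟩ := h.exists_lt
    have := h1 a ha
    have := h2 a ha
    omega

theorem Passed.mono (hle : height G M ≤ height G N) (h : Passed G ρ M) : Passed G ρ N := by
  obtain ⟨a, b, b', h1, h2⟩ := h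
  exact ⟨a, b, b', h1, h2.trans (hle a)⟩

theorem passed_right (h : IsStrictSuccessor G P Q) : Passed G (P ∆ Q) Q :=
  (passed_iff h h.2.1).2 fun _ _ => le_rfl

theorem not_passed_left (h : IsStrictSuccessor G P Q) (hR : IsSuperStable G R)
    (hle : height G R ≤ height G P) : ¬ Passed G (P ∆ Q) R :=
  (not_passed_iff h hR).2 fun a _ => hle a

open Classical in
/-- The rotations that are passed on the way to `M`. -/
noncomputable def passedSet (G : Instance A B) (M : Finset (A × B)) : Finset (Finset (A × B)) :=
  Finset.univ.filter fun ρ => IsRotation G ρ ∧ Passed G ρ M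

theorem mem_passedSet : ρ ∈ passedSet G M ↔ IsRotation G ρ ∧ Passed G ρ M := by
  simp [passedSet]

/-- A rotation that N has passed and M has not crosses the step from M to N at a moved man, so it is
the rotation of this step. -/
theorem passedSet_eq_insert (h : IsStrictSuccessor G M N) :
    passedSet G N = insert (M ∆ N) (passedSet G M) := by
  ext ρ
  rw [Finset.mem_insert, mem_passedSet, mem_passedSet]
  constructor
  · rintro ⟨h1, h2⟩
    by_cases h3 : Passed G ρ M
    · exact Or.inr ⟨h1, h3⟩
    left
    obtain ⟨P, Q, hPQ, rfl⟩ := h1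
    obtain ⟨a, ha⟩ := hPQ.exists_lt
    have h4 := (not_passed_iff hPQ h.1).1 h3 a ha
    have h5 := (passed_iff hPQ h.2.1).1 h2 a ha
    exact (symmDiff_eq_of_crossing hPQ h h4 (by omega) ha).symm
  · rintro (rfl | ⟨h1, h2⟩)
    · exact ⟨⟨M, N, h, rfl⟩, passed_right h⟩
    · exact ⟨h1, h2.mono h.lt.le⟩

theorem notMem_passedSet (h : IsStrictSuccessor G M N) : M ∆ N ∉ passedSet G M := fun hmem =>
  not_passed_left h h.1 le_rfl (mem_passedSet.1 hmem).2

/-! ### Chains of strict successors -/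

/-- Among the matchings strictly below M that still dominate N, one of least total height has
nothing between itself and M. -/
theorem exists_strictSuccessor (hM : IsSuperStable G M) (hN : IsSuperStable G N)
    (hlt : height G M < height G N) :
    ∃ P, IsStrictSuccessor G M P ∧ height G P ≤ height G N := by
  classical
  let S : Finset (Finset (A × B)) := Finset.univ.filter fun P =>
    IsSuperStable G P ∧ height G M < height G P ∧ height G P ≤ height G N
  obtain ⟨P, hP, hmin⟩ := S.exists_min_image (fun P => ∑ a, height G P a)
    ⟨N, by simp only [S, Finset.mem_filter, Finset.mem_univ, true_and]; exact ⟨hN, hlt, le_rfl⟩⟩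
  simp only [S, Finset.mem_filter, Finset.mem_univ, true_and] at hP hmin
  refine ⟨P, isStrictSuccessor_of hM hP.1 hP.2.1 fun R hR h1 h2 => ?_, hP.2.2⟩
  rcases h1.eq_or_lt with h1 | h1
  · exact Or.inl (eq_of_height_eq hR hM h1.symm)
  right
  have h3 := hmin R ⟨hR, h1, h2.trans hP.2.2⟩
  refine eq_of_height_eq hR hP.1 (funext fun a => ?_)
  by_contra hne
  have := Finset.sum_lt_sum (fun a _ => h2 a) ⟨a, Finset.mem_univ a, lt_of_le_of_ne (h2 a) hne⟩
  omega

theorem exists_chain (hM : IsSuperStable G M) (hN : IsSuperStable G N)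
    (hle : height G M ≤ height G N) : Relation.ReflTransGen (IsStrictSuccessor G) M N := by
  induction hn : ∑ a, (height G N a - height G M a) using Nat.strong_induction_on generalizing M with
  | _ n ih =>
    rcases hle.eq_or_lt with h | h
    · rw [eq_of_height_eq hM hN h]
    · obtain ⟨P, hP, hPN⟩ := exists_strictSuccessor hM hN h
      refine Relation.ReflTransGen.head hP (ih _ ?_ hP.2.1 hPN rfl)
      rw [← hn]
      obtain ⟨a, ha⟩ := hP.exists_lt
      refine Finset.sum_lt_sum (fun x _ => ?_) ⟨a, Finset.mem_univ a, ?_⟩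
      · have := hP.le x; omega
      · have : height G P a ≤ height G N a := hPN a
        omega

theorem height_le_of_chain (h : Relation.ReflTransGen (IsStrictSuccessor G) M N) :
    height G M ≤ height G N := by
  induction h with
  | refl => exact le_rfl
  | tail _ h ih => exact ih.trans h.lt.le

/-- On the way from `M` down to `N` there is a step at which a property gets lost. -/
theorem exists_step (p : Finset (A × B) → Prop) (hM : IsSuperStable G M) (hN : IsSuperStable G N)
    (hle : height G M ≤ height G N) (h : p M) (h' : ¬ p N) :
    ∃ X Y, IsStrictSuccessor G X Y ∧ height G M ≤ height G X ∧ height G Y ≤ height G N ∧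
      p X ∧ ¬ p Y := by
  have hc := exists_chain hM hN hle
  clear hN hle
  induction hc with
  | refl => exact absurd h h'
  | @tail P Q h1 h2 ih =>
    by_cases hP : p P
    · exact ⟨P, Q, h2, height_le_of_chain h1, le_rfl, hP, h'⟩
    · obtain ⟨X, Y, e1, e2, e3, e4⟩ := ih hP
      exact ⟨X, Y, e1, e2, e3.trans h2.lt.le, e4⟩

theorem isManOptimal_iff : IsManOptimal G M ↔
    IsSuperStable G M ∧ ∀ N, IsSuperStable G N → height G M ≤ height G N :=
  and_congr_right fun h => forall_congr' fun _ => forall_congr' fun h' => dominates_iff h h'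

theorem flip_flip (M : Finset (A × B)) : flip (flip M) = M := by
  ext ⟨a, b⟩
  rw [mem_flip, mem_flip]

theorem height_le_of_heightB_le (hM : IsSuperStable G M) (hN : IsSuperStable G N)
    (h : heightB G M ≤ heightB G N) : height G N ≤ height G M := by
  have : height G (flip (flip N)) ≤ height G (flip (flip M)) :=
    heightB_antitone hM.flip hN.flip h
  rwa [flip_flip, flip_flip] at this

theorem isWomanOptimal_iff : IsWomanOptimal G M ↔
    IsSuperStable G M ∧ ∀ N, IsSuperStable G N → height G N ≤ height G M := by
  refine and_congr_right fun h => forall_congr' fun N => forall_congr' fun h' => ?_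
  have h1 : (∀ b a', (a', b) ∈ N → ∃ a, (a, b) ∈ M ∧ G.rankB b a ≤ G.rankB b a') ↔
      Dominates G.swap (flip M) (flip N) := by
    simp only [Dominates, mem_flip]; rfl
  rw [h1, dominates_iff h.flip h'.flip]
  exact ⟨height_le_of_heightB_le h h', heightB_antitone h' h⟩

/-- A super-stable matching of least total height cannot be improved by a join, so it is pointwise
least. -/
theorem exists_manOptimal (h : ∃ M, IsSuperStable G M) : ∃ M, IsManOptimal G M := by
  classical
  obtain ⟨M, hM⟩ := h
  obtain ⟨P, hP, hmin⟩ := (Finset.univ.filter fun P => IsSuperStable G P).exists_min_image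
    (fun P => ∑ a, height G P a) ⟨M, by simpa using hM⟩
  simp only [Finset.mem_filter, Finset.mem_univ, true_and] at hP hmin
  refine ⟨P, isManOptimal_iff.2 ⟨hP, fun N hN a => ?_⟩⟩
  by_contra! hlt
  refine absurd (hmin _ (isSuperStable_join hP hN)) (not_le.2 (Finset.sum_lt_sum (fun x _ => ?_)
    ⟨a, Finset.mem_univ a, ?_⟩))
  · rw [height_join hP hN]; exact min_le_left _ _
  · rw [height_join hP hN]; exact min_lt_of_right_lt hlt

theorem exists_womanOptimal (h : ∃ M, IsSuperStable G M) : ∃ M, IsWomanOptimal G M := by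
  obtain ⟨M, hM⟩ := h
  obtain ⟨P, hP⟩ := exists_manOptimal (G := G.swap) ⟨_, hM.flip⟩
  have h1 : IsSuperStable G (flip P) := hP.1.flip
  refine ⟨flip P, isWomanOptimal_iff.2 ⟨h1, fun N hN => height_le_of_heightB_le h1 hN ?_⟩⟩
  have : height G.swap (flip (flip P)) ≤ height G.swap (flip N) := by
    rw [flip_flip]
    exact (isManOptimal_iff.1 hP).2 _ hN.flip
  exact this

/-! ### Eliminating rotations -/

theorem passedSet_manOptimal (h : IsManOptimal G M) : passedSet G M = ∅ := by
  rw [Finset.eq_empty_iff_forall_notMem]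
  intro ρ hρ
  obtain ⟨⟨P, Q, hPQ, rfl⟩, h2⟩ := mem_passedSet.1 hρ
  exact not_passed_left hPQ h.1 ((isManOptimal_iff.1 h).2 P hPQ.1) h2

theorem eliminate_insert {S : Finset (Finset (A × B))} (h : ρ ∉ S) :
    eliminate M (insert ρ S) = ρ ∆ eliminate M S := by
  rw [eliminate, Finset.fold_insert h]; rfl

/-- Along a chain of strict successors each step contributes exactly its own, new rotation, and
symmetric differences cancel. -/
theorem eliminate_passedSet (hM : IsManOptimal G M) (hN : IsSuperStable G N) :
    eliminate M (passedSet G N) = N := by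
  have hc := exists_chain hM.1 hN ((isManOptimal_iff.1 hM).2 N hN)
  clear hN
  induction hc with
  | refl => rw [passedSet_manOptimal hM]; rfl
  | @tail P Q h1 h2 ih =>
    rw [passedSet_eq_insert h2, eliminate_insert (notMem_passedSet h2), ih, symmDiff_comm,
      symmDiff_symmDiff_cancel_left]

/-- If a man were strictly worse off in M, then on the way from the join down to M some step would
take him below his position in N. The rotation of this step is passed by M and hence by N, which
puts him at least that far down in N. -/
theorem height_le_of_passedSet_subset (hM : IsSuperStable G M) (hN : IsSuperStable G N)
    (h : passedSet G M ⊆ passedSet G N) : height G M ≤ height G N := by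
  intro a
  by_contra! hlt
  have hJ := isSuperStable_join hM hN
  have ha := height_join hM hN a
  obtain ⟨X, Y, h1, -, h3, h4, h5⟩ := exists_step (fun P => height G P a ≤ height G N a) hJ hM
    (fun x => by rw [height_join hM hN]; exact min_le_left _ _) (by rw [ha]; exact min_le_right _ _)
    (not_le.2 hlt)
  have h6 : X ∆ Y ∈ passedSet G M :=
    mem_passedSet.2 ⟨⟨X, Y, h1, rfl⟩, (passed_right h1).mono h3⟩
  have h7 := (passed_iff h1 hN).1 (mem_passedSet.1 (h h6)).2 a (by omega)
  omega

theorem passedSet_mono (h : height G M ≤ height G N) : passedSet G M ⊆ passedSet G N := fun ρ hρ => by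
  rw [mem_passedSet] at hρ ⊢
  exact ⟨hρ.1, hρ.2.mono h⟩

/-! ### Precedence -/

/-- `ρ'` is passed whenever `ρ` is passed. -/
def Before (G : Instance A B) (ρ' ρ : Finset (A × B)) : Prop :=
  IsRotation G ρ' ∧ IsRotation G ρ ∧ ρ' ≠ ρ ∧
    ∀ M, IsSuperStable G M → Passed G ρ M → Passed G ρ' M

theorem eq_of_passed (h : IsStrictSuccessor G P Q) (hρ : IsRotation G ρ) (h1 : Passed G ρ Q)
    (h2 : ¬ Passed G ρ P) : ρ = P ∆ Q := by
  have h3 : ρ ∈ passedSet G Q := mem_passedSet.2 ⟨hρ, h1⟩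
  rw [passedSet_eq_insert h, Finset.mem_insert] at h3
  exact h3.resolve_right fun h4 => h2 (mem_passedSet.1 h4).2

/-- Only ρ₁ ≠ ρ₃ needs an argument. A single step passes a single rotation, so two rotations that
are passed by the same matchings coincide. -/
theorem Before.trans {ρ₁ ρ₂ ρ₃ : Finset (A × B)} (h : Before G ρ₁ ρ₂) (h' : Before G ρ₂ ρ₃) :
    Before G ρ₁ ρ₃ := by
  refine ⟨h.1, h'.2.1, ?_, fun M hM hp => h.2.2.2 M hM (h'.2.2.2 M hM hp)⟩
  rintro rfl
  obtain ⟨P, Q, hPQ, rfl⟩ := h.1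
  refine h'.2.2.1 (eq_of_passed hPQ h.2.1 (h'.2.2.2 _ hPQ.2.1 (passed_right hPQ)) fun hp => ?_)
  exact not_passed_left hPQ hPQ.1 le_rfl (h.2.2.2 _ hPQ.1 hp)

theorem IsStrictSuccessor.exists_moved (h : IsStrictSuccessor G P Q) {a : A} {b : B}
    (hb : (a, b) ∈ Q) (ha : height G P a < height G Q a) :
    ∃ a', (a', b) ∈ P ∧ height G P a' < height G Q a' ∧ G.rankB b a < G.rankB b a' := by
  obtain ⟨b', hb'⟩ := exists_partnerA h.2.1 h.1 hb
  have ha' := ha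
  rw [height_eq h.1.1 hb', height_eq h.2.1.1 hb] at ha'
  obtain ⟨a', h1, h2⟩ := rankB_lt_of_rankA_lt' h.1 h.2.1 hb' hb ha'
  refine ⟨a', h1, lt_of_le_of_ne (h.le a') fun he => ?_, h2⟩
  obtain rfl := h.2.1.1.left_unique hb ((mem_iff_of_height_eq h.1 h.2.1 he b).1 h1)
  omega

theorem IsStrictSuccessor.exists_moved' (h : IsStrictSuccessor G P Q) {a : A} {b : B}
    (hb : (a, b) ∈ P) (ha : height G P a < height G Q a) :
    ∃ a', (a', b) ∈ Q ∧ height G P a' < height G Q a' ∧ G.rankB b a' < G.rankB b a := by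
  obtain ⟨b', hb'⟩ := exists_partnerA h.1 h.2.1 hb
  have ha' := ha
  rw [height_eq h.1.1 hb, height_eq h.2.1.1 hb'] at ha'
  obtain ⟨a', h1, h2⟩ := rankB_lt_of_rankA_lt h.1 h.2.1 hb hb' ha'
  refine ⟨a', h1, lt_of_le_of_ne (h.le a') fun he => ?_, h2⟩
  obtain rfl := h.1.1.left_unique hb ((mem_iff_of_height_eq h.1 h.2.1 he b).2 h1)
  omega

/-- Once ρ is passed, the man a is below b, which is where ρ' takes him; he witnesses that ρ' is
passed. -/
theorem before_of_typeOne (hρ' : IsRotation G ρ') (hρ : IsRotation G ρ) (h : TypeOne G ρ' ρ) :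
    Before G ρ' ρ := by
  obtain ⟨a, b₁, b, b₂, h1, h2⟩ := h
  obtain ⟨P, Q, hPQ, rfl⟩ := hρ
  refine ⟨hρ', ⟨P, Q, hPQ, rfl⟩, ?_, fun M hM hp => ?_⟩
  · rintro rfl
    rw [movesDown_iff hPQ] at h1 h2
    obtain rfl := hPQ.1.1.right_unique h1.1 h2.1
    omega
  · have h3 := (passed_iff hPQ hM).1 hp a (height_lt_of_movesDown hPQ h2)
    have h4 := h2
    rw [movesDown_iff hPQ] at h4
    rw [height_eq hPQ.2.1.1 h4.2.1] at h3
    exact ⟨a, b₁, b, h1, by omega⟩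

/-- Suppose that M has passed ρ but not ρ'. In M the man x has nobody strictly better than y, and
not y herself, since b₂ may tie with y but differs from her. So y must have a partner strictly
better than x. Before ρ', however, y has nobody better than a₁, who is no better than x. -/
theorem before_of_typeTwo (hρ' : IsRotation G ρ') (hρ : IsRotation G ρ) (h : TypeTwo G ρ' ρ) :
    Before G ρ' ρ := by
  obtain ⟨hne, x, y, he, ⟨b₁, b₂, h1, h2, h3, h4⟩, a₁, a₂, h5, h6, h7⟩ := h
  refine ⟨hρ', hρ, hne, fun M hM hp => ?_⟩
  obtain ⟨P, Q, hPQ, rfl⟩ := hρ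
  obtain ⟨P', Q', hPQ', rfl⟩ := hρ'
  have h8 := (passed_iff hPQ hM).1 hp x (height_lt_of_movesDown hPQ h1)
  rw [movesDown_iff hPQ] at h1
  rw [height_eq hPQ.2.1.1 h1.2.1] at h8
  by_contra hn
  rw [not_passed_iff hPQ' hM] at hn
  rw [movesUp_iff hPQ'] at h5
  by_cases hxy : (x, y) ∈ M
  · rw [height_eq hM.1 hxy] at h8
    exact h2 (eq_of_rankA_eq hPQ.2.1 hM h1.2.1 hxy (by omega))
  rcases hM.cover he hxy with ⟨c, h9, h10⟩ | ⟨c, h9, h10⟩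
  · rw [height_eq hM.1 h9] at h8
    omega
  · have h11 : height G P' a₁ < height G Q' a₁ := by
      refine lt_of_le_of_ne (hPQ'.le a₁) fun hh => ?_
      obtain rfl := hPQ'.2.1.1.left_unique h5.2.1
        ((mem_iff_of_height_eq hPQ'.1 hPQ'.2.1 hh y).1 h5.1)
      omega
    have h12 := heightB_le_of_height_le' hM hPQ'.1 h5.1 (hn a₁ h11)
    rw [heightB_eq hPQ'.1.1 h5.1, heightB_eq hM.1 h9] at h12
    omega

theorem before_of_labelEdge (h : LabelEdge G ρ' ρ) : Before G ρ' ρ :=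
  h.2.2.elim (before_of_typeOne h.1 h.2.1) (before_of_typeTwo h.1 h.2.1)

/-! ### Eliminating a rotation all of whose predecessors in the digraph are passed -/

/-- The men that move from `P` to `Q` get their partners in `Q`, the others keep those in `M`. -/
def exchange (G : Instance A B) (M P Q : Finset (A × B)) : Finset (A × B) :=
  Finset.univ.filter fun e => if height G P e.1 < height G Q e.1 then e ∈ Q else e ∈ M

theorem mem_exchange_of_lt {a : A} {b : B} (h : height G P a < height G Q a) :
    (a, b) ∈ exchange G M P Q ↔ (a, b) ∈ Q := by
  simp [exchange, h]

theorem mem_exchange_of_not_lt {a : A} {b : B} (h : ¬ height G P a < height G Q a) :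
    (a, b) ∈ exchange G M P Q ↔ (a, b) ∈ M := by
  simp [exchange, h]

/-- If M were strictly above P at a moved man, then on the way down some step would bring him to his
woman in P. The rotation of this step is a type 1 predecessor that M has not passed. -/
theorem height_eq_of_labelEdge (hM : IsSuperStable G M) (h : IsStrictSuccessor G P Q)
    (hn : ¬ Passed G (P ∆ Q) M) (hpre : ∀ ρ', LabelEdge G ρ' (P ∆ Q) → Passed G ρ' M) {a : A}
    (ha : height G P a < height G Q a) : height G M a = height G P a := by
  by_contra hne
  have hle := (not_passed_iff h hM).1 hn a ha
  have hX := isSuperStable_meet hM h.1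
  have hXa := height_meet hM h.1 a
  obtain ⟨X, Y, h1, h2, h3, h4, h5⟩ := exists_step (fun R => height G R a < height G P a) hM hX
    (fun x => by rw [height_meet hM h.1]; exact le_max_left _ _) (by omega) (by omega)
  have h6 : height G Y a ≤ height G (meet G M P) a := h3 a
  obtain ⟨b, b', h7, h8, h9⟩ := exists_movesDown h ha
  obtain ⟨c, c', h10, h11, h12⟩ := exists_movesDown h1 (a := a) (by omega)
  have h13 : c' = b := by
    refine eq_of_rankA_eq h1.2.1 h.1 h11 h7 ?_
    rw [← height_eq h1.2.1.1 h11, ← height_eq h.1.1 h7]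
    omega
  subst h13
  refine not_passed_left h1 hM h2 (hpre _ ⟨⟨X, Y, h1, rfl⟩, ⟨P, Q, h, rfl⟩, Or.inl ?_⟩)
  exact ⟨a, c, c', b', (movesDown_iff h1).2 ⟨h10, h11, h12⟩, (movesDown_iff h).2 ⟨h7, h8, h9⟩⟩

/-- The moved men have the same partners in M and in P, so the exchange is a matching and no woman
loses. A blocking edge (x, y) must therefore belong to a moved man, whom the rotation moves past y,
and it betrays a type 2 predecessor that M has not passed. -/
theorem isSuperStable_exchange (hM : IsSuperStable G M) (h : IsStrictSuccessor G P Q)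
    (hn : ¬ Passed G (P ∆ Q) M) (hpre : ∀ ρ', LabelEdge G ρ' (P ∆ Q) → Passed G ρ' M) :
    IsSuperStable G (exchange G M P Q) := by
  have hP : ∀ {a : A}, height G P a < height G Q a → ∀ b, (a, b) ∈ M ↔ (a, b) ∈ P := fun ha b =>
    mem_iff_of_height_eq hM h.1 (height_eq_of_labelEdge hM h hn hpre ha) b
  have mixed : ∀ {a a' : A} {b : B}, height G P a < height G Q a → ¬ height G P a' < height G Q a' →
      (a, b) ∈ Q → (a', b) ∉ M := by
    intro a a' b ha ha' h1 h2
    obtain ⟨a'', h3, h4, -⟩ := h.exists_moved h1 ha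
    obtain rfl := hM.1.left_unique h2 ((hP h4 b).2 h3)
    exact ha' h4
  refine ⟨⟨?_, ?_⟩, ?_⟩
  · rintro ⟨a, b⟩ he
    by_cases ha : height G P a < height G Q a
    · exact h.2.1.1.1 ((mem_exchange_of_lt ha).1 he)
    · exact hM.1.1 ((mem_exchange_of_not_lt ha).1 he)
  · rintro ⟨a, b⟩ h1 ⟨a', b'⟩ h2 hh
    by_cases ha : height G P a < height G Q a <;> by_cases ha' : height G P a' < height G Q a'
    · rw [mem_exchange_of_lt ha] at h1
      rw [mem_exchange_of_lt ha'] at h2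
      exact h.2.1.1.2 _ h1 _ h2 hh
    · rw [mem_exchange_of_lt ha] at h1
      rw [mem_exchange_of_not_lt ha'] at h2
      rcases hh with hh | hh
      · simp only at hh
        rw [hh] at ha
        exact absurd ha ha'
      · simp only at hh
        subst hh
        exact absurd h2 (mixed ha ha' h1)
    · rw [mem_exchange_of_not_lt ha] at h1
      rw [mem_exchange_of_lt ha'] at h2
      rcases hh with hh | hh
      · simp only at hh
        rw [hh] at ha
        exact absurd ha' ha
      · simp only at hh
        subst hh
        exact absurd h1 (mixed ha' ha h2)
    · rw [mem_exchange_of_not_lt ha] at h1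
      rw [mem_exchange_of_not_lt ha'] at h2
      exact hM.1.2 _ h1 _ h2 hh
  · rintro x y ⟨he, hxy, h1, h2⟩
    have better : ∀ a', (a', y) ∈ M → G.rankB y x ≤ G.rankB y a' := by
      intro a' ha'
      by_contra! hlt
      by_cases hm : height G P a' < height G Q a'
      · obtain ⟨a'', h3, h4, h5⟩ := h.exists_moved' ((hP hm y).1 ha') hm
        have := h2 a'' ((mem_exchange_of_lt h4).2 h3)
        omega
      · have := h2 a' ((mem_exchange_of_not_lt hm).2 ha')
        omega
    by_cases hx : height G P x < height G Q x
    · rw [mem_exchange_of_lt hx] at hxy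
      by_cases hxM : (x, y) ∈ M
      · obtain ⟨a'', h3, h4, h5⟩ := h.exists_moved' ((hP hx y).1 hxM) hx
        have := h2 a'' ((mem_exchange_of_lt h4).2 h3)
        omega
      rcases hM.cover he hxM with ⟨b₁, h3, h4⟩ | ⟨a', h3, h4⟩
      swap
      · have := better a' h3; omega
      rcases h.2.1.cover he hxy with ⟨b₂, h5, h6⟩ | ⟨a₂, h5, h6⟩
      · have := h1 b₂ ((mem_exchange_of_lt hx).2 h5)
        omega
      -- In Q the woman y has a partner a₂ strictly better than x. He cannot be a moved man, for the
      -- exchange would then give him to y; so the rotation leaves y alone.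
      have ha₂ : ¬ height G P a₂ < height G Q a₂ := by
        intro hlt
        have := h2 a₂ ((mem_exchange_of_lt hlt).2 h5)
        omega
      have ha₂P : (a₂, y) ∈ P :=
        (mem_iff_of_height_eq h.1 h.2.1 (le_antisymm (h.le a₂) (not_lt.1 ha₂)) y).2 h5
      -- In M the woman y has nobody better than x, below Q she has. The step at which this changes
      -- moves her above x and supplies the label.
      have hX := isSuperStable_meet hM h.2.1
      obtain ⟨X, Y, e1, e2, -, e4, e5⟩ := exists_step
        (fun R => G.rankB y x ≤ heightB G R y) hM hX
        (fun x => by rw [height_meet hM h.2.1]; exact le_max_left _ _) (by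
          obtain ⟨a₁, ha₁⟩ := exists_partnerB h.2.1 hM h5
          rw [heightB_eq hM.1 ha₁]
          exact better a₁ ha₁) (by
          have : heightB G (meet G M Q) y ≤ heightB G Q y := heightB_antitone h.2.1 hX
            (fun x => by rw [height_meet hM h.2.1]; exact le_max_right _ _) y
          rw [heightB_eq h.2.1.1 h5] at this
          omega)
      obtain ⟨c, hc⟩ := exists_partnerB h.2.1 e1.1 h5
      obtain ⟨c', hc'⟩ := exists_partnerB h.2.1 e1.2.1 h5
      rw [heightB_eq e1.1.1 hc] at e4
      rw [heightB_eq e1.2.1.1 hc'] at e5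
      have hup : MovesUp G (X ∆ Y) y c c' := (movesUp_iff e1).2 ⟨hc, hc', by omega⟩
      obtain ⟨b₂, hb₂⟩ := exists_partnerA hM h.2.1 h3
      have hb₂' := h1 b₂ ((mem_exchange_of_lt hx).2 hb₂)
      refine not_passed_left e1 hM e2 (hpre _ ⟨⟨X, Y, e1, rfl⟩, ⟨P, Q, h, rfl⟩, Or.inr ⟨?_, x, y, he,
        ⟨b₁, b₂, (movesDown_iff h).2 ⟨(hP hx b₁).1 h3, hb₂, by omega⟩, ?_, h4.le, hb₂'⟩,
        c, c', hup, by omega, e4⟩⟩)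
      · intro heq
        rw [heq, movesUp_iff h] at hup
        obtain rfl := h.1.1.left_unique hup.1 ha₂P
        obtain rfl := h.2.1.1.left_unique hup.2.1 h5
        omega
      · rintro rfl
        exact hxy hb₂
    · rw [mem_exchange_of_not_lt hx] at hxy
      rcases hM.cover he hxy with ⟨b₁, h3, h4⟩ | ⟨a', h3, h4⟩
      · have := h1 b₁ ((mem_exchange_of_not_lt hx).2 h3)
        omega
      · have := better a' h3
        omega

theorem height_exchange (a : A) : height G (exchange G M P Q) a =
    if height G P a < height G Q a then height G Q a else height G M a := by
  split_ifs with h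
  · simp only [height, mem_exchange_of_lt h]
  · simp only [height, mem_exchange_of_not_lt h]

/-- The exchange is a strict successor: a matching between it and M is, by the dichotomy, on one
side of all moves of the rotation, and elsewhere it has no freedom. -/
theorem exists_successor_of_labelEdge (hM : IsSuperStable G M) (hρ : IsRotation G ρ)
    (hn : ¬ Passed G ρ M) (hpre : ∀ ρ', LabelEdge G ρ' ρ → Passed G ρ' M) :
    ∃ N, IsStrictSuccessor G M N ∧ M ∆ N = ρ := by
  obtain ⟨P, Q, h, rfl⟩ := hρ
  have hE := isSuperStable_exchange hM h hn hpre
  have hP : ∀ {a : A}, height G P a < height G Q a → height G M a = height G P a := fun ha =>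
    height_eq_of_labelEdge hM h hn hpre ha
  have hh := height_exchange (G := G) (M := M) (P := P) (Q := Q)
  refine ⟨exchange G M P Q, isStrictSuccessor_of hM hE ?_ ?_, ?_⟩
  · refine Pi.lt_def.2 ⟨fun a => ?_, h.exists_lt.imp fun a ha => ?_⟩
    · rw [hh]
      split_ifs with ha
      · rw [hP ha]; exact ha.le
      · exact le_rfl
    · rw [hh, if_pos ha, hP ha]; exact ha
  · intro R hR h1 h2
    rcases h.dichotomy hR with h3 | h3
    · refine Or.inl (eq_of_height_eq hR hM (funext fun a => le_antisymm ?_ (h1 a)))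
      by_cases ha : height G P a < height G Q a
      · rw [hP ha]; exact h3 a ha
      · have := h2 a
        rwa [hh, if_neg ha] at this
    · refine Or.inr (eq_of_height_eq hR hE (funext fun a => le_antisymm (h2 a) ?_))
      rw [hh]
      split_ifs with ha
      · exact h3 a ha
      · exact h1 a
  · refine symmDiff_congr hM hE h.1 h.2.1 fun x => ?_
    rw [hh]
    split_ifs with hx
    · exact Or.inl ⟨hP hx, rfl⟩
    · exact Or.inr ⟨rfl, le_antisymm (h.le x) (not_lt.1 hx)⟩

/-- Greedy elimination: take M with as many passed rotations in S as possible. If S contains others,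
one of them with fewest rotations before it has all its label predecessors passed and can be
eliminated next. -/
theorem exists_passedSet_eq (hex : ∃ M, IsSuperStable G M) (S : Finset (Finset (A × B)))
    (hS : ∀ ρ ∈ S, IsRotation G ρ) (hcl : ∀ ρ ∈ S, ∀ ρ', LabelEdge G ρ' ρ → ρ' ∈ S) :
    ∃ M, IsSuperStable G M ∧ passedSet G M = S := by
  classical
  obtain ⟨M₀, hM₀⟩ := exists_manOptimal hex
  obtain ⟨M, hM, hmax⟩ := (Finset.univ.filter fun M => IsSuperStable G M ∧
    passedSet G M ⊆ S).exists_max_image (fun M => (passedSet G M).card)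
    ⟨M₀, by simp [hM₀.1, passedSet_manOptimal hM₀]⟩
  simp only [Finset.mem_filter, Finset.mem_univ, true_and] at hM hmax
  refine ⟨M, hM.1, ?_⟩
  by_contra hne
  have hd : (S \ passedSet G M).Nonempty := by
    rw [Finset.sdiff_nonempty]
    exact fun hc => hne (Finset.Subset.antisymm hM.2 hc)
  obtain ⟨σ, hσ, hmin⟩ := (S \ passedSet G M).exists_min_image
    (fun σ => (Finset.univ.filter fun τ => Before G τ σ).card) hd
  rw [Finset.mem_sdiff, mem_passedSet] at hσ
  obtain ⟨N, hN, rfl⟩ := exists_successor_of_labelEdge hM.1 (hS σ hσ.1)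
    (fun hp => hσ.2 ⟨hS σ hσ.1, hp⟩) (fun τ hτ => by
      by_contra hnp
      have h1 := hmin τ (Finset.mem_sdiff.2 ⟨hcl σ hσ.1 τ hτ, fun hp => hnp (mem_passedSet.1 hp).2⟩)
      have h2 := before_of_labelEdge hτ
      refine absurd h1 (not_le.2 (Finset.card_lt_card ?_))
      rw [Finset.ssubset_iff_of_subset]
      · refine ⟨τ, by simpa using h2, ?_⟩
        simp only [Finset.mem_filter, Finset.mem_univ, true_and]
        exact fun h3 => h3.2.2.1 rfl
      · intro υ hυ
        simp only [Finset.mem_filter, Finset.mem_univ, true_and] at hυ ⊢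
        exact hυ.trans h2)
  have h3 := hmax N ⟨hN.2.1, by
    rw [passedSet_eq_insert hN]
    exact Finset.insert_subset hσ.1 hM.2⟩
  rw [passedSet_eq_insert hN, Finset.card_insert_of_notMem (notMem_passedSet hN)] at h3
  omega

/-- For the converse, the label ancestors of ρ together with ρ form a label-closed set, which is the
passed set of some matching. This matching has passed ρ, hence ρ', so ρ' is among the ancestors. -/
theorem transGen_labelEdge_iff : Relation.TransGen (LabelEdge G) ρ' ρ ↔ Before G ρ' ρ := by
  classical
  constructor
  · intro h
    induction h with
    | single h => exact before_of_labelEdge h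
    | tail _ h ih => exact ih.trans (before_of_labelEdge h)
  · intro h
    have hex : ∃ M, IsSuperStable G M := h.1.elim fun M hM => hM.elim fun N hN => ⟨M, hN.1.1⟩
    obtain ⟨M, hM, hMS⟩ := exists_passedSet_eq hex
      (Finset.univ.filter fun σ => σ = ρ ∨ Relation.TransGen (LabelEdge G) σ ρ) (by
        simp only [Finset.mem_filter, Finset.mem_univ, true_and]
        rintro σ (rfl | hσ)
        · exact h.2.1
        · obtain ⟨τ, hτ, -⟩ := Relation.TransGen.head'_iff.1 hσ
          exact hτ.1) (by
        simp only [Finset.mem_filter, Finset.mem_univ, true_and]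
        rintro σ (rfl | hσ) τ hτ
        · exact Or.inr (Relation.TransGen.single hτ)
        · exact Or.inr (Relation.TransGen.head hτ hσ))
    have h1 : ρ ∈ passedSet G M := by simp [hMS]
    have h2 : ρ' ∈ passedSet G M :=
      mem_passedSet.2 ⟨h.1, h.2.2.2 M hM (mem_passedSet.1 h1).2⟩
    rw [hMS] at h2
    simp only [Finset.mem_filter, Finset.mem_univ, true_and] at h2
    exact h2.resolve_left h.2.2.1

end Rotations

end SuperStable

namespace SuperStable

/-! ### Maximal sequences and the structure theorem -/

section Sequences

variable {A B : Type*} [Fintype A] [Fintype B] [DecidableEq A] [DecidableEq B]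
  {G : Instance A B} {M N P Q R : Finset (A × B)} {ρ ρ' σ : Finset (A × B)}
  {L : List (Finset (A × B))}

/-! ### Maximal sequences -/

theorem length_differences (L : List (Finset (A × B))) :
    (differences L).length = L.length - 1 := by
  simp [differences]

theorem getElem_differences {i : ℕ} (hi : i < (differences L).length)
    (h : i + 1 < L.length) : (differences L)[i] = L[i] ∆ L[i + 1] := by
  simp [differences]

theorem mem_differences : ρ ∈ differences L ↔
    ∃ (i : ℕ) (h : i + 1 < L.length), ρ = L[i] ∆ L[i + 1] := by
  rw [List.mem_iff_getElem]
  constructor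
  · rintro ⟨i, hi, rfl⟩
    have h : i + 1 < L.length := by rw [length_differences] at hi; omega
    exact ⟨i, h, getElem_differences hi h⟩
  · rintro ⟨i, h, rfl⟩
    have hi : i < (differences L).length := by rw [length_differences]; omega
    exact ⟨i, hi, getElem_differences hi h⟩

theorem IsMaximalSequence.length_pos (h : IsMaximalSequence G L) : 0 < L.length := by
  obtain ⟨⟨M, hM, -⟩, -⟩ := h
  cases L <;> simp at hM ⊢

theorem IsMaximalSequence.successor (h : IsMaximalSequence G L) {i : ℕ} (hi : i + 1 < L.length) :
    IsStrictSuccessor G L[i] L[i + 1] :=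
  List.isChain_iff_getElem.1 h.2.2 i hi

theorem IsMaximalSequence.manOptimal (h : IsMaximalSequence G L) :
    IsManOptimal G (L[0]'h.length_pos) := by
  obtain ⟨⟨M, hM, h1⟩, -⟩ := h
  rw [List.head?_eq_getElem?, Option.mem_def, List.getElem?_eq_some_iff] at hM
  obtain ⟨_, rfl⟩ := hM
  exact h1

theorem IsMaximalSequence.womanOptimal (h : IsMaximalSequence G L) :
    IsWomanOptimal G (L[L.length - 1]'(Nat.sub_lt h.length_pos one_pos)) := by
  obtain ⟨-, ⟨M, hM, h1⟩, -⟩ := h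
  rw [List.getLast?_eq_getElem?, Option.mem_def, List.getElem?_eq_some_iff] at hM
  obtain ⟨_, rfl⟩ := hM
  exact h1

theorem IsMaximalSequence.superStable (h : IsMaximalSequence G L) {i : ℕ} (hi : i < L.length) :
    IsSuperStable G L[i] := by
  cases i with
  | zero => exact h.manOptimal.1
  | succ i => exact (h.successor hi).2.1

theorem IsMaximalSequence.height_mono (h : IsMaximalSequence G L) {i j : ℕ} (hij : i ≤ j)
    (hj : j < L.length) : height G (L[i]'(hij.trans_lt hj)) ≤ height G L[j] := by
  induction hij with
  | refl => exact le_rfl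
  | @step k hk ih => exact (ih (by omega)).trans (h.successor hj).lt.le

theorem IsMaximalSequence.passed_iff (h : IsMaximalSequence G L) {i j : ℕ} (hi : i + 1 < L.length)
    (hj : j < L.length) : Passed G (L[i] ∆ L[i + 1]) L[j] ↔ i < j := by
  constructor
  · intro hp
    by_contra! hle
    exact not_passed_left (h.successor hi) (h.superStable hj) (h.height_mono hle _) hp
  · intro hlt
    exact (passed_right (h.successor hi)).mono (h.height_mono (i := i + 1) hlt hj)

/-- The position of a difference can be read off from the members of the sequence that have passed
it. -/
theorem IsMaximalSequence.index_eq (h : IsMaximalSequence G L) {i j : ℕ} (hi : i + 1 < L.length)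
    (hj : j + 1 < L.length) (he : L[i] ∆ L[i + 1] = L[j] ∆ L[j + 1]) : i = j := by
  have h1 := h.passed_iff hi hi
  have h2 := h.passed_iff hj hi
  have h3 := h.passed_iff hi hj
  have h4 := h.passed_iff hj hj
  rw [he] at h1 h3
  have e1 := h1.symm.trans h2
  have e2 := h3.symm.trans h4
  omega

theorem IsMaximalSequence.exists_index (h : IsMaximalSequence G L) (hρ : IsRotation G ρ) {j : ℕ}
    (hj : j < L.length) (hp : Passed G ρ L[j]) :
    ∃ (i : ℕ) (hi : i + 1 < L.length), i < j ∧ ρ = L[i] ∆ L[i + 1] := by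
  induction j with
  | zero =>
    have : ρ ∈ passedSet G L[0] := mem_passedSet.2 ⟨hρ, hp⟩
    rw [passedSet_manOptimal h.manOptimal] at this
    simp at this
  | succ j ih =>
    by_cases h' : Passed G ρ L[j]
    · obtain ⟨i, hi, h1, h2⟩ := ih (by omega) h'
      exact ⟨i, hi, by omega, h2⟩
    · exact ⟨j, hj, by omega, eq_of_passed (h.successor hj) hρ hp h'⟩

theorem IsMaximalSequence.mem_differences_iff (h : IsMaximalSequence G L) :
    ρ ∈ differences L ↔ IsRotation G ρ := by
  rw [mem_differences]
  constructor
  · rintro ⟨i, hi, rfl⟩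
    exact ⟨_, _, h.successor hi, rfl⟩
  · intro hρ
    obtain ⟨i, hi, -, h1⟩ := h.exists_index hρ (Nat.sub_lt h.length_pos one_pos) (by
      obtain ⟨P, Q, hPQ, rfl⟩ := hρ
      exact (passed_right hPQ).mono ((isWomanOptimal_iff.1 h.womanOptimal).2 Q hPQ.2.1))
    exact ⟨i, hi, h1⟩

theorem IsMaximalSequence.nodup_differences (h : IsMaximalSequence G L) :
    (differences L).Nodup := by
  rw [List.nodup_iff_injective_getElem]
  intro i j hij
  have hi := i.2.trans_eq (length_differences L)
  have hj := j.2.trans_eq (length_differences L)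
  simp only [getElem_differences i.2 (by omega), getElem_differences j.2 (by omega)] at hij
  exact Fin.ext (h.index_eq (by omega) (by omega) hij)

/-- Some maximal sequence contains a given super-stable matching. -/
theorem exists_maximalSequence (hM : IsSuperStable G M) :
    ∃ L, IsMaximalSequence G L ∧ ∃ (i : ℕ) (hi : i < L.length), L[i] = M := by
  obtain ⟨T, hT⟩ := exists_manOptimal ⟨M, hM⟩
  obtain ⟨Z, hZ⟩ := exists_womanOptimal ⟨M, hM⟩
  obtain ⟨l₁, h1, h2⟩ := List.exists_isChain_cons_of_relationReflTransGen
    (exists_chain hT.1 hM ((isManOptimal_iff.1 hT).2 M hM))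
  obtain ⟨l₂, h3, h4⟩ := List.exists_isChain_cons_of_relationReflTransGen
    (exists_chain hM hZ.1 ((isWomanOptimal_iff.1 hZ).2 M hM))
  have h5 : (T :: l₁).getLast? = some M := by rw [List.getLast?_eq_some_getLast (by simp), h2]
  refine ⟨(T :: l₁) ++ l₂, ⟨⟨T, by simp, hT⟩, ⟨Z, ?_, hZ⟩, ?_⟩, l₁.length, by simp, ?_⟩
  · rw [Option.mem_def, List.getLast?_append, h5]
    have h6 : (M :: l₂).getLast? = some Z := by rw [List.getLast?_eq_some_getLast (by simp), h4]
    cases l₂ with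
    | nil => simpa using h6
    | cons x l =>
      rw [List.getLast?_cons_cons] at h6
      rw [h6]
      rfl
  · rw [List.isChain_append]
    refine ⟨h1, h3.tail, fun x hx y hy => ?_⟩
    rw [h5, Option.mem_def, Option.some_inj] at hx
    subst hx
    cases l₂ with
    | nil => simp at hy
    | cons z l =>
      simp only [List.head?_cons, Option.mem_def, Option.some.injEq] at hy
      subst hy
      exact (List.isChain_cons_cons.1 h3).1
  · rw [List.getElem_append_left (by simp)]
    rw [List.getLast?_eq_getElem?, List.getElem?_eq_some_iff] at h5
    obtain ⟨_, h5⟩ := h5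
    simpa using h5

theorem pair_sublist_iff {α : Type*} {x y : α} {l : List α} :
    List.Sublist [x, y] l ↔ ∃ (i j : ℕ) (hij : i < j) (hj : j < l.length), l[i] = x ∧ l[j] = y := by
  constructor
  · intro h
    obtain ⟨r₁, r₂, rfl, h1, h2⟩ := List.cons_sublist_iff.1 h
    rw [List.singleton_sublist] at h2
    obtain ⟨i, hi, rfl⟩ := List.mem_iff_getElem.1 h1
    obtain ⟨j, hj, rfl⟩ := List.mem_iff_getElem.1 h2
    exact ⟨i, r₁.length + j, by omega, by simp; omega, by simp [hi], by simp⟩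
  · rintro ⟨i, j, hij, hj, rfl, rfl⟩
    rw [List.cons_sublist_iff]
    refine ⟨l.take j, l.drop j, (List.take_append_drop j l).symm, ?_, ?_⟩
    · exact List.mem_iff_getElem.2 ⟨i, by simp; omega, by simp⟩
    · rw [List.singleton_sublist]
      exact List.mem_iff_getElem.2 ⟨0, by simp; omega, by simp⟩

/-- Every super-stable matching lies on some maximal sequence, so an order that holds on all
sequences constrains each matching. Conversely, a rotation is passed by exactly those members of a
sequence that come after it. -/
theorem precedes_iff : Precedes G ρ' ρ ↔ Before G ρ' ρ := by
  constructor
  · rintro ⟨h1, h2, h3⟩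
    have key : ∀ M, IsSuperStable G M → Passed G ρ M → Passed G ρ' M ∧ ρ' ≠ ρ := by
      intro M hM hp
      obtain ⟨L, hL, k, hk, rfl⟩ := exists_maximalSequence hM
      obtain ⟨i, j, hij, hj, h4, h5⟩ := pair_sublist_iff.1 (h3 L hL)
      have hj' := hj
      rw [length_differences] at hj'
      rw [getElem_differences _ (by omega)] at h4 h5
      subst h4 h5
      rw [hL.passed_iff] at hp ⊢
      exact ⟨by omega, fun he => hij.ne (hL.index_eq (by omega) (by omega) he)⟩
    refine ⟨h1, h2, ?_, fun M hM hp => (key M hM hp).1⟩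
    obtain ⟨P, Q, hPQ, rfl⟩ := h2
    exact (key Q hPQ.2.1 (passed_right hPQ)).2
  · rintro ⟨h1, h2, h3, h4⟩
    refine ⟨h1, h2, fun L hL => ?_⟩
    obtain ⟨j, hj, rfl⟩ := mem_differences.1 (hL.mem_differences_iff.2 h2)
    obtain ⟨i, hi, h5, rfl⟩ := hL.exists_index h1 hj
      (h4 _ (hL.superStable hj) ((hL.passed_iff hj hj).2 (by omega)))
    have hij : i ≠ j := by rintro rfl; exact h3 rfl
    rw [pair_sublist_iff]
    exact ⟨i, j, by omega, by rw [length_differences]; omega, getElem_differences _ _,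
      getElem_differences _ _⟩

theorem exists_of_isClosedSet (hex : ∃ M, IsSuperStable G M) {S : Finset (Finset (A × B))}
    (hS : IsClosedSet G S) : ∃ M, IsSuperStable G M ∧ passedSet G M = S :=
  exists_passedSet_eq hex S hS.1 fun ρ hρ ρ' h =>
    hS.2 ρ hρ ρ' (precedes_iff.2 (before_of_labelEdge h))

theorem isClosedSet_passedSet (hM : IsSuperStable G M) : IsClosedSet G (passedSet G M) := by
  refine ⟨fun ρ hρ => (mem_passedSet.1 hρ).1, fun ρ hρ ρ' h => ?_⟩
  have h1 := precedes_iff.1 h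
  exact mem_passedSet.2 ⟨h1.1, h1.2.2.2 M hM (mem_passedSet.1 hρ).2⟩

/-- The structure of the set of super-stable matchings. -/
theorem rotation_structure (G : Instance A B) :
    ((∃ M, IsSuperStable G M) → ∃ L, IsMaximalSequence G L) ∧
    (∀ L, IsMaximalSequence G L →
      (differences L).Nodup ∧ ∀ ρ, ρ ∈ differences L ↔ IsRotation G ρ) ∧
    (∀ ρ, ¬ Precedes G ρ ρ) ∧
    (∀ ρ₁ ρ₂ ρ₃, Precedes G ρ₁ ρ₂ → Precedes G ρ₂ ρ₃ → Precedes G ρ₁ ρ₃) ∧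
    (∀ M₀, IsManOptimal G M₀ →
      Set.BijOn (eliminate M₀) {S | IsClosedSet G S} {M | IsSuperStable G M} ∧
      ∀ S S', IsClosedSet G S → IsClosedSet G S' →
        (Dominates G (eliminate M₀ S) (eliminate M₀ S') ↔ S ⊆ S')) ∧
    (∀ ρ' ρ, Relation.TransGen (LabelEdge G) ρ' ρ ↔ Precedes G ρ' ρ) := by
  refine ⟨?_, fun L hL => ⟨hL.nodup_differences, fun ρ => hL.mem_differences_iff⟩, ?_, ?_, ?_, ?_⟩
  · rintro ⟨M, hM⟩
    exact (exists_maximalSequence hM).imp fun L h => h.1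
  · exact fun ρ h => (precedes_iff.1 h).2.2.1 rfl
  · exact fun ρ₁ ρ₂ ρ₃ h h' => precedes_iff.2 ((precedes_iff.1 h).trans (precedes_iff.1 h'))
  · intro M₀ hM₀
    refine ⟨⟨fun S hS => ?_, fun S hS S' hS' he => ?_, fun M hM => ?_⟩, fun S S' hS hS' => ?_⟩
    · obtain ⟨M, hM, rfl⟩ := exists_of_isClosedSet ⟨_, hM₀.1⟩ hS
      rw [eliminate_passedSet hM₀ hM]
      exact hM
    · obtain ⟨M, hM, rfl⟩ := exists_of_isClosedSet ⟨_, hM₀.1⟩ hS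
      obtain ⟨M', hM', rfl⟩ := exists_of_isClosedSet ⟨_, hM₀.1⟩ hS'
      rw [eliminate_passedSet hM₀ hM, eliminate_passedSet hM₀ hM'] at he
      rw [he]
    · exact ⟨_, isClosedSet_passedSet hM, eliminate_passedSet hM₀ hM⟩
    · obtain ⟨M, hM, rfl⟩ := exists_of_isClosedSet ⟨_, hM₀.1⟩ hS
      obtain ⟨M', hM', rfl⟩ := exists_of_isClosedSet ⟨_, hM₀.1⟩ hS'
      rw [eliminate_passedSet hM₀ hM, eliminate_passedSet hM₀ hM', dominates_iff hM hM']
      exact ⟨passedSet_mono, height_le_of_passedSet_subset hM hM'⟩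
  · exact fun ρ' ρ => transGen_labelEdge_iff.trans precedes_iff.symm

end Sequences

end SuperStable

namespace SuperStable

/-! ## A program logic with time credits -/

/-- All registers and array entries are words. -/
def State.Bounded (W : ℕ) (s : State) : Prop :=
  (∀ r, s.reg r < W) ∧ ∀ k i, s.arr k i < W

/-- The part of `Exp.Fits` that does not follow from the boundedness of the state. -/
def Exp.Ok (W : ℕ) (s : State) : Exp → Prop
  | .const c => c < W
  | .reg _ => True
  | .read _ e => e.Ok W s
  | .op .add e₁ e₂ => e₁.Ok W s ∧ e₂.Ok W s ∧ e₁.eval s + e₂.eval s < W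
  | .op .mul e₁ e₂ => e₁.Ok W s ∧ e₂.Ok W s ∧ e₁.eval s * e₂.eval s < W
  | .op .sub e₁ e₂ => e₁.Ok W s ∧ e₂.Ok W s
  | .op .lt e₁ e₂ => e₁.Ok W s ∧ e₂.Ok W s ∧ 1 < W
  | .op .eq e₁ e₂ => e₁.Ok W s ∧ e₂.Ok W s ∧ 1 < W

/-- In a bounded state registers and array reads are words, and truncated subtraction cannot
overflow. What remains to be checked are constants, sums, products, and that 1 is a word for the
comparisons. -/
theorem Exp.fits_and_lt {W : ℕ} {s : State} (hs : s.Bounded W) (e : Exp) (h : e.Ok W s) :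
    e.Fits W s ∧ e.eval s < W := by
  induction e with
  | const c => exact ⟨h, h⟩
  | reg r => exact ⟨hs.1 r, hs.1 r⟩
  | read k e ih => exact ⟨⟨(ih h).1, hs.2 _ _⟩, hs.2 _ _⟩
  | op o e₁ e₂ ih₁ ih₂ =>
    cases o with
    | add => exact ⟨⟨(ih₁ h.1).1, (ih₂ h.2.1).1, h.2.2⟩, h.2.2⟩
    | mul => exact ⟨⟨(ih₁ h.1).1, (ih₂ h.2.1).1, h.2.2⟩, h.2.2⟩
    | sub =>
      have := (ih₁ h.1).2
      have h' : e₁.eval s - e₂.eval s < W := by omega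
      exact ⟨⟨(ih₁ h.1).1, (ih₂ h.2).1, h'⟩, h'⟩
    | lt =>
      have h1 := h.2.2
      have h' : (if e₁.eval s < e₂.eval s then 1 else 0) < W := by split_ifs <;> omega
      exact ⟨⟨(ih₁ h.1).1, (ih₂ h.2.1).1, h'⟩, h'⟩
    | eq =>
      have h1 := h.2.2
      have h' : (if e₁.eval s = e₂.eval s then 1 else 0) < W := by split_ifs <;> omega
      exact ⟨⟨(ih₁ h.1).1, (ih₂ h.2.1).1, h'⟩, h'⟩

@[simp] theorem State.setReg_reg (s : State) (r v r' : ℕ) :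
    (s.setReg r v).reg r' = if r' = r then v else s.reg r' := by
  simp [State.setReg, Function.update_apply]

@[simp] theorem State.setReg_arr (s : State) (r v : ℕ) : (s.setReg r v).arr = s.arr := rfl

@[simp] theorem State.setArr_reg (s : State) (k i v : ℕ) : (s.setArr k i v).reg = s.reg := rfl

@[simp] theorem State.setArr_arr (s : State) (k i v k' : ℕ) :
    (s.setArr k i v).arr k' = if k' = k then Function.update (s.arr k) i v else s.arr k' := by
  simp [State.setArr, Function.update_apply]

theorem State.Bounded.setReg {W : ℕ} {s : State} (hs : s.Bounded W) {r v : ℕ} (hv : v < W) :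
    (s.setReg r v).Bounded W := by
  refine ⟨fun r' => ?_, hs.2⟩
  rw [State.setReg_reg]
  split_ifs
  exacts [hv, hs.1 r']

theorem State.Bounded.setArr {W : ℕ} {s : State} (hs : s.Bounded W) {k i v : ℕ} (hv : v < W) :
    (s.setArr k i v).Bounded W := by
  refine ⟨hs.1, fun l j => ?_⟩
  rw [State.setArr_arr]
  split_ifs
  · rw [Function.update_apply]
    split_ifs
    exacts [hv, hs.2 k j]
  · exact hs.2 l j

/-- Started with `k` time credits in the state `s`, the command ends in a state that satisfies `Q`
together with the number of credits left. -/
def wp (W : ℕ) : Cmd → (ℕ → State → Prop) → ℕ → State → Prop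
  | .skip, Q, k, s => 1 ≤ k ∧ Q (k - 1) s
  | .assign r e, Q, k, s => e.Ok W s ∧ e.size + 1 ≤ k ∧ Q (k - (e.size + 1)) (s.setReg r (e.eval s))
  | .store a i e, Q, k, s => i.Ok W s ∧ e.Ok W s ∧ i.size + e.size + 1 ≤ k ∧
      Q (k - (i.size + e.size + 1)) (s.setArr a (i.eval s) (e.eval s))
  | .seq c₁ c₂, Q, k, s => wp W c₁ (wp W c₂ Q) k s
  | .cond e c₁ c₂, Q, k, s => e.Ok W s ∧ e.size + 1 ≤ k ∧
      (e.eval s ≠ 0 → wp W c₁ Q (k - (e.size + 1)) s) ∧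
      (e.eval s = 0 → wp W c₂ Q (k - (e.size + 1)) s)
  -- A recursion on commands cannot unfold a loop. For loops the conclusion of soundness is taken as
  -- the definition, and loops are proved with an invariant.
  | .loop e c, Q, k, s => s.Bounded W → ∃ t s', Exec W (.loop e c) s t s' ∧ t ≤ k ∧
      s'.Bounded W ∧ Q (k - t) s'

attribute [simp] wp Exp.Ok Exp.eval Op.eval Exp.size Nat.sub_sub

theorem wp_sound {W : ℕ} {c : Cmd} {Q : ℕ → State → Prop} {k : ℕ} {s : State}
    (h : wp W c Q k s) (hs : s.Bounded W) :
    ∃ t s', Exec W c s t s' ∧ t ≤ k ∧ s'.Bounded W ∧ Q (k - t) s' := by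
  induction c generalizing Q k s with
  | skip => exact ⟨1, s, .skip s, h.1, hs, h.2⟩
  | assign r e =>
    have he := e.fits_and_lt hs h.1
    exact ⟨_, _, .assign s r e he.1, h.2.1, hs.setReg he.2, h.2.2⟩
  | store a i e =>
    have hi := i.fits_and_lt hs h.1
    have he := e.fits_and_lt hs h.2.1
    exact ⟨_, _, .store s a i e hi.1 he.1, h.2.2.1, hs.setArr he.2, h.2.2.2⟩
  | seq c₁ c₂ ih₁ ih₂ =>
    obtain ⟨t₁, s₁, e₁, l₁, b₁, h₁⟩ := ih₁ h hs
    obtain ⟨t₂, s₂, e₂, l₂, b₂, h₂⟩ := ih₂ h₁ b₁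
    refine ⟨t₁ + t₂, s₂, .seq _ _ _ _ _ _ _ e₁ e₂, by omega, b₂, ?_⟩
    rwa [Nat.sub_add_eq]
  | cond e c₁ c₂ ih₁ ih₂ =>
    have he := (e.fits_and_lt hs h.1).1
    by_cases hv : e.eval s = 0
    · obtain ⟨t, s', e', l, b, h'⟩ := ih₂ (h.2.2.2 hv) hs
      have := h.2.1
      exact ⟨e.size + 1 + t, s', .condFalse _ _ _ _ _ _ he hv e', by omega, b, by
        rwa [Nat.sub_add_eq]⟩
    · obtain ⟨t, s', e', l, b, h'⟩ := ih₁ (h.2.2.1 hv) hs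
      have := h.2.1
      exact ⟨e.size + 1 + t, s', .condTrue _ _ _ _ _ _ he hv e', by omega, b, by
        rwa [Nat.sub_add_eq]⟩
  | loop e c => exact h hs

/-- Every round pays at least for its test, so induction on the credits gives termination; no
separate variant is needed. -/
theorem wp_loop {W : ℕ} {e : Exp} {c : Cmd} {Q : ℕ → State → Prop} (I : ℕ → State → Prop)
    {k : ℕ} {s : State} (h₀ : I k s)
    (h : ∀ k s, I k s → e.Ok W s ∧ e.size + 1 ≤ k ∧ (e.eval s = 0 → Q (k - (e.size + 1)) s) ∧
      (e.eval s ≠ 0 → wp W c I (k - (e.size + 1)) s)) :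
    wp W (.loop e c) Q k s := by
  intro hs
  induction k using Nat.strong_induction_on generalizing s with
  | _ k ih =>
    obtain ⟨h1, h2, h3, h4⟩ := h k s h₀
    have he := (e.fits_and_lt hs h1).1
    by_cases hv : e.eval s = 0
    · exact ⟨_, _, .loopDone _ _ _ he hv, h2, hs, h3 hv⟩
    · obtain ⟨t₁, s₁, e₁, l₁, b₁, h₁⟩ := wp_sound (h4 hv) hs
      obtain ⟨t₂, s₂, e₂, l₂, b₂, h₂⟩ := ih _ (by omega) h₁ b₁
      refine ⟨e.size + 1 + t₁ + t₂, s₂, .loopStep _ _ _ _ _ _ _ he hv e₁ e₂, by omega, b₂, ?_⟩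
      rwa [show k - (e.size + 1 + t₁ + t₂) = k - (e.size + 1) - t₁ - t₂ by omega]

/-- The command may assign the register `r`. -/
def Cmd.writesReg (r : ℕ) : Cmd → Bool
  | .skip => false
  | .assign r' _ => r == r'
  | .store _ _ _ => false
  | .seq c₁ c₂ => c₁.writesReg r || c₂.writesReg r
  | .cond _ c₁ c₂ => c₁.writesReg r || c₂.writesReg r
  | .loop _ c => c.writesReg r

/-- The command may store to the array `a`. -/
def Cmd.writesArr (a : ℕ) : Cmd → Bool
  | .skip => false
  | .assign _ _ => false
  | .store a' _ _ => a == a'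
  | .seq c₁ c₂ => c₁.writesArr a || c₂.writesArr a
  | .cond _ c₁ c₂ => c₁.writesArr a || c₂.writesArr a
  | .loop _ c => c.writesArr a

/-- The states agree on everything that `c` does not write. -/
structure Frame (c : Cmd) (s s' : State) : Prop where
  reg : ∀ r, c.writesReg r = false → s'.reg r = s.reg r
  arr : ∀ a, c.writesArr a = false → s'.arr a = s.arr a

theorem Frame.refl (c : Cmd) (s : State) : Frame c s s := ⟨fun _ _ => rfl, fun _ _ => rfl⟩

theorem Frame.trans {c : Cmd} {s₁ s₂ s₃ : State} (h : Frame c s₁ s₂) (h' : Frame c s₂ s₃) :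
    Frame c s₁ s₃ :=
  ⟨fun r hr => (h'.reg r hr).trans (h.reg r hr), fun a ha => (h'.arr a ha).trans (h.arr a ha)⟩

theorem Frame.seq_left {c₁ c₂ : Cmd} {s s' : State} (h : Frame c₁ s s') : Frame (.seq c₁ c₂) s s' :=
  ⟨fun r hr => h.reg r (by simp_all [Cmd.writesReg]),
    fun a ha => h.arr a (by simp_all [Cmd.writesArr])⟩

theorem Frame.seq_right {c₁ c₂ : Cmd} {s s' : State} (h : Frame c₂ s s') :
    Frame (.seq c₁ c₂) s s' :=
  ⟨fun r hr => h.reg r (by simp_all [Cmd.writesReg]),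
    fun a ha => h.arr a (by simp_all [Cmd.writesArr])⟩

theorem Exec.frame {W : ℕ} {c : Cmd} {s : State} {t : ℕ} {s' : State} (h : Exec W c s t s') :
    Frame c s s' := by
  induction h with
  | skip s => exact Frame.refl _ _
  | assign s r e he =>
    refine ⟨fun r' hr => ?_, fun _ _ => rfl⟩
    rw [State.setReg_reg, if_neg]
    simpa [Cmd.writesReg] using hr
  | store s k i e hi he =>
    refine ⟨fun _ _ => rfl, fun a ha => ?_⟩
    rw [State.setArr_arr, if_neg]
    simpa [Cmd.writesArr] using ha
  | seq _ _ _ _ _ _ _ _ _ ih₁ ih₂ => exact ih₁.seq_left.trans ih₂.seq_right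
  | condTrue e c₁ c₂ s s' t he hv h ih =>
    exact ⟨fun r hr => ih.reg r (by simp_all [Cmd.writesReg]),
      fun a ha => ih.arr a (by simp_all [Cmd.writesArr])⟩
  | condFalse e c₁ c₂ s s' t he hv h ih =>
    exact ⟨fun r hr => ih.reg r (by simp_all [Cmd.writesReg]),
      fun a ha => ih.arr a (by simp_all [Cmd.writesArr])⟩
  | loopDone e c s he hv => exact Frame.refl _ _
  | loopStep e c s s₁ s₂ t₁ t₂ he hv h₁ h₂ ih₁ ih₂ =>
    exact Frame.trans ⟨ih₁.reg, ih₁.arr⟩ ih₂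

/-- The postcondition may use that everything the command does not write is unchanged.
Specifications therefore mention only what they modify, and the side conditions are decided by
computation. -/
theorem wp_frame {W : ℕ} {c : Cmd} {Q Q' : ℕ → State → Prop} {k : ℕ} {s : State}
    (h : wp W c Q' k s) (hQ : ∀ k' s', Frame c s s' → Q' k' s' → Q k' s') : wp W c Q k s := by
  induction c generalizing Q Q' k s with
  | skip => exact ⟨h.1, hQ _ _ (Frame.refl _ _) h.2⟩
  | assign r e =>
    refine ⟨h.1, h.2.1, hQ _ _ ⟨fun r' hr => ?_, fun _ _ => rfl⟩ h.2.2⟩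
    rw [State.setReg_reg, if_neg]
    simpa [Cmd.writesReg] using hr
  | store a i e =>
    refine ⟨h.1, h.2.1, h.2.2.1, hQ _ _ ⟨fun _ _ => rfl, fun a ha => ?_⟩ h.2.2.2⟩
    rw [State.setArr_arr, if_neg]
    simpa [Cmd.writesArr] using ha
  | seq c₁ c₂ ih₁ ih₂ =>
    exact ih₁ h fun k₁ s₁ f₁ h₁ => ih₂ h₁ fun k₂ s₂ f₂ h₂ =>
      hQ k₂ s₂ (f₁.seq_left.trans f₂.seq_right) h₂
  | cond e c₁ c₂ ih₁ ih₂ =>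
    refine ⟨h.1, h.2.1, fun hv => ih₁ (h.2.2.1 hv) fun k' s' f h' => hQ k' s' ?_ h',
      fun hv => ih₂ (h.2.2.2 hv) fun k' s' f h' => hQ k' s' ?_ h'⟩
    · exact ⟨fun r hr => f.reg r (by simp_all [Cmd.writesReg]),
        fun a ha => f.arr a (by simp_all [Cmd.writesArr])⟩
    · exact ⟨fun r hr => f.reg r (by simp_all [Cmd.writesReg]),
        fun a ha => f.arr a (by simp_all [Cmd.writesArr])⟩
  | loop e c =>
    intro hs
    obtain ⟨t, s', h1, h2, h3, h4⟩ := h hs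
    exact ⟨t, s', h1, h2, h3, hQ _ _ h1.frame h4⟩

theorem wp_seq_frame {W : ℕ} {c₁ c₂ : Cmd} {Q Q' : ℕ → State → Prop} {k : ℕ} {s : State}
    (h : wp W c₁ Q' k s) (hQ : ∀ k' s', Frame c₁ s s' → Q' k' s' → wp W c₂ Q k' s') :
    wp W (.seq c₁ c₂) Q k s := by
  change wp W c₁ (wp W c₂ Q) k s
  exact wp_frame h hQ

theorem wp_mono {W : ℕ} {c : Cmd} {Q Q' : ℕ → State → Prop} {k : ℕ} {s : State}
    (h : wp W c Q' k s) (hQ : ∀ k' s', Q' k' s' → Q k' s') : wp W c Q k s :=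
  wp_frame h fun k₁ s₁ _ => hQ k₁ s₁

/-- The loop rule with an invariant that need not mention what the body does not write. -/
theorem wp_loop' {W : ℕ} {e : Exp} {c : Cmd} {Q : ℕ → State → Prop} (I : ℕ → State → Prop)
    {k : ℕ} {s₀ : State} (h₀ : I k s₀)
    (h : ∀ k s, Frame c s₀ s → I k s → e.Ok W s ∧ e.size + 1 ≤ k ∧
      (e.eval s = 0 → Q (k - (e.size + 1)) s) ∧
      (e.eval s ≠ 0 → wp W c I (k - (e.size + 1)) s)) :
    wp W (.loop e c) Q k s₀ := by
  refine wp_loop (fun k s => Frame c s₀ s ∧ I k s) ⟨Frame.refl _ _, h₀⟩ ?_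
  rintro k s ⟨hf, hI⟩
  obtain ⟨h1, h2, h3, h4⟩ := h k s hf hI
  exact ⟨h1, h2, h3, fun hv => wp_frame (h4 hv) fun _ _ hf₁ hI₁ => ⟨hf.trans hf₁, hI₁⟩⟩

/-! ### Notation for programs -/

infixl:65 "+." => Exp.op Op.add
infixl:65 "-." => Exp.op Op.sub
infixl:70 "*." => Exp.op Op.mul
infix:50 "<." => Exp.op Op.lt
infix:50 "=." => Exp.op Op.eq
infix:40 "::=" => Cmd.assign
infixr:30 ";;" => Cmd.seq

/-- Read access to an array. -/
abbrev rd (k : ℕ) (e : Exp) : Exp := .read k e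

/-- The value of a register. -/
abbrev vr (r : ℕ) : Exp := .reg r

/-- A constant. -/
abbrev cst (c : ℕ) : Exp := .const c

/-- `for i < n do c`, where the register `i` starts with its current value. -/
def forLoop (i n : ℕ) (c : Cmd) : Cmd := .loop (vr i <. vr n) (c ;; (i ::= vr i +. cst 1))

/-- Rule for counting loops: `I j k s` holds before the round in which the counter is `j`. -/
theorem wp_forLoop {W : ℕ} {i n : ℕ} {c : Cmd} {Q : ℕ → State → Prop} (I : ℕ → ℕ → State → Prop)
    {k : ℕ} {s₀ : State} {N j₀ : ℕ} (hN : s₀.reg n = N) (hW : N + 1 < W) (hj : s₀.reg i = j₀)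
    (hj₀ : j₀ ≤ N) (hin : n ≠ i) (hi : c.writesReg i = false) (hn : c.writesReg n = false)
    (h₀ : I j₀ k s₀)
    (hstep : ∀ j k s, j < N → s.reg i = j → Frame (forLoop i n c) s₀ s → I j k s → 4 ≤ k ∧
      wp W c (fun k' s' => 4 ≤ k' ∧ I (j + 1) (k' - 4) (s'.setReg i (j + 1))) (k - 4) s)
    (hQ : ∀ k s, s.reg i = N → Frame (forLoop i n c) s₀ s → I N k s → 4 ≤ k ∧ Q (k - 4) s) :
    wp W (forLoop i n c) Q k s₀ := by
  refine wp_loop' (fun k s => ∃ j ≤ N, s.reg i = j ∧ I j k s) ⟨j₀, hj₀, hj, h₀⟩ ?_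
  rintro k s hf' ⟨j, hjN, hji, hI⟩
  have hf : Frame (forLoop i n c) s₀ s := ⟨hf'.reg, hf'.arr⟩
  have hn' : s.reg n = N := by
    rw [← hN]
    refine hf'.reg n ?_
    simp [Cmd.writesReg, hn, hin]
  have hev : Exp.eval s (vr i <. vr n) = if j < N then 1 else 0 := by
    simp only [Exp.eval, Op.eval, hji, hn']
  rw [hev]
  refine ⟨⟨trivial, trivial, by omega⟩, ?_⟩
  have hsz : (vr i <. vr n).size + 1 = 4 := rfl
  rw [hsz]
  by_cases hlt : j < N
  · obtain ⟨h1, h2⟩ := hstep j k s hlt hji hf hI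
    refine ⟨h1, fun h => by simp [hlt] at h, fun _ => ?_⟩
    change wp W c (wp W (i ::= vr i +. cst 1) _) _ _
    refine wp_frame h2 ?_
    rintro k' s' hf' ⟨h3, h4⟩
    have hji' : s'.reg i = j := (hf'.reg i hi).trans hji
    refine ⟨⟨trivial, show 1 < W by omega, ?_⟩, h3, j + 1, hlt, ?_, ?_⟩
    · simp only [Exp.eval, hji']; omega
    · simp [Exp.eval, Op.eval, hji']
    · simpa [Exp.eval, Op.eval, hji', Exp.size] using h4
  · obtain rfl : j = N := by omega
    obtain ⟨h1, h2⟩ := hQ k s hji hf hI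
    exact ⟨h1, fun _ => h2, fun h => by simp at h⟩

end SuperStable

namespace SuperStable

/-! ## Proposals on numbered edges -/

/-- An instance with `a` men and `b` women whose `m` edges are numbered: the ends of the edges, the
ranks of these ends for each other, and the first edge of each man. -/
structure FlatInstance where
  a : ℕ
  b : ℕ
  m : ℕ
  EX : ℕ → ℕ
  EY : ℕ → ℕ
  ER : ℕ → ℕ
  EB : ℕ → ℕ
  FI : ℕ → ℕ

/-- The edges of each man are consecutive and ordered by his preferences. -/
structure FlatInstance.Valid (D : FlatInstance) : Prop where
  ex_lt : ∀ e < D.m, D.EX e < D.a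
  ey_lt : ∀ e < D.m, D.EY e < D.b
  eb_lt : ∀ e < D.m, D.EB e < D.m
  inj : ∀ e < D.m, ∀ e' < D.m, D.EX e = D.EX e' → D.EY e = D.EY e' → e = e'
  block : ∀ x < D.a, ∀ e < D.m, D.EX e = x ↔ D.FI x ≤ e ∧ e < D.FI (x + 1)
  fi_le : ∀ x ≤ D.a, D.FI x ≤ D.m
  fi_mono : ∀ x < D.a, D.FI x ≤ D.FI (x + 1)
  er_mono : ∀ d e, d ≤ e → e < D.m → D.EX d = D.EX e → D.ER d ≤ D.ER e

/-- Super-stability for sets of numbered edges. -/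
structure FlatInstance.Stable (D : FlatInstance) (N : ℕ → Prop) : Prop where
  lt : ∀ e, N e → e < D.m
  injX : ∀ e e', N e → N e' → D.EX e = D.EX e' → e = e'
  injY : ∀ e e', N e → N e' → D.EY e = D.EY e' → e = e'
  cover : ∀ e < D.m, ¬ N e → (∃ e', N e' ∧ D.EX e' = D.EX e ∧ D.ER e' < D.ER e) ∨
    ∃ e', N e' ∧ D.EY e' = D.EY e ∧ D.EB e' < D.EB e

namespace FlatInstance

variable {D : FlatInstance} {p c f cur stk : ℕ → ℕ} {sp : ℕ}

/-- The number of women that hold `x`, where `f y` is one plus the number of the edge held by `y`,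
or `0`. -/
def count (D : FlatInstance) (f : ℕ → ℕ) (x : ℕ) : ℕ :=
  ∑ y ∈ Finset.range D.b, if f y ≠ 0 ∧ D.EX (f y - 1) = x then 1 else 0

/-- An additive form that avoids truncated subtraction: the old contribution of y is added on one
side, the new one on the other. -/
theorem count_update {y : ℕ} (hy : y < D.b) (v x : ℕ) :
    D.count (Function.update f y v) x + (if f y ≠ 0 ∧ D.EX (f y - 1) = x then 1 else 0) =
      D.count f x + if v ≠ 0 ∧ D.EX (v - 1) = x then 1 else 0 := by
  unfold count
  rw [← Finset.add_sum_erase _ _ (Finset.mem_range.2 hy),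
    ← Finset.add_sum_erase (Finset.range D.b) (fun y => if f y ≠ 0 ∧ D.EX (f y - 1) = x then 1 else 0)
    (Finset.mem_range.2 hy)]
  have : ∑ z ∈ (Finset.range D.b).erase y, (if Function.update f y v z ≠ 0 ∧
      D.EX (Function.update f y v z - 1) = x then 1 else 0) =
      ∑ z ∈ (Finset.range D.b).erase y, if f z ≠ 0 ∧ D.EX (f z - 1) = x then 1 else 0 := by
    refine Finset.sum_congr rfl fun z hz => ?_
    rw [Function.update_of_ne (Finset.ne_of_mem_erase hz)]
  rw [this]
  simp only [Function.update_self]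
  omega

theorem count_pos {y : ℕ} (hy : y < D.b) (hf : f y ≠ 0) : 0 < D.count f (D.EX (f y - 1)) := by
  refine lt_of_lt_of_le ?_ (Finset.single_le_sum (fun _ _ => Nat.zero_le _) (Finset.mem_range.2 hy))
  simp [hf]

theorem exists_of_count_pos {x : ℕ} (h : D.count f x ≠ 0) :
    ∃ y < D.b, f y ≠ 0 ∧ D.EX (f y - 1) = x := by
  by_contra! hc
  refine h (Finset.sum_eq_zero fun y hy => if_neg ?_)
  rintro ⟨h1, h2⟩
  exact hc y (Finset.mem_range.1 hy) h1 h2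

/-- The man `x` still has someone to propose to and is either held by nobody or in the middle of
a tie; `p x` is the next edge of `x`. -/
def Active (D : FlatInstance) (p c : ℕ → ℕ) (x : ℕ) : Prop :=
  p x < D.FI (x + 1) ∧ (c x = 0 ∨ D.ER (p x) = D.ER (p x - 1))

/-- Consistency of the data structure. -/
structure Shape (D : FlatInstance) (p c f cur : ℕ → ℕ) : Prop where
  p_ge : ∀ x < D.a, D.FI x ≤ p x
  p_le : ∀ x < D.a, p x ≤ D.FI (x + 1)
  held : ∀ y < D.b, f y ≠ 0 → f y - 1 < D.m ∧ D.EY (f y - 1) = y ∧ f y - 1 < p (D.EX (f y - 1)) ∧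
    D.ER (f y - 1) = D.ER (p (D.EX (f y - 1)) - 1) ∧ D.EB (f y - 1) = cur y
  c_eq : ∀ x < D.a, c x = D.count f x

/-- Each woman has bounded her situation by the proposals made to her. -/
structure Bound (D : FlatInstance) (p f cur : ℕ → ℕ) : Prop where
  cur_le : ∀ y < D.b, cur y ≤ D.m
  proposed : ∀ e < D.m, e < p (D.EX e) → cur (D.EY e) ≤ D.EB e ∧
    (cur (D.EY e) = D.EB e → f (D.EY e) = e + 1 ∨ f (D.EY e) = 0)

/-- The bounds hold for all matchings in the set `T`. -/
def Target (D : FlatInstance) (T : (ℕ → Prop) → Prop) (f cur : ℕ → ℕ) : Prop :=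
  ∀ N, T N → D.Stable N ∧ ∀ y < D.b, cur y < D.m →
    ∃ e, N e ∧ D.EY e = y ∧ D.EB e ≤ cur y ∧ (f y = 0 → D.EB e < cur y)

/-- All active men other than `h` are on the stack. -/
def Stacked (D : FlatInstance) (p c stk : ℕ → ℕ) (sp h : ℕ) : Prop :=
  (∀ i < sp, stk i < D.a) ∧ ∀ x < D.a, D.Active p c x → x = h ∨ ∃ i < sp, stk i = x

variable {T : (ℕ → Prop) → Prop}

/-- By the bounds, the woman's partner in N is at least as good as her best proposal, and so the
proposed edge of N is exactly at the bound. If she held nobody, N would have to be strictly better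
for her. -/
theorem held_of_mem (hD : D.Valid) (hB : D.Bound p f cur) (hT : D.Target T f cur) {N : ℕ → Prop}
    (hN : T N) {e : ℕ} (he : N e) (hp : e < p (D.EX e)) : f (D.EY e) = e + 1 := by
  obtain ⟨hS, h1⟩ := hT N hN
  have hm := hS.lt e he
  have h2 := hB.proposed e hm hp
  have h3 := hD.eb_lt e hm
  obtain ⟨e', h4, h5, h6, h7⟩ := h1 _ (hD.ey_lt e hm) (by omega)
  obtain rfl := hS.injY _ _ h4 he h5
  rcases h2.2 (by omega) with h8 | h8
  · exact h8
  · have := h7 h8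
    omega

theorem lt_m_of_active (hD : D.Valid) {x : ℕ} (hx : x < D.a) (ha : D.Active p c x) : p x < D.m :=
  ha.1.trans_le (hD.fi_le _ hx)

theorem ex_of_active (hD : D.Valid) (hS : D.Shape p c f cur) {x : ℕ} (hx : x < D.a)
    (ha : D.Active p c x) : D.EX (p x) = x :=
  (hD.block x hx _ (lt_m_of_active hD hx ha)).2 ⟨hS.p_ge x hx, ha.1⟩

/-- No matching of the target set gives an active man a partner better than his next one. -/
theorem not_better_of_active (hD : D.Valid) (hS : D.Shape p c f cur) (hB : D.Bound p f cur)
    (hT : D.Target T f cur) {x : ℕ} (hx : x < D.a) (ha : D.Active p c x) {N : ℕ → Prop} (hN : T N) :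
    ¬ ∃ e', N e' ∧ D.EX e' = x ∧ D.ER e' < D.ER (p x) := by
  rintro ⟨e', h1, h2, h3⟩
  have hm := (hT N hN).1.lt e' h1
  have hx' := ex_of_active hD hS hx ha
  have hlt : e' < p x := by
    by_contra! hle
    have := hD.er_mono _ _ hle hm (by rw [h2, hx'])
    omega
  have h4 := held_of_mem hD hB hT hN h1 (by rwa [h2])
  have hy := hD.ey_lt e' hm
  have h5 := count_pos hy (f := f) (by omega)
  have h6 := hS.held _ hy (by omega)
  rw [h4, Nat.add_sub_cancel, h2] at h5 h6
  rw [← hS.c_eq x hx] at h5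
  rcases ha.2 with h7 | h7
  · omega
  · omega

/-- The new bound is valid for N because e is in N or covered by it. It cannot be covered at x, who
has no better partner in N, so it is covered at the woman. -/
theorem bound_of_better (hD : D.Valid) (hS : D.Shape p c f cur) (hB : D.Bound p f cur)
    (hT : D.Target T f cur) {x e : ℕ} (hx : x < D.a) (ha : D.Active p c x) (he : e = p x)
    (hr : D.EB e < cur (D.EY e)) :
    D.Bound (Function.update p x (e + 1)) (Function.update f (D.EY e) (e + 1))
      (Function.update cur (D.EY e) (D.EB e)) ∧
    D.Target T (Function.update f (D.EY e) (e + 1)) (Function.update cur (D.EY e) (D.EB e)) := by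
  have hm : e < D.m := he ▸ lt_m_of_active hD hx ha
  have hex : D.EX e = x := he ▸ ex_of_active hD hS hx ha
  refine ⟨⟨fun y hy => ?_, fun e' he' hp => ?_⟩, fun N hN => ⟨(hT N hN).1, fun y hy hc => ?_⟩⟩
  · rw [Function.update_apply]
    split_ifs
    · exact (hD.eb_lt e hm).le
    · exact hB.cur_le y hy
  · by_cases hee : e' = e
    · subst hee
      simp
    have hp' : e' < p (D.EX e') := by
      rw [Function.update_apply] at hp
      split_ifs at hp with h
      · rw [h]; omega
      · exact hp
    have h1 := hB.proposed e' he' hp'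
    by_cases hy : D.EY e' = D.EY e
    · rw [hy] at h1
      rw [hy, Function.update_self, Function.update_self]
      exact ⟨by omega, fun h => by omega⟩
    · rwa [Function.update_of_ne hy, Function.update_of_ne hy]
  · by_cases hye : y = D.EY e
    · subst hye
      simp only [Function.update_self, Nat.add_eq_zero_iff, one_ne_zero, and_false,
        false_imp_iff, and_true]
      by_cases hNe : N e
      · exact ⟨e, hNe, rfl, le_rfl⟩
      rcases (hT N hN).1.cover e hm hNe with h | ⟨e', h1, h2, h3⟩
      · rw [hex, he] at h
        exact absurd h (not_better_of_active hD hS hB hT hx ha hN)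
      · exact ⟨e', h1, h2, h3.le⟩
    · rw [Function.update_of_ne hye] at hc ⊢
      rw [Function.update_of_ne hye]
      exact (hT N hN).2 y hy hc

/-- This is where super-stability enters. Of two proposals that tie at the bound, at least one is
not in N, and it has to be covered. It cannot be covered at its man, so the woman has a strictly
better partner in N, and both proposals may be rejected. -/
theorem bound_of_tie (hD : D.Valid) (hS : D.Shape p c f cur) (hB : D.Bound p f cur)
    (hT : D.Target T f cur) {x e : ℕ} (hx : x < D.a) (ha : D.Active p c x) (he : e = p x)
    (hr : D.EB e = cur (D.EY e)) :
    D.Bound (Function.update p x (e + 1)) (Function.update f (D.EY e) 0) cur ∧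
    D.Target T (Function.update f (D.EY e) 0) cur := by
  have hm : e < D.m := he ▸ lt_m_of_active hD hx ha
  have hex : D.EX e = x := he ▸ ex_of_active hD hS hx ha
  refine ⟨⟨hB.cur_le, fun e' he' hp => ?_⟩, fun N hN => ⟨(hT N hN).1, fun y hy hc => ?_⟩⟩
  · by_cases hee : e' = e
    · subst hee
      simp [hr]
    have hp' : e' < p (D.EX e') := by
      rw [Function.update_apply] at hp
      split_ifs at hp with h
      · rw [h]; omega
      · exact hp
    have h1 := hB.proposed e' he' hp'
    refine ⟨h1.1, fun h => ?_⟩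
    by_cases hy : D.EY e' = D.EY e
    · simp [hy]
    · rw [Function.update_of_ne hy]
      exact h1.2 h
  · obtain ⟨e', h1, h2, h3, h4⟩ := (hT N hN).2 y hy hc
    by_cases hye : y = D.EY e
    · subst hye
      refine ⟨e', h1, h2, h3, fun _ => ?_⟩
      -- If she already held nobody, the strict bound was known before.
      by_cases hf : f (D.EY e) = 0
      · exact h4 hf
      refine lt_of_le_of_ne h3 fun heq => ?_
      obtain ⟨g1, g2, g3, g4, g5⟩ := hS.held _ hy hf
      set e₁ := f (D.EY e) - 1 with he₁
      -- If N contains the new edge, the held edge e₁ needs a cover; otherwise the new edge does.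
      by_cases hee : e' = e
      · subst hee
        have hne : ¬ N e₁ := fun hN1 => by
          have h5 : e₁ = e' := (hT N hN).1.injY _ _ hN1 h1 g2
          rw [h5, hex] at g3
          omega
        rcases (hT N hN).1.cover e₁ g1 hne with ⟨e'', k1, k2, k3⟩ | ⟨e'', k1, k2, k3⟩
        · have hm'' := (hT N hN).1.lt _ k1
          have hlt : e'' < p (D.EX e'') := by
            by_contra! hle
            rw [k2] at hle
            have := hD.er_mono e₁ e'' (by omega) hm'' k2.symm
            omega
          have h6 := held_of_mem hD hB hT hN k1 hlt
          have h7 := (hS.held _ (hD.ey_lt _ hm'') (by omega)).2.2.2.1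
          rw [h6, Nat.add_sub_cancel, k2] at h7
          omega
        · have h8 : e'' = e' := (hT N hN).1.injY _ _ k1 h1 (k2.trans g2)
          subst h8
          omega
      · have hne : ¬ N e := fun hNe => hee ((hT N hN).1.injY _ _ h1 hNe h2)
        rcases (hT N hN).1.cover e hm hne with h | ⟨e'', k1, k2, k3⟩
        · rw [hex, he] at h
          exact not_better_of_active hD hS hB hT hx ha hN h
        · have h8 : e'' = e' := (hT N hN).1.injY _ _ k1 h1 (k2.trans h2.symm)
          subst h8
          omega
    · refine ⟨e', h1, h2, h3, ?_⟩
      rw [Function.update_of_ne hye]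
      exact h4

theorem bound_of_worse (hB : D.Bound p f cur) {x e : ℕ} (he : e = p x)
    (hr : cur (D.EY e) < D.EB e) : D.Bound (Function.update p x (e + 1)) f cur := by
  refine ⟨hB.cur_le, fun e' he' hp => ?_⟩
  by_cases hee : e' = e
  · subst hee
    exact ⟨hr.le, fun h => by omega⟩
  refine hB.proposed e' he' ?_
  rw [Function.update_apply] at hp
  split_ifs at hp with h
  · rw [h]; omega
  · exact hp

/-- Rejection of a held edge that belongs to no matching of the target set. -/
theorem bound_of_reject (hD : D.Valid) (hS : D.Shape p c f cur) (hB : D.Bound p f cur)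
    (hT : D.Target T f cur) {T' : (ℕ → Prop) → Prop} {y : ℕ} (hf : f y ≠ 0)
    (hT' : ∀ N, T' N → T N ∧ ¬ N (f y - 1)) :
    D.Bound p (Function.update f y 0) cur ∧ D.Target T' (Function.update f y 0) cur := by
  refine ⟨⟨hB.cur_le, fun e he hp => ?_⟩, fun N hN => ?_⟩
  · have h1 := hB.proposed e he hp
    refine ⟨h1.1, fun h => ?_⟩
    rw [Function.update_apply]
    split_ifs
    · exact Or.inr rfl
    · exact h1.2 h
  · obtain ⟨hN', hne⟩ := hT' N hN
    refine ⟨(hT N hN').1, fun z hz hc => ?_⟩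
    obtain ⟨e', h1, h2, h3, h4⟩ := (hT N hN').2 z hz hc
    by_cases hzy : z = y
    · subst hzy
      refine ⟨e', h1, h2, h3, fun _ => ?_⟩
      refine lt_of_le_of_ne h3 fun heq => ?_
      obtain ⟨g1, g2, g3, g4, g5⟩ := hS.held _ hz hf
      rcases (hT N hN').1.cover _ g1 hne with ⟨e'', k1, k2, k3⟩ | ⟨e'', k1, k2, k3⟩
      · have hm'' := (hT N hN').1.lt _ k1
        have hlt : e'' < p (D.EX e'') := by
          by_contra! hle
          rw [k2] at hle
          have := hD.er_mono _ e'' (g3.le.trans hle) hm'' k2.symm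
          omega
        have h6 := held_of_mem hD hB hT hN' k1 hlt
        have h7 := (hS.held _ (hD.ey_lt _ hm'') (by omega)).2.2.2.1
        rw [h6, Nat.add_sub_cancel, k2] at h7
        omega
      · have h8 : e'' = e' := (hT N hN').1.injY _ _ k1 h1 (by rw [k2, g2, h2])
        subst h8
        omega
    · refine ⟨e', h1, h2, h3, ?_⟩
      rw [Function.update_of_ne hzy]
      exact h4

/-! ### The data structure under the elementary steps -/

theorem Shape.reject (hS : D.Shape p c f cur) {y : ℕ} (hy : y < D.b) (hf : f y ≠ 0) :
    D.Shape p (Function.update c (D.EX (f y - 1)) (c (D.EX (f y - 1)) - 1)) (Function.update f y 0)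
      cur := by
  refine ⟨hS.p_ge, hS.p_le, fun z hz hz0 => ?_, fun x hx => ?_⟩
  · by_cases h : z = y
    · simp [h] at hz0
    · rw [Function.update_of_ne h] at hz0 ⊢
      exact hS.held z hz hz0
  · have h1 := count_update (f := f) hy 0 x
    have h2 := hS.c_eq x hx
    rw [Function.update_apply]
    by_cases h : x = D.EX (f y - 1)
    · subst h
      simp only [if_true, and_self, hf, ne_eq, not_true_eq_false, false_and, if_false,
        not_false_eq_true] at h1 ⊢
      omega
    · rw [if_neg h]
      simp only [Ne.symm h, and_false, if_false, ne_eq, not_true_eq_false, false_and] at h1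
      omega

/-- All held edges of a man must lie in the tie of his last proposal. The pointer of an active man
advances either within this tie or when nobody holds him. -/
theorem Shape.skip (hS : D.Shape p c f cur) {x : ℕ} (hx : x < D.a)
    (ha : D.Active p c x) : D.Shape (Function.update p x (p x + 1)) c f cur := by
  refine ⟨fun z hz => ?_, fun z hz => ?_, fun y hy hf => ?_, hS.c_eq⟩
  · have := hS.p_ge z hz
    rw [Function.update_apply]
    split_ifs with h
    · subst h; omega
    · exact this
  · have := hS.p_le z hz
    rw [Function.update_apply]
    split_ifs with h
    · subst h; have := ha.1; omega
    · exact this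
  · obtain ⟨h1, h2, h3, h4, h5⟩ := hS.held y hy hf
    refine ⟨h1, h2, ?_⟩
    by_cases h : D.EX (f y - 1) = x
    · rw [h, Function.update_self]
      rw [h] at h3 h4
      have h6 := count_pos (D := D) hy hf
      rw [h, ← hS.c_eq x hx] at h6
      refine ⟨by omega, ?_, h5⟩
      rw [Nat.add_sub_cancel, h4]
      rcases ha.2 with h7 | h7
      · omega
      · exact h7.symm
    · rw [Function.update_of_ne h]
      exact ⟨h3, h4, h5⟩

theorem Shape.accept (hD : D.Valid) (hS : D.Shape p c f cur) {e : ℕ} (he : e < D.m)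
    (hp : p (D.EX e) = e + 1) (hf : f (D.EY e) = 0) :
    D.Shape p (Function.update c (D.EX e) (c (D.EX e) + 1))
      (Function.update f (D.EY e) (e + 1)) (Function.update cur (D.EY e) (D.EB e)) := by
  refine ⟨hS.p_ge, hS.p_le, fun z hz hz0 => ?_, fun z hz => ?_⟩
  · by_cases h : z = D.EY e
    · subst h
      simp [he, hp]
    · rw [Function.update_of_ne h] at hz0 ⊢
      rw [Function.update_of_ne h]
      exact hS.held z hz hz0
  · have h1 := count_update (f := f) (hD.ey_lt e he) (e + 1) z
    have h2 := hS.c_eq z hz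
    rw [Function.update_apply]
    simp only [hf, ne_eq, not_true_eq_false, false_and, if_false, Nat.add_sub_cancel,
      Nat.add_eq_zero_iff, one_ne_zero, and_false, not_false_eq_true, true_and] at h1
    by_cases h : z = D.EX e
    · subst h
      simp only [if_true] at h1 ⊢
      omega
    · rw [if_neg h]
      simp only [Ne.symm h, if_false] at h1
      omega

theorem Stacked.pop (hst : D.Stacked p c stk (sp + 1) D.a) : D.Stacked p c stk sp (stk sp) := by
  refine ⟨fun i hi => hst.1 i (by omega), fun x hx ha => ?_⟩
  rcases hst.2 x hx ha with h | ⟨i, hi, rfl⟩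
  · omega
  · rcases Nat.lt_succ_iff_lt_or_eq.1 hi with h | rfl
    · exact Or.inr ⟨i, h, rfl⟩
    · exact Or.inl rfl

theorem Stacked.of_not_active {x : ℕ} (hst : D.Stacked p c stk sp x) (hx : ¬ D.Active p c x) :
    D.Stacked p c stk sp D.a := by
  refine ⟨hst.1, fun z hz ha => ?_⟩
  rcases hst.2 z hz ha with rfl | h
  · exact absurd ha hx
  · exact Or.inr h

theorem Stacked.push_of {x z : ℕ} {p' c' : ℕ → ℕ} (hst : D.Stacked p c stk sp x) (hz : z < D.a)
    (hpc : ∀ w < D.a, w ≠ z → w ≠ x → D.Active p' c' w → D.Active p c w) :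
    D.Stacked p' c' (Function.update stk sp z) (sp + 1) x := by
  refine ⟨fun i hi => ?_, fun w hw ha => ?_⟩
  · rw [Function.update_apply]
    split_ifs with h
    · exact hz
    · exact hst.1 i (by omega)
  · by_cases hwz : w = z
    · exact Or.inr ⟨sp, by omega, by simp [hwz]⟩
    by_cases hwx : w = x
    · exact Or.inl hwx
    rcases hst.2 w hw (hpc w hw hwz hwx ha) with h | ⟨i, hi, h⟩
    · exact Or.inl h
    · refine Or.inr ⟨i, by omega, ?_⟩
      rwa [Function.update_of_ne (by omega)]

theorem Stacked.close {x : ℕ} (hx : x < D.a) (hst : D.Stacked p c stk sp x) :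
    D.Stacked p c (Function.update stk sp x) (sp + 1) D.a := by
  have h := hst.push_of (p' := p) (c' := c) hx fun w _ _ _ h => h
  refine ⟨h.1, fun w hw ha => Or.inr ?_⟩
  rcases h.2 w hw ha with rfl | h'
  · exact ⟨sp, by omega, by simp⟩
  · exact h'

theorem Stacked.reject {x z : ℕ} (hst : D.Stacked p c stk sp x) (hz : z < D.a) (v : ℕ) :
    D.Stacked p (Function.update c z v) (Function.update stk sp z) (sp + 1) x :=
  hst.push_of hz fun w _ hw _ h => by rwa [Active, Function.update_of_ne hw] at h

theorem Stacked.update {x : ℕ} (hst : D.Stacked p c stk sp x) (v w : ℕ) :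
    D.Stacked (Function.update p x v) (Function.update c x w) stk sp x := by
  refine ⟨hst.1, fun z hz ha => ?_⟩
  by_cases h : z = x
  · exact Or.inl h
  · rw [Active, Function.update_of_ne h, Function.update_of_ne h] at ha
    exact hst.2 z hz ha

theorem Stacked.update_left {x : ℕ} (hst : D.Stacked p c stk sp x) (v : ℕ) :
    D.Stacked (Function.update p x v) c stk sp x := by
  simpa using hst.update v (c x)

/-- The number of proposals that have not been made. -/
def pot (D : FlatInstance) (p : ℕ → ℕ) : ℕ := ∑ x ∈ Finset.range D.a, (D.FI (x + 1) - p x)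

theorem pot_update {x : ℕ} (hx : x < D.a) (h : p x < D.FI (x + 1)) :
    D.pot (Function.update p x (p x + 1)) + 1 = D.pot p := by
  unfold pot
  rw [← Finset.add_sum_erase _ _ (Finset.mem_range.2 hx),
    ← Finset.add_sum_erase (Finset.range D.a) (fun x => D.FI (x + 1) - p x)
    (Finset.mem_range.2 hx)]
  have : ∑ z ∈ (Finset.range D.a).erase x, (D.FI (z + 1) - Function.update p x (p x + 1) z) =
      ∑ z ∈ (Finset.range D.a).erase x, (D.FI (z + 1) - p z) := by
    refine Finset.sum_congr rfl fun z hz => ?_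
    rw [Function.update_of_ne (Finset.ne_of_mem_erase hz)]
  rw [this]
  simp only [Function.update_self]
  omega

theorem pot_first_le (hD : D.Valid) : D.pot D.FI ≤ D.m := by
  have h : ∀ n ≤ D.a, ∑ x ∈ Finset.range n, (D.FI (x + 1) - D.FI x) + D.FI 0 = D.FI n := by
    intro n hn
    induction n with
    | zero => simp
    | succ n ih =>
      have h1 := ih (by omega)
      have h2 := hD.fi_mono n (by omega)
      rw [Finset.sum_range_succ]
      omega
  have h1 := h D.a le_rfl
  have h2 := hD.fi_le D.a le_rfl
  have h3 : D.pot D.FI = ∑ x ∈ Finset.range D.a, (D.FI (x + 1) - D.FI x) := rfl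
  omega

/-! ### The end of a phase of proposals -/

/-- Nobody is active. -/
def Done (D : FlatInstance) (p c : ℕ → ℕ) : Prop := ∀ x < D.a, ¬ D.Active p c x

theorem Stacked.done (hst : D.Stacked p c stk 0 D.a) : D.Done p c := fun x hx ha => by
  rcases hst.2 x hx ha with h | ⟨i, hi, -⟩ <;> omega

/-- Each woman that got a proposal holds a man whom nobody else holds. -/
def Succeeds (D : FlatInstance) (c f cur : ℕ → ℕ) : Prop :=
  ∀ y < D.b, (f y ≠ 0 ∧ c (D.EX (f y - 1)) = 1) ∨ (f y = 0 ∧ cur y = D.m)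

/-- The set of held edges. -/
def heldSet (D : FlatInstance) (f : ℕ → ℕ) (e : ℕ) : Prop := e < D.m ∧ f (D.EY e) = e + 1

/-- A man with an edge left who is not active is held and has finished his tie. The edge that holds
him lies in this tie, which is strictly better than everything he has not yet proposed. -/
theorem exists_held_of_done (hD : D.Valid) (hS : D.Shape p c f cur) (hdone : D.Done p c) {e : ℕ}
    (he : e < D.m) (hp : p (D.EX e) ≤ e) :
    ∃ e', D.heldSet f e' ∧ D.EX e' = D.EX e ∧ D.ER e' < D.ER e := by
  have hx := hD.ex_lt e he
  have hb := (hD.block _ hx e he).1 rfl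
  have hna := hdone _ hx
  simp only [Active, not_and, not_or] at hna
  obtain ⟨h1, h2⟩ := hna (by omega)
  rw [hS.c_eq _ hx] at h1
  obtain ⟨y, hy, hf, h3⟩ := exists_of_count_pos h1
  obtain ⟨g1, g2, g3, g4, -⟩ := hS.held y hy hf
  refine ⟨f y - 1, ⟨g1, by rw [g2]; omega⟩, h3, ?_⟩
  rw [h3] at g3 g4
  have hpm : p (D.EX e) < D.m := by omega
  have hge := hS.p_ge _ hx
  have hex : D.EX (p (D.EX e)) = D.EX e := (hD.block _ hx _ hpm).2 ⟨hge, by omega⟩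
  have h4 := hD.er_mono _ _ hp he hex
  have hfy := (hD.block _ hx _ g1).1 h3
  have hex' : D.EX (p (D.EX e) - 1) = D.EX e := (hD.block _ hx _ (by omega)).2 ⟨by omega, by omega⟩
  have h5 := hD.er_mono (p (D.EX e) - 1) (p (D.EX e)) (by omega) hpm (hex'.trans hex.symm)
  omega

/-- An edge that was proposed and is not held is covered by its woman, whose held edge attains her
bound and admits no tie. An edge not yet proposed is covered by its man. -/
theorem stable_heldSet (hD : D.Valid) (hS : D.Shape p c f cur) (hB : D.Bound p f cur)
    (hdone : D.Done p c) (hok : D.Succeeds c f cur) : D.Stable (D.heldSet f) := by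
  have hpos : ∀ {e}, D.heldSet f e → f (D.EY e) ≠ 0 := fun h => by rw [h.2]; omega
  refine ⟨fun e h => h.1, fun e e' h h' hx => ?_, fun e e' h h' hy => ?_, fun e he hn => ?_⟩
  · have hy := hD.ey_lt e h.1
    have hy' := hD.ey_lt e' h'.1
    by_contra hne
    have hyy : D.EY e ≠ D.EY e' := fun hh => hne (hD.inj e h.1 e' h'.1 hx hh)
    have h1 := (hok _ hy).resolve_right fun hh => hpos h hh.1
    rw [h.2, Nat.add_sub_cancel, hS.c_eq _ (hD.ex_lt e h.1)] at h1
    have h2 : (∑ y ∈ {D.EY e, D.EY e'}, if f y ≠ 0 ∧ D.EX (f y - 1) = D.EX e then 1 else 0) ≤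
        D.count f (D.EX e) := Finset.sum_le_sum_of_subset (by
      intro z hz
      simp only [Finset.mem_insert, Finset.mem_singleton] at hz
      rcases hz with rfl | rfl
      · exact Finset.mem_range.2 hy
      · exact Finset.mem_range.2 hy')
    rw [Finset.sum_pair hyy, h.2, h'.2] at h2
    simp [hx] at h2 h1
    omega
  · have h1 := h.2
    rw [hy, h'.2] at h1
    omega
  · by_cases hp : e < p (D.EX e)
    · right
      have hy := hD.ey_lt e he
      have h1 := hB.proposed e he hp
      have h2 := hD.eb_lt e he
      have h3 := (hok _ hy).resolve_right fun hh => by omega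
      obtain ⟨g1, g2, g3, g4, g5⟩ := hS.held _ hy h3.1
      refine ⟨f (D.EY e) - 1, ⟨g1, by rw [g2]; omega⟩, g2, ?_⟩
      refine lt_of_le_of_ne (by omega) fun heq => ?_
      rcases h1.2 (by omega) with h4 | h4
      · exact hn ⟨he, h4⟩
      · exact h3.1 h4
    · exact Or.inl (exists_held_of_done hD hS hdone he (not_lt.1 hp))

/-- The held edges are at least as good for the men as any matching of the target set. -/
theorem heldSet_dominates (hD : D.Valid) (hS : D.Shape p c f cur) (hB : D.Bound p f cur)
    (hT : D.Target T f cur) (hdone : D.Done p c) {N : ℕ → Prop} (hN : T N) {e : ℕ} (he : N e) :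
    ∃ e', D.heldSet f e' ∧ D.EX e' = D.EX e ∧ D.ER e' ≤ D.ER e := by
  have hm := (hT N hN).1.lt e he
  by_cases hp : e < p (D.EX e)
  · exact ⟨e, ⟨hm, held_of_mem hD hB hT hN he hp⟩, rfl, le_rfl⟩
  · obtain ⟨e', h1, h2, h3⟩ := exists_held_of_done hD hS hdone hm (not_lt.1 hp)
    exact ⟨e', h1, h2, h3.le⟩

/-- Every man matched in N is held by someone, only women with a bound below m hold, and N gives
each of these women a partner. Hence |held men| ≥ |men of N| ≥ |women with a bound| ≥ |holding
women|, and equality forces all these women to hold, and to hold distinct men. -/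
theorem succeeds_of_target (hD : D.Valid) (hS : D.Shape p c f cur) (hB : D.Bound p f cur)
    (hT : D.Target T f cur) (hdone : D.Done p c) {N : ℕ → Prop} (hN : T N) :
    D.Succeeds c f cur := by
  classical
  have hNS := (hT N hN).1
  let Y := (Finset.range D.b).filter fun y => cur y < D.m
  let H := (Finset.range D.b).filter fun y => f y ≠ 0
  let X := (Finset.range D.a).filter fun x => ∃ e, N e ∧ D.EX e = x
  have hHY : H ⊆ Y := by
    intro y hy
    simp only [H, Y, Finset.mem_filter, Finset.mem_range] at hy ⊢
    have h1 := hS.held y hy.1 hy.2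
    have h2 := hD.eb_lt _ h1.1
    exact ⟨hy.1, by omega⟩
  have hXH : X ⊆ H.image fun y => D.EX (f y - 1) := by
    intro x hx
    simp only [X, Finset.mem_filter, Finset.mem_range] at hx
    obtain ⟨hx, e, he, rfl⟩ := hx
    obtain ⟨e', h1, h2, -⟩ := heldSet_dominates hD hS hB hT hdone hN he
    refine Finset.mem_image.2 ⟨D.EY e', ?_, ?_⟩
    · simp only [H, Finset.mem_filter, Finset.mem_range]
      exact ⟨hD.ey_lt _ h1.1, by rw [h1.2]; omega⟩
    · simp only [h1.2, Nat.add_sub_cancel, h2]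
  have hYX : Y.card ≤ X.card := by
    have hch : ∀ y ∈ Y, ∃ e, N e ∧ D.EY e = y := fun y hy => by
      simp only [Y, Finset.mem_filter, Finset.mem_range] at hy
      obtain ⟨e, h1, h2, -⟩ := (hT N hN).2 y hy.1 hy.2
      exact ⟨e, h1, h2⟩
    choose! g hg using hch
    refine Finset.card_le_card_of_injOn (fun y => D.EX (g y)) (fun y hy => ?_) fun y hy y' hy' h => ?_
    · have := hg y hy
      simp only [X, Finset.coe_filter, Finset.mem_range, Set.mem_ofPred_eq]
      exact ⟨hD.ex_lt _ (hNS.lt _ this.1), g y, this.1, rfl⟩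
    · have h1 := hg y hy
      have h2 := hg y' hy'
      rw [← h1.2, ← h2.2, hNS.injX _ _ h1.1 h2.1 h]
  have hcard : (H.image fun y => D.EX (f y - 1)).card = H.card := by
    refine le_antisymm Finset.card_image_le ?_
    exact (Finset.card_le_card hHY).trans (hYX.trans (Finset.card_le_card hXH))
  have hHeq : H = Y := Finset.eq_of_subset_of_card_le hHY
    (hYX.trans ((Finset.card_le_card hXH).trans hcard.le))
  have hinj := Finset.card_image_iff.1 hcard
  intro y hy
  by_cases hf : f y = 0
  · refine Or.inr ⟨hf, le_antisymm (hB.cur_le y hy) ?_⟩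
    by_contra! hlt
    have : y ∈ H := by
      rw [hHeq]
      simp [Y, hy, hlt]
    simp [H, hf] at this
  · refine Or.inl ⟨hf, ?_⟩
    have h1 := hS.held y hy hf
    rw [hS.c_eq _ (hD.ex_lt _ h1.1), count, Finset.sum_eq_single y]
    · simp [hf]
    · intro z hz hzy
      refine if_neg fun hh => hzy (hinj ?_ ?_ hh.2)
      · simpa [H, hh.1] using hz
      · simp [H, hf, hy]
    · simp [hy]

end FlatInstance

end SuperStable

namespace SuperStable

open FlatInstance

/-! ## The program for the proposals

Registers `0`, `1`, `2` hold the numbers of men, women and edges, register `7` the height of the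
stack. The arrays `2` to `6` hold the instance, the arrays `8` to `12` the data structure. -/

/-- The arrays `2` to `6` hold the instance `D`. -/
structure Loaded (D : FlatInstance) (s : State) : Prop where
  a : s.reg 0 = D.a
  b : s.reg 1 = D.b
  m : s.reg 2 = D.m
  ex : s.arr 2 = D.EX
  ey : s.arr 3 = D.EY
  er : s.arr 4 = D.ER
  eb : s.arr 5 = D.EB
  fi : s.arr 6 = D.FI

theorem Loaded.of_frame {D : FlatInstance} {c : Cmd} {s s' : State} (h : Loaded D s)
    (hf : Frame c s s') (hr : ∀ r < 3, c.writesReg r = false)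
    (ha : ∀ a, 2 ≤ a → a < 7 → c.writesArr a = false) : Loaded D s' :=
  ⟨(hf.reg 0 (hr 0 (by omega))).trans h.a, (hf.reg 1 (hr 1 (by omega))).trans h.b,
    (hf.reg 2 (hr 2 (by omega))).trans h.m, (hf.arr 2 (ha 2 (by omega) (by omega))).trans h.ex,
    (hf.arr 3 (ha 3 (by omega) (by omega))).trans h.ey,
    (hf.arr 4 (ha 4 (by omega) (by omega))).trans h.er,
    (hf.arr 5 (ha 5 (by omega) (by omega))).trans h.eb,
    (hf.arr 6 (ha 6 (by omega) (by omega))).trans h.fi⟩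

/-- The woman in register `5` rejects the man she holds; he is put on the stack. -/
def rejectCode : Cmd :=
  8 ::= rd 2 (rd 10 (vr 5) -. cst 1) ;;
  .store 9 (vr 8) (rd 9 (vr 8) -. cst 1) ;;
  .store 12 (vr 7) (vr 8) ;;
  7 ::= vr 7 +. cst 1

/-- The woman in register `5` reacts to a proposal along the edge in register `4`, which has the
rank in register `6`, that she does not reject at once. -/
def settleCode : Cmd :=
  .cond (rd 10 (vr 5)) rejectCode .skip ;;
  .cond (vr 6 <. rd 11 (vr 5))
    (.store 10 (vr 5) (vr 4 +. cst 1) ;;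
      .store 11 (vr 5) (vr 6) ;;
      .store 9 (vr 3) (rd 9 (vr 3) +. cst 1))
    (.store 10 (vr 5) (cst 0))

/-- The man in register `3` is put on the stack. -/
def pushCode : Cmd := .store 12 (vr 7) (vr 3) ;; 7 ::= vr 7 +. cst 1

/-- The next proposal of the man in register `3` along the edge in register `4`. -/
def proposeCode : Cmd :=
  .store 8 (vr 3) (vr 4 +. cst 1) ;;
  5 ::= rd 3 (vr 4) ;;
  6 ::= rd 5 (vr 4) ;;
  .cond (vr 6 <. (rd 11 (vr 5) +. cst 1)) settleCode .skip ;;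
  pushCode

/-- Proposals until nobody is active. -/
def runCode : Cmd :=
  .loop (vr 7)
    (7 ::= vr 7 -. cst 1 ;;
      3 ::= rd 12 (vr 7) ;;
      4 ::= rd 8 (vr 3) ;;
      .cond ((vr 4 <. rd 6 (vr 3 +. cst 1)) *.
          ((rd 9 (vr 3) =. cst 0) +. (rd 4 (vr 4) =. rd 4 (vr 4 -. cst 1))))
        proposeCode .skip)

/-- The man `F.1` is held only for edges from `F.2` on. -/
def FlatInstance.Floor (D : FlatInstance) (F : ℕ × ℕ) (p f : ℕ → ℕ) : Prop :=
  F.2 ≤ p F.1 ∧ ∀ y < D.b, f y ≠ 0 → D.EX (f y - 1) = F.1 → F.2 ≤ f y - 1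

/-- The data structure is in order, and its bounds hold for the matchings in `T`. -/
structure Engaged (D : FlatInstance) (T : (ℕ → Prop) → Prop) (F : ℕ × ℕ) (s : State) : Prop where
  shape : D.Shape (s.arr 8) (s.arr 9) (s.arr 10) (s.arr 11)
  bound : D.Bound (s.arr 8) (s.arr 10) (s.arr 11)
  target : D.Target T (s.arr 10) (s.arr 11)
  floor : D.Floor F (s.arr 8) (s.arr 10)

variable {D : FlatInstance} {T : (ℕ → Prop) → Prop} {F : ℕ × ℕ} {W : ℕ}

theorem FlatInstance.Floor.skip {p f : ℕ → ℕ} (h : D.Floor F p f) (x : ℕ) :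
    D.Floor F (Function.update p x (p x + 1)) f := by
  refine ⟨h.1.trans ?_, h.2⟩
  rw [Function.update_apply]
  split_ifs with hx
  · rw [hx]; omega
  · exact le_rfl

theorem FlatInstance.Floor.clear {p f : ℕ → ℕ} (h : D.Floor F p f) (y : ℕ) :
    D.Floor F p (Function.update f y 0) := by
  refine ⟨h.1, fun z hz h0 hx => ?_⟩
  by_cases hzy : z = y
  · simp [hzy] at h0
  · rw [Function.update_of_ne hzy] at h0 hx ⊢
    exact h.2 z hz h0 hx

theorem FlatInstance.Floor.accept {p f : ℕ → ℕ} (h : D.Floor F p f) {e : ℕ} (y : ℕ)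
    (he : e = p (D.EX e)) : D.Floor F p (Function.update f y (e + 1)) := by
  refine ⟨h.1, fun z hz h0 hx => ?_⟩
  by_cases hzy : z = y
  · simp only [hzy, Function.update_self, Nat.add_sub_cancel] at hx ⊢
    rw [he, hx]
    exact h.1
  · rw [Function.update_of_ne hzy] at h0 hx ⊢
    exact h.2 z hz h0 hx


theorem count_le (f : ℕ → ℕ) (x : ℕ) : D.count f x ≤ D.b := by
  unfold count
  refine (Finset.sum_le_card_nsmul _ _ 1 fun y _ => ?_).trans (by simp)
  split_ifs <;> omega

/-- The entry of the woman is not cleared here, because every caller overwrites it next. The data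
structure is therefore in order only after the indicated update. -/
theorem wp_rejectCode (hD : D.Valid) {x k : ℕ} {s : State} (hW : 4 ≤ W) (hex : s.arr 2 = D.EX)
    (hS : D.Shape (s.arr 8) (s.arr 9) (s.arr 10) (s.arr 11)) (hy : s.reg 5 < D.b)
    (hst : D.Stacked (s.arr 8) (s.arr 9) (s.arr 12) (s.reg 7) x)
    (hf : s.arr 10 (s.reg 5) ≠ 0) (hB : s.reg 7 + 1 < W) (hk : 40 ≤ k) :
    wp W rejectCode (fun k' s' => k ≤ k' + 40 ∧
      D.Shape (s'.arr 8) (s'.arr 9) (Function.update (s'.arr 10) (s'.reg 5) 0) (s'.arr 11) ∧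
      D.Stacked (s'.arr 8) (s'.arr 9) (s'.arr 12) (s'.reg 7) x ∧ s'.reg 7 = s.reg 7 + 1) k s := by
  have h1 : 1 < W := by omega
  have h2 := (hS.held _ hy hf).1
  simp [rejectCode, hex, h1, hB]
  refine ⟨by omega, by omega, by omega, by omega, by omega, ?_, ?_⟩
  · exact hS.reject hy hf
  · exact hst.reject (hD.ex_lt _ h2) _

theorem wp_settleCode (hD : D.Valid) (hW : 4 * (D.a + D.b + D.m) + 16 ≤ W) {k x e : ℕ} {s : State}
    (hex : s.arr 2 = D.EX) (hx : s.reg 3 = x) (he : s.reg 4 = e) (hem : e < D.m) (hxe : D.EX e = x)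
    (h5 : s.reg 5 = D.EY e) (h6 : s.reg 6 = D.EB e) (hp : s.arr 8 x = e + 1)
    (hS : D.Shape (s.arr 8) (s.arr 9) (s.arr 10) (s.arr 11))
    (hst : D.Stacked (s.arr 8) (s.arr 9) (s.arr 12) (s.reg 7) x)
    (hle : D.EB e ≤ s.arr 11 (D.EY e)) (hB : s.reg 7 + 1 < W) (hk : 70 ≤ k) :
    wp W settleCode (fun k' s' => k ≤ k' + 70 ∧
      D.Shape (s'.arr 8) (s'.arr 9) (s'.arr 10) (s'.arr 11) ∧
      D.Stacked (s'.arr 8) (s'.arr 9) (s'.arr 12) (s'.reg 7) x ∧ s'.reg 7 ≤ s.reg 7 + 1 ∧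
      ((D.EB e < s.arr 11 (D.EY e) ∧ s'.arr 10 = Function.update (s.arr 10) (D.EY e) (e + 1) ∧
        s'.arr 11 = Function.update (s.arr 11) (D.EY e) (D.EB e)) ∨
      (D.EB e = s.arr 11 (D.EY e) ∧ s'.arr 10 = Function.update (s.arr 10) (D.EY e) 0 ∧
        s'.arr 11 = s.arr 11))) k s := by
  have h1 : 1 < W := by omega
  have hy := hD.ey_lt _ hem
  have hxa := hD.ex_lt _ hem
  have first : wp W (.cond (rd 10 (vr 5)) rejectCode .skip) (fun k' s' => k ≤ k' + 43 ∧
      D.Shape (s'.arr 8) (s'.arr 9) (Function.update (s'.arr 10) (s'.reg 5) 0) (s'.arr 11) ∧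
      D.Stacked (s'.arr 8) (s'.arr 9) (s'.arr 12) (s'.reg 7) x ∧ s'.reg 7 ≤ s.reg 7 + 1) k s := by
    simp
    refine ⟨by omega, fun hf => ?_, fun hf => ?_⟩
    · refine wp_mono (wp_rejectCode hD (by omega) hex hS (by omega) hst hf hB (by omega)) ?_
      rintro k' s' ⟨g1, g2, g3, g4⟩
      exact ⟨by omega, g2, g3, by omega⟩
    · refine ⟨by omega, by omega, ?_, hst⟩
      rwa [Function.update_eq_self_iff.2 hf.symm]
  refine wp_seq_frame first ?_
  rintro k₁ s₁ hf ⟨g1, g2, g3, g4⟩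
  have e3 := hf.reg 3 rfl
  have e4 := hf.reg 4 rfl
  have e5 := hf.reg 5 rfl
  have e6 := hf.reg 6 rfl
  have e8 := hf.arr 8 rfl
  have e10 := hf.arr 10 rfl
  have e11 := hf.arr 11 rfl
  rw [e5, h5] at g2
  have hc := g2.c_eq x (hxe ▸ hxa)
  have hc' := count_le (D := D) (Function.update (s₁.arr 10) (D.EY e) 0) x
  simp [h1, e3, e4, e5, e6, e10, e11, hx, he, h5, h6]
  refine ⟨by omega, fun hlt => ?_, fun hlt => ?_⟩
  · have := g2.accept hD hem (by rw [e8, hxe, hp]) (by simp)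
    refine ⟨by omega, by omega, by omega, by omega, by omega, by omega, ?_, ?_, g4, Or.inl hlt⟩
    · rw [hxe, Function.update_idem, e10, e11] at this
      exact this
    · simpa using g3.update (s₁.arr 8 x) (s₁.arr 9 x + 1)
  · rw [e10, e11] at g2
    exact ⟨by omega, by omega, by omega, g2, g3, g4, Or.inr (by omega)⟩

/-- A proposal pushes at most two men, the rejected one and the proposer. Giving each proposal not
yet made the weight 3 thus makes the potential drop by at least one. -/
theorem wp_proposeCode (hD : D.Valid) (hW : 4 * (D.a + D.b + D.m) + 16 ≤ W) {k K : ℕ} {s : State}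
    (hL : Loaded D s) (hE : Engaged D T F s) (hx : s.reg 3 < D.a)
    (ha : D.Active (s.arr 8) (s.arr 9) (s.reg 3)) (he : s.reg 4 = s.arr 8 (s.reg 3))
    (hst : D.Stacked (s.arr 8) (s.arr 9) (s.arr 12) (s.reg 7) (s.reg 3))
    (hBW : s.reg 7 + 4 ≤ W) (hk : K + 100 ≤ k) :
    wp W proposeCode (fun k' s' => K ≤ k' ∧ Engaged D T F s' ∧
      D.Stacked (s'.arr 8) (s'.arr 9) (s'.arr 12) (s'.reg 7) D.a ∧
      s'.reg 7 + 3 * D.pot (s'.arr 8) + 1 ≤ s.reg 7 + 3 * D.pot (s.arr 8) ∧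
      D.pot (s'.arr 8) ≤ D.pot (s.arr 8)) k s := by
  have h1 : 1 < W := by omega
  have hm := lt_m_of_active hD hx ha
  have hex := ex_of_active hD hE.shape hx ha
  have hpot := pot_update hx ha.1
  have hskip := hE.shape.skip hx ha
  have hstk := hst.update_left (s.arr 8 (s.reg 3) + 1)
  have hy := hD.ey_lt _ hm
  have hcur := hE.bound.cur_le _ hy
  rw [← he] at hm hex hpot hskip hstk hy hcur
  simp [proposeCode, hL.ey, hL.eb, h1]
  have last : ∀ {k' : ℕ} {s' : State}, K + 7 ≤ k' → s'.reg 3 = s.reg 3 → s'.reg 7 + 1 < W →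
      s'.reg 7 + 3 * D.pot (s'.arr 8) + 2 ≤ s.reg 7 + 3 * D.pot (s.arr 8) →
      D.pot (s'.arr 8) ≤ D.pot (s.arr 8) → Engaged D T F s' →
      D.Stacked (s'.arr 8) (s'.arr 9) (s'.arr 12) (s'.reg 7) (s.reg 3) →
      wp W pushCode (fun k' s' => K ≤ k' ∧ Engaged D T F s' ∧
        D.Stacked (s'.arr 8) (s'.arr 9) (s'.arr 12) (s'.reg 7) D.a ∧
        s'.reg 7 + 3 * D.pot (s'.arr 8) < s.reg 7 + 3 * D.pot (s.arr 8) ∧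
        D.pot (s'.arr 8) ≤ D.pot (s.arr 8)) k' s' := by
    intro k' s' g1 g2 g3 g4 g4' g5 g6
    simp [pushCode, h1, g2]
    exact ⟨by omega, by omega, by omega, by omega, ⟨g5.shape, g5.bound, g5.target, g5.floor⟩, g6.close hx,
      by omega, g4'⟩
  refine ⟨by omega, by omega, by omega, by omega, by omega, by omega, fun hle => ?_, fun hlt => ?_⟩
  · refine wp_frame (wp_settleCode (x := s.reg 3) (e := s.reg 4) hD hW (by simpa using hL.ex)
      (by simp) (by simp) hm hex (by simp) (by simp) (by simp) (by simpa using hskip)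
      (by simpa using hstk) (by simpa using hle) (by simp; omega) (by omega)) ?_
    rintro k' s' hf ⟨g1, g2, g3, g4, g5⟩
    have e3 := hf.reg 3 rfl
    have e8 := hf.arr 8 rfl
    simp at g4 g5 e3 e8
    refine last (k' := k') (by omega) e3 (by omega) (by rw [e8]; omega) (by rw [e8]; omega) ⟨g2, ?_, ?_, ?_⟩ g3
    all_goals rcases g5 with ⟨q1, q2, q3⟩ | ⟨q1, q2, q3⟩ <;> simp only [e8, q2, q3]
    · exact (bound_of_better hD hE.shape hE.bound hE.target hx ha he q1).1
    · exact (bound_of_tie hD hE.shape hE.bound hE.target hx ha he q1).1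
    · exact (bound_of_better hD hE.shape hE.bound hE.target hx ha he q1).2
    · exact (bound_of_tie hD hE.shape hE.bound hE.target hx ha he q1).2
    · simpa [he] using (hE.floor.accept (e := s.reg 4) _ (by rw [hex, he])).skip (s.reg 3)
    · simpa [he] using (hE.floor.clear _).skip (s.reg 3)
  · refine ⟨by omega, last (by omega) (by simp) (by simp; omega) (by simp; omega)
      (by simp; omega) ⟨?_, ?_, ?_, ?_⟩ ?_⟩
    · simpa using hskip
    · simpa using bound_of_worse hE.bound he hlt
    · simpa using hE.target
    · simpa [he] using hE.floor.skip (s.reg 3)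
    · simpa using hstk

/-- The proposals end with nobody active. -/
theorem wp_runCode (hD : D.Valid) (hW : 4 * (D.a + D.b + D.m) + 16 ≤ W) {k K : ℕ} {s : State}
    (hL : Loaded D s) (hE : Engaged D T F s)
    (hst : D.Stacked (s.arr 8) (s.arr 9) (s.arr 12) (s.reg 7) D.a)
    (hBW : s.reg 7 + 3 * D.pot (s.arr 8) + 4 ≤ W)
    (hk : K + 150 * (s.reg 7 + 3 * D.pot (s.arr 8)) + 10 ≤ k) :
    wp W runCode (fun k' s' => K + 150 * (3 * D.pot (s'.arr 8)) ≤ k' ∧ Engaged D T F s' ∧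
      D.Done (s'.arr 8) (s'.arr 9) ∧ D.pot (s'.arr 8) ≤ D.pot (s.arr 8)) k s := by
  have h1 : 1 < W := by omega
  refine wp_loop' (fun k s' => Engaged D T F s' ∧
    D.Stacked (s'.arr 8) (s'.arr 9) (s'.arr 12) (s'.reg 7) D.a ∧
    s'.reg 7 + 3 * D.pot (s'.arr 8) + 4 ≤ W ∧
    K + 150 * (s'.reg 7 + 3 * D.pot (s'.arr 8)) + 10 ≤ k ∧
    D.pot (s'.arr 8) ≤ D.pot (s.arr 8)) ⟨hE, hst, hBW, hk, le_rfl⟩ ?_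
  rintro k s' hf ⟨i1, i2, i3, i4, i5⟩
  have hL' := hL.of_frame hf (by decide) (by decide)
  refine ⟨trivial, by simp; omega, fun h0 => ?_, fun h0 => ?_⟩
  · have h0' : s'.reg 7 = 0 := h0
    rw [h0'] at i2 i4
    exact ⟨by simp; omega, i1, i2.done, i5⟩
  have h0' : s'.reg 7 ≠ 0 := h0
  obtain ⟨sp, hsp⟩ := Nat.exists_eq_succ_of_ne_zero h0'
  rw [hsp] at i2 i3 i4
  have i2' := i2.pop
  have hx := i2.1 sp (by omega)
  have hp := i1.shape.p_le _ hx
  simp [h1, hsp, hL'.fi, hL'.er]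
  have hfi := hD.fi_le _ (Nat.succ_le_of_lt hx)
  refine ⟨by omega, by omega, by omega, ⟨by omega, ⟨by omega, ?_⟩, ?_⟩, by omega, ?_, ?_⟩
  · split_ifs <;> omega
  · split_ifs <;> omega
  · intro g1 g2
    have hact : D.Active (s'.arr 8) (s'.arr 9) (s'.arr 12 sp) := ⟨g1, or_iff_not_imp_left.2 g2⟩
    refine wp_mono (wp_proposeCode (T := T) (F := F) (K := k - 140) hD hW
      ⟨by simp [hL'.a], by simp [hL'.b], by simp [hL'.m], by simp [hL'.ex], by simp [hL'.ey],
        by simp [hL'.er], by simp [hL'.eb], by simp [hL'.fi]⟩ ⟨i1.shape, i1.bound, i1.target, i1.floor⟩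
      (by simpa using hx) (by simpa using hact) (by simp) (by simpa using i2') (by simp; omega)
      (by omega)) ?_
    rintro k₁ s₁ ⟨q1, q2, q3, q4, q5⟩
    simp at q4 q5
    exact ⟨q2, q3, by omega, by omega, by omega⟩
  -- A stale entry of the stack: men are pushed without a test and may occur several times, so an
  -- inactive man is simply dropped.
  · intro hna
    refine ⟨by omega, ⟨i1.shape, i1.bound, i1.target, i1.floor⟩, i2'.of_not_active ?_, by omega, by omega, i5⟩
    rintro ⟨g1, g2⟩
    have := hna g1
    omega

end SuperStable

/-! ### Initialisation of the proposals and the test of success -/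

namespace SuperStable

open FlatInstance

/-- The initial state of the proposals. -/
def initCode : Cmd :=
  3 ::= cst 0 ;;
  forLoop 3 0 (.store 8 (vr 3) (rd 6 (vr 3)) ;; .store 9 (vr 3) (cst 0) ;; .store 12 (vr 3) (vr 3)) ;;
  7 ::= vr 0 ;;
  5 ::= cst 0 ;;
  forLoop 5 1 (.store 10 (vr 5) (cst 0) ;; .store 11 (vr 5) (vr 2))

variable {D : FlatInstance} {T : (ℕ → Prop) → Prop} {W : ℕ}

theorem FlatInstance.pot_congr {p p' : ℕ → ℕ} (h : ∀ x < D.a, p x = p' x) : D.pot p = D.pot p' :=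
  Finset.sum_congr rfl fun x hx => by rw [h x (Finset.mem_range.1 hx)]

/-- The initial bound m is larger than every rank, so it stands for a woman without a proposal and
promises nothing. -/
theorem engaged_start (hD : D.Valid) {s : State} (hp : ∀ x < D.a, s.arr 8 x = D.FI x)
    (hc : ∀ x < D.a, s.arr 9 x = 0) (hf : ∀ y < D.b, s.arr 10 y = 0)
    (hcur : ∀ y < D.b, s.arr 11 y = D.m) : Engaged D D.Stable (0, 0) s := by
  refine ⟨⟨fun x hx => (hp x hx).ge, fun x hx => ?_, fun y hy h => absurd (hf y hy) h,
    fun x hx => ?_⟩, ⟨fun y hy => (hcur y hy).le, fun e he h => ?_⟩,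
    fun N hN => ⟨hN, fun y hy h => ?_⟩,
    ⟨Nat.zero_le _, fun _ _ _ _ => Nat.zero_le _⟩⟩
  · rw [hp x hx]
    exact hD.fi_mono x hx
  · rw [hc x hx, count, Finset.sum_eq_zero]
    intro y hy
    simp [hf y (Finset.mem_range.1 hy)]
  · have hx := hD.ex_lt e he
    have := ((hD.block _ hx e he).1 rfl).1
    rw [hp _ hx] at h
    omega
  · rw [hcur y hy] at h
    omega

theorem wp_initCode (hD : D.Valid) (hW : 4 * (D.a + D.b + D.m) + 16 ≤ W) {k K : ℕ} {s : State}
    (hL : Loaded D s) (hk : K + 30 * (D.a + D.b) + 30 ≤ k) :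
    wp W initCode (fun k' s' => K ≤ k' ∧ Engaged D D.Stable (0, 0) s' ∧
      D.Stacked (s'.arr 8) (s'.arr 9) (s'.arr 12) (s'.reg 7) D.a ∧ s'.reg 7 = D.a ∧
      D.pot (s'.arr 8) ≤ D.m) k s := by
  refine ⟨by simp; omega, by simp; omega, ?_⟩
  refine wp_seq_frame (wp_forLoop (N := D.a) (j₀ := 0)
    (Q := fun k' s' => K + 30 * D.b + 20 ≤ k' ∧
      ∀ x < D.a, s'.arr 8 x = D.FI x ∧ s'.arr 9 x = 0 ∧ s'.arr 12 x = x)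
    (fun j k' s' => K + 30 * (D.a - j) + 30 * D.b + 26 ≤ k' ∧
      ∀ x < j, s'.arr 8 x = D.FI x ∧ s'.arr 9 x = 0 ∧ s'.arr 12 x = x)
    (by simp [hL.a]) (by omega) (by simp) (by omega) (by decide) rfl rfl (by simp; omega) ?_ ?_) ?_
  · intro j k' s' hj hr hf ⟨h1, h2⟩
    have e6 : s'.arr 6 = D.FI := (hf.arr 6 rfl).trans (by simp [hL.fi])
    simp [hr, e6]
    refine ⟨by omega, by omega, by omega, by omega, by omega, by omega, by omega, fun x hx => ?_⟩
    by_cases hxj : x = j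
    · simp [hxj]
    · simp only [Function.update_of_ne hxj]
      exact h2 x (by omega)
  · intro k' s' hr hf ⟨h1, h2⟩
    exact ⟨by omega, by omega, h2⟩
  intro k₁ s₁ hf₁ ⟨h1, h2⟩
  have e0 : s₁.reg 0 = D.a := (hf₁.reg 0 rfl).trans (by simp [hL.a])
  have e1 : s₁.reg 1 = D.b := (hf₁.reg 1 rfl).trans (by simp [hL.b])
  have e2 : s₁.reg 2 = D.m := (hf₁.reg 2 rfl).trans (by simp [hL.m])
  refine ⟨trivial, by simp; omega, by simp; omega, by simp; omega, ?_⟩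
  refine wp_forLoop (N := D.b) (j₀ := 0)
    (fun j k' s' => K + 30 * (D.b - j) + 10 ≤ k' ∧
      ∀ x < j, s'.arr 10 x = 0 ∧ s'.arr 11 x = D.m)
    (by simp [e1]) (by omega) (by simp) (by omega) (by decide) rfl rfl (by simp; omega) ?_ ?_
  · intro j k' s' hj hr hf ⟨h1, h2⟩
    have e2 : s'.reg 2 = D.m := (hf.reg 2 rfl).trans (by simp [e2])
    simp [hr, e2]
    refine ⟨by omega, by omega, by omega, by omega, by omega, by omega, fun x hx => ?_⟩
    by_cases hxj : x = j
    · simp [hxj]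
    · simp only [Function.update_of_ne hxj]
      exact h2 x (by omega)
  · intro k' s' hr hf ⟨h3, h4⟩
    have e7 : s'.reg 7 = D.a := (hf.reg 7 rfl).trans (by simp [e0])
    have e8 : s'.arr 8 = s₁.arr 8 := (hf.arr 8 rfl).trans (by simp)
    have e9 : s'.arr 9 = s₁.arr 9 := (hf.arr 9 rfl).trans (by simp)
    have e12 : s'.arr 12 = s₁.arr 12 := (hf.arr 12 rfl).trans (by simp)
    refine ⟨by omega, by omega, engaged_start hD (fun x hx => by rw [e8, (h2 x hx).1])
      (fun x hx => by rw [e9, (h2 x hx).2.1]) (fun y hy => (h4 y hy).1) (fun y hy => (h4 y hy).2),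
      ?_, e7, ?_⟩
    · rw [e7, e12]
      exact ⟨fun i hi => by rw [(h2 i hi).2.2]; exact hi, fun x hx _ => Or.inr ⟨x, hx, (h2 x hx).2.2⟩⟩
    · rw [e8, pot_congr fun x hx => (h2 x hx).1]
      exact pot_first_le hD

/-- The entries of `t` are one plus the numbers of the edges in `N`, or `0` for free men. -/
def FlatInstance.IsRow (D : FlatInstance) (N : ℕ → Prop) (t : ℕ → ℕ) : Prop :=
  ∀ x < D.a, (t x = 0 ∧ ∀ e, N e → D.EX e ≠ x) ∨ ∃ e, N e ∧ D.EX e = x ∧ t x = e + 1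

/-- Test of success, with result in register `9`, and writing of the row at the base in
register `10`. -/
def checkCode : Cmd :=
  3 ::= cst 0 ;;
  forLoop 3 0 (.store 13 (vr 10 +. vr 3) (cst 0)) ;;
  9 ::= cst 1 ;;
  5 ::= cst 0 ;;
  forLoop 5 1
    (4 ::= rd 10 (vr 5) ;;
      .cond (vr 4)
        (3 ::= rd 2 (vr 4 -. cst 1) ;;
          .cond (rd 9 (vr 3) =. cst 1) (.store 13 (vr 10 +. vr 3) (vr 4)) (9 ::= cst 0))
        (.cond (rd 11 (vr 5) =. vr 2) .skip (9 ::= cst 0)))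

/-- The row is cleared first because it may contain the remains of a failed attempt. The counters of
the men make the test of injectivity a single look-up per woman. -/
theorem wp_checkCode (hD : D.Valid) (hW : 4 * (D.a + D.b + D.m) + 16 ≤ W) {k K B : ℕ} {s : State}
    (hL : Loaded D s) (hS : D.Shape (s.arr 8) (s.arr 9) (s.arr 10) (s.arr 11)) (hB : s.reg 10 = B)
    (hBW : B + D.a < W) (hk : K + 40 * (D.a + D.b) + 30 ≤ k) :
    wp W checkCode (fun k' s' => K ≤ k' ∧
      (s'.reg 9 ≠ 0 ↔ D.Succeeds (s.arr 9) (s.arr 10) (s.arr 11)) ∧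
      (s'.reg 9 ≠ 0 → D.IsRow (D.heldSet (s.arr 10)) fun x => s'.arr 13 (B + x)) ∧
      ∀ i, i < B → s'.arr 13 i = s.arr 13 i) k s := by
  have hW1 : 1 < W := by omega
  refine ⟨by simp; omega, by simp; omega, ?_⟩
  refine wp_seq_frame (wp_forLoop (N := D.a) (j₀ := 0)
    (Q := fun k' s' => K + 40 * D.b + 20 ≤ k' ∧
      (∀ x < D.a, s'.arr 13 (B + x) = 0) ∧ ∀ i < B, s'.arr 13 i = s.arr 13 i)
    (fun j k' s' => K + 40 * (D.a - j) + 40 * D.b + 26 ≤ k' ∧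
      (∀ x < j, s'.arr 13 (B + x) = 0) ∧ ∀ i < B, s'.arr 13 i = s.arr 13 i)
    (by simp [hL.a]) (by omega) (by simp) (by omega) (by decide) rfl rfl (by simp; omega) ?_ ?_) ?_
  · intro j k' s' hj hr hf ⟨h1, h2, h3⟩
    have e10 : s'.reg 10 = B := (hf.reg 10 rfl).trans (by simp [hB])
    simp [hr, e10]
    refine ⟨by omega, by omega, by omega, by omega, by omega, by omega, fun x hx => ?_,
      fun i hi => ?_⟩
    · by_cases hxj : x = j
      · simp [hxj]
      · rw [Function.update_of_ne (by omega)]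
        exact h2 x (by omega)
    · rw [Function.update_of_ne (by omega)]
      exact h3 i hi
  · intro k' s' hr hf ⟨h1, h2, h3⟩
    exact ⟨by omega, by omega, h2, h3⟩
  intro k₁ s₁ hf₁ ⟨h1, h2, h3⟩
  have e1 : s₁.reg 1 = D.b := (hf₁.reg 1 rfl).trans (by simp [hL.b])
  have e2 : s₁.reg 2 = D.m := (hf₁.reg 2 rfl).trans (by simp [hL.m])
  have e10 : s₁.reg 10 = B := (hf₁.reg 10 rfl).trans (by simp [hB])
  have a2 : s₁.arr 2 = D.EX := (hf₁.arr 2 rfl).trans (by simp [hL.ex])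
  have a9 : s₁.arr 9 = s.arr 9 := (hf₁.arr 9 rfl).trans (by simp)
  have a10 : s₁.arr 10 = s.arr 10 := (hf₁.arr 10 rfl).trans (by simp)
  have a11 : s₁.arr 11 = s.arr 11 := (hf₁.arr 11 rfl).trans (by simp)
  refine ⟨by simp; omega, by simp; omega, by simp; omega, by simp; omega, ?_⟩
  let good : ℕ → Prop := fun y => (s.arr 10 y ≠ 0 ∧ s.arr 9 (D.EX (s.arr 10 y - 1)) = 1) ∨
    (s.arr 10 y = 0 ∧ s.arr 11 y = D.m)
  refine wp_forLoop (N := D.b) (j₀ := 0)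
    (fun j k' s' => K + 40 * (D.b - j) + 10 ≤ k' ∧ (s'.reg 9 ≠ 0 ↔ ∀ y < j, good y) ∧
      (∀ x < D.a, s'.arr 13 (B + x) = 0 ∨ ∃ e, s'.arr 13 (B + x) = e + 1 ∧ D.EX e = x ∧
        D.heldSet (s.arr 10) e) ∧
      (∀ y < j, s.arr 10 y ≠ 0 → s.arr 9 (D.EX (s.arr 10 y - 1)) = 1 →
        s'.arr 13 (B + D.EX (s.arr 10 y - 1)) = s.arr 10 y) ∧
      ∀ i < B, s'.arr 13 i = s.arr 13 i)
    (by simp [e1]) (by omega) (by simp) (by omega) (by decide) rfl rfl ?_ ?_ ?_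
  · simp
    exact ⟨by omega, fun x hx => Or.inl (h2 x hx), h3⟩
  · intro j k' s' hj hr hf ⟨i1, i2, i3, i4, i5⟩
    have e2 : s'.reg 2 = D.m := (hf.reg 2 rfl).trans (by simp [e2])
    have e10 : s'.reg 10 = B := (hf.reg 10 rfl).trans (by simp [e10])
    have a2 : s'.arr 2 = D.EX := (hf.arr 2 rfl).trans (by simp [a2])
    have a9 : s'.arr 9 = s.arr 9 := (hf.arr 9 rfl).trans (by simp [a9])
    have a10 : s'.arr 10 = s.arr 10 := (hf.arr 10 rfl).trans (by simp [a10])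
    have a11 : s'.arr 11 = s.arr 11 := (hf.arr 11 rfl).trans (by simp [a11])
    have hsucc : ∀ {P : ℕ → Prop}, (∀ y ≤ j, P y) ↔ (∀ y < j, P y) ∧ P j := fun {P} =>
      ⟨fun h => ⟨fun y hy => h y (by omega), h j (by omega)⟩, fun h y hy => by
        rcases Nat.lt_or_eq_of_le hy with h' | rfl
        exacts [h.1 y h', h.2]⟩
    simp [hr, e2, e10, a2, a9, a10, a11, hW1]
    refine ⟨by omega, by omega, by omega, fun hf0 => ⟨by omega, by omega, fun hc => ?_, fun hc => ?_⟩,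
      fun hf0 => ⟨by omega, fun hc => ?_, fun hc => ?_⟩⟩
    · obtain ⟨g1, g2, g3, g4, g5⟩ := hS.held j hj hf0
      have hx := hD.ex_lt _ g1
      refine ⟨by omega, by omega, by omega, by omega, ?_, ?_, ?_, ?_⟩
      · rw [hsucc, ← i2]
        simp [good, hf0, hc]
      · intro x hx
        by_cases hxx : x = D.EX (s.arr 10 j - 1)
        · right
          subst hxx
          refine ⟨s.arr 10 j - 1, by simp; omega, rfl, g1, by rw [g2]; omega⟩
        · rw [Function.update_of_ne (by omega)]
          exact i3 x hx
      · rw [hsucc]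
        refine ⟨fun y hy hy0 hy1 => ?_, fun _ _ => by simp⟩
        -- The counter of the man of j is 1, so no earlier woman holds him and no entry written
        -- before is overwritten.
        by_cases hxx : D.EX (s.arr 10 y - 1) = D.EX (s.arr 10 j - 1)
        · exfalso
          rw [hS.c_eq _ hx, count] at hc
          have h2 : (∑ y ∈ {y, j}, if s.arr 10 y ≠ 0 ∧ D.EX (s.arr 10 y - 1) =
              D.EX (s.arr 10 j - 1) then 1 else 0) ≤ 1 := by
            refine (Finset.sum_le_sum_of_subset ?_).trans hc.le
            intro z hz
            simp only [Finset.mem_insert, Finset.mem_singleton] at hz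
            rcases hz with rfl | rfl
            · exact Finset.mem_range.2 (by omega)
            · exact Finset.mem_range.2 hj
          rw [Finset.sum_pair (by omega), if_pos ⟨hy0, hxx⟩, if_pos ⟨hf0, rfl⟩] at h2
          omega
        · rw [Function.update_of_ne (by omega)]
          exact i4 y hy hy0 hy1
      · intro i hi
        rw [Function.update_of_ne (by omega)]
        exact i5 i hi
    · refine ⟨by omega, by omega, by omega, by omega, ?_, i3, ?_, i5⟩
      · refine ⟨j, by omega, ?_⟩
        simp [good, hf0, hc]
      · rw [hsucc]
        exact ⟨i4, fun _ h => absurd h hc⟩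
    · refine ⟨by omega, by omega, by omega, ?_, i3, ?_, i5⟩
      · rw [hsucc, ← i2]
        simp [good, hf0, hc]
      · rw [hsucc]
        exact ⟨i4, fun h => absurd hf0 h⟩
    · refine ⟨by omega, by omega, by omega, by omega, ?_, i3, ?_, i5⟩
      · refine ⟨j, by omega, ?_⟩
        simp [good, hf0, hc]
      · rw [hsucc]
        exact ⟨i4, fun h => absurd hf0 h⟩
  · intro k' s' hr hf ⟨i1, i2, i3, i4, i5⟩
    refine ⟨by omega, by omega, i2, fun h9 x hx => ?_, i5⟩
    have hg := i2.1 h9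
    have hrow : ∀ e, D.heldSet (s.arr 10) e → s'.arr 13 (B + D.EX e) = e + 1 := by
      intro e he
      have hy := hD.ey_lt e he.1
      have h0 : s.arr 10 (D.EY e) ≠ 0 := by rw [he.2]; omega
      have := i4 _ hy h0 ((hg _ hy).resolve_right fun h => h0 h.1).2
      rwa [he.2, Nat.add_sub_cancel] at this
    rcases i3 x hx with h | ⟨e, h, h', h''⟩
    · refine Or.inl ⟨h, fun e he hex => ?_⟩
      have := hrow e he
      rw [hex] at this
      omega
    · exact Or.inr ⟨e, h'', h', h⟩

end SuperStable

/-! ### Numbered edges against the bipartite instance, and best matchings below a height -/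

namespace SuperStable

open FlatInstance

/-- The edge `(x, y)` of `G` has the number `num x y` in `D`. -/
structure Represents (D : FlatInstance) {a b : ℕ} (G : Instance (Fin a) (Fin b))
    (num : Fin a → Fin b → ℕ) : Prop where
  valid : D.Valid
  ha : D.a = a
  hb : D.b = b
  hm : D.m = G.edges.card
  lt : ∀ {x y}, (x, y) ∈ G.edges → num x y < D.m
  ex : ∀ {x y}, (x, y) ∈ G.edges → D.EX (num x y) = x
  ey : ∀ {x y}, (x, y) ∈ G.edges → D.EY (num x y) = y
  er : ∀ {x y}, (x, y) ∈ G.edges → D.ER (num x y) = G.rankA x y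
  eb : ∀ {x y}, (x, y) ∈ G.edges → D.EB (num x y) = G.rankB y x
  surj : ∀ e < D.m, ∃ x y, (x, y) ∈ G.edges ∧ num x y = e

variable {D : FlatInstance} {a b : ℕ} {G : Instance (Fin a) (Fin b)} {num : Fin a → Fin b → ℕ}
  {M N : Finset (Fin a × Fin b)}

/-- The numbers of the edges in `M`. -/
def edgeSet (num : Fin a → Fin b → ℕ) (M : Finset (Fin a × Fin b)) (e : ℕ) : Prop :=
  ∃ x y, (x, y) ∈ M ∧ num x y = e

theorem Represents.num_inj (hR : Represents D G num) {x x' : Fin a} {y y' : Fin b}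
    (h : (x, y) ∈ G.edges) (h' : (x', y') ∈ G.edges) (he : num x y = num x' y') :
    x = x' ∧ y = y' := by
  have h1 := hR.ex h
  have h2 := hR.ey h
  rw [he, hR.ex h'] at h1
  rw [he, hR.ey h'] at h2
  exact ⟨Fin.ext h1.symm, Fin.ext h2.symm⟩

theorem Represents.edgeSet_num (hR : Represents D G num) (hM : M ⊆ G.edges) {x : Fin a} {y : Fin b}
    (h : (x, y) ∈ G.edges) : edgeSet num M (num x y) ↔ (x, y) ∈ M := by
  refine ⟨?_, fun h => ⟨x, y, h, rfl⟩⟩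
  rintro ⟨x', y', h1, h2⟩
  obtain ⟨rfl, rfl⟩ := hR.num_inj (hM h1) h h2
  exact h1

theorem Represents.stable_edgeSet (hR : Represents D G num) (hM : IsSuperStable G M) :
    D.Stable (edgeSet num M) := by
  have hsub := hM.1.1
  refine ⟨?_, ?_, ?_, ?_⟩
  · rintro e ⟨x, y, h, rfl⟩
    exact hR.lt (hsub h)
  · rintro e e' ⟨x, y, h, rfl⟩ ⟨x', y', h', rfl⟩ hx
    rw [hR.ex (hsub h), hR.ex (hsub h'), Fin.val_inj] at hx
    have := hM.1.2 _ h _ h' (Or.inl hx)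
    simp only [Prod.mk.injEq] at this
    rw [this.1, this.2]
  · rintro e e' ⟨x, y, h, rfl⟩ ⟨x', y', h', rfl⟩ hx
    rw [hR.ey (hsub h), hR.ey (hsub h'), Fin.val_inj] at hx
    have := hM.1.2 _ h _ h' (Or.inr hx)
    simp only [Prod.mk.injEq] at this
    rw [this.1, this.2]
  · intro e he hne
    obtain ⟨x, y, h, rfl⟩ := hR.surj e he
    rw [hR.edgeSet_num hsub h] at hne
    have hb := hM.2 x y
    simp only [Blocks, h, hne, true_and, not_false_eq_true, not_and_or] at hb
    push Not at hb
    rcases hb with ⟨y', h1, h2⟩ | ⟨x', h1, h2⟩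
    · refine Or.inl ⟨num x y', ⟨x, y', h1, rfl⟩, ?_, ?_⟩
      · rw [hR.ex h, hR.ex (hsub h1)]
      · rwa [hR.er h, hR.er (hsub h1)]
    · refine Or.inr ⟨num x' y, ⟨x', y, h1, rfl⟩, ?_, ?_⟩
      · rw [hR.ey h, hR.ey (hsub h1)]
      · rwa [hR.eb h, hR.eb (hsub h1)]

theorem Represents.exists_of_stable (hR : Represents D G num) {P : ℕ → Prop} (hP : D.Stable P) :
    ∃ M, IsSuperStable G M ∧ P = edgeSet num M := by
  classical
  let M := G.edges.filter fun e => P (num e.1 e.2)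
  have hsub : M ⊆ G.edges := Finset.filter_subset _ _
  have hmem : ∀ {x y}, (x, y) ∈ M ↔ (x, y) ∈ G.edges ∧ P (num x y) := by
    intro x y
    simp [M]
  refine ⟨M, ⟨⟨hsub, ?_⟩, ?_⟩, ?_⟩
  · rintro ⟨x, y⟩ h ⟨x', y'⟩ h' hor
    have h1 := hmem.1 h
    have h2 := hmem.1 h'
    have : num x y = num x' y' := by
      rcases hor with he | he
      · exact hP.injX _ _ h1.2 h2.2 (by rw [hR.ex h1.1, hR.ex h2.1]; exact congrArg Fin.val he)
      · exact hP.injY _ _ h1.2 h2.2 (by rw [hR.ey h1.1, hR.ey h2.1]; exact congrArg Fin.val he)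
    obtain ⟨rfl, rfl⟩ := hR.num_inj h1.1 h2.1 this
    rfl
  · rintro x y ⟨h1, h2, h3, h4⟩
    have h5 : ¬ P (num x y) := fun h => h2 (hmem.2 ⟨h1, h⟩)
    rcases hP.cover _ (hR.lt h1) h5 with ⟨e, g1, g2, g3⟩ | ⟨e, g1, g2, g3⟩
    · obtain ⟨x', y', h, rfl⟩ := hR.surj e (hP.lt e g1)
      rw [hR.ex h, hR.ex h1, Fin.val_inj] at g2
      subst g2
      rw [hR.er h, hR.er h1] at g3
      have := h3 y' (hmem.2 ⟨h, g1⟩)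
      omega
    · obtain ⟨x', y', h, rfl⟩ := hR.surj e (hP.lt e g1)
      rw [hR.ey h, hR.ey h1, Fin.val_inj] at g2
      subst g2
      rw [hR.eb h, hR.eb h1] at g3
      have := h4 x' (hmem.2 ⟨h, g1⟩)
      omega
  · funext e
    refine propext ⟨fun h => ?_, ?_⟩
    · obtain ⟨x, y, h1, rfl⟩ := hR.surj e (hP.lt e h)
      exact ⟨x, y, hmem.2 ⟨h1, h⟩, rfl⟩
    · rintro ⟨x, y, h, rfl⟩
      exact (hmem.1 h).2

/-- The sets of numbers of the super-stable matchings that satisfy `P`. -/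
def Targets (G : Instance (Fin a) (Fin b)) (num : Fin a → Fin b → ℕ)
    (P : Finset (Fin a × Fin b) → Prop) (S : ℕ → Prop) : Prop :=
  ∃ N, IsSuperStable G N ∧ P N ∧ S = edgeSet num N

/-- `N` is the best super-stable matching in which `x` is worse off than at the height `h`. -/
def IsNext (G : Instance (Fin a) (Fin b)) (x : Fin a) (h : ℕ) (N : Finset (Fin a × Fin b)) : Prop :=
  IsSuperStable G N ∧ h < height G N x ∧
    ∀ R, IsSuperStable G R → h < height G R x → ∀ z, height G N z ≤ height G R z

/-- The entries of `t` are one plus the numbers of the edges in `M`, or `0` for free men. -/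
def IsRowOf (num : Fin a → Fin b → ℕ) (M : Finset (Fin a × Fin b)) (t : ℕ → ℕ) : Prop :=
  ∀ x : Fin a, (t x = 0 ∧ ∀ y, (x, y) ∉ M) ∨ ∃ y, (x, y) ∈ M ∧ t x = num x y + 1

theorem Represents.isRowOf (hR : Represents D G num) (hM : M ⊆ G.edges) {t : ℕ → ℕ}
    (h : D.IsRow (edgeSet num M) t) : IsRowOf num M t := by
  intro x
  rcases h x (by rw [hR.ha]; exact x.2) with ⟨h1, h2⟩ | ⟨e, ⟨x', y, h1, rfl⟩, h2, h3⟩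
  · exact Or.inl ⟨h1, fun y hy => h2 _ ⟨x, y, hy, rfl⟩ (hR.ex (hM hy))⟩
  · rw [hR.ex (hM h1), Fin.val_inj] at h2
    subst h2
    exact Or.inr ⟨y, h1, h3⟩

/-- The matching found dominates all targets but need not satisfy P itself. When it is required to
be worse for a given man, this has to come from elsewhere, namely from the floor for his proposals.
-/
theorem Represents.of_succeeds (hR : Represents D G num) {p c f cur : ℕ → ℕ}
    {P : Finset (Fin a × Fin b) → Prop} (hS : D.Shape p c f cur)
    (hB : D.Bound p f cur) (hT : D.Target (Targets G num P) f cur) (hdone : D.Done p c)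
    (hok : D.Succeeds c f cur) :
    ∃ M, IsSuperStable G M ∧ D.heldSet f = edgeSet num M ∧
      ∀ N, IsSuperStable G N → P N → ∀ z, height G M z ≤ height G N z := by
  obtain ⟨M, hM, he⟩ := hR.exists_of_stable (stable_heldSet hR.valid hS hB hdone hok)
  refine ⟨M, hM, he, fun N hN hP => (dominates_iff hM hN).1 ?_⟩
  intro x y hxy
  obtain ⟨e, h1, h2, h3⟩ := heldSet_dominates hR.valid hS hB hT hdone (N := edgeSet num N)
    ⟨N, hN, hP, rfl⟩ ⟨x, y, hxy, rfl⟩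
  rw [he] at h1
  obtain ⟨x', y', h4, rfl⟩ := h1
  rw [hR.ex (hM.1.1 h4), hR.ex (hN.1.1 hxy), Fin.val_inj] at h2
  subst h2
  rw [hR.er (hM.1.1 h4), hR.er (hN.1.1 hxy)] at h3
  exact ⟨y', h4, h3⟩

/-- The edges of a man are numbered along his list. -/
theorem Represents.height_le_of_num_lt (hR : Represents D G num) {x : Fin a} {y y' : Fin b}
    (h : (x, y) ∈ G.edges) (h' : (x, y') ∈ G.edges) (hlt : num x y ≤ num x y') :
    G.rankA x y ≤ G.rankA x y' := by
  rw [← hR.er h, ← hR.er h']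
  exact hR.valid.er_mono _ _ hlt (hR.lt h') ((hR.ex h).trans (hR.ex h').symm)

/-- For super-stable matchings the numbers of the edges of a man compare as the heights. -/
theorem Represents.num_lt_iff (hR : Represents D G num) (hM : IsSuperStable G M)
    (hN : IsSuperStable G N) {x : Fin a} {y y' : Fin b} (h : (x, y) ∈ M) (h' : (x, y') ∈ N) :
    num x y < num x y' ↔ height G M x < height G N x := by
  rw [height_eq hM.1 h, height_eq hN.1 h']
  have e := hM.1.1 h
  have e' := hN.1.1 h'
  constructor
  · intro hlt
    refine lt_of_le_of_ne (hR.height_le_of_num_lt e e' hlt.le) fun heq => ?_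
    have := eq_of_rankA_eq hM hN h h' heq
    rw [this] at hlt
    omega
  · intro hlt
    by_contra! hle
    have := hR.height_le_of_num_lt e' e hle
    omega

/-! ### Rows of best matchings -/

/-- The rows from `lo` to `hi` of the table `t` are the best super-stable matchings in which `x` is
worse and worse off, from the height `h` on. -/
def Rows (G : Instance (Fin a) (Fin b)) (num : Fin a → Fin b → ℕ) (t : ℕ → ℕ) (x : Fin a)
    (lo hi h h' : ℕ) : Prop :=
  lo ≤ hi ∧ ∃ g : ℕ → ℕ, g lo = h ∧ g hi = h' ∧ ∀ i, lo ≤ i → i < hi →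
    ∃ N, IsNext G x (g i) N ∧ IsRowOf num N (fun z => t (i * a + z)) ∧ height G N x = g (i + 1)

theorem Rows.refl (t : ℕ → ℕ) (x : Fin a) (lo h : ℕ) : Rows G num t x lo lo h h :=
  ⟨le_rfl, fun _ => h, rfl, rfl, fun i h1 h2 => by omega⟩

theorem IsRowOf.congr {t t' : ℕ → ℕ} (h : IsRowOf num M t) (ht : ∀ x < a, t' x = t x) :
    IsRowOf num M t' := fun x => by
  rw [ht x x.2]
  exact h x

theorem Rows.congr {t t' : ℕ → ℕ} {x : Fin a} {lo hi h h' : ℕ} (hr : Rows G num t x lo hi h h')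
    (ht : ∀ i < hi * a, t' i = t i) : Rows G num t' x lo hi h h' := by
  obtain ⟨hle, g, g1, g2, g3⟩ := hr
  refine ⟨hle, g, g1, g2, fun i h1 h2 => ?_⟩
  obtain ⟨N, n1, n2, n3⟩ := g3 i h1 h2
  refine ⟨N, n1, n2.congr fun z hz => ht _ ?_, n3⟩
  calc i * a + z < (i + 1) * a := by rw [Nat.add_mul]; omega
    _ ≤ hi * a := Nat.mul_le_mul_right _ h2

theorem Rows.snoc {t : ℕ → ℕ} {x : Fin a} {lo hi h h' : ℕ} (hr : Rows G num t x lo hi h h')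
    (hN : IsNext G x h' N) (ht : IsRowOf num N fun z => t (hi * a + z)) :
    Rows G num t x lo (hi + 1) h (height G N x) := by
  obtain ⟨hle, g, g1, g2, g3⟩ := hr
  refine ⟨by omega, Function.update g (hi + 1) (height G N x), ?_, by simp, fun i h1 h2 => ?_⟩
  · rwa [Function.update_of_ne (by omega)]
  · rw [Function.update_of_ne (by omega)]
    rcases Nat.lt_succ_iff_lt_or_eq.1 h2 with h3 | rfl
    · rw [Function.update_of_ne (by omega)]
      exact g3 i h1 h3
    · rw [Function.update_self, g2]
      exact ⟨N, hN, ht, rfl⟩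

/-- Consuming the best remaining row of a man turns the height of this row into the new reference
height. -/
theorem Rows.uncons {t : ℕ → ℕ} {x : Fin a} {lo hi h h' : ℕ} (hr : Rows G num t x lo hi h h')
    (hlt : lo < hi) : ∃ N, IsNext G x h N ∧ IsRowOf num N (fun z => t (lo * a + z)) ∧
      Rows G num t x (lo + 1) hi (height G N x) h' := by
  obtain ⟨hle, g, g1, g2, g3⟩ := hr
  obtain ⟨N, n1, n2, n3⟩ := g3 lo le_rfl hlt
  rw [g1] at n1
  exact ⟨N, n1, n2, hlt, g, n3.symm, g2, fun i h1 h2 => g3 i (by omega) h2⟩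

/-- The rows from `lo` to `hi` are all that there are. -/
def AllRows (G : Instance (Fin a) (Fin b)) (num : Fin a → Fin b → ℕ) (t : ℕ → ℕ) (x : Fin a)
    (lo hi h : ℕ) : Prop :=
  ∃ h', Rows G num t x lo hi h h' ∧ ∀ N, IsSuperStable G N → height G N x ≤ h'

end SuperStable

namespace SuperStable

open FlatInstance

/-! ## The program for the rows -/

/-- The partner of the man with the edge in register `12` rejects him. -/
def forceCode : Cmd :=
  5 ::= rd 3 (vr 12 -. cst 1) ;;
  7 ::= cst 0 ;;
  rejectCode ;;
  .store 10 (vr 5) (cst 0)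

/-- The proposals resume from the pointers reached so far. The proposals of all phases for one man
together therefore number at most m. -/
def nextCode : Cmd :=
  forceCode ;; runCode ;; 10 ::= vr 13 *. vr 0 ;; checkCode

/-- After success, the new edge of the man is the next one to be rejected. After failure the row
counter stays, and the failed row may be overwritten. -/
def recordCode : Cmd :=
  .cond (vr 9) (12 ::= rd 13 (vr 10 +. vr 11) ;; 13 ::= vr 13 +. cst 1) .skip

def startCode : Cmd := initCode ;; runCode

/-- All rows of the man in register `11`. -/
def manCode : Cmd :=
  startCode ;; 12 ::= rd 13 (vr 11) ;; 9 ::= cst 1 ;; .loop (vr 9) (nextCode ;; recordCode)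

/-- The best super-stable matching, in row `0`; register `9` tells whether there is one. -/
def firstCode : Cmd := startCode ;; 10 ::= cst 0 ;; checkCode

/-- Row 0 holds the best matching, hence the start at 1. Arrays 14 and 15 delimit the rows of each
man. A man who is free in the best matching is free in all of them and gets no rows. -/
def rowsCode : Cmd :=
  13 ::= cst 1 ;;
  11 ::= cst 0 ;;
  forLoop 11 0
    (.store 14 (vr 11) (vr 13) ;; .cond (rd 13 (vr 11)) manCode .skip ;; .store 15 (vr 11) (vr 13))

variable {D : FlatInstance} {a b : ℕ} {G : Instance (Fin a) (Fin b)} {num : Fin a → Fin b → ℕ}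
  {M N : Finset (Fin a × Fin b)} {P : Finset (Fin a × Fin b) → Prop} {W : ℕ}
  {T : (ℕ → Prop) → Prop} {F : ℕ × ℕ}

/-- The man is held by one woman only, so after her rejection nobody holds him. From now on he can
be held only for edges from his current pointer on; this is the floor. -/
theorem wp_forceCode (hD : D.Valid) (hW : 4 * (D.a + D.b + D.m) + 16 ≤ W) {k : ℕ} {s : State}
    (hL : Loaded D s) (hE : Engaged D T F s) (hdone : D.Done (s.arr 8) (s.arr 9)) {e : ℕ}
    (he : s.reg 12 = e + 1) (hh : D.heldSet (s.arr 10) e) (hc : s.arr 9 (D.EX e) = 1)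
    {T' : (ℕ → Prop) → Prop} (hT : ∀ S, T' S → T S ∧ ¬ S e) (hk : 60 ≤ k) :
    wp W forceCode (fun k' s' => k ≤ k' + 60 ∧ Engaged D T' (D.EX e, s.arr 8 (D.EX e)) s' ∧
      D.Stacked (s'.arr 8) (s'.arr 9) (s'.arr 12) (s'.reg 7) D.a ∧ s'.reg 7 = 1) k s := by
  have h1 : 1 < W := by omega
  have hy := hD.ey_lt e hh.1
  have hf0 : s.arr 10 (D.EY e) ≠ 0 := by rw [hh.2]; omega
  refine ⟨by simp; omega, by simp; omega, by simp; omega, by simp; omega, ?_⟩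
  refine wp_seq_frame (wp_rejectCode (x := D.a) hD (by omega) (by simp [hL.ex])
    (by simpa using hE.shape) (by simp [hL.ey, he, hy]) ?_ (by simp [hL.ey, he, hf0])
    (by simp; omega) (by simp; omega)) ?_
  · exact ⟨by simp, fun x hx ha => absurd ha (hdone x hx)⟩
  rintro k₁ s₁ hf ⟨g1, g2, g3, g4⟩
  have e5 : s₁.reg 5 = D.EY e := (hf.reg 5 rfl).trans (by simp [hL.ey, he])
  have e8 : s₁.arr 8 = s.arr 8 := (hf.arr 8 rfl).trans (by simp)
  have e10 : s₁.arr 10 = s.arr 10 := (hf.arr 10 rfl).trans (by simp)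
  have e11 : s₁.arr 11 = s.arr 11 := (hf.arr 11 rfl).trans (by simp)
  obtain ⟨hB, hT'⟩ := bound_of_reject hD hE.shape hE.bound hE.target hf0 (T' := T')
    (by rwa [hh.2])
  rw [e5] at g2
  simp at g1 g4
  simp [e5]
  refine ⟨by omega, by omega, by omega, ⟨?_, ?_, ?_, ?_⟩, g3, g4⟩
  · simpa using g2
  · simpa [e8, e10, e11] using hB
  · simpa [e10, e11] using hT'
  -- His counter was 1, so after clearing the entry of his woman the count is 0, and no entry of his
  -- is left.
  · simp only [State.setArr_arr, e8, e10]
    refine ⟨by simp, fun y hy' hy0 hyx => ?_⟩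
    exfalso
    simp only [if_true] at hy0 hyx
    have h2 := count_update (D := D) (f := s.arr 10) hy 0 (D.EX e)
    rw [hh.2, Nat.add_sub_cancel, ← hE.shape.c_eq _ (hD.ex_lt e hh.1), hc] at h2
    have h3 := count_pos (D := D) hy' hy0
    rw [hyx] at h3
    simp at h2
    omega

/-- Keeps the addresses in the table of rows, of the form row · a + man, within the word size. -/
theorem mul_add_lt {n u v w W : ℕ} (hW : n ^ 2 * 4 ≤ W) (hu : u ≤ n) (hv : v ≤ n) (hw : w ≤ n)
    (hn : 2 ≤ n) : u * v + w < W := by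
  have := Nat.mul_le_mul hu hv
  nlinarith

/-- After the phase of proposals the rows of the table are written as required. -/
theorem wp_nextCode (hR : Represents D G num) {n : ℕ} (hn : n = D.a + D.b + D.m + 2)
    (hW : n ^ 2 * 32 ≤ W) {k K R : ℕ} {s : State}
    (hL : Loaded D s) (hE : Engaged D (Targets G num P) F s)
    (hdone : D.Done (s.arr 8) (s.arr 9)) (hok : D.Succeeds (s.arr 9) (s.arr 10) (s.arr 11))
    (hM : IsSuperStable G M) (hf : D.heldSet (s.arr 10) = edgeSet num M) {x : Fin a} {y : Fin b}
    (hxy : (x, y) ∈ M) (h12 : s.reg 12 = num x y + 1) (h13 : s.reg 13 = R) (hRm : R ≤ D.m + 1)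
    (hP : ∀ N, IsSuperStable G N → height G M x < height G N x → P N)
    (hk : K + 450 * D.pot (s.arr 8) + 40 * (D.a + D.b) + 300 ≤ k) (hpot : D.pot (s.arr 8) ≤ D.m) :
    wp W nextCode (fun k' s' => K + 450 * D.pot (s'.arr 8) ≤ k' ∧ D.pot (s'.arr 8) ≤ D.m ∧
      Engaged D (Targets G num fun N => height G M x < height G N x)
        (D.EX (num x y), s.arr 8 (D.EX (num x y))) s' ∧ D.Done (s'.arr 8) (s'.arr 9) ∧
      s'.reg 10 = R * D.a ∧ (∀ i, i < R * D.a → s'.arr 13 i = s.arr 13 i) ∧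
      ((s'.reg 9 = 0 ∧ ∀ N, IsSuperStable G N → height G N x ≤ height G M x) ∨
        (s'.reg 9 ≠ 0 ∧ D.Succeeds (s'.arr 9) (s'.arr 10) (s'.arr 11) ∧
          ∃ N, IsNext G x (height G M x) N ∧ D.heldSet (s'.arr 10) = edgeSet num N ∧
            IsRowOf num N fun z => s'.arr 13 (R * a + z)))) k s := by
  have hD := hR.valid
  have hn2 : n ≤ n ^ 2 := Nat.le_self_pow (by omega) n
  have hW' : 4 * (D.a + D.b + D.m) + 16 ≤ W := by omega
  have hxe := hM.1.1 hxy
  have hh : D.heldSet (s.arr 10) (num x y) := by rw [hf]; exact ⟨x, y, hxy, rfl⟩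
  have hc : s.arr 9 (D.EX (num x y)) = 1 := by
    have h0 : s.arr 10 (D.EY (num x y)) ≠ 0 := by rw [hh.2]; omega
    have := ((hok _ (hD.ey_lt _ hh.1)).resolve_right fun h => h0 h.1).2
    rwa [hh.2, Nat.add_sub_cancel] at this
  have hple : num x y < s.arr 8 (D.EX (num x y)) := by
    have h0 : s.arr 10 (D.EY (num x y)) ≠ 0 := by rw [hh.2]; omega
    have := (hE.shape.held _ (hD.ey_lt _ hh.1) h0).2.2.1
    rwa [hh.2, Nat.add_sub_cancel] at this
  refine wp_seq_frame (wp_forceCode hD hW' hL hE hdone h12 hh hc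
    (T' := Targets G num fun N => height G M x < height G N x) ?_ (by omega)) ?_
  · rintro S ⟨N, h1, h2, rfl⟩
    refine ⟨⟨N, h1, hP N h1 h2, rfl⟩, fun h => ?_⟩
    rw [hR.edgeSet_num h1.1.1 hxe] at h
    rw [height_eq hM.1 hxy, height_eq h1.1 h] at h2
    omega
  rintro k₁ s₁ hf₁ ⟨g1, g2, g3, g4⟩
  have hL₁ := hL.of_frame hf₁ (by decide) (by decide)
  have e8 : s₁.arr 8 = s.arr 8 := hf₁.arr 8 rfl
  refine wp_seq_frame (wp_runCode (K := K + 40 * (D.a + D.b) + 40) hD hW' hL₁ g2 g3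
    (by rw [g4, e8]; omega) (by rw [g4, e8]; omega)) ?_
  rintro k₂ s₂ hf₂ ⟨q1, q2, q3, q4⟩
  have hL₂ := hL₁.of_frame hf₂ (by decide) (by decide)
  have e13 : s₂.reg 13 = R := (hf₂.reg 13 rfl).trans ((hf₁.reg 13 rfl).trans h13)
  have b13 : s₂.arr 13 = s.arr 13 := (hf₂.arr 13 rfl).trans (hf₁.arr 13 rfl)
  have hRW := mul_add_lt (n := n) (u := R) (v := D.a) (w := D.a) (W := W) (by omega) (by omega)
    (by omega) (by omega) (by omega)
  refine ⟨by simp [e13, hL₂.a]; omega, by simp; omega, ?_⟩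
  refine wp_frame (wp_checkCode (K := K + 450 * D.pot (s₂.arr 8)) (B := R * D.a) hD hW'
    ⟨by simp [hL₂.a], by simp [hL₂.b], by simp [hL₂.m], by simp [hL₂.ex], by simp [hL₂.ey],
      by simp [hL₂.er], by simp [hL₂.eb], by simp [hL₂.fi]⟩ (by simpa using q2.shape)
    (by simp [e13, hL₂.a]) hRW (by simp; omega)) ?_
  rintro k₃ s₃ hf₃ ⟨r1, r2, r3, r4⟩
  simp at r2 r3 r4
  have f8 : s₃.arr 8 = s₂.arr 8 := (hf₃.arr 8 rfl).trans (by simp)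
  have f9 : s₃.arr 9 = s₂.arr 9 := (hf₃.arr 9 rfl).trans (by simp)
  have f10 : s₃.arr 10 = s₂.arr 10 := (hf₃.arr 10 rfl).trans (by simp)
  have f11 : s₃.arr 11 = s₂.arr 11 := (hf₃.arr 11 rfl).trans (by simp)
  have h10 : s₃.reg 10 = R * D.a := (hf₃.reg 10 rfl).trans (by simp [e13, hL₂.a])
  rw [e8] at q4
  refine ⟨by rw [f8]; omega, by rw [f8]; omega, ⟨?_, ?_, ?_, ?_⟩, ?_, h10,
    fun i hi => (r4 i hi).trans (by rw [b13]), ?_⟩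
  · rw [f8, f9, f10, f11]; exact q2.shape
  · rw [f8, f10, f11]; exact q2.bound
  · rw [f10, f11]; exact q2.target
  · rw [f8, f10]; exact q2.floor
  · rw [f8, f9]; exact q3
  by_cases h9 : s₃.reg 9 = 0
  -- A failed test means that the target set is empty, so x cannot be worse off than in M.
  · refine Or.inl ⟨h9, fun N hN => ?_⟩
    by_contra! hlt
    have := succeeds_of_target hD q2.shape q2.bound q2.target q3 ⟨N, hN, hlt, rfl⟩
    exact (r2.2 this) h9
  have hs := r2.1 h9
  obtain ⟨N, hN, hhN, hmax⟩ := hR.of_succeeds q2.shape q2.bound q2.target q3 hs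
  refine Or.inr ⟨h9, by rw [f9, f10, f11]; exact hs, N, ⟨hN, ?_, hmax⟩, by rw [f10]; exact hhN, ?_⟩
  -- The matching found is itself worse for x: by the floor his new edge has a number at least his
  -- old pointer, which is beyond his edge in M.
  · obtain ⟨y', hy'⟩ := exists_partnerA hM hN hxy
    refine (hR.num_lt_iff hM hN hxy hy').1 ?_
    have hh' : D.heldSet (s₂.arr 10) (num x y') := by rw [hhN]; exact ⟨x, y', hy', rfl⟩
    have h0 : s₂.arr 10 (D.EY (num x y')) ≠ 0 := by rw [hh'.2]; omega
    have := q2.floor.2 _ (hD.ey_lt _ hh'.1) h0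
    rw [hh'.2, Nat.add_sub_cancel, hR.ex hxe, hR.ex (hN.1.1 hy')] at this
    have := this rfl
    rw [hR.ex hxe] at hple
    dsimp only at this
    omega
  · have := r3 h9
    rw [hhN] at this
    simpa only [hR.ha] using hR.isRowOf hN.1.1 this

/-- The invariant of the loop for the rows of `x`, with the last row found in `M`. -/
structure RowState (D : FlatInstance) (G : Instance (Fin a) (Fin b)) (num : Fin a → Fin b → ℕ)
    (M₀ : Finset (Fin a × Fin b)) (x : Fin a) (t₀ : ℕ → ℕ) (R K C k : ℕ) (s : State)
    (M : Finset (Fin a × Fin b)) (y : Fin b) : Prop where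
  stable : IsSuperStable G M
  mem : (x, y) ∈ M
  edge : s.reg 12 = num x y + 1
  le : s.reg 13 ≤ num x y + 1
  rows : Rows G num (s.arr 13) x R (s.reg 13) (height G M₀ x) (height G M x)
  keep : ∀ i < R * a, s.arr 13 i = t₀ i
  more : s.reg 9 ≠ 0 → ∃ P F, Engaged D (Targets G num P) F s ∧ D.Done (s.arr 8) (s.arr 9) ∧
    D.Succeeds (s.arr 9) (s.arr 10) (s.arr 11) ∧ D.heldSet (s.arr 10) = edgeSet num M ∧
    (∀ N, IsSuperStable G N → height G M x < height G N x → P N) ∧ D.pot (s.arr 8) ≤ D.m ∧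
    K + 450 * D.pot (s.arr 8) + (D.FI (x + 1) - num x y) * C + 10 ≤ k
  last : s.reg 9 = 0 → (∀ N, IsSuperStable G N → height G N x ≤ height G M x) ∧ K + 5 ≤ k

/-- Amortisation: the proposals are paid by the potential, which is shared by all rounds, and each
round pays C for the fixed costs. The edge of x advances in each successful round, so there are at
most as many rounds as edges of x from the current one on. -/
theorem wp_rowLoop (hR : Represents D G num) {n : ℕ} (hn : n = D.a + D.b + D.m + 2)
    (hW : n ^ 2 * 32 ≤ W) {k K R C : ℕ} {s : State} (hL : Loaded D s) {x : Fin a} {y : Fin b}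
    {M₀ : Finset (Fin a × Fin b)} (hC : 40 * (D.a + D.b) + 340 ≤ C) (hx : s.reg 11 = x)
    {t₀ : ℕ → ℕ} (h₀ : RowState D G num M₀ x t₀ R K C k s M y) :
    wp W (.loop (vr 9) (nextCode ;; recordCode)) (fun k' s' => K ≤ k' ∧ R ≤ s'.reg 13 ∧
      s'.reg 13 ≤ D.FI (x + 1) + 1 ∧
      AllRows G num (s'.arr 13) x R (s'.reg 13) (height G M₀ x) ∧
      ∀ i < R * a, s'.arr 13 i = t₀ i) k s := by
  have hD := hR.valid
  have hxa : (x : ℕ) < D.a := by rw [hR.ha]; exact x.2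
  have hedge : ∀ {N y}, IsSuperStable G N → (x, y) ∈ N → num x y < D.FI (x + 1) := fun hN h =>
    ((hD.block x hxa _ (hR.lt (hN.1.1 h))).1 (hR.ex (hN.1.1 h))).2
  refine wp_loop' (fun k s => ∃ M y, RowState D G num M₀ x t₀ R K C k s M y) ⟨M, y, h₀⟩ ?_
  rintro k s' hf ⟨M, y, h⟩
  have hlt := hedge h.stable h.mem
  have hL' := hL.of_frame hf (by decide) (by decide)
  have e11 : s'.reg 11 = x := (hf.reg 11 rfl).trans hx
  refine ⟨trivial, ?_, fun h0 => ?_, fun h0 => ?_⟩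
  · by_cases h9 : s'.reg 9 = 0
    · have := (h.last h9).2
      simp; omega
    · obtain ⟨P, F, -, -, -, -, -, -, h1⟩ := h.more h9
      simp; omega
  · obtain ⟨h1, h2⟩ := h.last h0
    have := h.le
    exact ⟨by simp; omega, h.rows.1, by omega, ⟨_, h.rows, h1⟩, h.keep⟩
  obtain ⟨P, F, h1, h2, h3, h4, h5, h6, h7⟩ := h.more h0
  have hfi := hD.fi_le (x + 1) hxa
  have hle := h.le
  have hCC : (D.FI (x + 1) - num x y) * C = (D.FI (x + 1) - num x y - 1) * C + C := by
    obtain ⟨d, hd⟩ := Nat.exists_eq_add_of_lt hlt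
    rw [show D.FI (x + 1) - num x y = d + 1 by omega, Nat.add_sub_cancel, Nat.add_mul, Nat.one_mul]
  refine wp_seq_frame (wp_nextCode (R := s'.reg 13)
    (K := K + (D.FI (x + 1) - num x y - 1) * C + 30) hR hn hW hL' h1 h2 h3 h.stable h4 h.mem
    h.edge rfl (by omega) h5 (by have : (vr 9).size + 1 = 2 := rfl; omega) h6) ?_
  rintro k₁ s₁ hf₁ ⟨g1, g2, g3, g4, g5, g6, g7⟩
  have e13 : s₁.reg 13 = s'.reg 13 := hf₁.reg 13 rfl
  have e12 : s₁.reg 12 = s'.reg 12 := hf₁.reg 12 rfl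
  have e11 : s₁.reg 11 = x := (hf₁.reg 11 rfl).trans e11
  have hRle : R * a ≤ s'.reg 13 * D.a := by
    rw [hR.ha]
    exact Nat.mul_le_mul_right _ h.rows.1
  have hrows : Rows G num (s₁.arr 13) x R (s₁.reg 13) (height G M₀ x) (height G M x) := by
    rw [e13]
    exact h.rows.congr fun i hi => g6 i (by rwa [hR.ha])
  have hkeep : ∀ i < R * a, s₁.arr 13 i = t₀ i := fun i hi =>
    (g6 i (hi.trans_le hRle)).trans (h.keep i hi)
  have hn2 : n ≤ n ^ 2 := Nat.le_self_pow (by omega) n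
  have hRW := mul_add_lt (n := n) (u := s'.reg 13) (v := D.a) (w := D.a) (W := W) (by omega)
    (by omega) (by omega) (by omega) (by omega)
  simp only [recordCode, wp]
  rcases g7 with ⟨h9, g7⟩ | ⟨h9, g7, N, hN, g8, g9⟩
  · refine ⟨trivial, by simp; omega, fun hh => absurd h9 hh, fun _ => ⟨by simp; omega, M, y, ?_⟩⟩
    exact ⟨h.stable, h.mem, e12.trans h.edge, by omega, hrows, hkeep, fun hh => absurd h9 hh,
      fun _ => ⟨g7, by simp; omega⟩⟩
  · obtain ⟨y', hy'⟩ := exists_partnerA h.stable hN.1 h.mem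
    have hnum := (hR.num_lt_iff h.stable hN.1 h.mem hy').2 hN.2.1
    have hlt' := hedge hN.1 hy'
    have hval : s₁.arr 13 (s₁.reg 10 + s₁.reg 11) = num x y' + 1 := by
      rcases g9 x with ⟨-, h'⟩ | ⟨y'', hy'', h'⟩
      · exact absurd hy' (h' y')
      · have := hN.1.1.right_unique hy' hy''
        subst this
        rw [g5, e11, hR.ha]
        exact h'
    refine ⟨trivial, by simp; omega, fun _ => ⟨⟨trivial, trivial, ?_⟩, by simp; omega,
      ⟨trivial, by show 1 < W; omega, ?_⟩, by simp; omega, N, y', ?_⟩, fun hh => absurd hh h9⟩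
    · simp [g5, e11]; omega
    · simp [e13]; omega
    · have hpow : (D.FI (x + 1) - num x y') * C ≤ (D.FI (x + 1) - num x y - 1) * C :=
        Nat.mul_le_mul_right _ (by omega)
      have hsn := hrows.snoc hN (by rw [e13]; exact g9)
      refine ⟨hN.1, hy', by simp [hval], by simp; omega, by simpa using hsn, hkeep, fun _ =>
        ⟨_, _, ⟨g3.shape, g3.bound, g3.target, g3.floor⟩, g4, g7, g8, fun _ _ => hN.2.1.trans, g2, ?_⟩,
        fun hh => absurd hh (by simpa using h9)⟩
      simp; omega

/-- The best of all super-stable matchings. -/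
def IsBest (G : Instance (Fin a) (Fin b)) (M : Finset (Fin a × Fin b)) : Prop :=
  IsSuperStable G M ∧ ∀ N, IsSuperStable G N → ∀ z, height G M z ≤ height G N z

theorem IsBest.unique (hM : IsBest G M) (hN : IsBest G N) : M = N :=
  eq_of_height_eq hM.1 hN.1 <| funext fun z => le_antisymm (hM.2 N hN.1 z) (hN.2 M hM.1 z)

theorem wp_startCode (hR : Represents D G num) (hW : 4 * (D.a + D.b + D.m) + 16 ≤ W) {k K : ℕ}
    {s : State} (hL : Loaded D s) (hk : K + 180 * (D.a + D.b) + 450 * D.m + 40 ≤ k) :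
    wp W startCode (fun k' s' => K + 450 * D.pot (s'.arr 8) ≤ k' ∧
      Engaged D (Targets G num fun _ => True) (0, 0) s' ∧ D.Done (s'.arr 8) (s'.arr 9) ∧
      D.pot (s'.arr 8) ≤ D.m) k s := by
  have hD := hR.valid
  refine wp_seq_frame (wp_initCode (K := K + 150 * D.a + 450 * D.m + 10) hD hW hL (by omega)) ?_
  rintro k₁ s₁ hf ⟨g1, g2, g3, g4, g5⟩
  refine wp_mono (wp_runCode (K := K) hD hW (hL.of_frame hf (by decide) (by decide)) g2 g3 ?_ ?_) ?_
  · omega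
  · omega
  · rintro k₂ s₂ ⟨q1, q2, q3, q4⟩
    refine ⟨by omega, ⟨q2.shape, q2.bound, ?_, q2.floor⟩, q3, by omega⟩
    rintro S ⟨N, hN, -, rfl⟩
    exact q2.target _ (hR.stable_edgeSet hN)

theorem wp_firstCode (hR : Represents D G num) (hW : 4 * (D.a + D.b + D.m) + 16 ≤ W) {k K : ℕ}
    {s : State} (hL : Loaded D s) (hk : K + 220 * (D.a + D.b) + 450 * D.m + 80 ≤ k) :
    wp W firstCode (fun k' s' => K ≤ k' ∧
      ((s'.reg 9 = 0 ∧ ¬ ∃ M, IsSuperStable G M) ∨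
        (s'.reg 9 ≠ 0 ∧ ∃ M, IsBest G M ∧ IsRowOf num M (s'.arr 13)))) k s := by
  have hD := hR.valid
  refine wp_seq_frame (wp_startCode (K := K + 40 * (D.a + D.b) + 40) hR hW hL (by omega)) ?_
  rintro k₂ s₂ hf₂ ⟨q1, q2, q3, q4⟩
  have hL₂ := hL.of_frame hf₂ (by decide) (by decide)
  refine ⟨by simp; omega, by simp; omega, ?_⟩
  refine wp_mono (wp_checkCode (K := K) (B := 0) hD hW
    ⟨by simp [hL₂.a], by simp [hL₂.b], by simp [hL₂.m], by simp [hL₂.ex], by simp [hL₂.ey],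
      by simp [hL₂.er], by simp [hL₂.eb], by simp [hL₂.fi]⟩ (by simpa using q2.shape)
    (by simp) (by omega) (by simp; omega)) ?_
  rintro k₃ s₃ ⟨r1, r2, r3, r4⟩
  simp at r2 r3 r4
  refine ⟨r1, ?_⟩
  by_cases h9 : s₃.reg 9 = 0
  · refine Or.inl ⟨h9, ?_⟩
    rintro ⟨N, hN⟩
    exact r2.2 (succeeds_of_target hD q2.shape q2.bound q2.target q3 ⟨N, hN, trivial, rfl⟩) h9
  obtain ⟨N, hN, hhN, hmax⟩ := hR.of_succeeds q2.shape q2.bound q2.target q3 (r2.1 h9)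
  refine Or.inr ⟨h9, N, ⟨hN, fun R hR => hmax R hR trivial⟩, hR.isRowOf hN.1.1 ?_⟩
  rw [← hhN]
  exact r3 h9

/-- The proposals start afresh for each man, and their outcome is the best matching by uniqueness;
the rejections begin there. The term 5C covers the initialisation. -/
theorem wp_manCode (hR : Represents D G num) {n : ℕ} (hn : n = D.a + D.b + D.m + 2)
    (hW : n ^ 2 * 32 ≤ W) {k K R C : ℕ} {s : State} (hL : Loaded D s) {x : Fin a} {y : Fin b}
    (hM : IsBest G M) (hxy : (x, y) ∈ M) (hrow : IsRowOf num M (s.arr 13)) (hx : s.reg 11 = x)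
    (h13 : s.reg 13 = R) (hRx : R ≤ D.FI x + 1) (hC : 40 * (D.a + D.b) + 340 ≤ C)
    (hk : K + 5 * C + 450 * D.m + (D.FI (x + 1) - D.FI x) * C ≤ k) :
    wp W manCode (fun k' s' => K ≤ k' ∧ R ≤ s'.reg 13 ∧ s'.reg 13 ≤ D.FI (x + 1) + 1 ∧
      AllRows G num (s'.arr 13) x R (s'.reg 13) (height G M x) ∧
      ∀ i < R * a, s'.arr 13 i = s.arr 13 i) k s := by
  have hD := hR.valid
  have hxa : (x : ℕ) < D.a := by rw [hR.ha]; exact x.2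
  have hn2 : n ≤ n ^ 2 := Nat.le_self_pow (by omega) n
  refine wp_seq_frame (wp_startCode (K := K + (D.FI (x + 1) - D.FI x) * C + 20) hR (by omega) hL
    (by omega)) ?_
  rintro k₁ s₁ hf₁ ⟨q1, q2, q3, q4⟩
  have e11 : s₁.reg 11 = x := (hf₁.reg 11 rfl).trans hx
  have e13 : s₁.reg 13 = R := (hf₁.reg 13 rfl).trans h13
  have f13 : s₁.arr 13 = s.arr 13 := hf₁.arr 13 rfl
  have hL₁ := hL.of_frame hf₁ (by decide) (by decide)
  have hok := succeeds_of_target hD q2.shape q2.bound q2.target q3 ⟨M, hM.1, trivial, rfl⟩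
  obtain ⟨N, hN, hhN, hmax⟩ := hR.of_succeeds q2.shape q2.bound q2.target q3 hok
  obtain rfl : N = M := IsBest.unique ⟨hN, fun R hR => hmax R hR trivial⟩ hM
  have hval : s.arr 13 x = num x y + 1 := by
    rcases hrow x with ⟨-, h'⟩ | ⟨y', hy', h'⟩
    · exact absurd hxy (h' y)
    · rwa [hN.1.right_unique hxy hy']
  have hblock := (hD.block x hxa _ (hR.lt (hN.1.1 hxy))).1 (hR.ex (hN.1.1 hxy))
  refine ⟨trivial, by simp; omega, by simp; omega, by simp; omega, ?_⟩
  refine wp_mono (wp_rowLoop (K := K) (C := C) (R := R) (M₀ := N) (M := N) (y := y)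
    (t₀ := s.arr 13) (x := x) hR hn hW
    ⟨by simp [hL₁.a], by simp [hL₁.b], by simp [hL₁.m], by simp [hL₁.ex], by simp [hL₁.ey],
      by simp [hL₁.er], by simp [hL₁.eb], by simp [hL₁.fi]⟩ hC (by simp [e11]) ?_) ?_
  · have hpow : (D.FI (x + 1) - num x y) * C ≤ (D.FI (x + 1) - D.FI x) * C :=
      Nat.mul_le_mul_right _ (by omega)
    refine ⟨hN, hxy, by simp [e11, f13, hval], by simp [e13]; omega, ?_, by simp [f13],
      fun _ => ⟨_, _, ⟨q2.shape, q2.bound, q2.target, q2.floor⟩, q3, hok, hhN, fun _ _ _ => trivial,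
        q4, ?_⟩, fun h => absurd h (by simp)⟩
    · simp only [State.setReg_reg]
      simp only [e13]
      exact Rows.refl _ _ _ _
    · simp; omega
  · exact fun k' s' h => h

theorem sub_mul_succ {n j : ℕ} (u : ℕ) (h : j < n) : (n - j) * u = (n - (j + 1)) * u + u := by
  rw [show n - j = n - (j + 1) + 1 by omega, Nat.add_mul, Nat.one_mul]

/-- The row counter stays at most one plus the number of edges of the men treated so far. So the
table has at most m + 1 rows and all its addresses are words. -/
theorem wp_rowsCode (hR : Represents D G num) {n : ℕ} (hn : n = D.a + D.b + D.m + 2)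
    (hW : n ^ 2 * 32 ≤ W) {k K C : ℕ} {s : State} (hL : Loaded D s) (hM : IsBest G M)
    (hrow : IsRowOf num M (s.arr 13)) (hC : 40 * (D.a + D.b) + 340 ≤ C)
    (hk : K + D.a * (450 * D.m + 40) + D.m * (6 * C) + 30 ≤ k) :
    wp W rowsCode (fun k' s' => K ≤ k' ∧ IsRowOf num M (s'.arr 13) ∧
      ∀ x : Fin a, s'.arr 15 x ≤ D.m + 1 ∧
        AllRows G num (s'.arr 13) x (s'.arr 14 x) (s'.arr 15 x) (height G M x)) k s := by
  have hD := hR.valid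
  have hn2 : n ≤ n ^ 2 := Nat.le_self_pow (by omega) n
  refine ⟨by simp; omega, by simp; omega, by simp; omega, by simp; omega, ?_⟩
  refine wp_forLoop (N := D.a) (j₀ := 0)
    (fun j k' s' => K + (D.a - j) * (450 * D.m + 40) + (D.m - D.FI j) * (6 * C) + 20 ≤ k' ∧
      IsRowOf num M (s'.arr 13) ∧ 1 ≤ s'.reg 13 ∧ s'.reg 13 ≤ D.FI j + 1 ∧
      ∀ x : Fin a, (x : ℕ) < j → s'.arr 15 x ≤ s'.reg 13 ∧
        AllRows G num (s'.arr 13) x (s'.arr 14 x) (s'.arr 15 x) (height G M x))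
    (by simp [hL.a]) (by omega) (by simp) (by omega) (by decide) rfl rfl ?_ ?_ ?_
  · have : (D.m - D.FI 0) * (6 * C) ≤ D.m * (6 * C) := Nat.mul_le_mul_right _ (by omega)
    simp
    exact ⟨by omega, hrow⟩
  · intro j k' s' hj hr hf ⟨i1, i2, i3, i4, i5⟩
    have hja : j < a := by rwa [hR.ha] at hj
    let x : Fin a := ⟨j, hja⟩
    have hL' := (Loaded.mk (D := D) (by simp [hL.a]) (by simp [hL.b]) (by simp [hL.m])
      (by simp [hL.ex]) (by simp [hL.ey]) (by simp [hL.er]) (by simp [hL.eb])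
      (by simp [hL.fi])).of_frame hf (by decide) (by decide)
    have e1 := sub_mul_succ (450 * D.m + 40) hj
    have hfi := hD.fi_mono j hj
    have hfm := hD.fi_le (j + 1) hj
    have e2 : (D.m - D.FI j) * (6 * C) =
        (D.m - D.FI (j + 1)) * (6 * C) + (D.FI (j + 1) - D.FI j) * (6 * C) := by
      rw [← Nat.add_mul]
      congr 1
      omega
    have key : ∀ k₁ s₁, K + (D.a - (j + 1)) * (450 * D.m + 40) +
        (D.m - D.FI (j + 1)) * (6 * C) + 30 ≤ k₁ → s₁.reg 11 = j → s'.reg 13 ≤ s₁.reg 13 →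
        s₁.reg 13 ≤ D.FI (j + 1) + 1 →
        AllRows G num (s₁.arr 13) x (s'.reg 13) (s₁.reg 13) (height G M x) →
        (∀ i < s'.reg 13 * a, s₁.arr 13 i = s'.arr 13 i) →
        s₁.arr 14 = Function.update (s'.arr 14) j (s'.reg 13) → s₁.arr 15 = s'.arr 15 →
        wp W (.store 15 (vr 11) (vr 13)) (fun k' s' => 4 ≤ k' ∧
          K + (D.a - (j + 1)) * (450 * D.m + 40) + (D.m - D.FI (j + 1)) * (6 * C) + 20 ≤ k' - 4 ∧
          IsRowOf num M ((s'.setReg 11 (j + 1)).arr 13) ∧ 1 ≤ (s'.setReg 11 (j + 1)).reg 13 ∧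
          (s'.setReg 11 (j + 1)).reg 13 ≤ D.FI (j + 1) + 1 ∧
          ∀ x : Fin a, (x : ℕ) < j + 1 →
            (s'.setReg 11 (j + 1)).arr 15 x ≤ (s'.setReg 11 (j + 1)).reg 13 ∧
            AllRows G num ((s'.setReg 11 (j + 1)).arr 13) x ((s'.setReg 11 (j + 1)).arr 14 x)
              ((s'.setReg 11 (j + 1)).arr 15 x) (height G M x)) k₁ s₁ := by
      intro k₁ s₁ g1 g2 g3 g4 g5 g6 g7 g8
      simp [g2, g7, g8]
      refine ⟨by omega, by omega, by omega, i2.congr fun z hz => g6 z ?_, by omega, g4,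
        fun z hz => ?_⟩
      · exact hz.trans_le (Nat.le_mul_of_pos_left _ i3)
      · by_cases hzj : (z : ℕ) = j
        · obtain rfl : z = x := Fin.ext hzj
          simp only [x, Function.update_self]
          exact ⟨le_rfl, g5⟩
        · rw [Function.update_of_ne hzj, Function.update_of_ne hzj]
          obtain ⟨h1, h2, h3, h4⟩ := i5 z (by omega)
          refine ⟨h1.trans g3, h2, h3.congr fun i hi => g6 i (hi.trans_le ?_), h4⟩
          exact Nat.mul_le_mul_right _ h1
    refine ⟨by omega, trivial, trivial, by simp; omega, ?_⟩
    refine wp_seq_frame (Q' := fun k₁ s₁ =>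
      K + (D.a - (j + 1)) * (450 * D.m + 40) +
        (D.m - D.FI (j + 1)) * (6 * C) + 30 ≤ k₁ ∧ s'.reg 13 ≤ s₁.reg 13 ∧
        s₁.reg 13 ≤ D.FI (j + 1) + 1 ∧
        AllRows G num (s₁.arr 13) x (s'.reg 13) (s₁.reg 13) (height G M x) ∧
        (∀ i < s'.reg 13 * a, s₁.arr 13 i = s'.arr 13 i)) ?_
      fun k₁ s₁ hf₁ ⟨g1, g2, g3, g4, g5⟩ => key k₁ s₁ g1 ((hf₁.reg 11 rfl).trans (by simp [hr])) g2 g3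
        g4 g5 ((hf₁.arr 14 rfl).trans (by simp [hr])) ((hf₁.arr 15 rfl).trans (by simp))
    refine ⟨trivial, by simp; omega, fun hv => ?_, fun hv => ?_⟩
    · have hv' : s'.arr 13 j ≠ 0 := by simpa [hr] using hv
      rcases i2 x with ⟨h1, -⟩ | ⟨y, hxy, -⟩
      · exact absurd h1 hv'
      have hb := (hD.block j hj _ (hR.lt (hM.1.1.1 hxy))).1 (hR.ex (hM.1.1.1 hxy))
      -- A matched man has at least one edge, to which his initialisation cost of order n is
      -- charged. Charging it to the man would cost order n for every isolated vertex.
      have hdeg : 1 * (5 * C) ≤ (D.FI (j + 1) - D.FI j) * (5 * C) :=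
        Nat.mul_le_mul_right _ (by omega)
      have hsplit : (D.FI (j + 1) - D.FI j) * (6 * C) =
        (D.FI (j + 1) - D.FI j) * (5 * C) + (D.FI (j + 1) - D.FI j) * C := by ring
      refine wp_mono (wp_manCode (C := C) (x := x) (y := y) (M := M) (R := s'.reg 13) (K :=
        K + (D.a - (j + 1)) * (450 * D.m + 40) + (D.m - D.FI (j + 1)) * (6 * C) + 30) hR hn hW
        ⟨by simp [hL'.a], by simp [hL'.b], by simp [hL'.m], by simp [hL'.ex], by simp [hL'.ey],
        by simp [hL'.er], by simp [hL'.eb], by simp [hL'.fi]⟩ hM hxy (by simpa using i2)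
        (by simp [hr, x]) (by simp) i4 hC ?_) ?_
      · simp [x]; omega
      · intro k₁ s₁ h
        simpa using h
    · have hv' : s'.arr 13 j = 0 := by simpa [hr] using hv
      rcases i2 x with ⟨-, h1⟩ | ⟨y, hxy, h1⟩
      · refine ⟨by simp; omega, by simp; omega, by simp, by simp; omega, ?_, by simp⟩
        simp only [State.setArr_arr, State.setArr_reg]
        refine ⟨height G M x, by simpa using Rows.refl _ _ _ _, fun N hN => ?_⟩
        rw [height_eq_zero (M := N)]
        · exact Nat.zero_le _
        · intro y hy
          obtain ⟨y', hy'⟩ := exists_partnerA hN hM.1 hy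
          exact h1 y' hy'
      · rw [show s'.arr 13 x = 0 from hv'] at h1
        omega
  · intro k' s' hr hf ⟨i1, i2, i3, i4, i5⟩
    have hfm := hD.fi_le D.a le_rfl
    refine ⟨by omega, by omega, i2, fun x => ?_⟩
    obtain ⟨h1, h2⟩ := i5 x (by rw [hR.ha]; exact x.2)
    exact ⟨by omega, h2⟩

end SuperStable

namespace SuperStable

open FlatInstance

/-! ## Maximal sequences from the rows -/

variable {D : FlatInstance} {a b : ℕ} {G : Instance (Fin a) (Fin b)} {num : Fin a → Fin b → ℕ}
  {M N M₀ : Finset (Fin a × Fin b)}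

/-- The edges that are worse for their men than the situation in `M`. -/
def worse (G : Instance (Fin a) (Fin b)) (M : Finset (Fin a × Fin b)) : Finset (Fin a × Fin b) :=
  G.edges.filter fun e => height G M e.1 < G.rankA e.1 e.2

/-- The new edge of a moved man was worse than his situation and no longer is. This bounds the
number of rotations by m and pays for time and output length. -/
theorem card_worse_lt (hM : IsSuperStable G M) (hN : IsSuperStable G N)
    (hlt : height G M < height G N) : (worse G N).card < (worse G M).card := by
  obtain ⟨hle, x, hx⟩ := Pi.lt_def.1 hlt
  refine Finset.card_lt_card (Finset.ssubset_iff_of_subset ?_ |>.2 ?_)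
  · intro e he
    simp only [worse, Finset.mem_filter] at he ⊢
    exact ⟨he.1, (hle e.1).trans_lt he.2⟩
  · obtain ⟨y, y', h1, h2⟩ := exists_mem_of_height_lt hM hN hx.ne
    refine ⟨(x, y'), ?_, ?_⟩
    · simp only [worse, Finset.mem_filter]
      exact ⟨hN.1.1 h2, by rwa [← height_eq hN.1 h2]⟩
    · simp only [worse, Finset.mem_filter, not_and, not_lt]
      intro _
      rw [height_eq hN.1 h2]

/-- The value `v` is one plus the number of the edge of `x` in `M`, or `0` if `x` is free. -/
def IsEntry (num : Fin a → Fin b → ℕ) (M : Finset (Fin a × Fin b)) (x : Fin a) (v : ℕ) : Prop :=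
  (v = 0 ∧ ∀ y, (x, y) ∉ M) ∨ ∃ y, (x, y) ∈ M ∧ v = num x y + 1

/-- Entries of stored matchings can be compared directly; free men cause no trouble, since they have
the entry 0 in all of them. -/
theorem Represents.entry_lt_iff (hR : Represents D G num) (hM : IsSuperStable G M)
    (hN : IsSuperStable G N) {x : Fin a} {u v : ℕ} (hu : IsEntry num M x u)
    (hv : IsEntry num N x v) : u < v ↔ height G M x < height G N x := by
  rcases hu with ⟨rfl, hu⟩ | ⟨y, hy, rfl⟩
  · rcases hv with ⟨rfl, hv⟩ | ⟨y', hy', rfl⟩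
    · rw [height_eq_zero hu, height_eq_zero hv]
    · obtain ⟨y'', h⟩ := exists_partnerA hN hM hy'
      exact absurd h (hu y'')
  · rcases hv with ⟨rfl, hv⟩ | ⟨y', hy', rfl⟩
    · obtain ⟨y'', h⟩ := exists_partnerA hM hN hy
      exact absurd h (hv y'')
    · rw [← hR.num_lt_iff hM hN hy hy']
      omega

theorem IsEntry.eq (hM : IsMatching G M) {x : Fin a} {y : Fin b} {v : ℕ} (h : IsEntry num M x v)
    (hxy : (x, y) ∈ M) : v = num x y + 1 := by
  rcases h with ⟨-, h⟩ | ⟨y', h, rfl⟩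
  · exact absurd hxy (h y)
  · rw [hM.right_unique hxy h]

theorem IsEntry.congr {x : Fin a} {v : ℕ} (h : IsEntry num M x v)
    (hiff : ∀ y, (x, y) ∈ M ↔ (x, y) ∈ N) : IsEntry num N x v := by
  rcases h with ⟨h1, h2⟩ | ⟨y, h1, h2⟩
  · exact Or.inl ⟨h1, fun y hy => h2 y ((hiff y).2 hy)⟩
  · exact Or.inr ⟨y, (hiff y).1 h1, h2⟩

/-- A matching R between M and the meet that differs from M moves some man x. Then N moves x as
well, and N is the best matching that does so, whence N dominates R and R is the meet. -/
theorem isStrictSuccessor_meet (hM : IsSuperStable G M) (hN : IsSuperStable G N)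
    (hlt : ∃ x, height G M x < height G N x)
    (hmin : ∀ x R, IsSuperStable G R → height G M x < height G N x →
      height G M x < height G R x → ∀ z, height G N z ≤ height G R z) :
    IsStrictSuccessor G M (meet G M N) := by
  have hS := isSuperStable_meet hM hN
  refine isStrictSuccessor_of hM hS ?_ fun R hR h1 h2 => ?_
  · obtain ⟨x, hx⟩ := hlt
    refine Pi.lt_def.2 ⟨fun z => ?_, x, ?_⟩
    · rw [height_meet hM hN]
      exact le_max_left _ _
    · rw [height_meet hM hN]
      exact lt_max_of_lt_right hx
  · by_cases he : height G R = height G M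
    · exact Or.inl (eq_of_height_eq hR hM he)
    · right
      obtain ⟨x, hx⟩ : ∃ x, height G M x < height G R x := by
        by_contra! hc
        exact he (le_antisymm hc h1)
      have h3 := h2 x
      rw [height_meet hM hN] at h3
      have h4 : height G M x < height G N x := by
        exact (lt_max_iff.1 (hx.trans_le h3)).resolve_left (lt_irrefl _)
      refine eq_of_height_eq hR hS (le_antisymm h2 fun z => ?_)
      rw [height_meet hM hN]
      exact max_le (h1 z) (hmin x R hR h4 hx z)

theorem AllRows.lt {t : ℕ → ℕ} {x : Fin a} {lo hi h : ℕ} (hr : AllRows G num t x lo hi h)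
    (hN : IsSuperStable G N) (hlt : h < height G N x) : lo < hi := by
  obtain ⟨h', ⟨h1, g, g1, g2, -⟩, h3⟩ := hr
  rcases h1.lt_or_eq with h4 | rfl
  · exact h4
  · have := h3 N hN
    omega

theorem AllRows.uncons {t : ℕ → ℕ} {x : Fin a} {lo hi h : ℕ} (hr : AllRows G num t x lo hi h)
    (hlt : lo < hi) : ∃ N, IsNext G x h N ∧ IsRowOf num N (fun z => t (lo * a + z)) ∧
      AllRows G num t x (lo + 1) hi (height G N x) := by
  obtain ⟨h', h1, h2⟩ := hr
  obtain ⟨N, n1, n2, n3⟩ := h1.uncons hlt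
  exact ⟨N, n1, n2, h', n3, h2⟩

/-- A strict successor takes a moved man exactly to his next row: this row is the best matching that
makes him worse off, and the successor is at least as good for him as any such matching. -/
theorem AllRows.step {t : ℕ → ℕ} {x : Fin a} {lo hi h : ℕ} (hr : AllRows G num t x lo hi h)
    (hN : IsSuperStable G N) (hlt : h < height G N x)
    (hmin : ∀ R, IsSuperStable G R → h < height G R x → height G N x ≤ height G R x) :
    AllRows G num t x (lo + 1) hi (height G N x) := by
  obtain ⟨N', n1, -, n3⟩ := hr.uncons (hr.lt hN hlt)
  rwa [le_antisymm (hmin N' n1.1 n1.2.1) (n1.2.2 N hN hlt x)]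

/-- The matchings `Ms 0`, …, `Ms z` are a sequence of strict successors. -/
structure SuccChain (G : Instance (Fin a) (Fin b)) (z : ℕ) (Ms : ℕ → Finset (Fin a × Fin b)) :
    Prop where
  zero : IsBest G (Ms 0)
  succ : ∀ i < z, IsStrictSuccessor G (Ms i) (Ms (i + 1))

variable {z : ℕ} {Ms : ℕ → Finset (Fin a × Fin b)}

theorem SuccChain.stable (h : SuccChain G z Ms) {i : ℕ} (hi : i ≤ z) : IsSuperStable G (Ms i) := by
  cases i with
  | zero => exact h.zero.1
  | succ i => exact (h.succ i hi).2.1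

theorem SuccChain.mono (h : SuccChain G z Ms) {i j : ℕ} (hij : i ≤ j) (hj : j ≤ z) (x : Fin a) :
    height G (Ms i) x ≤ height G (Ms j) x := by
  induction j, hij using Nat.le_induction with
  | base => exact le_rfl
  | succ j hij ih => exact (ih (by omega)).trans ((h.succ j hj).le x)

theorem SuccChain.snoc (h : SuccChain G z Ms) (hN : IsStrictSuccessor G (Ms z) N) :
    SuccChain G (z + 1) (Function.update Ms (z + 1) N) := by
  refine ⟨?_, fun i hi => ?_⟩
  · rw [Function.update_of_ne (by omega)]
    exact h.zero
  · rw [Function.update_of_ne (by omega : i ≠ z + 1)]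
    rcases Nat.lt_succ_iff_lt_or_eq.1 hi with hi | rfl
    · rw [Function.update_of_ne (by omega)]
      exact h.succ i hi
    · rwa [Function.update_self]

/-- For the moves of a sequence of matchings for which `p` holds, the arrays hold the numbers of the
rotation that adds and of the one that removes an edge, and the former edges of both its ends. -/
structure Recorded (G : Instance (Fin a) (Fin b)) (num : Fin a → Fin b → ℕ)
    (Ms : ℕ → Finset (Fin a × Fin b)) (p : ℕ → Fin a → Prop) (i o pe pw : ℕ → ℕ) : Prop where
  ins : ∀ {x y}, (x, y) ∈ G.edges → ∀ r, i (num x y) = r + 1 ↔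
    p r x ∧ (x, y) ∈ Ms (r + 1) ∧ (x, y) ∉ Ms r
  outs : ∀ {x y}, (x, y) ∈ G.edges → ∀ r, o (num x y) = r + 1 ↔
    p r x ∧ (x, y) ∈ Ms r ∧ (x, y) ∉ Ms (r + 1)
  prevA : ∀ {x y y' r}, p r x → (x, y) ∈ Ms (r + 1) → (x, y) ∉ Ms r → (x, y') ∈ Ms r →
    pe (num x y) = num x y' + 1
  prevB : ∀ {x x' y r}, p r x → (x, y) ∈ Ms (r + 1) → (x, y) ∉ Ms r → (x', y) ∈ Ms r →
    pw (num x y) = num x' y + 1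

variable {p q : ℕ → Fin a → Prop} {i o pe pw : ℕ → ℕ}

theorem Recorded.congr {Ms' : ℕ → Finset (Fin a × Fin b)} (h : Recorded G num Ms p i o pe pw)
    (hpq : ∀ r x, p r x ↔ q r x) (hMs : ∀ r x, p r x → Ms' r = Ms r ∧ Ms' (r + 1) = Ms (r + 1)) :
    Recorded G num Ms' q i o pe pw := by
  obtain rfl : p = q := by
    funext r x
    exact propext (hpq r x)
  refine ⟨fun hxy r => ?_, fun hxy r => ?_, fun hp => ?_, fun hp => ?_⟩
  · rw [h.ins hxy]
    refine and_congr_right fun hp => ?_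
    rw [(hMs _ _ hp).1, (hMs _ _ hp).2]
  · rw [h.outs hxy]
    refine and_congr_right fun hp => ?_
    rw [(hMs _ _ hp).1, (hMs _ _ hp).2]
  · rw [(hMs _ _ hp).1, (hMs _ _ hp).2]
    exact h.prevA hp
  · rw [(hMs _ _ hp).1, (hMs _ _ hp).2]
    exact h.prevB hp

theorem Recorded.skip (h : Recorded G num Ms p i o pe pw) {x₀ : Fin a} {z : ℕ}
    (hq : ∀ r x, q r x ↔ p r x ∨ r = z ∧ x = x₀)
    (hx : ∀ y, (x₀, y) ∈ Ms z ↔ (x₀, y) ∈ Ms (z + 1)) : Recorded G num Ms q i o pe pw := by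
  refine ⟨fun {x y} hxy r => ?_, fun {x y} hxy r => ?_, fun {x y y' r} hp h1 h2 => ?_,
    fun {x x' y r} hp h1 h2 => ?_⟩
  · rw [h.ins hxy, hq]
    refine ⟨fun hh => ⟨Or.inl hh.1, hh.2⟩, ?_⟩
    rintro ⟨h1 | ⟨rfl, rfl⟩, h2⟩
    · exact ⟨h1, h2⟩
    · exact absurd ((hx y).2 h2.1) h2.2
  · rw [h.outs hxy, hq]
    refine ⟨fun hh => ⟨Or.inl hh.1, hh.2⟩, ?_⟩
    rintro ⟨h1 | ⟨rfl, rfl⟩, h2⟩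
    · exact ⟨h1, h2⟩
    · exact absurd ((hx y).1 h2.1) h2.2
  · rcases (hq r x).1 hp with hp | ⟨rfl, rfl⟩
    · exact h.prevA hp h1 h2
    · exact absurd ((hx y).2 h1) h2
  · rcases (hq r x).1 hp with hp | ⟨rfl, rfl⟩
    · exact h.prevB hp h1 h2
    · exact absurd ((hx y).2 h1) h2

/-- Along the sequence the heights of a man only grow, so an edge is added at most once and removed
at most once. The updates therefore overwrite no earlier record. -/
theorem Recorded.move (h : Recorded G num Ms p i o pe pw) (hR : Represents D G num) {z : ℕ}
    (hc : SuccChain G (z + 1) Ms) {x₀ x₁ : Fin a} {y₀ y₁ : Fin b} (h₀ : (x₀, y₀) ∈ Ms z)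
    (h₁ : (x₀, y₁) ∈ Ms (z + 1)) (h₂ : (x₁, y₁) ∈ Ms z)
    (hlt : height G (Ms z) x₀ < height G (Ms (z + 1)) x₀)
    (hp : ∀ r x, p r x → r < z ∨ r = z ∧ x ≠ x₀) (hq : ∀ r x, q r x ↔ p r x ∨ r = z ∧ x = x₀) :
    Recorded G num Ms q (Function.update i (num x₀ y₁) (z + 1))
      (Function.update o (num x₀ y₀) (z + 1)) (Function.update pe (num x₀ y₁) (num x₀ y₀ + 1))
      (Function.update pw (num x₀ y₁) (num x₁ y₁ + 1)) := by
  have hS := hc.stable (i := z) (by omega)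
  have hS' := hc.stable (i := z + 1) le_rfl
  have e₀ := hS.1.1 h₀
  have e₁ := hS'.1.1 h₁
  have hno : (x₀, y₁) ∉ Ms z := fun hh => by
    rw [height_eq hS.1 hh, height_eq hS'.1 h₁] at hlt
    omega
  have hno' : (x₀, y₀) ∉ Ms (z + 1) := fun hh => by
    rw [height_eq hS.1 h₀, height_eq hS'.1 hh] at hlt
    omega
  have late : ∀ {r}, q r x₀ → (x₀, y₁) ∈ Ms (r + 1) → r = z := by
    intro r hr hm
    rcases (hq _ _).1 hr with hr | hr
    · rcases hp _ _ hr with hr | hr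
      · have h3 := hc.mono (i := r + 1) (j := z) (by omega) (by omega) x₀
        rw [height_eq hS'.1 h₁, ← height_eq (hc.stable (i := r + 1) (by omega)).1 hm] at hlt
        omega
      · exact absurd rfl hr.2
    · exact hr.1
  have late' : ∀ {r}, q r x₀ → (x₀, y₀) ∈ Ms r → (x₀, y₀) ∉ Ms (r + 1) → r = z := by
    intro r hr hm hm'
    rcases (hq _ _).1 hr with hr | hr
    · rcases hp _ _ hr with hr | hr
      · exfalso
        have h3 := hc.mono (i := r + 1) (j := z) (by omega) (by omega) x₀
        have h4 := hc.mono (i := r) (j := r + 1) (by omega) (by omega) x₀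
        have hSr := hc.stable (i := r) (by omega)
        have hSr' := hc.stable (i := r + 1) (by omega)
        rw [height_eq hS.1 h₀] at h3
        rw [height_eq hSr.1 hm] at h4
        have h5 : height G (Ms (r + 1)) x₀ = height G (Ms z) x₀ := by
          rw [height_eq hS.1 h₀]
          omega
        exact hm' ((mem_iff_of_height_eq hSr' hS h5 y₀).2 h₀)
      · exact absurd rfl hr.2
    · exact hr.1
  refine ⟨fun {x y} hxy r => ?_, fun {x y} hxy r => ?_, fun {x y y' r} hr h3 h4 h5 => ?_,
    fun {x x' y r} hr h3 h4 h5 => ?_⟩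
  · by_cases he : num x y = num x₀ y₁
    · obtain ⟨rfl, rfl⟩ := hR.num_inj hxy e₁ he
      rw [Function.update_self]
      constructor
      · intro hh
        obtain rfl : z = r := by omega
        exact ⟨(hq _ _).2 (Or.inr ⟨rfl, rfl⟩), h₁, hno⟩
      · rintro ⟨h3, h4, -⟩
        rw [late h3 h4]
    · rw [Function.update_of_ne he, h.ins hxy, hq]
      refine ⟨fun hh => ⟨Or.inl hh.1, hh.2⟩, ?_⟩
      rintro ⟨h3 | ⟨rfl, rfl⟩, h4⟩
      · exact ⟨h3, h4⟩
      · rw [hS'.1.right_unique h4.1 h₁] at he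
        exact absurd rfl he
  · by_cases he : num x y = num x₀ y₀
    · obtain ⟨rfl, rfl⟩ := hR.num_inj hxy e₀ he
      rw [Function.update_self]
      constructor
      · intro hh
        obtain rfl : z = r := by omega
        exact ⟨(hq _ _).2 (Or.inr ⟨rfl, rfl⟩), h₀, hno'⟩
      · rintro ⟨h3, h4, h5⟩
        rw [late' h3 h4 h5]
    · rw [Function.update_of_ne he, h.outs hxy, hq]
      refine ⟨fun hh => ⟨Or.inl hh.1, hh.2⟩, ?_⟩
      rintro ⟨h3 | ⟨rfl, rfl⟩, h4⟩
      · exact ⟨h3, h4⟩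
      · rw [hS.1.right_unique h4.1 h₀] at he
        exact absurd rfl he
  · have hrz : r ≤ z := by
      rcases (hq _ _).1 hr with hr | hr
      · rcases hp _ _ hr with hr | hr <;> omega
      · omega
    have hxy := (hc.stable (i := r + 1) (by omega)).1.1 h3
    by_cases he : num x y = num x₀ y₁
    · obtain ⟨rfl, rfl⟩ := hR.num_inj hxy e₁ he
      rw [Function.update_self]
      have hrz' := late hr h3
      subst hrz'
      rw [hS.1.right_unique h5 h₀]
    · rw [Function.update_of_ne he]
      rcases (hq _ _).1 hr with hr | ⟨rfl, rfl⟩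
      · exact h.prevA hr h3 h4 h5
      · rw [hS'.1.right_unique h3 h₁] at he
        exact absurd rfl he
  · have hrz : r ≤ z := by
      rcases (hq _ _).1 hr with hr | hr
      · rcases hp _ _ hr with hr | hr <;> omega
      · omega
    have hxy := (hc.stable (i := r + 1) (by omega)).1.1 h3
    by_cases he : num x y = num x₀ y₁
    · obtain ⟨rfl, rfl⟩ := hR.num_inj hxy e₁ he
      rw [Function.update_self]
      have hrz' := late hr h3
      subst hrz'
      rw [hS.1.left_unique h5 h₂]
    · rw [Function.update_of_ne he]
      rcases (hq _ _).1 hr with hr | ⟨rfl, rfl⟩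
      · exact h.prevB hr h3 h4 h5
      · rw [hS'.1.right_unique h3 h₁] at he
        exact absurd rfl he

/-! ## Output -/

/-- The output `out`, of length `n`, is the list `L`. -/
def OutAt (out : ℕ → ℕ) (n : ℕ) (L : List ℕ) : Prop :=
  n = L.length ∧ ∀ i (hi : i < L.length), out i = L[i]

theorem OutAt.push {out : ℕ → ℕ} {n : ℕ} {L : List ℕ} (h : OutAt out n L) (v : ℕ) :
    OutAt (Function.update out n v) (n + 1) (L ++ [v]) := by
  obtain ⟨rfl, h⟩ := h
  refine ⟨by simp, fun i hi => ?_⟩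
  rw [List.getElem_append]
  split_ifs with hiL
  · rw [Function.update_of_ne (by omega)]
    exact h i hiL
  · simp at hi
    obtain rfl : i = L.length := by omega
    simp

/-- The length of a list precedes it in the output but is known only at the end. A placeholder is
written first and replaced later. -/
theorem OutAt.set {out : ℕ → ℕ} {n : ℕ} {L L' : List ℕ} {v : ℕ}
    (h : OutAt out n (L ++ v :: L')) (w : ℕ) :
    OutAt (Function.update out L.length w) n (L ++ w :: L') := by
  obtain ⟨rfl, h⟩ := h
  refine ⟨by simp, fun i hi => ?_⟩
  by_cases hiL : i = L.length
  · subst hiL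
    simp
  · rw [Function.update_of_ne hiL, h i (by simpa using hi), List.getElem_append,
      List.getElem_append]
    split_ifs with h1
    · rfl
    · rw [List.getElem_cons, List.getElem_cons, dif_neg (by omega), dif_neg (by omega)]

/-- The expression is appended to the output, whose length is in register `18`. -/
def emit (e : Exp) : Cmd := .store 1 (vr 18) e ;; 18 ::= vr 18 +. cst 1

theorem wp_emit {W : ℕ} {e : Exp} {Q : ℕ → State → Prop} {k : ℕ} {s : State} (he : e.Ok W s)
    (hW : s.reg 18 + 1 < W) (hk : e.size + 6 ≤ k)
    (hQ : Q (k - (e.size + 6)) ((s.setArr 1 (s.reg 18) (e.eval s)).setReg 18 (s.reg 18 + 1))) :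
    wp W (emit e) Q k s := by
  refine ⟨trivial, he, by simp; omega, ⟨trivial, show 1 < W by omega, by simpa using hW⟩,
    by simp; omega, ?_⟩
  have : k - ((vr 18).size + e.size + 1) - ((vr 18 +. cst 1).size + 1) = k - (e.size + 6) := by
    simp; omega
  rw [this]
  exact hQ

end SuperStable

namespace SuperStable

open FlatInstance

/-! ## The program for the rotations -/

/-- The edges of the women, from those of the men in array `16`. -/
def womenCode : Cmd :=
  15 ::= cst 0 ;;
  forLoop 15 0
    (.cond (rd 16 (vr 15)) (.store 17 (rd 3 (rd 16 (vr 15) -. cst 1)) (rd 16 (vr 15))) .skip)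

/-- Choice of a row that is minimal among the next rows of the men, starting from the man in
register `11`; register `14` gets a man with this row. -/
def pickCode : Cmd :=
  14 ::= vr 11 ;;
  15 ::= cst 0 ;;
  forLoop 15 0
    (.cond (rd 16 (vr 15) <. rd 13 (rd 14 (vr 14) *. vr 0 +. vr 15)) (14 ::= vr 15) .skip)

/-- The man in register `15` moves to his edge in the row with the base in register `17`. -/
def moveCode : Cmd :=
  4 ::= rd 13 (vr 17 +. vr 15) ;;
  6 ::= rd 16 (vr 15) ;;
  5 ::= rd 3 (vr 4 -. cst 1) ;;
  emit (vr 15) ;;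
  emit (rd 3 (vr 6 -. cst 1)) ;;
  emit (vr 15) ;;
  emit (vr 5) ;;
  22 ::= vr 22 +. cst 2 ;;
  .store 18 (vr 4 -. cst 1) (vr 16 +. cst 1) ;;
  .store 19 (vr 6 -. cst 1) (vr 16 +. cst 1) ;;
  .store 20 (vr 4 -. cst 1) (vr 6) ;;
  .store 21 (vr 4 -. cst 1) (rd 17 (vr 5)) ;;
  .store 16 (vr 15) (vr 4) ;;
  .store 14 (vr 15) (rd 14 (vr 15) +. cst 1)

def movesCode : Cmd :=
  15 ::= cst 0 ;;
  forLoop 15 0 (.cond (rd 16 (vr 15) <. rd 13 (vr 17 +. vr 15)) moveCode .skip)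

/-- One rotation. -/
def rotationCode : Cmd :=
  pickCode ;;
  17 ::= rd 14 (vr 14) *. vr 0 ;;
  21 ::= vr 18 ;;
  22 ::= cst 0 ;;
  emit (cst 0) ;;
  movesCode ;;
  .store 1 (vr 21) (vr 22) ;;
  womenCode ;;
  16 ::= vr 16 +. cst 1

variable {D : FlatInstance} {a b : ℕ} {G : Instance (Fin a) (Fin b)} {num : Fin a → Fin b → ℕ}
  {M N : Finset (Fin a × Fin b)} {W : ℕ}

theorem wp_womenCode (hR : Represents D G num) (hW : D.a + D.m + 2 < W) {k K : ℕ} {s : State}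
    (hL : Loaded D s) (hM : IsMatching G M) (hrow : IsRowOf num M (s.arr 16))
    (hk : K + 40 * D.a + 20 ≤ k) :
    wp W womenCode (fun k' s' => K ≤ k' ∧
      ∀ x y, (x, y) ∈ M → s'.arr 17 y = num x y + 1) k s := by
  refine ⟨by simp; omega, by simp; omega, ?_⟩
  refine wp_forLoop (N := D.a) (j₀ := 0)
    (fun j k' s' => K + 40 * (D.a - j) + 10 ≤ k' ∧
      ∀ x y, x.val < j → (x, y) ∈ M → s'.arr 17 y = num x y + 1)
    (by simp [hL.a]) (by omega) (by simp) (by omega) (by decide) rfl rfl (by simp; omega) ?_ ?_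
  · intro j k' s' hj hr hf ⟨i1, i3⟩
    have hja : j < a := by rwa [hR.ha] at hj
    have e3 : s'.arr 3 = D.EY := (hf.arr 3 rfl).trans (by simp [hL.ey])
    have e16 : s'.arr 16 = s.arr 16 := (hf.arr 16 rfl).trans (by simp)
    simp [hr, e3, e16]
    refine ⟨by omega, by omega, fun h0 => ⟨by omega, by omega, by omega, by omega, ?_⟩,
      fun h0 => ⟨by omega, by omega, by omega, ?_⟩⟩
    · intro x y hx hxy
      rcases hrow ⟨j, hja⟩ with ⟨h1, -⟩ | ⟨y', h1, h2⟩
      · exact absurd h1 h0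
      · simp only at h2
        rw [h2, Nat.add_sub_cancel, hR.ey (hM.1 h1), Function.update_apply]
        split_ifs with hyy
        · obtain rfl := Fin.ext hyy
          rw [hM.left_unique hxy h1]
        · refine i3 x y ?_ hxy
          refine lt_of_le_of_ne (by omega) fun hxj => hyy ?_
          obtain rfl : x = ⟨j, hja⟩ := Fin.ext hxj
          rw [hM.right_unique hxy h1]
    · intro x y hx hxy
      by_cases hxj : (x : ℕ) = j
      · have := IsEntry.eq hM (hrow x) hxy
        rw [hxj, h0] at this
        omega
      · exact i3 x y (by omega) hxy
  · intro k' s' hr hf ⟨i1, i3⟩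
    exact ⟨by omega, by omega, fun x y hxy => i3 x y (by rw [hR.ha]; exact x.2) hxy⟩

/-- The candidate is replaced by the next row of each man whom it moves. The new candidate dominates
the old one, so what was established for earlier men persists, and one pass suffices. -/
theorem wp_pickCode (hR : Represents D G num) {n : ℕ} (hn : n = D.a + D.b + D.m + 2)
    (hW : n ^ 2 * 32 ≤ W) {k K : ℕ} {s : State} (hL : Loaded D s) (hM : IsSuperStable G M)
    (hrow : IsRowOf num M (s.arr 16)) (hrows : ∀ x : Fin a, s.arr 15 x ≤ D.m + 1 ∧
      AllRows G num (s.arr 13) x (s.arr 14 x) (s.arr 15 x) (height G M x)) {x₀ : Fin a}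
    (hx₀ : s.reg 11 = x₀) (hlt : s.arr 14 x₀ < s.arr 15 x₀) (hk : K + 40 * D.a + 20 ≤ k) :
    wp W pickCode (fun k' s' => K ≤ k' ∧ ∃ (x₁ : Fin a) (N : _),
      s'.reg 14 = x₁ ∧ s.arr 14 x₁ < s.arr 15 x₁ ∧ IsSuperStable G N ∧
      IsRowOf num N (fun z => s.arr 13 (s.arr 14 x₁ * a + z)) ∧
      (∃ x, height G M x < height G N x) ∧ ∀ x R, IsSuperStable G R →
        height G M x < height G N x → height G M x < height G R x →
        ∀ z, height G N z ≤ height G R z) k s := by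
  have hn2 : n ≤ n ^ 2 := Nat.le_self_pow (by omega) n
  refine ⟨by simp, by simp; omega, by simp; omega, by simp; omega, ?_⟩
  refine wp_forLoop (N := D.a) (j₀ := 0)
    (fun j k' s' => K + 40 * (D.a - j) + 10 ≤ k' ∧ ∃ (x₁ : Fin a) (N : _),
      s'.reg 14 = x₁ ∧ s.arr 14 x₁ < s.arr 15 x₁ ∧ IsNext G x₁ (height G M x₁) N ∧
      IsRowOf num N (fun z => s.arr 13 (s.arr 14 x₁ * a + z)) ∧
      ∀ x : Fin a, x.val < j → ∀ R, IsSuperStable G R →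
        height G M x < height G N x → height G M x < height G R x →
        ∀ z, height G N z ≤ height G R z)
    (by simp [hL.a]) (by omega) (by simp) (by omega) (by decide) rfl rfl ?_ ?_ ?_
  · obtain ⟨N, n1, n2, n3⟩ := (hrows x₀).2.uncons hlt
    simp
    exact ⟨by omega, x₀, by simp [hx₀], hlt, N, n1, n2⟩
  · intro j k' s' hj hr hf ⟨i1, x₁, N, n1, n2, n3, n4, n5⟩
    have hja : j < a := by rwa [hR.ha] at hj
    have e0 : s'.reg 0 = a := (hf.reg 0 rfl).trans (by simp [hL.a, hR.ha])
    have e13 : s'.arr 13 = s.arr 13 := (hf.arr 13 rfl).trans (by simp)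
    have e14 : s'.arr 14 = s.arr 14 := (hf.arr 14 rfl).trans (by simp)
    have e16 : s'.arr 16 = s.arr 16 := (hf.arr 16 rfl).trans (by simp)
    have h15 := (hrows x₁).1
    have hRW := mul_add_lt (n := n) (u := s.arr 14 x₁) (v := a) (w := a) (W := W) (by omega)
      (by omega) (by rw [← hR.ha]; omega) (by rw [← hR.ha]; omega) (by omega)
    have hent := hR.entry_lt_iff hM n3.1 (hrow ⟨j, hja⟩) (n4 ⟨j, hja⟩)
    simp only at hent
    simp [hr, e0, e13, e14, e16, n1]
    rw [hent]
    refine ⟨by omega, by omega, by omega, fun hh => ⟨by omega, by omega, by omega, ⟨j, hja⟩, rfl, ?_⟩,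
      fun hh => ⟨by omega, by omega, by omega, x₁, rfl, n2, N, n3, n4, ?_⟩⟩
    · have hlt := (hrows ⟨j, hja⟩).2.lt n3.1 hh
      obtain ⟨N', m1, m2, m3⟩ := (hrows ⟨j, hja⟩).2.uncons hlt
      refine ⟨hlt, N', m1, m2, fun x hx R hR' h1 h2 z => ?_⟩
      -- The old candidate N makes man j worse off, so his next row, being the best such matching,
      -- dominates N.
      have hle := m1.2.2 N n3.1 hh
      by_cases hxj : (x : ℕ) = j
      · obtain rfl : x = ⟨j, hja⟩ := Fin.ext hxj
        exact m1.2.2 R hR' h2 z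
      · exact (hle z).trans (n5 x (by omega) R hR' (h1.trans_le (hle x)) h2 z)
    · intro x hx R hR' h1 h2 z
      by_cases hxj : (x : ℕ) = j
      · obtain rfl : x = ⟨j, hja⟩ := Fin.ext hxj
        omega
      · exact n5 x (by omega) R hR' h1 h2 z
  · intro k' s' hr hf ⟨i1, x₁, N, n1, n2, n3, n4, n5⟩
    refine ⟨by omega, by omega, x₁, N, n1, n2, n3.1, n4, ⟨x₁, n3.2.1⟩, fun x R => ?_⟩
    exact n5 x (by rw [hR.ha]; exact x.2) R

/-- The encoding of a list of edges. -/
def encodeEdges (ρ : List (Fin a × Fin b)) : List ℕ :=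
  encodePairs (ρ.map fun p => (p.1.val, p.2.val))

/-- The members of the encoding of a list of edges. -/
def flatEdges (ρ : List (Fin a × Fin b)) : List ℕ := ρ.flatMap fun p => [p.1.val, p.2.val]

theorem encodeEdges_eq (ρ : List (Fin a × Fin b)) : encodeEdges ρ = ρ.length :: flatEdges ρ := by
  simp [encodeEdges, encodePairs, flatEdges, List.flatMap_map]

/-- The state while the men before `j` have moved from `M` to `N`. -/
structure MoveState (D : FlatInstance) (G : Instance (Fin a) (Fin b)) (num : Fin a → Fin b → ℕ)
    (Ms : ℕ → Finset (Fin a × Fin b)) (z j : ℕ) (L : List ℕ) (ρ : List (Fin a × Fin b))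
    (s : State) : Prop where
  row : ∀ x : Fin a, (x.val < j → IsEntry num (Ms (z + 1)) x (s.arr 16 x)) ∧
    (j ≤ x.val → IsEntry num (Ms z) x (s.arr 16 x))
  rows : ∀ x : Fin a, s.arr 15 x ≤ D.m + 1 ∧
    (x.val < j → AllRows G num (s.arr 13) x (s.arr 14 x) (s.arr 15 x) (height G (Ms (z + 1)) x)) ∧
    (j ≤ x.val → AllRows G num (s.arr 13) x (s.arr 14 x) (s.arr 15 x) (height G (Ms z) x))
  recd : Recorded G num Ms (fun r x => r < z ∨ r = z ∧ x.val < j) (s.arr 18) (s.arr 19) (s.arr 20)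
    (s.arr 21)
  nodup : ρ.Nodup
  mem : ∀ x y, (x, y) ∈ ρ ↔ x.val < j ∧ (x, y) ∈ Ms z ∆ Ms (z + 1)
  count : s.reg 22 = ρ.length
  out : OutAt (s.arr 1) (s.reg 18) (L ++ flatEdges ρ)

theorem MoveState.skip {Ms : ℕ → Finset (Fin a × Fin b)} {z j : ℕ} {L : List ℕ}
    {ρ : List (Fin a × Fin b)} {s : State} (h : MoveState D G num Ms z j L ρ s)
    (hM : IsSuperStable G (Ms z)) (hN : IsSuperStable G (Ms (z + 1))) (hj : j < a)
    (heq : height G (Ms z) ⟨j, hj⟩ = height G (Ms (z + 1)) ⟨j, hj⟩) :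
    MoveState D G num Ms z (j + 1) L ρ s := by
  have hiff := mem_iff_of_height_eq hM hN heq
  have hfin : ∀ {x : Fin a}, x.val < j + 1 → x.val < j ∨ x = ⟨j, hj⟩ := fun {x} hx => by
    rcases Nat.lt_succ_iff_lt_or_eq.1 hx with h | h
    exacts [Or.inl h, Or.inr (Fin.ext h)]
  refine ⟨fun x => ⟨fun hx => ?_, fun hx => (h.row x).2 (by omega)⟩, fun x => ⟨(h.rows x).1,
    fun hx => ?_, fun hx => (h.rows x).2.2 (by omega)⟩, ?_, h.nodup, fun x y => ?_, h.count, h.out⟩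
  · rcases hfin hx with hx | rfl
    · exact (h.row x).1 hx
    · exact ((h.row ⟨j, hj⟩).2 le_rfl).congr hiff
  · rcases hfin hx with hx | rfl
    · exact (h.rows x).2.1 hx
    · rw [← heq]
      exact (h.rows ⟨j, hj⟩).2.2 le_rfl
  · refine h.recd.skip (x₀ := ⟨j, hj⟩) (z := z) (fun r x => ?_) hiff
    rw [Fin.ext_iff]
    simp only
    omega
  · rw [h.mem]
    refine and_congr_left fun hm => ⟨fun h => by omega, fun hx => ?_⟩
    rcases hfin hx with hx | rfl
    · exact hx
    · rw [mem_symmDiff', hiff y] at hm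
      tauto

/-- While the men move one by one, the array of the women still describes the old matching, so it
yields the former edge of the new partner. It is rebuilt only after all men have moved. -/
theorem wp_moveCode (hR : Represents D G num) {Ms : ℕ → Finset (Fin a × Fin b)} {z j : ℕ}
    {L : List ℕ} {ρ : List (Fin a × Fin b)} {k K : ℕ} {s : State}
    (h : MoveState D G num Ms z j L ρ s) (hL : Loaded D s) (hc : SuccChain G (z + 1) Ms)
    (hW : 2 * D.m + D.a + D.b + 3 < W) (hout : s.reg 18 + 6 < W) (hρ : ρ.length + 2 < W)
    (hz : s.reg 16 = z) (hzW : z + 1 < W) (hj : j < a) (hr : s.reg 15 = j)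
    (hmw : ∀ x y, (x, y) ∈ Ms z → s.arr 17 y = num x y + 1)
    (hlt : height G (Ms z) ⟨j, hj⟩ < height G (Ms (z + 1)) ⟨j, hj⟩)
    (hentry : IsEntry num (Ms (z + 1)) ⟨j, hj⟩ (s.arr 13 (s.reg 17 + s.reg 15)))
    (hBW : s.reg 17 + s.reg 15 < W) (hk : K + 150 ≤ k) :
    wp W moveCode (fun k' s' => K ≤ k' ∧
      ∃ ρ' : List (Fin a × Fin b), ρ'.length = ρ.length + 2 ∧
        MoveState D G num Ms z (j + 1) L ρ' s') k s := by
  have hM := hc.stable (i := z) (by omega)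
  have hN := hc.stable (i := z + 1) le_rfl
  obtain ⟨y₀, y₁, h₀, h₁⟩ := exists_mem_of_height_lt hM hN hlt.ne
  obtain ⟨x₁, h₂⟩ := exists_partnerB hN hM h₁
  have e₀ := hM.1.1 h₀
  have e₁ := hN.1.1 h₁
  have hq := IsEntry.eq hN.1 hentry h₁
  have hold := IsEntry.eq hM.1 ((h.row ⟨j, hj⟩).2 le_rfl) h₀
  rw [hr] at hq
  simp only at hold
  have hl₀ := hR.lt e₀
  have hl₁ := hR.lt e₁
  have hy₀ := hR.ey e₀
  have hy₁ := hR.ey e₁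
  have hprev := hmw x₁ y₁ h₂
  have hrow := (h.rows ⟨j, hj⟩).2.2 le_rfl
  -- The minimality needed here is the dichotomy for the step: a matching that makes this man worse
  -- off has passed the rotation.
  have hstep := hrow.step hN hlt fun R hR' hRlt => ?_
  · simp [moveCode, emit, hr, hq, hold, hL.ey, hz, hprev, hy₀, hy₁]
    have h14 := hrow.lt hN hlt
    have h15 := (h.rows ⟨j, hj⟩).1
    have hcount := h.count
    simp only at h14 h15 hstep
    have hfin : ∀ {x : Fin a}, x.val < j + 1 → x.val < j ∨ x = ⟨j, hj⟩ := fun {x} hx => by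
      rcases Nat.lt_succ_iff_lt_or_eq.1 hx with h | h
      exacts [Or.inl h, Or.inr (Fin.ext h)]
    have hno₁ : (⟨j, hj⟩, y₁) ∉ Ms z := fun hh => by
      rw [height_eq hM.1 hh, height_eq hN.1 h₁] at hlt
      omega
    have hno₀ : (⟨j, hj⟩, y₀) ∉ Ms (z + 1) := fun hh => by
      rw [height_eq hM.1 h₀, height_eq hN.1 hh] at hlt
      omega
    have hy01 : y₀ ≠ y₁ := fun hh => hno₁ (hh ▸ h₀)
    and_intros
    any_goals omega
    refine ⟨ρ ++ [(⟨j, hj⟩, y₀), (⟨j, hj⟩, y₁)], by simp, ⟨fun x => ?_, fun x => ?_, ?_, ?_,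
      fun x y => ?_, ?_, ?_⟩⟩
    · simp
      refine ⟨fun hx => ?_, fun hx => ?_⟩
      · rcases hfin (x := x) (by omega) with hx | rfl
        · rw [Function.update_of_ne (by omega)]
          exact (h.row x).1 hx
        · exact Or.inr ⟨y₁, h₁, by simp⟩
      · rw [Function.update_of_ne (by omega)]
        exact (h.row x).2 (by omega)
    · simp
      refine ⟨(h.rows x).1, fun hx => ?_, fun hx => ?_⟩
      · rcases hfin (x := x) (by omega) with hx | rfl
        · rw [Function.update_of_ne (by omega)]
          exact (h.rows x).2.1 hx
        · simpa using hstep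
      · rw [Function.update_of_ne (by omega)]
        exact (h.rows x).2.2 (by omega)
    · simp
      refine h.recd.move hR hc h₀ h₁ h₂ hlt (fun r x hx => ?_) fun r x => ?_
      · rw [ne_eq, Fin.ext_iff]
        simp only
        omega
      · rw [Fin.ext_iff]
        simp only
        omega
    · refine List.nodup_append.2 ⟨h.nodup, by simpa using hy01, ?_⟩
      rintro ⟨x, y⟩ hxy ⟨x', y'⟩ hxy' heq
      have h3 := ((h.mem x y).1 hxy).1
      simp only [List.mem_cons, List.not_mem_nil, or_false, ← heq, Prod.mk.injEq] at hxy'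
      rcases hxy' with ⟨rfl, -⟩ | ⟨rfl, -⟩ <;> simp at h3
    · simp only [List.mem_append, h.mem, List.mem_cons, List.not_mem_nil, or_false, Prod.mk.injEq]
      constructor
      · rintro (h3 | ⟨rfl, rfl⟩ | ⟨rfl, rfl⟩)
        · exact ⟨by omega, h3.2⟩
        · exact ⟨by simp, mem_symmDiff'.2 (Or.inl ⟨h₀, hno₀⟩)⟩
        · exact ⟨by simp, mem_symmDiff'.2 (Or.inr ⟨h₁, hno₁⟩)⟩
      · rintro ⟨hx, h3⟩
        rcases hfin hx with hx | rfl
        · exact Or.inl ⟨hx, h3⟩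
        · rcases mem_symmDiff'.1 h3 with h4 | h4
          · exact Or.inr (Or.inl ⟨rfl, hM.1.right_unique h4.1 h₀⟩)
          · exact Or.inr (Or.inr ⟨rfl, hN.1.right_unique h4.1 h₁⟩)
    · simp [hcount]
    · have := (((h.out.push j).push y₀.val).push j).push y₁.val
      simpa [flatEdges] using this
  · rcases (hc.succ z (by omega)).dichotomy hR' with h' | h'
    · exact absurd (h' _ hlt) (by omega)
    · exact h' _ hlt

end SuperStable

/-! ### One rotation: the moves of all men and the new state -/

namespace SuperStable

open FlatInstance

variable {D : FlatInstance} {a b : ℕ} {G : Instance (Fin a) (Fin b)} {num : Fin a → Fin b → ℕ}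
  {M N : Finset (Fin a × Fin b)} {W : ℕ}

theorem length_flatEdges (ρ : List (Fin a × Fin b)) : (flatEdges ρ).length = 2 * ρ.length := by
  induction ρ with
  | nil => rfl
  | cons p ρ ih => simp only [flatEdges, List.flatMap_cons, List.length_append] at ih ⊢; simp [ih]; omega

/-- The successor is the meet of the current matching with the chosen row. So exactly the men who
are worse off in the row move, and they move to their edges in the row. -/
theorem wp_movesCode (hR : Represents D G num) {Ms : ℕ → Finset (Fin a × Fin b)} {z : ℕ}
    {L : List ℕ} {k K : ℕ} {s : State} (hL : Loaded D s) (hc : SuccChain G (z + 1) Ms)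
    (h : MoveState D G num Ms z 0 L [] s)
    (hW : 2 * D.m + D.a + D.b + 3 < W) (hout : L.length + 4 * a + 6 < W)
    (hz : s.reg 16 = z) (hzW : z + 1 < W)
    (hmw : ∀ x y, (x, y) ∈ Ms z → s.arr 17 y = num x y + 1)
    (hN : IsSuperStable G N) (hNrow : IsRowOf num N fun x => s.arr 13 (s.reg 17 + x))
    (hle : ∀ x, height G (Ms z) x < height G N x → ∀ y, (x, y) ∈ N ↔ (x, y) ∈ Ms (z + 1))
    (hle' : ∀ x, ¬ height G (Ms z) x < height G N x →
      height G (Ms z) x = height G (Ms (z + 1)) x)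
    (hBW : s.reg 17 + a < W) (hk : K + 200 * D.a + 20 ≤ k) :
    wp W movesCode (fun k' s' => K ≤ k' ∧ ∃ ρ : List (Fin a × Fin b), ρ.length ≤ 2 * a ∧
        MoveState D G num Ms z a L ρ s') k s := by
  have hM := hc.stable (i := z) (by omega)
  have hN' := hc.stable (i := z + 1) le_rfl
  refine ⟨by simp; omega, by simp; omega, ?_⟩
  refine wp_forLoop (N := D.a) (j₀ := 0)
    (fun j k' s' => K + 200 * (D.a - j) + 10 ≤ k' ∧ ∃ ρ : List (Fin a × Fin b),
      ρ.length ≤ 2 * j ∧ MoveState D G num Ms z j L ρ s')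
    (by simp [hL.a]) (by omega) (by simp) (by omega) (by decide) rfl rfl ?_ ?_ ?_
  · simp
    exact ⟨by omega, ⟨h.row, h.rows, h.recd, h.nodup, h.mem, h.count, h.out⟩⟩
  · intro j k' s' hj hr hf ⟨i1, ρ, i2, i3⟩
    have hja : j < a := by rwa [hR.ha] at hj
    have hL' := (Loaded.mk (D := D) (by simp [hL.a]) (by simp [hL.b]) (by simp [hL.m])
      (by simp [hL.ex]) (by simp [hL.ey]) (by simp [hL.er]) (by simp [hL.eb])
      (by simp [hL.fi])).of_frame hf (by decide) (by decide)
    have e16 : s'.reg 16 = z := (hf.reg 16 rfl).trans (by simp [hz])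
    have e17 : s'.reg 17 = s.reg 17 := (hf.reg 17 rfl).trans (by simp)
    have f13 : s'.arr 13 = s.arr 13 := (hf.arr 13 rfl).trans (by simp)
    have f17 : s'.arr 17 = s.arr 17 := (hf.arr 17 rfl).trans (by simp)
    have hold := (i3.row ⟨j, hja⟩).2 le_rfl
    have hent := hR.entry_lt_iff hM hN hold (hNrow ⟨j, hja⟩)
    have hev : Exp.eval s' (rd 16 (vr 15) <. rd 13 (vr 17 +. vr 15)) ≠ 0 ↔
        height G (Ms z) ⟨j, hja⟩ < height G N ⟨j, hja⟩ := by
      rw [← hent]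
      simp [hr, f13, e17]
    have hol := i3.out.1
    rw [List.length_append, length_flatEdges] at hol
    have close : ∀ {k₁ s₁ ρ'}, K + 200 * (D.a - (j + 1)) + 20 ≤ k₁ → ρ'.length ≤ ρ.length + 2 →
        MoveState D G num Ms z (j + 1) L ρ' s₁ →
        4 ≤ k₁ ∧ K + 200 * (D.a - (j + 1)) + 10 ≤ k₁ - 4 ∧ ∃ ρ : List (Fin a × Fin b),
          ρ.length ≤ 2 * (j + 1) ∧ MoveState D G num Ms z (j + 1) L ρ (s₁.setReg 15 (j + 1)) :=
      fun g1 g2 g => ⟨by omega, by omega, _, by omega, ⟨g.row, g.rows, g.recd, g.nodup, g.mem,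
        g.count, g.out⟩⟩
    refine ⟨by omega, ⟨trivial, ⟨trivial, trivial, ?_⟩, by omega⟩, by simp; omega, fun hv => ?_,
      fun hv => ⟨by simp; omega, close (ρ' := ρ) (by simp; omega) (by omega)
        (i3.skip hM hN' hja (hle' _ fun hh => hev.2 hh hv))⟩⟩
    · simp [e17, hr]; omega
    · have hlt := hev.1 hv
      refine wp_mono (wp_moveCode (K := K + 200 * (D.a - (j + 1)) + 20) hR i3 hL' hc hW
        (by omega) (by omega) e16 hzW hja hr (by rw [f17]; exact hmw) ?_ ?_ ?_ (by simp; omega)) ?_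
      · rwa [show height G N ⟨j, hja⟩ = height G (Ms (z + 1)) ⟨j, hja⟩ by simp only [height, hle _ hlt]] at hlt
      · rw [f13, e17, hr]
        exact IsEntry.congr (hNrow ⟨j, hja⟩) (hle _ hlt)
      · rw [e17, hr]; omega
      · rintro k₁ s₁ ⟨g1, ρ', g2, g3⟩
        exact close g1 g2.le g3
  · intro k' s' hr hf ⟨i1, ρ, i2, i3⟩
    rw [hR.ha] at i2 i3
    exact ⟨by omega, by omega, ρ, i2, i3⟩

/-- The state between two rotations. -/
structure RotationState (D : FlatInstance) (G : Instance (Fin a) (Fin b))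
    (num : Fin a → Fin b → ℕ) (L : List ℕ) (rs : List (List (Fin a × Fin b))) (z : ℕ)
    (Ms : ℕ → Finset (Fin a × Fin b)) (s : State) : Prop where
  chain : SuccChain G z Ms
  reg : s.reg 16 = z
  row : IsRowOf num (Ms z) (s.arr 16)
  women : ∀ x y, (x, y) ∈ Ms z → s.arr 17 y = num x y + 1
  rows : ∀ x : Fin a, s.arr 15 x ≤ D.m + 1 ∧
    AllRows G num (s.arr 13) x (s.arr 14 x) (s.arr 15 x) (height G (Ms z) x)
  recd : Recorded G num Ms (fun r _ => r < z) (s.arr 18) (s.arr 19) (s.arr 20) (s.arr 21)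
  len : rs.length = z
  rots : ∀ i (hi : i < rs.length), rs[i].Nodup ∧ rs[i].toFinset = Ms i ∆ Ms (i + 1)
  out : OutAt (s.arr 1) (s.reg 18) (L ++ rs.flatMap encodeEdges)

/-- A rotation writes at most 4a + 1 words, its length and two edges for each man, and removes at
least one edge from those that are still worse. The bound B is the potential formed from both. -/
theorem wp_rotationCode (hR : Represents D G num) {n : ℕ} (hn : n = D.a + D.b + D.m + 2)
    (hW : n ^ 2 * 32 ≤ W) {k K B : ℕ} {L : List ℕ} {rs : List (List (Fin a × Fin b))} {z : ℕ}
    {Ms : ℕ → Finset (Fin a × Fin b)} {s : State} (hL : Loaded D s)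
    (h : RotationState D G num L rs z Ms s) {x₀ : Fin a} (hx₀ : s.reg 11 = x₀)
    (hlt : s.arr 14 x₀ < s.arr 15 x₀) (hB : B + 8 < W)
    (hlen : (L ++ rs.flatMap encodeEdges).length + (worse G (Ms z)).card * (4 * a + 1) ≤ B)
    (hz : z + (worse G (Ms z)).card ≤ D.m)
    (hk : K + 300 * D.a + 150 ≤ k) :
    wp W rotationCode (fun k' s' => K ≤ k' ∧ ∃ N ρ,
      RotationState D G num L (rs ++ [ρ]) (z + 1) (Function.update Ms (z + 1) N) s' ∧
      (worse G N).card < (worse G (Ms z)).card ∧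
      (L ++ (rs ++ [ρ]).flatMap encodeEdges).length + (worse G N).card * (4 * a + 1) ≤ B) k s := by
  have hn2 : n ≤ n ^ 2 := Nat.le_self_pow (by omega) n
  have hM := h.chain.stable le_rfl
  have haa := hR.ha
  have hol := h.out.1
  refine wp_seq_frame (wp_pickCode (K := K + 260 * D.a + 130) hR hn hW hL hM h.row h.rows hx₀ hlt
    (by omega)) ?_
  rintro k₁ s₁ hf₁ ⟨g1, x₁, N, g2, g3, hN, g4, g5, g6⟩
  have hL₁ := hL.of_frame hf₁ (by decide) (by decide)
  have f1 : s₁.arr 1 = s.arr 1 := hf₁.arr 1 rfl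
  have f13 : s₁.arr 13 = s.arr 13 := hf₁.arr 13 rfl
  have f14 : s₁.arr 14 = s.arr 14 := hf₁.arr 14 rfl
  have f15 : s₁.arr 15 = s.arr 15 := hf₁.arr 15 rfl
  have f16 : s₁.arr 16 = s.arr 16 := hf₁.arr 16 rfl
  have f17 : s₁.arr 17 = s.arr 17 := hf₁.arr 17 rfl
  have f18 : s₁.arr 18 = s.arr 18 := hf₁.arr 18 rfl
  have f19 : s₁.arr 19 = s.arr 19 := hf₁.arr 19 rfl
  have f20 : s₁.arr 20 = s.arr 20 := hf₁.arr 20 rfl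
  have f21 : s₁.arr 21 = s.arr 21 := hf₁.arr 21 rfl
  have e16 : s₁.reg 16 = z := (hf₁.reg 16 rfl).trans h.reg
  have e18 : s₁.reg 18 = s.reg 18 := hf₁.reg 18 rfl
  have hS := isStrictSuccessor_meet hM hN g5 fun x R hR' => g6 x R hR'
  set N' := meet G (Ms z) N with hN'
  set Ms' := Function.update Ms (z + 1) N' with hMs'
  have hchain := h.chain.snoc hS
  have hz' : Ms' z = Ms z := Function.update_of_ne (by omega) _ _
  have hz1 : Ms' (z + 1) = N' := Function.update_self _ _ _
  have hcard := card_worse_lt hM hS.2.1 hS.lt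
  have hmul : (worse G N').card * (4 * a + 1) + (4 * a + 1) ≤
      (worse G (Ms z)).card * (4 * a + 1) := by
    rw [← Nat.succ_mul]
    exact Nat.mul_le_mul_right _ hcard
  have hr1 := (h.rows x₁).1
  have hRW := mul_add_lt (n := n) (u := s.arr 14 x₁) (v := a) (w := a) (W := W) (by omega)
    (by omega) (by omega) (by omega) (by omega)
  have hW1 : 1 < W := by omega
  refine ⟨⟨trivial, trivial, by simp [f14, g2, hL₁.a, haa]; omega⟩, by simp; omega, trivial,
    by simp; omega, by simp; omega, by simp; omega, ?_⟩
  refine wp_emit (by simp; omega) (by simp; omega) (by simp; omega) ?_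
  refine wp_seq_frame (wp_movesCode (K := K + 40 * D.a + 40) (Ms := Ms') (z := z) (N := N)
    (L := L ++ rs.flatMap encodeEdges ++ [0]) hR
    ⟨by simp [hL₁.a], by simp [hL₁.b], by simp [hL₁.m], by simp [hL₁.ex], by simp [hL₁.ey],
      by simp [hL₁.er], by simp [hL₁.eb], by simp [hL₁.fi]⟩ hchain ?_ (by omega) ?_ (by simp [e16])
    (by omega) ?_ hN ?_ ?_ ?_ ?_ (by simp; omega)) ?_
  · simp
    refine ⟨fun x => ⟨fun hx => by omega, fun _ => ?_⟩, fun x => ⟨?_, fun hx => by omega,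
      fun _ => ?_⟩, ?_, List.nodup_nil, by simp, by simp, ?_⟩
    · rw [hz']
      have : IsEntry num (Ms z) x (s.arr 16 x) := h.row x
      simpa [f16] using this
    · simpa [f15] using (h.rows x).1
    · rw [hz']
      simpa [f13, f14, f15] using (h.rows x).2
    · simp [f18, f19, f20, f21]
      refine h.recd.congr (fun r x => by simp) fun r x hr => ⟨?_, ?_⟩
      · exact Function.update_of_ne (by omega) _ _
      · exact Function.update_of_ne (by omega) _ _
    · simpa [flatEdges, f1, e18] using h.out.push 0
  · simp at hlen ⊢
    omega
  · rw [hz']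
    simpa [f17] using h.women
  · simpa [f13, f14, g2, hL₁.a, haa] using g4
  · rw [hz', hz1]
    intro x hx y
    refine mem_iff_of_height_eq hN hS.2.1 ?_ y
    rw [hN', height_meet hM hN, max_eq_right hx.le]
  · rw [hz', hz1]
    intro x hx
    rw [hN', height_meet hM hN, max_eq_left (not_lt.1 hx)]
  · simp [f14, g2, hL₁.a, haa]
    omega
  rintro k₂ s₂ hf₂ ⟨q1, ρ, q2, q3⟩
  have u16 : s₂.reg 16 = z := (hf₂.reg 16 rfl).trans (by simp [e16])
  have u21 : s₂.reg 21 = (L ++ rs.flatMap encodeEdges).length :=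
    (hf₂.reg 21 rfl).trans (by simp [e18, hol])
  have hL₂ := (Loaded.mk (D := D) (by simp [hL₁.a]) (by simp [hL₁.b]) (by simp [hL₁.m])
      (by simp [hL₁.ex]) (by simp [hL₁.ey]) (by simp [hL₁.er]) (by simp [hL₁.eb])
      (by simp [hL₁.fi])).of_frame hf₂ (by decide) (by decide)
  have hrow : IsRowOf num N' (s₂.arr 16) := fun x => by
    have := (q3.row x).1 x.2
    rwa [hz1] at this
  refine ⟨trivial, trivial, by simp; omega, ?_⟩
  refine wp_seq_frame (wp_womenCode (K := K + 10) hR (by omega) ⟨by simp [hL₂.a], by simp [hL₂.b],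
    by simp [hL₂.m], by simp [hL₂.ex], by simp [hL₂.ey], by simp [hL₂.er], by simp [hL₂.eb],
    by simp [hL₂.fi]⟩ hS.2.1.1 (by simpa using hrow) (by simp; omega)) ?_
  rintro k₃ s₃ hf₃ ⟨r1, r2⟩
  have v16 : s₃.reg 16 = z := (hf₃.reg 16 rfl).trans (by simp [u16])
  have v18 : s₃.reg 18 = s₂.reg 18 := (hf₃.reg 18 rfl).trans (by simp)
  have w1 : s₃.arr 1 = Function.update (s₂.arr 1) (s₂.reg 21) (s₂.reg 22) :=
    (hf₃.arr 1 rfl).trans (by simp)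
  have w13 : s₃.arr 13 = s₂.arr 13 := (hf₃.arr 13 rfl).trans (by simp)
  have w14 : s₃.arr 14 = s₂.arr 14 := (hf₃.arr 14 rfl).trans (by simp)
  have w15 : s₃.arr 15 = s₂.arr 15 := (hf₃.arr 15 rfl).trans (by simp)
  have w16 : s₃.arr 16 = s₂.arr 16 := (hf₃.arr 16 rfl).trans (by simp)
  have w18 : s₃.arr 18 = s₂.arr 18 := (hf₃.arr 18 rfl).trans (by simp)
  have w19 : s₃.arr 19 = s₂.arr 19 := (hf₃.arr 19 rfl).trans (by simp)
  have w20 : s₃.arr 20 = s₂.arr 20 := (hf₃.arr 20 rfl).trans (by simp)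
  have w21 : s₃.arr 21 = s₂.arr 21 := (hf₃.arr 21 rfl).trans (by simp)
  have hlen' : (L ++ (rs ++ [ρ]).flatMap encodeEdges).length =
      (L ++ rs.flatMap encodeEdges).length + 1 + 2 * ρ.length := by
    simp [encodeEdges_eq, length_flatEdges]
    omega
  refine ⟨⟨trivial, hW1, by simp [v16]; omega⟩, by simp; omega, by simp; omega, N', ρ, ?_, hcard, ?_⟩
  · change RotationState D G num L (rs ++ [ρ]) (z + 1) Ms' _
    refine ⟨hchain, by simp [v16], ?_, ?_, fun x => ?_, ?_, by simp [h.len], fun i hi => ?_, ?_⟩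
    · rw [hz1]; simpa [w16] using hrow
    · rw [hz1]; simpa using r2
    · rw [hz1]
      have := (q3.rows x).2.1 x.2
      rw [hz1] at this
      simpa [w13, w14, w15] using And.intro (q3.rows x).1 this
    · simp [w18, w19, w20, w21]
      exact q3.recd.congr (fun r x => by simp; omega) fun r x _ => ⟨rfl, rfl⟩
    · rw [List.getElem_append]
      have hlen := h.len
      split_ifs with hir
      · rw [hMs', Function.update_of_ne (by omega), Function.update_of_ne (by omega)]
        exact h.rots i hir
      · simp at hi
        obtain rfl : i = z := by omega
        simp only [List.getElem_singleton]
        refine ⟨q3.nodup, ?_⟩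
        ext ⟨x, y⟩
        rw [List.mem_toFinset, q3.mem]
        simp
    · have := OutAt.set (L := L ++ rs.flatMap encodeEdges) (L' := flatEdges ρ) (v := 0)
        (by simpa using q3.out) ρ.length
      simpa [w1, v18, u21, q3.count, encodeEdges_eq] using this
  · rw [hlen']
    omega

end SuperStable

/-! ### The whole sequence of rotations and the output of the optimal matching -/

namespace SuperStable

open FlatInstance

/-- All rotations. -/
def sequenceCode : Cmd :=
  11 ::= cst 0 ;; forLoop 11 0 (.loop (rd 14 (vr 11) <. rd 15 (vr 11)) rotationCode)

/-- The best matching, from row `0`, is copied and put out. -/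
def startOutputCode : Cmd :=
  18 ::= cst 0 ;;
  emit (cst 1) ;;
  21 ::= vr 18 ;;
  22 ::= cst 0 ;;
  emit (cst 0) ;;
  15 ::= cst 0 ;;
  forLoop 15 0
    (.store 16 (vr 15) (rd 13 (vr 15)) ;;
      .cond (rd 13 (vr 15))
        (emit (vr 15) ;; emit (rd 3 (rd 13 (vr 15) -. cst 1)) ;; 22 ::= vr 22 +. cst 1) .skip) ;;
  .store 1 (vr 21) (vr 22) ;;
  womenCode ;;
  16 ::= cst 0 ;;
  23 ::= vr 18 ;;
  emit (cst 0)

variable {D : FlatInstance} {a b : ℕ} {G : Instance (Fin a) (Fin b)} {num : Fin a → Fin b → ℕ}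
  {M N : Finset (Fin a × Fin b)} {W : ℕ}

theorem RotationState.of_arr {L : List ℕ} {rs : List (List (Fin a × Fin b))} {z : ℕ}
    {Ms : ℕ → Finset (Fin a × Fin b)} {s s' : State} (h : RotationState D G num L rs z Ms s)
    (harr : s'.arr = s.arr) (h16 : s'.reg 16 = s.reg 16) (h18 : s'.reg 18 = s.reg 18) :
    RotationState D G num L rs z Ms s' := by
  obtain ⟨h1, h2, h3, h4, h5, h6, h7, h8, h9⟩ := h
  refine ⟨h1, h16.trans h2, ?_, ?_, ?_, ?_, h7, h8, ?_⟩ <;> simpa only [harr, h18]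

/-- Bounds for the length of the output and the number of rotations. -/
def RotationBound (D : FlatInstance) (G : Instance (Fin a) (Fin b)) (L : List ℕ)
    (rs : List (List (Fin a × Fin b))) (z : ℕ) (M : Finset (Fin a × Fin b)) (B : ℕ) : Prop :=
  (L ++ rs.flatMap encodeEdges).length + (worse G M).card * (4 * a + 1) ≤ B ∧
    z + (worse G M).card ≤ D.m

/-- Rotations are eliminated until the man of the outer loop has no row left, that is, until he is
in his worst situation. This persists under later rotations, so at the end all men are there and the
matching is woman-optimal. -/
theorem wp_sequenceCode (hR : Represents D G num) {n : ℕ} (hn : n = D.a + D.b + D.m + 2)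
    (hW : n ^ 2 * 32 ≤ W) {k K B C : ℕ} {L : List ℕ} {rs : List (List (Fin a × Fin b))} {z : ℕ}
    {Ms : ℕ → Finset (Fin a × Fin b)} {s : State} (hL : Loaded D s)
    (h : RotationState D G num L rs z Ms s) (hbd : RotationBound D G L rs z (Ms z) B)
    (hB : B + 8 < W) (hC : 300 * D.a + 160 ≤ C)
    (hk : K + 20 * D.a + (worse G (Ms z)).card * C + 20 ≤ k) :
    wp W sequenceCode (fun k' s' => K ≤ k' ∧ ∃ rs z Ms, RotationState D G num L rs z Ms s' ∧
      RotationBound D G L rs z (Ms z) B ∧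
      ∀ N, IsSuperStable G N → ∀ x, height G N x ≤ height G (Ms z) x) k s := by
  have hn2 : n ≤ n ^ 2 := Nat.le_self_pow (by omega) n
  refine ⟨by simp; omega, by simp; omega, ?_⟩
  let I : ℕ → ℕ → State → Prop := fun j k' s' => ∃ rs z Ms, RotationState D G num L rs z Ms s' ∧
    RotationBound D G L rs z (Ms z) B ∧ K + 20 * (D.a - j) + (worse G (Ms z)).card * C + 10 ≤ k' ∧
    ∀ N, IsSuperStable G N → ∀ x : Fin a, x.val < j → height G N x ≤ height G (Ms z) x
  refine wp_forLoop (N := D.a) (j₀ := 0) I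
    (by simp [hL.a]) (by omega) (by simp) (by omega) (by decide) rfl rfl ?_ ?_ ?_
  · exact ⟨rs, z, Ms, h.of_arr rfl (by simp) (by simp), hbd, by simp; omega,
      fun _ _ x hx => by omega⟩
  · rintro j k₀ s₀ hj hr hf hI
    have hja : j < a := by rwa [hR.ha] at hj
    have hL₀ := (Loaded.mk (D := D) (by simp [hL.a]) (by simp [hL.b]) (by simp [hL.m])
      (by simp [hL.ex]) (by simp [hL.ey]) (by simp [hL.er]) (by simp [hL.eb])
      (by simp [hL.fi])).of_frame hf (by decide) (by decide)
    refine ⟨by obtain ⟨rs, z, Ms, -, -, h3, -⟩ := hI; omega, ?_⟩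
    refine wp_loop' (fun k' s' => I j (k' + 4) s') ?_ ?_
    · have : 4 ≤ k₀ := by obtain ⟨rs, z, Ms, -, -, h3, -⟩ := hI; omega
      rwa [Nat.sub_add_cancel this]
    rintro k₁ s₁ hf₁ ⟨rs, z, Ms, h1, h2, h3, h4⟩
    have hL₁ := hL₀.of_frame hf₁ (by decide) (by decide)
    have e11 : s₁.reg 11 = j := (hf₁.reg 11 rfl).trans hr
    have hsz : (rd 14 (vr 11) <. rd 15 (vr 11)).size + 1 = 6 := rfl
    have hev : Exp.eval s₁ (rd 14 (vr 11) <. rd 15 (vr 11)) = 0 ↔ ¬ s₁.arr 14 j < s₁.arr 15 j := by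
      simp [e11]
    rw [hsz]
    refine ⟨⟨trivial, trivial, by omega⟩, by omega, fun h0 => ?_, fun h0 => ?_⟩
    · refine ⟨by omega, rs, z, Ms, h1.of_arr rfl (by simp) (by simp), h2, by omega,
        fun N hN x hx => ?_⟩
      by_cases hxj : (x : ℕ) = j
      · by_contra! hlt
        have := (h1.rows x).2.lt hN hlt
        rw [hxj] at this
        exact hev.1 h0 this
      · exact h4 N hN x (by omega)
    · have hlt : s₁.arr 14 j < s₁.arr 15 j := by
        by_contra hh
        exact h0 (hev.2 hh)
      obtain ⟨N₀, hN₀, -, -⟩ := (h1.rows ⟨j, hja⟩).2.uncons hlt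
      -- A remaining row provides an edge that is still worse; it pays for the coming rotation.
      have hpos : (worse G (Ms z)).card ≠ 0 := by
        obtain ⟨y, y', m1, m2⟩ := exists_mem_of_height_lt (h1.chain.stable le_rfl) hN₀.1 hN₀.2.1.ne
        refine Finset.card_ne_zero_of_mem (a := (⟨j, hja⟩, y')) ?_
        simp only [worse, Finset.mem_filter]
        exact ⟨hN₀.1.1.1 m2, by rw [← height_eq hN₀.1.1 m2]; exact hN₀.2.1⟩
      obtain ⟨d, hd⟩ := Nat.exists_eq_succ_of_ne_zero hpos
      have hdC : (worse G (Ms z)).card * C = d * C + C := by rw [hd, Nat.succ_mul]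
      refine wp_mono (wp_rotationCode (K := K + 20 * (D.a - j) + d * C + 10) (x₀ := ⟨j, hja⟩) hR hn
        hW hL₁ h1 e11 hlt hB h2.1 h2.2 (by omega)) ?_
      rintro k₂ s₂ ⟨g1, N, ρ, g2, g3, g4⟩
      have hle : (worse G N).card * C ≤ d * C := Nat.mul_le_mul_right _ (by omega)
      have h22 := h2.2
      refine ⟨rs ++ [ρ], z + 1, _, g2, ?_, ?_, fun N' hN' x hx => (h4 N' hN' x hx).trans ?_⟩
      · rw [Function.update_self]
        exact ⟨g4, by omega⟩
      · rw [Function.update_self]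
        omega
      · have := g2.chain.mono (i := z) (j := z + 1) (by omega) le_rfl x
        rwa [Function.update_of_ne (by omega : z ≠ z + 1)] at this
  · rintro k₀ s₀ hr hf ⟨rs, z, Ms, h1, h2, h3, h4⟩
    exact ⟨by omega, by omega, rs, z, Ms, h1, h2, fun N hN x => h4 N hN x (by rw [hR.ha]; exact x.2)⟩

/-- Arrays 18 and 19 are still zero, which encodes that no edge has been added or removed by a
rotation. The final placeholder 0 is for the number of rotations. -/
theorem wp_startOutputCode (hR : Represents D G num) {n : ℕ} (hn : n = D.a + D.b + D.m + 2)
    (hW : n ^ 2 * 32 ≤ W) {k K : ℕ} {s : State} (hL : Loaded D s) (hM : IsBest G M)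
    (hrow : IsRowOf num M (s.arr 13)) (hrows : ∀ x : Fin a, s.arr 15 x ≤ D.m + 1 ∧
      AllRows G num (s.arr 13) x (s.arr 14 x) (s.arr 15 x) (height G M x))
    (h18 : s.arr 18 = 0) (h19 : s.arr 19 = 0) (hk : K + 140 * D.a + 100 ≤ k) :
    wp W startOutputCode (fun k' s' => K ≤ k' ∧ ∃ l : List (Fin a × Fin b), l.Nodup ∧
      l.toFinset = M ∧ l.length ≤ a ∧ s'.reg 23 = (1 :: encodeEdges l).length ∧
      RotationState D G num (1 :: encodeEdges l ++ [0]) [] 0 (fun _ => M) s') k s := by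
  have hn2 : n ≤ n ^ 2 := Nat.le_self_pow (by omega) n
  have hW1 : 1 < W := by omega
  have haa := hR.ha
  refine ⟨by simp; omega, by simp; omega, ?_⟩
  refine wp_emit hW1 (by simp; omega) (by simp; omega) ?_
  refine ⟨trivial, by simp; omega, by simp; omega, by simp; omega, ?_⟩
  refine wp_emit (by simp; omega) (by simp; omega) (by simp; omega) ?_
  refine ⟨by simp; omega, by simp; omega, ?_⟩
  refine wp_seq_frame (wp_forLoop (N := D.a) (j₀ := 0)
    (Q := fun k' s' => K + 40 * D.a + 50 ≤ k' ∧ IsRowOf num M (s'.arr 16) ∧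
      ∃ l : List (Fin a × Fin b), l.Nodup ∧ (∀ x y, (x, y) ∈ l ↔ (x, y) ∈ M) ∧
      l.length ≤ a ∧ s'.reg 22 = l.length ∧ OutAt (s'.arr 1) (s'.reg 18) (1 :: 0 :: flatEdges l))
    (fun j k' s' => K + 40 * D.a + 100 * (D.a - j) + 60 ≤ k' ∧
      (∀ x < j, s'.arr 16 x = s.arr 13 x) ∧
      ∃ l : List (Fin a × Fin b), l.Nodup ∧ (∀ x y, (x, y) ∈ l ↔ x.val < j ∧ (x, y) ∈ M) ∧
      l.length ≤ j ∧ s'.reg 22 = l.length ∧ OutAt (s'.arr 1) (s'.reg 18) (1 :: 0 :: flatEdges l))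
    (by simp [hL.a]) (by omega) (by simp) (by omega) (by decide) rfl rfl ?_ ?_ ?_) ?_
  · simp
    refine ⟨by omega, ?_⟩
    have : OutAt (s.arr 1) 0 [] := ⟨rfl, fun i hi => by simp at hi⟩
    simpa [flatEdges] using (this.push 1).push 0
  · intro j k' s' hj hr hf ⟨i1, i2, l, i3, i4, i5, i6, i7⟩
    have hja : j < a := by rwa [hR.ha] at hj
    have f3 : s'.arr 3 = D.EY := (hf.arr 3 rfl).trans (by simp [hL.ey])
    have f13 : s'.arr 13 = s.arr 13 := (hf.arr 13 rfl).trans (by simp)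
    have hol := i7.1
    simp [length_flatEdges] at hol
    have hfin : ∀ {x : Fin a}, x.val < j + 1 → x.val < j ∨ x = ⟨j, hja⟩ := fun {x} hx => by
      rcases Nat.lt_succ_iff_lt_or_eq.1 hx with h | h
      exacts [Or.inl h, Or.inr (Fin.ext h)]
    have hcopy : ∀ x ≤ j, Function.update (s'.arr 16) j (s.arr 13 j) x = s.arr 13 x := by
      intro x hx
      by_cases hxj : x = j
      · simp [hxj]
      · rw [Function.update_of_ne hxj, i2 x (by omega)]
    simp [hr, f13, f3, emit]
    refine ⟨by omega, by omega, by omega, fun h0 => ?_, fun h0 => ?_⟩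
    · rcases hrow ⟨j, hja⟩ with ⟨h1, -⟩ | ⟨y, hxy, hv⟩
      · exact absurd h1 h0
      have hxe := hM.1.1.1 hxy
      have hnm := hR.lt hxe
      simp only at hv
      simp [hv, hR.ey hxe]
      rw [hv] at hcopy
      and_intros
      any_goals omega
      refine ⟨l ++ [(⟨j, hja⟩, y)], ?_, fun x y' => ?_, by simpa using i5, by simp [i6], ?_⟩
      · refine List.nodup_append.2 ⟨i3, by simp, ?_⟩
        rintro ⟨x, y₁⟩ hx ⟨x', y'⟩ hx' heq
        have h3 := ((i4 x y₁).1 hx).1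
        simp only [List.mem_cons, List.not_mem_nil, or_false, ← heq, Prod.mk.injEq] at hx'
        rw [hx'.1] at h3
        simp at h3
      · simp only [List.mem_append, i4, List.mem_cons, List.not_mem_nil, or_false, Prod.mk.injEq]
        constructor
        · rintro (h3 | ⟨rfl, rfl⟩)
          · exact ⟨by omega, h3.2⟩
          · exact ⟨by simp, hxy⟩
        · rintro ⟨hx, h3⟩
          rcases hfin (x := x) (by omega) with hx | rfl
          · exact Or.inl ⟨hx, h3⟩
          · exact Or.inr ⟨rfl, hM.1.1.right_unique h3 hxy⟩
      · simpa [flatEdges] using (i7.push j).push y.val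
    · refine ⟨by omega, by omega, by omega, hcopy, l, i3, fun x y => ?_, by omega, i6, i7⟩
      rw [i4]
      refine and_congr_left fun hxy => ⟨fun h => by omega, fun hx => ?_⟩
      rcases hfin (x := x) (by omega) with hx | rfl
      · exact hx
      · have := IsEntry.eq hM.1.1 (hrow ⟨j, hja⟩) hxy
        simp only at this
        omega
  · intro k' s' hr hf ⟨i1, i2, l, i3, i4, i5, i6, i7⟩
    refine ⟨by omega, by omega, hrow.congr fun x hx => i2 x (by omega), l, i3, fun x y => ?_,
      by omega, i6, i7⟩
    rw [i4, haa]
    exact and_iff_right x.2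
  rintro k₁ s₁ hf₁ ⟨g1, g2, l, g3, g4, g5, g6, g7⟩
  have hL₁ := (Loaded.mk (D := D) (by simp [hL.a]) (by simp [hL.b]) (by simp [hL.m])
      (by simp [hL.ex]) (by simp [hL.ey]) (by simp [hL.er]) (by simp [hL.eb])
      (by simp [hL.fi])).of_frame hf₁ (by decide) (by decide)
  have e21 : s₁.reg 21 = 1 := (hf₁.reg 21 rfl).trans (by simp)
  have f13 : s₁.arr 13 = s.arr 13 := (hf₁.arr 13 rfl).trans (by simp)
  have f14 : s₁.arr 14 = s.arr 14 := (hf₁.arr 14 rfl).trans (by simp)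
  have f15 : s₁.arr 15 = s.arr 15 := (hf₁.arr 15 rfl).trans (by simp)
  have f18 : s₁.arr 18 = 0 := (hf₁.arr 18 rfl).trans (by simp [h18])
  have f19 : s₁.arr 19 = 0 := (hf₁.arr 19 rfl).trans (by simp [h19])
  have hol := g7.1
  simp [length_flatEdges] at hol
  refine ⟨trivial, trivial, by simp; omega, ?_⟩
  refine wp_seq_frame (wp_womenCode (K := K + 20) (M := M) hR (by omega) ⟨by simp [hL₁.a],
    by simp [hL₁.b], by simp [hL₁.m], by simp [hL₁.ex], by simp [hL₁.ey], by simp [hL₁.er],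
    by simp [hL₁.eb], by simp [hL₁.fi]⟩ hM.1.1 (by simpa using g2) (by simp; omega)) ?_
  rintro k₂ s₂ hf₂ ⟨q1, q2⟩
  have u18 : s₂.reg 18 = s₁.reg 18 := (hf₂.reg 18 rfl).trans (by simp)
  have w1 : s₂.arr 1 = Function.update (s₁.arr 1) 1 l.length :=
    (hf₂.arr 1 rfl).trans (by simp [e21, g6])
  have w13 : s₂.arr 13 = s.arr 13 := (hf₂.arr 13 rfl).trans (by simp [f13])
  have w14 : s₂.arr 14 = s.arr 14 := (hf₂.arr 14 rfl).trans (by simp [f14])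
  have w15 : s₂.arr 15 = s.arr 15 := (hf₂.arr 15 rfl).trans (by simp [f15])
  have w16 : s₂.arr 16 = s₁.arr 16 := (hf₂.arr 16 rfl).trans (by simp)
  have w18 : s₂.arr 18 = 0 := (hf₂.arr 18 rfl).trans (by simp [f18])
  have w19 : s₂.arr 19 = 0 := (hf₂.arr 19 rfl).trans (by simp [f19])
  refine ⟨by simp; omega, by simp; omega, trivial, by simp; omega, ?_⟩
  refine wp_emit (by simp; omega) (by simp [u18]; omega) (by simp; omega) ?_
  refine ⟨by simp; omega, l, g3, ?_, g5, by simp [u18, hol, encodeEdges_eq, length_flatEdges], ?_⟩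
  · ext ⟨x, y⟩
    rw [List.mem_toFinset, g4]
  · refine ⟨⟨hM, fun i hi => by omega⟩, by simp, ?_, by simpa using q2, fun x => ?_, ?_, rfl,
      fun i hi => by simp at hi, ?_⟩
    · simpa [w16] using g2
    · simpa [w13, w14, w15] using hrows x
    · simp [w18, w19]
      exact ⟨fun _ r => by simp, fun _ r => by simp, fun h => h.elim, fun h => h.elim⟩
    · have := (OutAt.set (L := [1]) (L' := flatEdges l) (v := 0) (by simpa using g7) l.length).push 0
      simpa [u18, w1, encodeEdges_eq] using this

end SuperStable

namespace SuperStable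

open FlatInstance

/-! ## The rotation digraph -/

variable {D : FlatInstance} {a b : ℕ} {G : Instance (Fin a) (Fin b)} {num : Fin a → Fin b → ℕ}
  {W z : ℕ} {Ms : ℕ → Finset (Fin a × Fin b)} {i o pe pw : ℕ → ℕ}

/-- A step that moves a man is found at the edge that it adds for him, where his former edge is
recorded too. That he moves strictly down is automatic, since equal heights would mean the same
edge. -/
theorem SuccChain.movesPast_iff (hc : SuccChain G z Ms) (hR : Represents D G num)
    (hr : Recorded G num Ms (fun r _ => r < z) i o pe pw) {x : Fin a} {y : Fin b}
    (hxy : (x, y) ∈ G.edges) {k : ℕ} : k < z ∧ MovesPast G (Ms k ∆ Ms (k + 1)) x y ↔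
      ∃ y₂, (x, y₂) ∈ G.edges ∧ i (num x y₂) = k + 1 ∧ y₂ ≠ y ∧
        D.ER (pe (num x y₂) - 1) ≤ D.ER (num x y) ∧ D.ER (num x y) ≤ D.ER (num x y₂) := by
  constructor
  · rintro ⟨hk, y₁, y₂, h1, h2, h3, h4⟩
    obtain ⟨g1, g2, g3⟩ := (movesDown_iff (hc.succ k hk)).1 h1
    have hne : (x, y₂) ∉ Ms k := fun hh => by
      rw [(hc.succ k hk).1.1.right_unique g1 hh] at g3
      omega
    have he := (hc.succ k hk).2.1.1.1 g2
    refine ⟨y₂, he, (hr.ins he k).2 ⟨hk, g2, hne⟩, h2, ?_, ?_⟩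
    · rw [hr.prevA hk g2 hne g1, Nat.add_sub_cancel, hR.er ((hc.succ k hk).1.1.1 g1), hR.er hxy]
      exact h3
    · rw [hR.er hxy, hR.er he]
      exact h4
  · rintro ⟨y₂, he, h1, h2, h3, h4⟩
    obtain ⟨hk, g1, g2⟩ := (hr.ins he k).1 h1
    have hs := hc.succ k hk
    obtain ⟨y₁, g3⟩ := exists_partnerA hs.2.1 hs.1 g1
    rw [hr.prevA hk g1 g2 g3, Nat.add_sub_cancel, hR.er (hs.1.1.1 g3), hR.er hxy] at h3
    rw [hR.er hxy, hR.er he] at h4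
    refine ⟨hk, y₁, y₂, (movesDown_iff hs).2 ⟨g3, g1, lt_of_le_of_ne (h3.trans h4) fun hh => ?_⟩,
      h2, h3, h4⟩
    refine g2 ((mem_iff_of_height_eq hs.2.1 hs.1 ?_ y₂).1 g1)
    rw [height_eq hs.2.1.1 g1, height_eq hs.1.1 g3, hh]

theorem SuccChain.movesAbove_iff (hc : SuccChain G z Ms) (hR : Represents D G num)
    (hr : Recorded G num Ms (fun r _ => r < z) i o pe pw) {x : Fin a} {y : Fin b}
    (hxy : (x, y) ∈ G.edges) {k : ℕ} : k < z ∧ MovesAbove G (Ms k ∆ Ms (k + 1)) y x ↔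
      ∃ x₂, (x₂, y) ∈ G.edges ∧ i (num x₂ y) = k + 1 ∧
        D.EB (num x₂ y) < D.EB (num x y) ∧ D.EB (num x y) ≤ D.EB (pw (num x₂ y) - 1) := by
  constructor
  · rintro ⟨hk, x₁, x₂, h1, h2, h3⟩
    obtain ⟨g1, g2, g3⟩ := (movesUp_iff (hc.succ k hk)).1 h1
    have hne : (x₂, y) ∉ Ms k := fun hh => by
      rw [(hc.succ k hk).1.1.left_unique g1 hh] at g3
      omega
    have he := (hc.succ k hk).2.1.1.1 g2
    refine ⟨x₂, he, (hr.ins he k).2 ⟨hk, g2, hne⟩, ?_, ?_⟩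
    · rw [hR.eb hxy, hR.eb he]
      exact h2
    · rw [hr.prevB hk g2 hne g1, Nat.add_sub_cancel, hR.eb ((hc.succ k hk).1.1.1 g1), hR.eb hxy]
      exact h3
  · rintro ⟨x₂, he, h1, h2, h3⟩
    obtain ⟨hk, g1, g2⟩ := (hr.ins he k).1 h1
    have hs := hc.succ k hk
    obtain ⟨x₁, g3⟩ := exists_partnerB hs.2.1 hs.1 g1
    rw [hr.prevB hk g1 g2 g3, Nat.add_sub_cancel, hR.eb (hs.1.1.1 g3), hR.eb hxy] at h3
    rw [hR.eb hxy, hR.eb he] at h2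
    exact ⟨hk, x₁, x₂, (movesUp_iff hs).2 ⟨g3, g1, h2.trans_le h3⟩, h2, h3⟩

/-- Women only improve along the sequence, so the level of x on the list of y is crossed at most
once. -/
theorem SuccChain.movesAbove_unique (hc : SuccChain G z Ms) {x : Fin a} {y : Fin b} {k l : ℕ}
    (hk : k < z) (hl : l < z) (h : MovesAbove G (Ms k ∆ Ms (k + 1)) y x)
    (h' : MovesAbove G (Ms l ∆ Ms (l + 1)) y x) : k = l := by
  have key : ∀ {k l : ℕ}, k < l → l < z → MovesAbove G (Ms k ∆ Ms (k + 1)) y x →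
      MovesAbove G (Ms l ∆ Ms (l + 1)) y x → False := by
    rintro k l hkl hl ⟨x₁, x₂, h1, h2, -⟩ ⟨x₃, x₄, h3, -, h4⟩
    have hs := hc.succ k (by omega)
    have hs' := hc.succ l hl
    have g1 := ((movesUp_iff hs).1 h1).2.1
    have g2 := ((movesUp_iff hs').1 h3).1
    have := heightB_antitone hs.2.1 hs'.1 (fun v => hc.mono (by omega) (by omega) v) y
    rw [heightB_eq hs.2.1.1 g1, heightB_eq hs'.1.1 g2] at this
    exact lt_irrefl _ (h2.trans_le (h4.trans this))
  rcases lt_trichotomy k l with hlt | rfl | hlt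
  · exact (key hlt hl h h').elim
  · rfl
  · exact (key hlt hk h' h).elim

/-- The numbers of the edges can be looked up in `t`. -/
def Indexed (G : Instance (Fin a) (Fin b)) (num : Fin a → Fin b → ℕ) (t : ℕ → ℕ) : Prop :=
  ∀ (x : Fin a) (y : Fin b), (t (x * b + y) = 0 ∧ (x, y) ∉ G.edges) ∨
    t (x * b + y) = num x y + 1 ∧ (x, y) ∈ G.edges

/-- Register `20` becomes one plus the index of the rotation that moves the woman of the edge in
register `11` above its man, or `0`. -/
def aboveCode : Cmd :=
  20 ::= cst 0 ;;
  15 ::= cst 0 ;;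
  forLoop 15 0
    (4 ::= rd 7 (vr 15 *. vr 1 +. vr 5) ;;
      .cond (vr 4)
        (.cond (rd 18 (vr 4 -. cst 1))
          (.cond (rd 5 (vr 4 -. cst 1) <. rd 5 (vr 11))
            (.cond (rd 5 (rd 21 (vr 4 -. cst 1) -. cst 1) <. rd 5 (vr 11)) .skip
              (20 ::= rd 18 (vr 4 -. cst 1)))
            .skip)
          .skip)
        .skip)

/-- All possible new partners of the woman are tried. Since at most one rotation qualifies, it does
not matter that a later hit overwrites an earlier one. -/
theorem wp_aboveCode (hR : Represents D G num) {n : ℕ} (hn : n = D.a + D.b + D.m + 2)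
    (hW : n ^ 2 * 32 ≤ W) {k K : ℕ} {s : State} (hL : Loaded D s) (hc : SuccChain G z Ms)
    (hr : Recorded G num Ms (fun r _ => r < z) (s.arr 18) (s.arr 19) (s.arr 20) (s.arr 21))
    (hi : Indexed G num (s.arr 7)) {x : Fin a} {y : Fin b} (hxy : (x, y) ∈ G.edges)
    (h11 : s.reg 11 = num x y) (h5 : s.reg 5 = y) (hk : K + 60 * D.a + 20 ≤ k) :
    wp W aboveCode (fun k' s' => K ≤ k' ∧ ∀ l, s'.reg 20 = l + 1 ↔
      l < z ∧ MovesAbove G (Ms l ∆ Ms (l + 1)) y x) k s := by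
  have hn2 : n ≤ n ^ 2 := Nat.le_self_pow (by omega) n
  have haa := hR.ha
  have hbb := hR.hb
  refine ⟨by simp; omega, by simp; omega, by simp; omega, by simp; omega, ?_⟩
  refine wp_forLoop (N := D.a) (j₀ := 0) (fun j k' s' => K + 60 * (D.a - j) + 10 ≤ k' ∧
      (∀ l, s'.reg 20 = l + 1 → l < z ∧ MovesAbove G (Ms l ∆ Ms (l + 1)) y x) ∧
      (s'.reg 20 = 0 → ∀ x₂ : Fin a, x₂.val < j → ∀ l, ¬ ((x₂, y) ∈ G.edges ∧
        s.arr 18 (num x₂ y) = l + 1 ∧ D.EB (num x₂ y) < D.EB (num x y) ∧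
        D.EB (num x y) ≤ D.EB (s.arr 21 (num x₂ y) - 1))))
    (by simp [hL.a]) (by omega) (by simp) (by omega) (by decide) rfl rfl ?_ ?_ ?_
  · simp
    omega
  · rintro j k₀ s₀ hj hrj hf ⟨i1, i2, i3⟩
    have hja : j < a := by rwa [hR.ha] at hj
    have f1 : s₀.reg 1 = b := by rw [← hbb, ← hL.b]; exact (hf.reg 1 rfl).trans (by simp)
    have f5 : s₀.reg 5 = y := (hf.reg 5 rfl).trans (by simp [h5])
    have f11 : s₀.reg 11 = num x y := (hf.reg 11 rfl).trans (by simp [h11])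
    have g5 : s₀.arr 5 = D.EB := (hf.arr 5 rfl).trans (by simp [hL.eb])
    have g7 : s₀.arr 7 = s.arr 7 := (hf.arr 7 rfl).trans (by simp)
    have g18 : s₀.arr 18 = s.arr 18 := (hf.arr 18 rfl).trans (by simp)
    have g21 : s₀.arr 21 = s.arr 21 := (hf.arr 21 rfl).trans (by simp)
    have hmul : j * b + y < n ^ 2 := by
      have h1 : j * b + b ≤ D.a * D.b := by
        rw [haa, hbb]
        calc j * b + b = (j + 1) * b := by ring
          _ ≤ a * b := Nat.mul_le_mul_right _ hja
      have h2 : D.a * D.b ≤ n ^ 2 := by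
        rw [sq]
        exact Nat.mul_le_mul (by omega) (by omega)
      have := y.2
      omega
    have step : (s₀.reg 20 = 0 → ∀ l, ¬ ((⟨j, hja⟩, y) ∈ G.edges ∧
        s.arr 18 (num ⟨j, hja⟩ y) = l + 1 ∧ D.EB (num ⟨j, hja⟩ y) < D.EB (num x y) ∧
        D.EB (num x y) ≤ D.EB (s.arr 21 (num ⟨j, hja⟩ y) - 1))) →
        (s₀.reg 20 = 0 → ∀ x₂ : Fin a, x₂.val < j + 1 → ∀ l, ¬ ((x₂, y) ∈ G.edges ∧
        s.arr 18 (num x₂ y) = l + 1 ∧ D.EB (num x₂ y) < D.EB (num x y) ∧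
        D.EB (num x y) ≤ D.EB (s.arr 21 (num x₂ y) - 1))) := by
      intro h h0 x₂ hx
      rcases Nat.lt_succ_iff_lt_or_eq.1 hx with hx | hx
      · exact i3 h0 x₂ hx
      · obtain rfl : x₂ = ⟨j, hja⟩ := Fin.ext hx
        exact h h0
    refine ⟨by omega, ⟨⟨trivial, trivial, ?_⟩, trivial, ?_⟩, by simp; omega, ?_⟩
    · simp [hrj, f1]; omega
    · simp [hrj, f1, f5]; omega
    rcases hi ⟨j, hja⟩ y with ⟨v0, v1⟩ | ⟨v0, v1⟩
    · simp only at v0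
      simp [hrj, f1, f5, g7, v0]
      and_intros
      any_goals omega
      · simpa [Nat.lt_succ_iff] using step (fun _ l hh => v1 hh.1)
    · simp only at v0
      simp [hrj, f1, f5, f11, g5, g7, g18, g21, v0]
      and_intros
      any_goals omega
      intro n1
      and_intros
      any_goals omega
      · intro n2
        and_intros
        any_goals omega
        · intro n3
          and_intros
          any_goals omega
          · simpa [Nat.lt_succ_iff] using step (fun _ l hh => by omega)
        · intro n3
          and_intros
          any_goals omega
          · intro l hl
            exact (hc.movesAbove_iff hR hr hxy).2 ⟨_, v1, hl, n2, n3⟩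
      · intro n2
        and_intros
        any_goals omega
        · simpa [Nat.lt_succ_iff] using step (fun _ l hh => by omega)
      · intro n1
        and_intros
        any_goals omega
        · simpa [Nat.lt_succ_iff] using step (fun _ l hh => by omega)
  · rintro k₀ s₀ hrj hf ⟨i1, i2, i3⟩
    refine ⟨by omega, by omega, fun l => ⟨i2 l, fun hl => ?_⟩⟩
    have h0 : s₀.reg 20 ≠ 0 := fun h0 => by
      obtain ⟨x₂, hx₂⟩ := (hc.movesAbove_iff hR hr hxy).1 hl
      exact i3 h0 x₂ (by rw [haa]; exact x₂.2) l hx₂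
    obtain ⟨l', hl'⟩ := Nat.exists_eq_succ_of_ne_zero h0
    have := i2 l' hl'
    rw [hl', hc.movesAbove_unique hl.1 this.1 hl.2 this.2]

/-- The numbers in a list of pairs. -/
def flatArcs (ν : List (ℕ × ℕ)) : List ℕ := ν.flatMap fun p => [p.1, p.2]

theorem length_flatArcs (ν : List (ℕ × ℕ)) : (flatArcs ν).length = 2 * ν.length := by
  induction ν with
  | nil => rfl
  | cons p ν ih => simp only [flatArcs, List.flatMap_cons, List.length_append] at ih ⊢; simp [ih]; omega

/-- For the edge in register `11`, with the man in register `3` and the woman in register `5`, and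
the rotation in register `20`, the arcs from this rotation to those that move the man past the woman
are put out. -/
def pastCode : Cmd :=
  15 ::= cst 0 ;;
  forLoop 15 1
    (4 ::= rd 7 (vr 3 *. vr 1 +. vr 15) ;;
      .cond (vr 4)
        (.cond (rd 18 (vr 4 -. cst 1))
          (.cond (rd 18 (vr 4 -. cst 1) =. vr 20) .skip
            (.cond (vr 15 =. vr 5) .skip
              (.cond (rd 4 (vr 11) <. rd 4 (rd 20 (vr 4 -. cst 1) -. cst 1)) .skip
                (.cond (rd 4 (vr 4 -. cst 1) <. rd 4 (vr 11)) .skip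
                  (emit (vr 20 -. cst 1) ;; emit (rd 18 (vr 4 -. cst 1) -. cst 1) ;;
                    22 ::= vr 22 +. cst 1)))))
          .skip)
        .skip)

/-- The rotation `k` moves `x` past `y` and down to `y₂`. -/
def PastBy (D : FlatInstance) (G : Instance (Fin a) (Fin b)) (num : Fin a → Fin b → ℕ)
    (i pe : ℕ → ℕ) (x : Fin a) (y : Fin b) (k : ℕ) (y₂ : Fin b) : Prop :=
  (x, y₂) ∈ G.edges ∧ i (num x y₂) = k + 1 ∧ y₂ ≠ y ∧
    D.ER (pe (num x y₂) - 1) ≤ D.ER (num x y) ∧ D.ER (num x y) ≤ D.ER (num x y₂)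

theorem exists_lt_succ_iff {P : Fin b → Prop} {j : ℕ} (hj : j < b) :
    (∃ y : Fin b, y.val < j + 1 ∧ P y) ↔ (∃ y : Fin b, y.val < j ∧ P y) ∨ P ⟨j, hj⟩ := by
  constructor
  · rintro ⟨y, h1, h2⟩
    rcases Nat.lt_succ_iff_lt_or_eq.1 h1 with h | h
    · exact Or.inl ⟨y, h, h2⟩
    · obtain rfl : y = ⟨j, hj⟩ := Fin.ext h
      exact Or.inr h2
  · rintro (⟨y, h1, h2⟩ | h)
    · exact ⟨y, by omega, h2⟩
    · exact ⟨_, Nat.lt_succ_self j, h⟩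

/-- Each woman who could be the new partner of the man contributes at most one arc. This bounds the
output as well as the time by the number of women. -/
theorem wp_pastCode (hR : Represents D G num) {n : ℕ} (hn : n = D.a + D.b + D.m + 2)
    (hW : n ^ 2 * 32 ≤ W) {k K B : ℕ} {L : List ℕ} {s : State} (hL : Loaded D s)
    (hc : SuccChain G z Ms)
    (hr : Recorded G num Ms (fun r _ => r < z) (s.arr 18) (s.arr 19) (s.arr 20) (s.arr 21))
    (hi : Indexed G num (s.arr 7)) {x : Fin a} {y : Fin b} (hxy : (x, y) ∈ G.edges)
    (h11 : s.reg 11 = num x y) (h3 : s.reg 3 = x) (h5 : s.reg 5 = y) (h20 : s.reg 20 ≠ 0)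
    (hB : B + 4 < W) (hlen : L.length + 2 * D.b ≤ B) (h22 : s.reg 22 + D.b ≤ B)
    (hout : OutAt (s.arr 1) (s.reg 18) L) (hk : K + 80 * D.b + 20 ≤ k) :
    wp W pastCode (fun k' s' => K ≤ k' ∧ ∃ ν : List (ℕ × ℕ), ν.length ≤ D.b ∧
      s'.reg 22 = s.reg 22 + ν.length ∧ OutAt (s'.arr 1) (s'.reg 18) (L ++ flatArcs ν) ∧
      ∀ l r, (l, r) ∈ ν ↔ s.reg 20 = l + 1 ∧ l ≠ r ∧
        r < z ∧ MovesPast G (Ms r ∆ Ms (r + 1)) x y) k s := by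
  have hn2 : n ≤ n ^ 2 := Nat.le_self_pow (by omega) n
  have haa := hR.ha
  have hbb := hR.hb
  refine ⟨by simp; omega, by simp; omega, ?_⟩
  refine wp_forLoop (N := D.b) (j₀ := 0) (fun j k' s' => K + 80 * (D.b - j) + 10 ≤ k' ∧
      ∃ ν : List (ℕ × ℕ), ν.length ≤ j ∧
      s'.reg 22 = s.reg 22 + ν.length ∧ OutAt (s'.arr 1) (s'.reg 18) (L ++ flatArcs ν) ∧
      ∀ l r, (l, r) ∈ ν ↔ s.reg 20 = l + 1 ∧ l ≠ r ∧
        ∃ y₂ : Fin b, y₂.val < j ∧ PastBy D G num (s.arr 18) (s.arr 20) x y r y₂)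
    (by simp [hL.b]) (by omega) (by simp) (by omega) (by decide) rfl rfl ?_ ?_ ?_
  · simp
    exact ⟨by omega, by simpa [flatArcs] using hout⟩
  · rintro j k₀ s₀ hj hrj hf ⟨i1, ν, i2, i3, i4, i5⟩
    have hjb : j < b := by rwa [hR.hb] at hj
    have f1 : s₀.reg 1 = b := by rw [← hbb, ← hL.b]; exact (hf.reg 1 rfl).trans (by simp)
    have f3 : s₀.reg 3 = x := (hf.reg 3 rfl).trans (by simp [h3])
    have f5 : s₀.reg 5 = y := (hf.reg 5 rfl).trans (by simp [h5])
    have f11 : s₀.reg 11 = num x y := (hf.reg 11 rfl).trans (by simp [h11])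
    have f20 : s₀.reg 20 = s.reg 20 := (hf.reg 20 rfl).trans (by simp)
    have g4 : s₀.arr 4 = D.ER := (hf.arr 4 rfl).trans (by simp [hL.er])
    have g7 : s₀.arr 7 = s.arr 7 := (hf.arr 7 rfl).trans (by simp)
    have g18 : s₀.arr 18 = s.arr 18 := (hf.arr 18 rfl).trans (by simp)
    have g20 : s₀.arr 20 = s.arr 20 := (hf.arr 20 rfl).trans (by simp)
    have hol := i4.1
    simp [length_flatArcs] at hol
    have hmul : x * b + j < n ^ 2 := by
      have h1 : x * b + b ≤ D.a * D.b := by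
        rw [haa, hbb]
        calc x * b + b = (x + 1) * b := by ring
          _ ≤ a * b := Nat.mul_le_mul_right _ x.2
      have h2 : D.a * D.b ≤ n ^ 2 := by
        rw [sq]
        exact Nat.mul_le_mul (by omega) (by omega)
      omega
    have keep : (∀ l r, s.reg 20 = l + 1 → l ≠ r →
        ¬ PastBy D G num (s.arr 18) (s.arr 20) x y r ⟨j, hjb⟩) → ∀ l r, (l, r) ∈ ν ↔
        s.reg 20 = l + 1 ∧ l ≠ r ∧
        ∃ y₂ : Fin b, y₂.val < j + 1 ∧ PastBy D G num (s.arr 18) (s.arr 20) x y r y₂ := by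
      intro h l r
      rw [i5, exists_lt_succ_iff hjb]
      refine and_congr_right fun h1 => and_congr_right fun h2 => ?_
      rw [or_iff_left (h l r h1 h2)]
    have done : ∀ {k' : ℕ} {s' : State}, s'.reg 22 = s₀.reg 22 → s'.reg 18 = s₀.reg 18 →
        s'.arr 1 = s₀.arr 1 → K + 80 * (D.b - (j + 1)) + 14 ≤ k' → (∀ l r, s.reg 20 = l + 1 → l ≠ r →
        ¬ PastBy D G num (s.arr 18) (s.arr 20) x y r ⟨j, hjb⟩) → 4 ≤ k' ∧
        K + 80 * (D.b - (j + 1)) + 10 ≤ k' - 4 ∧ ∃ ν : List (ℕ × ℕ), ν.length ≤ j + 1 ∧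
        (s'.setReg 15 (j + 1)).reg 22 = s.reg 22 + ν.length ∧
        OutAt ((s'.setReg 15 (j + 1)).arr 1) ((s'.setReg 15 (j + 1)).reg 18) (L ++ flatArcs ν) ∧
        ∀ l r, (l, r) ∈ ν ↔ s.reg 20 = l + 1 ∧ l ≠ r ∧
        ∃ y₂ : Fin b, y₂.val < j + 1 ∧ PastBy D G num (s.arr 18) (s.arr 20) x y r y₂ := by
      intro k' s' e1 e2 e3 e4 e5
      exact ⟨by omega, by omega, ν, by omega, by simp [e1, i3], by simpa [e2, e3] using i4, keep e5⟩
    refine ⟨by omega, ⟨⟨trivial, trivial, ?_⟩, trivial, ?_⟩, by simp; omega, ?_⟩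
    · simp [f3, f1]
      omega
    · simp [hrj, f1, f3]
      omega
    rcases hi x ⟨j, hjb⟩ with ⟨v0, v1⟩ | ⟨v0, v1⟩
    · simp only at v0
      refine ⟨trivial, by simp; omega, fun h => ?_, fun h => ⟨by simp; omega, ?_⟩⟩
      · simp [hrj, f1, f3, g7, v0] at h
      · exact done (by simp) (by simp) (by simp) (by simp; omega) fun l r _ _ hh => v1 hh.1
    simp only at v0
    have hev : (Exp.eval s₀ (rd 7 (vr 3 *. vr 1 +. vr 15))) = num x ⟨j, hjb⟩ + 1 := by
      simp [hrj, f1, f3, g7, v0]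
    rw [hev]
    refine ⟨trivial, by simp; omega, fun _ => ?_, fun h => by simp at h⟩
    refine ⟨⟨trivial, by simp; omega⟩, by simp; omega, fun q1 => ?_, fun q1 => ⟨by simp; omega, ?_⟩⟩
    swap
    · simp [g18] at q1
      exact done (by simp) (by simp) (by simp) (by simp; omega) fun l r _ _ hh => by
        have := hh.2.1
        omega
    simp [g18] at q1
    refine ⟨⟨⟨trivial, by simp; omega⟩, trivial, by omega⟩, by simp; omega,
      fun q2 => ⟨by simp; omega, ?_⟩, fun q2 => ?_⟩
    · simp [g18, f20] at q2
      exact done (by simp) (by simp) (by simp) (by simp; omega) fun l r h1 h2 hh => by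
        have := hh.2.1
        omega
    simp [g18, f20] at q2
    refine ⟨⟨trivial, trivial, by omega⟩, by simp; omega,
      fun q3 => ⟨by simp; omega, ?_⟩, fun q3 => ?_⟩
    · simp [hrj, f5] at q3
      exact done (by simp) (by simp) (by simp) (by simp; omega) fun l r h1 h2 hh =>
        hh.2.2.1 (Fin.ext q3)
    simp [hrj, f5] at q3
    refine ⟨⟨trivial, ⟨⟨trivial, by simp; omega⟩, by simp; omega⟩, by omega⟩, by simp; omega,
      fun q4 => ⟨by simp; omega, ?_⟩, fun q4 => ?_⟩
    · simp [f11, g20, g4] at q4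
      exact done (by simp) (by simp) (by simp) (by simp; omega) fun l r h1 h2 hh => by
        have := hh.2.2.2.1
        omega
    simp [f11, g20, g4] at q4
    refine ⟨⟨⟨trivial, by simp; omega⟩, trivial, by omega⟩, by simp; omega,
      fun q5 => ⟨by simp; omega, ?_⟩, fun q5 => ?_⟩
    · simp [f11, g4] at q5
      exact done (by simp) (by simp) (by simp) (by simp; omega) fun l r h1 h2 hh => by
        have := hh.2.2.2.2
        omega
    simp [f11, g4] at q5
    refine wp_emit (by simp; omega) (by simp; omega) (by simp; omega) ?_
    refine wp_emit (by simp; omega) (by simp; omega) (by simp; omega) ?_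
    refine ⟨⟨trivial, by simp; omega, by simp; omega⟩, by simp; omega, by simp; omega, by simp; omega,
      ν ++ [(s.reg 20 - 1, s.arr 18 (num x ⟨j, hjb⟩) - 1)], by simpa using i2, by simp [i3]; omega,
      ?_, fun l r => ?_⟩
    · have := (i4.push (s.reg 20 - 1)).push (s.arr 18 (num x ⟨j, hjb⟩) - 1)
      simpa [flatArcs, f20, g18] using this
    · rw [exists_lt_succ_iff hjb, and_or_left, and_or_left, ← i5]
      simp only [List.mem_append, List.mem_cons, List.not_mem_nil, or_false, Prod.mk.injEq]
      refine or_congr_right ?_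
      constructor
      · rintro ⟨rfl, rfl⟩
        exact ⟨by omega, by omega, v1, by omega, fun hh => q3 (congrArg Fin.val hh), q4, q5⟩
      · rintro ⟨h1, -, h2⟩
        have := h2.2.1
        omega
  · rintro k₀ s₀ hrj hf ⟨i1, ν, i2, i3, i4, i5⟩
    refine ⟨by omega, by omega, ν, i2, i3, i4, fun l r => ?_⟩
    rw [i5, hc.movesPast_iff hR hr hxy, hbb]
    simp only [Fin.is_lt, true_and, PastBy]

end SuperStable

/-! ### The arcs of both types, collected edge by edge -/

namespace SuperStable

open FlatInstance

variable {D : FlatInstance} {a b : ℕ} {G : Instance (Fin a) (Fin b)} {num : Fin a → Fin b → ℕ}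
  {W z : ℕ} {Ms : ℕ → Finset (Fin a × Fin b)} {i o pe pw : ℕ → ℕ}

/-- The edge `(x, y)` is added by the rotation `l` and removed by the rotation `r`. -/
def PassedOn (z : ℕ) (Ms : ℕ → Finset (Fin a × Fin b)) (l r : ℕ) (x : Fin a) (y : Fin b) : Prop :=
  (l < z ∧ (x, y) ∈ Ms (l + 1) ∧ (x, y) ∉ Ms l) ∧ r < z ∧ (x, y) ∈ Ms r ∧ (x, y) ∉ Ms (r + 1)

/-- The edge `(x, y)` is the reason for an arc of the second type. -/
def Overtaken (G : Instance (Fin a) (Fin b)) (z : ℕ) (Ms : ℕ → Finset (Fin a × Fin b)) (l r : ℕ)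
    (x : Fin a) (y : Fin b) : Prop :=
  (l < z ∧ MovesAbove G (Ms l ∆ Ms (l + 1)) y x) ∧ l ≠ r ∧
    r < z ∧ MovesPast G (Ms r ∆ Ms (r + 1)) x y

/-- The common woman of the two moves gives an edge that one step adds and the other removes.
Conversely, a man whose edge changes moves strictly down. -/
theorem SuccChain.typeOne_iff (hc : SuccChain G z Ms) {l r : ℕ} (hl : l < z) (hr : r < z) :
    TypeOne G (Ms l ∆ Ms (l + 1)) (Ms r ∆ Ms (r + 1)) ↔ ∃ x y, PassedOn z Ms l r x y := by
  have h1 := hc.succ l hl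
  have h2 := hc.succ r hr
  constructor
  · rintro ⟨x, y₁, y, y₂, h3, h4⟩
    rw [movesDown_iff h1] at h3
    rw [movesDown_iff h2] at h4
    refine ⟨x, y, ⟨hl, h3.2.1, fun h => ?_⟩, hr, h4.1, fun h => ?_⟩
    · rw [h1.1.1.right_unique h h3.1] at h3
      omega
    · rw [h2.2.1.1.right_unique h h4.2.1] at h4
      omega
  · rintro ⟨x, y, ⟨-, h3, h4⟩, -, h5, h6⟩
    obtain ⟨y₁, h7⟩ := exists_partnerA h1.2.1 h1.1 h3
    obtain ⟨y₂, h8⟩ := exists_partnerA h2.1 h2.2.1 h5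
    refine ⟨x, y₁, y, y₂, (movesDown_iff h1).2 ⟨h7, h3, ?_⟩, (movesDown_iff h2).2 ⟨h5, h8, ?_⟩⟩
    · rw [← height_eq h1.1.1 h7, ← height_eq h1.2.1.1 h3]
      exact lt_of_le_of_ne (h1.le x) fun hh => h4 ((mem_iff_of_height_eq h1.1 h1.2.1 hh y).2 h3)
    · rw [← height_eq h2.1.1 h5, ← height_eq h2.2.1.1 h8]
      exact lt_of_le_of_ne (h2.le x) fun hh => h6 ((mem_iff_of_height_eq h2.1 h2.2.1 hh y).1 h5)

/-- Different steps have different rotations, because a man moved by the earlier step has left his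
old edge for good. So the condition that the rotations differ becomes one on indices. -/
theorem SuccChain.typeTwo_iff (hc : SuccChain G z Ms) {l r : ℕ} (hl : l < z) (hr : r < z) :
    TypeTwo G (Ms l ∆ Ms (l + 1)) (Ms r ∆ Ms (r + 1)) ↔
      ∃ x y, (x, y) ∈ G.edges ∧ Overtaken G z Ms l r x y := by
  have hne : l ≠ r → Ms l ∆ Ms (l + 1) ≠ Ms r ∆ Ms (r + 1) := by
    have key : ∀ {l r}, l < r → r < z → Ms l ∆ Ms (l + 1) ≠ Ms r ∆ Ms (r + 1) := by
      intro l r hlr hr heq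
      have hs := hc.succ r hr
      have hs' := hc.succ l (by omega)
      obtain ⟨x, hx⟩ := hs'.exists_lt
      obtain ⟨y, y', h1, h2⟩ := exists_mem_of_height_lt hs'.1 hs'.2.1 hx.ne
      have h3 := (movesDown_iff hs').2 ⟨h1, h2, by
        rwa [height_eq hs'.1.1 h1, height_eq hs'.2.1.1 h2] at hx⟩
      rw [heq] at h3
      have h4 := ((movesDown_iff hs).1 h3).1
      have h5 := hc.mono (i := l + 1) (j := r) (by omega) (by omega) x
      rw [height_eq hs.1.1 h4, ← height_eq hs'.1.1 h1] at h5
      omega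
    intro h
    rcases lt_or_gt_of_ne h with h | h
    · exact key h hr
    · exact (key h hl).symm
  constructor
  · rintro ⟨h0, x, y, h1, h2, h3⟩
    exact ⟨x, y, h1, ⟨hl, h3⟩, fun h => h0 (by rw [h]), hr, h2⟩
  · rintro ⟨x, y, h1, ⟨-, h3⟩, h0, -, h2⟩
    exact ⟨hne h0, x, y, h1, h2, h3⟩

theorem SuccChain.labelEdge_iff (hc : SuccChain G z Ms) {l r : ℕ} (hl : l < z) (hr : r < z) :
    LabelEdge G (Ms l ∆ Ms (l + 1)) (Ms r ∆ Ms (r + 1)) ↔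
      ∃ x y, (x, y) ∈ G.edges ∧ (PassedOn z Ms l r x y ∨ Overtaken G z Ms l r x y) := by
  have h1 : LabelEdge G (Ms l ∆ Ms (l + 1)) (Ms r ∆ Ms (r + 1)) ↔
      TypeOne G (Ms l ∆ Ms (l + 1)) (Ms r ∆ Ms (r + 1)) ∨
      TypeTwo G (Ms l ∆ Ms (l + 1)) (Ms r ∆ Ms (r + 1)) :=
    ⟨fun h => h.2.2, fun h => ⟨⟨_, _, hc.succ l hl, rfl⟩, ⟨_, _, hc.succ r hr, rfl⟩, h⟩⟩
  rw [h1, hc.typeOne_iff hl hr, hc.typeTwo_iff hl hr]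
  constructor
  · rintro (⟨x, y, h⟩ | ⟨x, y, h, h'⟩)
    · exact ⟨x, y, (hc.stable (i := r) hr.le).1.1 h.2.2.1, Or.inl h⟩
    · exact ⟨x, y, h, Or.inr h'⟩
  · rintro ⟨x, y, h, hp | ho⟩
    · exact Or.inl ⟨x, y, hp⟩
    · exact Or.inr ⟨x, y, h, ho⟩

/-- The arcs of the rotation digraph are put out. -/
def arcsCode : Cmd :=
  21 ::= vr 18 ;;
  22 ::= cst 0 ;;
  emit (cst 0) ;;
  11 ::= cst 0 ;;
  forLoop 11 2
    (3 ::= rd 2 (vr 11) ;;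
      5 ::= rd 3 (vr 11) ;;
      .cond (rd 18 (vr 11))
        (.cond (rd 19 (vr 11))
          (emit (rd 18 (vr 11) -. cst 1) ;; emit (rd 19 (vr 11) -. cst 1) ;; 22 ::= vr 22 +. cst 1)
          .skip)
        .skip ;;
      aboveCode ;;
      .cond (vr 20) pastCode .skip) ;;
  .store 1 (vr 21) (vr 22)

theorem Represents.exists_lt_succ_iff (hR : Represents D G num) {P : Fin a → Fin b → Prop}
    {x : Fin a} {y : Fin b} (hxy : (x, y) ∈ G.edges) :
    (∃ x' y', (x', y') ∈ G.edges ∧ num x' y' < num x y + 1 ∧ P x' y') ↔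
      (∃ x' y', (x', y') ∈ G.edges ∧ num x' y' < num x y ∧ P x' y') ∨ P x y := by
  constructor
  · rintro ⟨x', y', h1, h2, h3⟩
    rcases Nat.lt_succ_iff_lt_or_eq.1 h2 with h | h
    · exact Or.inl ⟨x', y', h1, h, h3⟩
    · obtain ⟨rfl, rfl⟩ := hR.num_inj h1 hxy h
      exact Or.inr h3
  · rintro (⟨x', y', h1, h2, h3⟩ | h)
    · exact ⟨x', y', h1, by omega, h3⟩
    · exact ⟨x, y, hxy, by omega, h⟩

theorem encodePairs_eq (ν : List (ℕ × ℕ)) : encodePairs ν = ν.length :: flatArcs ν := rfl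

/-- An edge gives at most one arc of the first type and at most one per woman of the second. The
same arc may be put out for several edges, which does not matter for the set of arcs. -/
theorem wp_arcsCode (hR : Represents D G num) {n : ℕ} (hn : n = D.a + D.b + D.m + 2)
    (hW : n ^ 2 * 32 ≤ W) {k K B : ℕ} {L : List ℕ} {s : State} (hL : Loaded D s)
    (hc : SuccChain G z Ms)
    (hr : Recorded G num Ms (fun r _ => r < z) (s.arr 18) (s.arr 19) (s.arr 20) (s.arr 21))
    (hi : Indexed G num (s.arr 7)) (hB : B + 8 < W)
    (hlen : L.length + 2 * (D.m * (D.b + 1)) + 2 ≤ B) (hout : OutAt (s.arr 1) (s.reg 18) L)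
    (hk : K + D.m * (60 * D.a + 80 * D.b + 120) + 40 ≤ k) :
    wp W arcsCode (fun k' s' => K ≤ k' ∧ ∃ arcs : List (ℕ × ℕ),
      OutAt (s'.arr 1) (s'.reg 18) (L ++ encodePairs arcs) ∧
      ∀ l r, (l, r) ∈ arcs ↔ ∃ x y, (x, y) ∈ G.edges ∧
        (PassedOn z Ms l r x y ∨ Overtaken G z Ms l r x y)) k s := by
  have hn2 : n ≤ n ^ 2 := Nat.le_self_pow (by omega) n
  have hol := hout.1
  refine ⟨trivial, by simp; omega, by simp; omega, by simp; omega, ?_⟩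
  refine wp_emit (by simp; omega) (by simp; omega) (by simp; omega) ?_
  refine ⟨by simp; omega, by simp; omega, ?_⟩
  set C := 60 * D.a + 80 * D.b + 120 with hC
  refine wp_seq_frame (wp_forLoop (N := D.m) (j₀ := 0)
    (Q := fun k' s' => K + 6 ≤ k' ∧ ∃ ν : List (ℕ × ℕ), ν.length ≤ D.m * (D.b + 1) ∧
      s'.reg 22 = ν.length ∧ OutAt (s'.arr 1) (s'.reg 18) (L ++ 0 :: flatArcs ν) ∧
      ∀ l r, (l, r) ∈ ν ↔ ∃ x y, (x, y) ∈ G.edges ∧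
        (PassedOn z Ms l r x y ∨ Overtaken G z Ms l r x y))
    (fun j k' s' => K + (D.m - j) * C + 10 ≤ k' ∧
      ∃ ν : List (ℕ × ℕ), ν.length ≤ j * (D.b + 1) ∧
      s'.reg 22 = ν.length ∧ OutAt (s'.arr 1) (s'.reg 18) (L ++ 0 :: flatArcs ν) ∧
      ∀ l r, (l, r) ∈ ν ↔ ∃ x y, (x, y) ∈ G.edges ∧ num x y < j ∧
        (PassedOn z Ms l r x y ∨ Overtaken G z Ms l r x y))
    (by simp [hL.m]) (by omega) (by simp) (by omega) (by decide) rfl rfl ?_ ?_ ?_) ?_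
  · refine ⟨by simp; omega, [], by simp, by simp, ?_, by simp⟩
    simpa [flatArcs] using hout.push 0
  · rintro j k₀ s₀ hj hrj hf ⟨i1, ν, i2, i3, i4, i5⟩
    obtain ⟨x, y, hxy, rfl⟩ := hR.surj j hj
    have hL₀ := (Loaded.mk (D := D) (by simp [hL.a]) (by simp [hL.b]) (by simp [hL.m])
      (by simp [hL.ex]) (by simp [hL.ey]) (by simp [hL.er]) (by simp [hL.eb])
      (by simp [hL.fi])).of_frame hf (by decide) (by decide)
    have g7 : s₀.arr 7 = s.arr 7 := (hf.arr 7 rfl).trans (by simp)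
    have g18 : s₀.arr 18 = s.arr 18 := (hf.arr 18 rfl).trans (by simp)
    have g19 : s₀.arr 19 = s.arr 19 := (hf.arr 19 rfl).trans (by simp)
    have g20 : s₀.arr 20 = s.arr 20 := (hf.arr 20 rfl).trans (by simp)
    have g21 : s₀.arr 21 = s.arr 21 := (hf.arr 21 rfl).trans (by simp)
    have hol' := i4.1
    simp [length_flatArcs] at hol'
    have hle : num x y * (D.b + 1) + (D.b + 1) ≤ D.m * (D.b + 1) := by
      rw [← Nat.succ_mul]
      exact Nat.mul_le_mul_right _ hj
    have hmC : (D.m - num x y) * C = (D.m - (num x y + 1)) * C + C := by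
      rw [← Nat.succ_mul]
      congr 1
      omega
    refine ⟨by omega, trivial, by simp; omega, trivial, by simp; omega, ?_⟩
    set s₁ : State := (s₀.setReg 3 _).setReg 5 _ with hs₁
    have r3 : s₁.reg 3 = x := by simp [hs₁, hrj, hL₀.ex, hR.ex hxy]
    have r5 : s₁.reg 5 = y := by simp [hs₁, hrj, hL₀.ey, hR.ey hxy]
    have r11 : s₁.reg 11 = num x y := by simp [hs₁, hrj]
    refine wp_seq_frame (Q' := fun k' s' => K + (D.m - (num x y + 1)) * C + (C - 60) + 10 ≤ k' ∧
      ∃ ν₁ : List (ℕ × ℕ), ν₁.length ≤ 1 ∧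
      s'.reg 22 = (ν ++ ν₁).length ∧ OutAt (s'.arr 1) (s'.reg 18) (L ++ 0 :: flatArcs (ν ++ ν₁)) ∧
      ∀ l r, (l, r) ∈ ν₁ ↔ PassedOn z Ms l r x y) ?_ ?_
    · have none : (∀ l r, ¬ PassedOn z Ms l r x y) → ∃ ν₁ : List (ℕ × ℕ), ν₁.length ≤ 1 ∧
          s₁.reg 22 = (ν ++ ν₁).length ∧
          OutAt (s₁.arr 1) (s₁.reg 18) (L ++ 0 :: flatArcs (ν ++ ν₁)) ∧
          ∀ l r, (l, r) ∈ ν₁ ↔ PassedOn z Ms l r x y := fun h =>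
        ⟨[], by simp, by simpa [hs₁] using i3, by simpa [hs₁] using i4, fun l r => by simp [h l r]⟩
      refine ⟨trivial, by simp; omega, fun q1 => ?_, fun q1 => ⟨by simp; omega, by simp; omega, ?_⟩⟩
      swap
      · refine none fun l r hh => ?_
        have := (hr.ins hxy l).2 hh.1
        simp [hs₁, hrj, g18] at q1
        omega
      refine ⟨trivial, by simp; omega, fun q2 => ?_, fun q2 => ⟨by simp; omega, by simp; omega, ?_⟩⟩
      swap
      · refine none fun l r hh => ?_
        have := (hr.outs hxy r).2 hh.2
        simp [hs₁, hrj, g19] at q2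
        omega
      simp [hs₁, hrj, g18] at q1
      simp [hs₁, hrj, g19] at q2
      refine wp_emit (by simp; omega) (by simp [hs₁]; omega) (by simp; omega) ?_
      refine wp_emit (by simp; omega) (by simp [hs₁]; omega) (by simp; omega) ?_
      refine ⟨⟨trivial, by simp; omega, by simp [hs₁]; omega⟩, by simp; omega, by simp; omega,
        [(s.arr 18 (num x y) - 1, s.arr 19 (num x y) - 1)], by simp, by simp [hs₁, i3], ?_,
        fun l r => ?_⟩
      · have := (i4.push (s.arr 18 (num x y) - 1)).push (s.arr 19 (num x y) - 1)
        simpa [hs₁, hrj, flatArcs, g18, g19] using this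
      · rw [PassedOn, ← hr.ins hxy, ← hr.outs hxy]
        simp only [List.mem_cons, List.not_mem_nil, or_false, Prod.mk.injEq]
        omega
    rintro k₂ s₂ hf₂ ⟨j1, ν₁, j2, j3, j4, j5⟩
    have hL₂ := (Loaded.mk (D := D) (by simp [hs₁, hL₀.a]) (by simp [hs₁, hL₀.b])
      (by simp [hs₁, hL₀.m]) (by simp [hs₁, hL₀.ex]) (by simp [hs₁, hL₀.ey]) (by simp [hs₁, hL₀.er])
      (by simp [hs₁, hL₀.eb]) (by simp [hs₁, hL₀.fi]) : Loaded D s₁).of_frame hf₂ (by decide)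
      (by decide)
    have w7 : s₂.arr 7 = s.arr 7 := (hf₂.arr 7 rfl).trans (by simp [hs₁, g7])
    have w18 : s₂.arr 18 = s.arr 18 := (hf₂.arr 18 rfl).trans (by simp [hs₁, g18])
    have w19 : s₂.arr 19 = s.arr 19 := (hf₂.arr 19 rfl).trans (by simp [hs₁, g19])
    have w20 : s₂.arr 20 = s.arr 20 := (hf₂.arr 20 rfl).trans (by simp [hs₁, g20])
    have w21 : s₂.arr 21 = s.arr 21 := (hf₂.arr 21 rfl).trans (by simp [hs₁, g21])
    have v3 : s₂.reg 3 = x := (hf₂.reg 3 rfl).trans r3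
    have v5 : s₂.reg 5 = y := (hf₂.reg 5 rfl).trans r5
    have v11 : s₂.reg 11 = num x y := (hf₂.reg 11 rfl).trans r11
    refine wp_seq_frame (wp_aboveCode (K := K + (D.m - (num x y + 1)) * C + 80 * D.b + 40) hR hn hW
      hL₂ hc (by simpa [w18, w19, w20, w21] using hr) (by simpa [w7] using hi) hxy v11 v5
      (by omega)) ?_
    rintro k₃ s₃ hf₃ ⟨l1, l2⟩
    have u1 : s₃.arr 1 = s₂.arr 1 := hf₃.arr 1 rfl
    have u18 : s₃.reg 18 = s₂.reg 18 := hf₃.reg 18 rfl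
    have u22 : s₃.reg 22 = s₂.reg 22 := hf₃.reg 22 rfl
    have fin : ∀ (ν₂ : List (ℕ × ℕ)), ν₂.length ≤ D.b →
        (∀ l r, (l, r) ∈ ν₂ ↔ Overtaken G z Ms l r x y) →
        (ν ++ ν₁ ++ ν₂).length ≤ (num x y + 1) * (D.b + 1) ∧
        ∀ l r, (l, r) ∈ ν ++ ν₁ ++ ν₂ ↔ ∃ x' y', (x', y') ∈ G.edges ∧ num x' y' < num x y + 1 ∧
        (PassedOn z Ms l r x' y' ∨ Overtaken G z Ms l r x' y') := by
      intro ν₂ h1 h2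
      constructor
      · simp only [List.length_append, Nat.succ_mul]
        omega
      · intro l r
        rw [hR.exists_lt_succ_iff hxy, ← i5, ← j5, ← h2, List.mem_append, List.mem_append, or_assoc]
    refine ⟨trivial, by simp; omega, fun q => ?_, fun q => ⟨by simp; omega, by simp; omega,
      by simp; omega, ν ++ ν₁, ?_⟩⟩
    · have hlν : (ν ++ ν₁).length ≤ num x y * (D.b + 1) + 1 := by
        simp only [List.length_append]
        omega
      refine wp_mono (wp_pastCode (K := K + (D.m - (num x y + 1)) * C + 14) (B := B) hR hn hW
        (hL₂.of_frame hf₃ (by decide) (by decide)) hc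
        (by simpa [hf₃.arr 18 rfl, hf₃.arr 19 rfl, hf₃.arr 20 rfl, hf₃.arr 21 rfl, w18, w19, w20,
          w21] using hr) (by simpa [hf₃.arr 7 rfl, w7] using hi) hxy
        ((hf₃.reg 11 rfl).trans v11) ((hf₃.reg 3 rfl).trans v3) ((hf₃.reg 5 rfl).trans v5) q
        (by omega) ?_ ?_ (by rw [u1, u18]; exact j4) (by simp; omega)) ?_
      · rw [List.length_append, List.length_cons, length_flatArcs]
        omega
      · rw [u22, j3]
        omega
      · rintro k₄ s₄ ⟨m1, ν₂, m2, m3, m4, m5⟩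
        have := fin ν₂ m2 fun l r => by rw [m5, l2, Overtaken]
        refine ⟨by omega, by omega, ν ++ ν₁ ++ ν₂, this.1, ?_, ?_, this.2⟩
        · simp [m3, u22, j3, Nat.add_assoc]
        · simpa [flatArcs] using m4
    · have := fin [] (by simp) fun l r => by
        rw [Overtaken, ← l2]
        simp at q
        simp [q]
      rw [List.append_nil] at this
      refine ⟨this.1, ?_, ?_, this.2⟩
      · simp [u22, j3]
      · simpa [u1, u18] using j4
  · rintro k₀ s₀ hrj hf ⟨i1, ν, i2, i3, i4, i5⟩
    refine ⟨by omega, by omega, ν, i2, i3, i4, fun l r => ?_⟩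
    rw [i5]
    constructor
    · rintro ⟨x, y, h1, -, h2⟩
      exact ⟨x, y, h1, h2⟩
    · rintro ⟨x, y, h1, h2⟩
      exact ⟨x, y, h1, hR.lt h1, h2⟩
  · rintro k₁ s₁ hf₁ ⟨g1, ν, g2, g3, g4, g5⟩
    refine ⟨trivial, trivial, by simp; omega, by simp; omega, ν, ?_, g5⟩
    have e21 : s₁.reg 21 = L.length := (hf₁.reg 21 rfl).trans (by simp [hol])
    have := g4.set ν.length
    simpa [encodePairs_eq, e21, g3] using this

end SuperStable

namespace SuperStable

open FlatInstance

/-! ## Reading the preference lists -/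

/-- From the address `p` on, the array `f` holds the list `L`. -/
def ReadsAt (f : ℕ → ℕ) (p : ℕ) (L : List ℕ) : Prop := ∀ i (hi : i < L.length), f (p + i) = L[i]

theorem readsAt_cons {f : ℕ → ℕ} {p v : ℕ} {L : List ℕ} :
    ReadsAt f p (v :: L) ↔ f p = v ∧ ReadsAt f (p + 1) L := by
  constructor
  · refine fun h => ⟨h 0 (by simp), fun i hi => ?_⟩
    have := h (i + 1) (by simpa using hi)
    simpa [Nat.add_assoc, Nat.add_comm 1] using this
  · rintro ⟨rfl, h⟩ i hi
    cases i with
    | zero => rfl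
    | succ i =>
      have := h i (by simpa using hi)
      simpa [Nat.add_assoc, Nat.add_comm 1] using this

theorem readsAt_append {f : ℕ → ℕ} {p : ℕ} {L L' : List ℕ} :
    ReadsAt f p (L ++ L') ↔ ReadsAt f p L ∧ ReadsAt f (p + L.length) L' := by
  induction L generalizing p with
  | nil => simp [ReadsAt]
  | cons v L ih => simp [readsAt_cons, ih, and_assoc, Nat.add_assoc, Nat.add_comm 1]

/-- The members of a list of ties with their ranks. -/
def ranked {α : Type*} (L : List (List α)) : List (ℕ × α) :=
  L.zipIdx.flatMap fun p => p.1.map fun v => (p.2, v)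

theorem ranked_append {α : Type*} (L : List (List α)) (tie : List α) :
    ranked (L ++ [tie]) = ranked L ++ tie.map fun v => (L.length, v) := by
  simp [ranked, List.zipIdx_append]

theorem ranked_prefix {α : Type*} (L L' : List (List α)) : ranked L <+: ranked (L ++ L') := by
  simp [ranked, List.zipIdx_append]

theorem map_snd_ranked {α : Type*} (L : List (List α)) : (ranked L).map Prod.snd = L.flatten := by
  induction L using List.reverseRecOn with
  | nil => rfl
  | append_singleton L tie ih => simp [ranked_append, ih]

theorem length_ranked {α : Type*} (L : List (List α)) : (ranked L).length = L.flatten.length := by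
  rw [← map_snd_ranked, List.length_map]

/-- The list of ties at the address in register `24` is read. The body is executed for each member,
with the member in register `5` and its rank in register `15`. -/
def tiesCode (body : Cmd) : Cmd :=
  21 ::= rd 0 (vr 24) ;;
  24 ::= vr 24 +. cst 1 ;;
  15 ::= cst 0 ;;
  forLoop 15 21
    (22 ::= rd 0 (vr 24) ;;
      24 ::= vr 24 +. cst 1 ;;
      4 ::= cst 0 ;;
      forLoop 4 22 (5 ::= rd 0 (vr 24) ;; body ;; 24 ::= vr 24 +. cst 1))

/-- The encoding of a tie. -/
def encodeTie {d : ℕ} (tie : List (Fin d)) : List ℕ := tie.length :: tie.map Fin.val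

theorem encodeTies_eq {d : ℕ} (L : List (List (Fin d))) :
    encodeTies L = L.length :: L.flatMap encodeTie := rfl

theorem length_le_flatMap_encodeTie {d : ℕ} (L : List (List (Fin d))) :
    L.length ≤ (L.flatMap encodeTie).length := by
  induction L with
  | nil => simp
  | cons tie L ih => simp [encodeTie] at ih ⊢; omega

/-- The invariant may depend only on the arrays and on register 25, the running edge number
(condition `hI`). The bookkeeping of the two loops can then not disturb it, and the same reader
serves both sides. -/
theorem wp_tiesCode {W c d p k K : ℕ} {body : Cmd} {L : List (List (Fin d))}
    (I : List (ℕ × Fin d) → State → Prop) {s₀ : State}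
    (hreg : ∀ r ∈ [4, 15, 21, 22, 24], body.writesReg r = false) (harr : body.writesArr 0 = false)
    (hp : s₀.reg 24 = p) (hin : ReadsAt (s₀.arr 0) p (encodeTies L))
    (hW : p + (encodeTies L).length + 4 < W)
    (hI : ∀ l s s', I l s → s'.arr = s.arr → s'.reg 25 = s.reg 25 → I l s') (h₀ : I [] s₀)
    (hbody : ∀ k s K l t v, l ++ [(t, v)] <+: ranked L → Frame (tiesCode body) s₀ s →
      s.reg 15 = t → s.reg 5 = v.val → I l s → K + c ≤ k →
      wp W body (fun k' s' => K ≤ k' ∧ I (l ++ [(t, v)]) s') k s)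
    (hk : K + 40 * L.length + (c + 20) * L.flatten.length + 40 ≤ k) :
    wp W (tiesCode body) (fun k' s' => K ≤ k' ∧ s'.reg 24 = p + (encodeTies L).length ∧
      I (ranked L) s') k s₀ := by
  rw [encodeTies_eq] at hin hW ⊢
  rw [readsAt_cons] at hin
  have hlen := length_le_flatMap_encodeTie L
  rw [List.length_cons] at hW
  refine ⟨trivial, by simp [-List.length_flatten]; omega, ⟨trivial, by simp [-List.length_flatten]; omega, by simp [hp]; omega⟩, by simp [-List.length_flatten]; omega,
    by simp [-List.length_flatten]; omega, by simp [-List.length_flatten]; omega, ?_⟩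
  set s₁ : State := _
  change wp W _ _ _ s₁
  have hf₁ : Frame (tiesCode body) s₀ s₁ := by
    refine ⟨fun r hr => ?_, fun a _ => rfl⟩
    simp [tiesCode, Cmd.writesReg, forLoop] at hr
    simp [s₁, hr]
  refine wp_forLoop (N := L.length) (j₀ := 0) (fun j k' s' => ∃ done rest, L = done ++ rest ∧
      done.length = j ∧ ReadsAt (s₀.arr 0) (s'.reg 24) (rest.flatMap encodeTie) ∧
      s'.reg 24 + (rest.flatMap encodeTie).length = p + ((L.flatMap encodeTie).length + 1) ∧
      I (ranked done) s' ∧ K + 40 * rest.length + (c + 20) * rest.flatten.length + 10 ≤ k')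
    (by simp [s₁, hp, hin.1]) (by omega) (by simp [s₁]) (by omega) (by decide) ?_ ?_ ?_ ?_ ?_
  · simp [Cmd.writesReg, forLoop, hreg 15]
  · simp [Cmd.writesReg, forLoop, hreg 21]
  · refine ⟨[], L, rfl, rfl, by simpa [s₁, hp] using hin.2, by simp [s₁, hp]; omega,
      hI _ _ _ h₀ rfl (by simp [s₁]), by simp [-List.length_flatten]; omega⟩
  · rintro j k₂ s₂ hj hrj hf₂ ⟨done, rest, rfl, rfl, i3, i4, i5, i6⟩
    have a2 : s₂.arr 0 = s₀.arr 0 := (hf₂.arr 0 (by simp [forLoop, Cmd.writesArr, harr])).trans rfl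
    obtain ⟨tie, rest, rfl⟩ : ∃ tie rest', rest = tie :: rest' := by
      cases rest with
      | nil => simp at hj
      | cons tie rest => exact ⟨_, _, rfl⟩
    rw [List.flatMap_cons, readsAt_append, encodeTie, readsAt_cons] at i3
    obtain ⟨⟨i3, i7⟩, i8⟩ := i3
    rw [List.flatMap_cons, List.length_append, encodeTie, List.length_cons, List.length_map] at i4
    rw [List.length_cons, List.length_map] at i8
    rw [List.flatten_cons, List.length_append, List.length_cons, Nat.mul_add (c + 20)] at i6
    refine ⟨by omega, trivial, by simp [-List.length_flatten]; omega, ⟨trivial, by simp [-List.length_flatten]; omega, by simp [-List.length_flatten]; omega⟩,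
      by simp [-List.length_flatten]; omega, by simp [-List.length_flatten]; omega, by simp [-List.length_flatten]; omega, ?_⟩
    set s₃ : State := _
    change wp W _ _ _ s₃
    have hf₃ : Frame (tiesCode body) s₀ s₃ := by
      refine hf₁.trans (Frame.trans (s₂ := s₂) ?_ ?_)
      · exact hf₂.seq_right.seq_right.seq_right
      · refine ⟨fun r hr => ?_, fun a _ => rfl⟩
        simp [tiesCode, Cmd.writesReg, forLoop] at hr
        simp [s₃, hr]
    have b24 : s₃.reg 24 = s₂.reg 24 + 1 := by simp [s₃]
    refine wp_forLoop (N := tie.length) (j₀ := 0) (fun i k' s' => ∃ d₁ d₂, tie = d₁ ++ d₂ ∧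
        d₁.length = i ∧ ReadsAt (s₀.arr 0) (s'.reg 24) (d₂.map Fin.val) ∧
        s'.reg 24 = s₂.reg 24 + 1 + i ∧
        I (ranked done ++ d₁.map fun v => (done.length, v)) s' ∧
        K + 40 * rest.length + (c + 20) * rest.flatten.length + (c + 20) * d₂.length + 20 ≤ k')
      (by simp [s₃, a2, i3]) (by omega) (by simp [s₃]) (by omega) (by decide) ?_ ?_ ?_ ?_ ?_
    · simp [Cmd.writesReg, hreg 4]
    · simp [Cmd.writesReg, hreg 22]
    · refine ⟨[], tie, rfl, rfl, by rwa [b24], b24, ?_, by simp [-List.length_flatten]; omega⟩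
      rw [List.map_nil, List.append_nil]
      exact hI _ _ _ i5 rfl (by simp [s₃])
    · rintro i k₄ s₄ hi hri hf₄ ⟨d₁, d₂, rfl, rfl, j3, j4, j5, j6⟩
      obtain ⟨v, d₂, rfl⟩ : ∃ v d', d₂ = v :: d' := by
        cases d₂ with
        | nil => simp at hi
        | cons v d₂ => exact ⟨_, _, rfl⟩
      have a4 : s₄.arr 0 = s₀.arr 0 :=
        (hf₄.arr 0 (by simp [forLoop, Cmd.writesArr, harr])).trans (hf₃.arr 0 (by
          simp [tiesCode, forLoop, Cmd.writesArr, harr]))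
      have c15 : s₄.reg 15 = done.length := (hf₄.reg 15 (by
        simp [forLoop, Cmd.writesReg, hreg 15])).trans (by simp [s₃, hrj])
      rw [List.map_cons, readsAt_cons] at j3
      rw [List.length_cons, Nat.mul_succ] at j6
      rw [List.length_append, List.length_cons] at i4
      refine ⟨by omega, trivial, by simp [-List.length_flatten]; omega, ?_⟩
      refine wp_seq_frame (hbody _ _ (K + 40 * rest.length + (c + 20) * rest.flatten.length +
        (c + 20) * d₂.length + 29) (ranked done ++ d₁.map fun v => (done.length, v)) done.length v
        ?_ ?_ (by simp [c15]) (by simp [a4, j3.1]) (hI _ _ _ j5 rfl (by simp)) (by simp [-List.length_flatten]; omega)) ?_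
      · have h1 := ranked_prefix (done ++ [d₁ ++ v :: d₂]) rest
        rw [List.append_assoc, List.singleton_append] at h1
        refine List.IsPrefix.trans ?_ h1
        rw [ranked_append, List.append_assoc, List.prefix_append_right_inj, List.map_append,
          List.map_cons, List.prefix_append_right_inj]
        exact ⟨_, rfl⟩
      · refine hf₃.trans (Frame.trans (s₂ := s₄) ?_ ?_)
        · exact Frame.seq_right (Frame.seq_right (Frame.seq_right
            ⟨fun r hr => hf₄.reg r (by simp_all [forLoop, Cmd.writesReg]),
             fun r hr => hf₄.arr r (by simp_all [forLoop, Cmd.writesArr])⟩))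
        · refine ⟨fun r hr => ?_, fun a _ => rfl⟩
          simp [tiesCode, Cmd.writesReg, forLoop] at hr
          simp [hr]
      rintro k₅ s₅ hf₅ ⟨l1, l2⟩
      have c24 : s₅.reg 24 = s₄.reg 24 := (hf₅.reg 24 (hreg 24 (by simp))).trans (by simp)
      refine ⟨⟨trivial, by simp [-List.length_flatten]; omega, by simp [-List.length_flatten]; omega⟩, by simp [-List.length_flatten]; omega, by simp [-List.length_flatten]; omega,
        d₁ ++ [v], d₂, by simp, by simp, by simpa [c24] using j3.2, by simp [c24]; omega, ?_,
        by simp [-List.length_flatten]; omega⟩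
      rw [List.map_append, ← List.append_assoc]
      exact hI _ _ _ l2 rfl (by simp)
    · rintro k₄ s₄ hri hf₄ ⟨d₁, d₂, rfl, j2, j3, j4, j5, j6⟩
      obtain rfl : d₂ = [] := by
        simp at j2
        exact j2
      rw [List.append_nil] at i8 i4 i7 ⊢
      refine ⟨by omega, by omega, done ++ [d₁], rest, by simp, by simp, ?_, ?_, ?_, by omega⟩
      · simpa [j4, Nat.add_assoc, Nat.add_comm 1] using i8
      · simp [j4]
        simp at i4
        omega
      · rw [ranked_append]
        exact hI _ _ _ j5 rfl (by simp)
  · rintro k₂ s₂ hrj hf₂ ⟨done, rest, rfl, i2, i3, i4, i5, i6⟩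
    obtain rfl : rest = [] := by
      simp at i2
      exact i2
    refine ⟨by omega, by omega, by simpa using i4, by simpa using i5⟩

end SuperStable

/-! ### Reading the preference lists of one side -/

namespace SuperStable

open FlatInstance

/-- All entries of the preference lists of one side, with their ranks. -/
def blocks {d d' : ℕ} (prefs : Fin d' → List (List (Fin d))) (l : List (Fin d')) :
    List (Fin d' × ℕ × Fin d) :=
  l.flatMap fun x => (ranked (prefs x)).map fun q => (x, q)

theorem blocks_append {d d' : ℕ} (prefs : Fin d' → List (List (Fin d))) (l l' : List (Fin d')) :
    blocks prefs (l ++ l') = blocks prefs l ++ blocks prefs l' := List.flatMap_append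

/-- The preference lists of all vertices of one side, whose number is in register `r`, are read. -/
def listsCode (r : ℕ) (pre body : Cmd) : Cmd :=
  11 ::= cst 0 ;; forLoop 11 r (pre ;; tiesCode body)

theorem length_le_flatMap_encodeTies {d d' : ℕ} (prefs : Fin d' → List (List (Fin d)))
    (l : List (Fin d')) : l.length ≤ (l.flatMap fun x => encodeTies (prefs x)).length := by
  induction l with
  | nil => simp
  | cons x l ih =>
    rw [List.flatMap_cons, List.length_append, encodeTies_eq]
    simp only [List.length_cons]
    omega

/-- Ties are nonempty, so the overhead for each tie is charged to its members. The total is linear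
in the numbers of vertices and of entries. -/
theorem wp_listsCode {W r c d d' p k K : ℕ} {pre body : Cmd} {prefs : Fin d' → List (List (Fin d))}
    (I : ℕ → List (Fin d' × ℕ × Fin d) → State → Prop) {s₀ : State}
    (hr : r ∉ [4, 5, 11, 15, 21, 22, 24])
    (hreg : ∀ q ∈ [4, 11, 15, 21, 22, 24, r], body.writesReg q = false)
    (hreg' : ∀ q ∈ [11, 24, r], pre.writesReg q = false)
    (harr : body.writesArr 0 = false) (harr' : pre.writesArr 0 = false) (hN : s₀.reg r = d')
    (hp : s₀.reg 24 = p)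
    (hin : ReadsAt (s₀.arr 0) p ((List.finRange d').flatMap fun x => encodeTies (prefs x)))
    (hW : p + ((List.finRange d').flatMap fun x => encodeTies (prefs x)).length + 4 < W)
    (hne : ∀ x, (prefs x).length ≤ (prefs x).flatten.length)
    (hI : ∀ j l s s', I j l s → s'.arr = s.arr → s'.reg 25 = s.reg 25 → I j l s') (h₀ : I 0 [] s₀)
    (hpre : ∀ k s K (x : Fin d') l, Frame (listsCode r pre body) s₀ s → s.reg 11 = x.val →
      I x l s → K + 20 ≤ k → wp W pre (fun k' s' => K ≤ k' ∧ I (x + 1) l s') k s)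
    (hbody : ∀ k s K l (x : Fin d') t v, l ++ [(x, t, v)] <+: blocks prefs (List.finRange d') →
      Frame (listsCode r pre body) s₀ s → s.reg 11 = x.val → s.reg 15 = t → s.reg 5 = v.val →
      I (x + 1) l s → K + c ≤ k →
      wp W body (fun k' s' => K ≤ k' ∧ I (x + 1) (l ++ [(x, t, v)]) s') k s)
    (hk : K + 80 * d' + (c + 60) * (blocks prefs (List.finRange d')).length + 20 ≤ k) :
    wp W (listsCode r pre body) (fun k' s' => K ≤ k' ∧
      s'.reg 24 = p + ((List.finRange d').flatMap fun x => encodeTies (prefs x)).length ∧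
      I d' (blocks prefs (List.finRange d')) s') k s₀ := by
  have hlen := length_le_flatMap_encodeTies prefs (List.finRange d')
  rw [List.length_finRange] at hlen
  simp only [List.mem_cons, List.not_mem_nil, or_false, not_or] at hr
  obtain ⟨hr4, hr5, hr11, hr15, hr21, hr22, hr24⟩ := hr
  set T := ((List.finRange d').flatMap fun x => encodeTies (prefs x)).length with hT
  refine ⟨by simp; omega, by simp; omega, ?_⟩
  set s₁ : State := _
  change wp W _ _ _ s₁
  have hf₁ : Frame (listsCode r pre body) s₀ s₁ := by
    refine ⟨fun r hr => ?_, fun a _ => rfl⟩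
    simp [listsCode, Cmd.writesReg, forLoop] at hr
    simp [s₁, hr]
  have hloop : ∀ {s}, Frame (forLoop 11 r (pre ;; tiesCode body)) s₁ s →
      Frame (listsCode r pre body) s₀ s := fun hf => hf₁.trans hf.seq_right
  have hseq : ∀ {s s'}, Frame (pre ;; tiesCode body) s s' → Frame (listsCode r pre body) s s' :=
    fun hf => Frame.seq_right ⟨fun q hq => hf.reg q (by
        simp only [forLoop, Cmd.writesReg, Bool.or_eq_false_iff] at hq ⊢
        exact hq.1), fun q hq => hf.arr q (by
        simp only [forLoop, Cmd.writesArr, Bool.or_eq_false_iff] at hq ⊢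
        exact hq.1)⟩
  have w0 : (listsCode r pre body).writesArr 0 = false := by
    simp [listsCode, tiesCode, forLoop, Cmd.writesArr, harr, harr']
  refine wp_forLoop (N := d') (j₀ := 0) (fun j k' s' => ∃ done rest, List.finRange d' = done ++ rest ∧
      done.length = j ∧ ReadsAt (s₀.arr 0) (s'.reg 24) (rest.flatMap fun x => encodeTies (prefs x)) ∧
      s'.reg 24 + (rest.flatMap fun x => encodeTies (prefs x)).length = p + T ∧
      I j (blocks prefs done) s' ∧
      K + 80 * rest.length + (c + 60) * (blocks prefs rest).length + 10 ≤ k')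
    (by simp [s₁, hr11, hN]) (by omega) (by simp [s₁]) (by omega) hr11 ?_ ?_ ?_ ?_ ?_
  · simp [Cmd.writesReg, tiesCode, forLoop, hreg, hreg']
  · simp [Cmd.writesReg, tiesCode, forLoop, hreg, hreg', hr4, hr5, hr15, hr21, hr22, hr24]
  · refine ⟨[], List.finRange d', rfl, rfl, by simpa [s₁, hp] using hin, by simp [s₁, hp, hT],
      hI _ _ _ _ h₀ rfl (by simp [s₁]), by simp; omega⟩
  · rintro j k₂ s₂ hj hrj hf₂ ⟨done, rest, i1, i2, i3, i4, i5, i6⟩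
    have a2 : s₂.arr 0 = s₀.arr 0 := (hloop hf₂).arr 0 w0
    obtain ⟨x, rest, rfl⟩ : ∃ x rest', rest = x :: rest' := by
      cases rest with
      | nil =>
        have := congrArg List.length i1
        simp at this
        omega
      | cons x rest => exact ⟨_, _, rfl⟩
    have hx : x.val = j := by
      have h1 : (List.finRange d')[j]? = some x := by
        rw [i1, ← i2, List.getElem?_append_right le_rfl]
        simp
      rw [List.getElem?_eq_getElem (by simpa using hj)] at h1
      simp only [List.getElem_finRange, Option.some.injEq] at h1
      rw [← h1]
      rfl
    rw [List.flatMap_cons, readsAt_append] at i3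
    rw [List.flatMap_cons, List.length_append] at i4
    have hb : (blocks prefs (x :: rest)).length =
        (prefs x).flatten.length + (blocks prefs rest).length := by
      rw [← length_ranked]
      simp [blocks]
    have hxl := hne x
    have hmul : (c + 60) * (prefs x).flatten.length =
        40 * (prefs x).flatten.length + (c + 20) * (prefs x).flatten.length := by ring
    rw [hb, List.length_cons, Nat.mul_add (c + 60), hmul] at i6
    rw [← hx] at i5
    refine ⟨by omega, ?_⟩
    refine wp_seq_frame (hpre _ _ (k₂ - 4 - 20) x _ (hloop hf₂) (by rw [hrj, hx]) i5 (by omega)) ?_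
    rintro k₃ s₃ hf₃ ⟨j1, j2⟩
    have a3 : s₃.arr 0 = s₀.arr 0 := (hf₃.arr 0 harr').trans a2
    have b3 : s₃.reg 24 = s₂.reg 24 := hf₃.reg 24 (hreg' 24 (by simp))
    have hf₃' : Frame (listsCode r pre body) s₀ s₃ := (hloop hf₂).trans (hseq hf₃.seq_left)
    refine wp_mono (wp_tiesCode (c := c) (K := K + 80 * rest.length +
      (c + 60) * (blocks prefs rest).length + 14) (L := prefs x) (p := s₂.reg 24)
      (fun l s => I (x + 1) (blocks prefs done ++ l.map fun q => (x, q)) s)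
      (fun q hq => hreg q (by simp at hq ⊢; tauto)) harr b3 (by rw [a3]; exact i3.1) (by omega)
      (fun l s s' => hI _ _ _ _) (by simpa using j2) ?_ (by omega)) ?_
    · intro k₄ s₄ K' l t v hl hf₄ h15 h5 hIl hk'
      have h11 : s₄.reg 11 = x.val := by
        rw [hf₄.reg 11 (by simp [tiesCode, forLoop, Cmd.writesReg, hreg]), hf₃.reg 11
          (hreg' 11 (by simp)), hrj, hx]
      rw [List.map_append, ← List.append_assoc]
      refine hbody _ _ _ _ x t v ?_ (hf₃'.trans (hseq hf₄.seq_right)) h11 h15 h5 hIl hk'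
      rw [i1, blocks_append, List.append_assoc, List.prefix_append_right_inj]
      have : blocks prefs (x :: rest) =
          (ranked (prefs x)).map (fun q => (x, q)) ++ blocks prefs rest := rfl
      rw [this]
      have h2 := hl.map fun q => (x, q)
      rw [List.map_append] at h2
      exact h2.trans (List.prefix_append _ _)
    · rintro k₄ s₄ ⟨l1, l2, l3⟩
      refine ⟨by omega, done ++ [x], rest, by simp [i1], by simp [i2], ?_, ?_, ?_, by omega⟩
      · simpa [l2] using i3.2
      · simp [l2, -List.length_flatMap]
        omega
      · have : blocks prefs (done ++ [x]) =
            blocks prefs done ++ (ranked (prefs x)).map (fun q => (x, q)) := by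
          simp [blocks]
        rw [this, ← hx]
        exact hI _ _ _ _ l3 rfl (by simp)
  · rintro k₂ s₂ hrj hf₂ ⟨done, rest, i1, i2, i3, i4, i5, i6⟩
    obtain rfl : rest = [] := by
      have := congrArg List.length i1
      simp [i2] at this
      exact this
    rw [List.append_nil] at i1
    rw [← i1] at i5
    exact ⟨by omega, by omega, by simpa using i4, i5⟩

end SuperStable

/-! ### Ranks and numbers of the edges in the order of the input -/

namespace SuperStable

open FlatInstance

/-- Ties are disjoint, so the first tie that contains a member is the only one. -/
theorem mem_ranked {α : Type*} [DecidableEq α] {L : List (List α)} (hL : L.flatten.Nodup) {t : ℕ}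
    {v : α} : (t, v) ∈ ranked L ↔ v ∈ L.flatten ∧ t = L.findIdx fun tie => decide (v ∈ tie) := by
  have h1 : (t, v) ∈ ranked L ↔ ∃ tie, L[t]? = some tie ∧ v ∈ tie := by
    simp only [ranked, List.mem_flatMap, List.mem_map, Prod.mk.injEq, Prod.exists,
      List.mem_zipIdx_iff_getElem?]
    constructor
    · rintro ⟨tie, t', h1, v', h2, rfl, rfl⟩
      exact ⟨tie, h1, h2⟩
    · rintro ⟨tie, h1, h2⟩
      exact ⟨tie, t, h1, v, h2, rfl, rfl⟩
  rw [h1]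
  constructor
  · rintro ⟨tie, h2, h3⟩
    obtain ⟨ht, rfl⟩ := List.getElem?_eq_some_iff.1 h2
    refine ⟨List.mem_flatten.2 ⟨_, List.getElem_mem ht, h3⟩, ((List.findIdx_eq ht).2 ⟨by simpa, ?_⟩).symm⟩
    intro j hj
    have := List.pairwise_iff_getElem.1 (List.nodup_flatten.1 hL).2 j t (by omega) ht hj
    simp only [decide_eq_false_iff_not]
    exact fun h => this h h3
  · rintro ⟨h2, rfl⟩
    obtain ⟨tie, h3, h4⟩ := List.mem_flatten.1 h2
    have hlt : L.findIdx (fun tie => decide (v ∈ tie)) < L.length :=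
      List.findIdx_lt_length_of_exists ⟨tie, h3, by simpa⟩
    refine ⟨_, List.getElem?_eq_getElem hlt, ?_⟩
    simpa using List.findIdx_getElem (w := hlt)

theorem pairwise_ranked {α : Type*} (L : List (List α)) :
    (ranked L).Pairwise fun p q => p.1 ≤ q.1 := by
  have hlt : ∀ {L : List (List α)} {p : ℕ × α}, p ∈ ranked L → p.1 < L.length := by
    rintro L ⟨t, v⟩ h
    simp only [ranked, List.mem_flatMap, List.mem_map, Prod.mk.injEq, Prod.exists,
      List.mem_zipIdx_iff_getElem?] at h
    obtain ⟨tie, t', h1, v', h2, rfl, rfl⟩ := h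
    exact (List.getElem?_eq_some_iff.1 h1).1
  induction L using List.reverseRecOn with
  | nil => simp [ranked]
  | append_singleton L tie ih =>
    rw [ranked_append, List.pairwise_append]
    refine ⟨ih, ?_, ?_⟩
    · exact List.pairwise_map.2 (List.pairwise_of_forall fun _ _ => le_rfl)
    · intro p hp q hq
      obtain ⟨v, -, rfl⟩ := List.mem_map.1 hq
      exact (hlt hp).le

/-- In a sorted list the entries below a threshold form an initial segment. With the men as keys,
its length is the number of the first edge of a man. -/
theorem lt_countP_iff {α : Type*} {f : α → ℕ} {l : List α} (hl : l.Pairwise fun p q => f p ≤ f q)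
    {x e : ℕ} (he : e < l.length) : e < l.countP (fun p => decide (f p < x)) ↔ f l[e] < x := by
  induction l generalizing e with
  | nil => simp at he
  | cons p l ih =>
    rw [List.pairwise_cons] at hl
    rw [List.countP_cons]
    by_cases hp : f p < x
    · cases e with
      | zero => simp [hp]
      | succ e =>
        have := ih hl.2 (e := e) (by simpa using he)
        simp [hp, this]
    · have h0 : l.countP (fun p => decide (f p < x)) = 0 := by
        rw [List.countP_eq_zero]
        intro q hq
        have := hl.1 q hq
        simp
        omega
      rw [h0]
      cases e with
      | zero => simp [hp]
      | succ e =>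
        have := hl.1 (l[e]'(by simpa using he)) (List.getElem_mem _)
        simp [hp]
        omega

section Blocks

variable {a b : ℕ} (G : Instance (Fin a) (Fin b))

/-- The entries of all lists of the men. -/
def Instance.entries : List (Fin a × ℕ × Fin b) := blocks G.prefA (List.finRange a)

theorem Instance.mem_entries {x : Fin a} {t : ℕ} {y : Fin b} :
    (x, t, y) ∈ G.entries ↔ (x, y) ∈ G.edges ∧ t = G.rankA x y := by
  rw [Instance.mem_edges, Instance.rankA, ← mem_ranked (G.nodupA x)]
  simp [Instance.entries, blocks]

theorem Instance.nodup_entries : (G.entries.map fun p => (p.1, p.2.2)).Nodup := by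
  have : (G.entries.map fun p => (p.1, p.2.2)) =
      (List.finRange a).flatMap fun x => (G.prefA x).flatten.map fun y => (x, y) := by
    simp only [Instance.entries, blocks, List.map_flatMap, List.map_map, ← map_snd_ranked]
    rfl
  rw [this, List.nodup_flatMap]
  refine ⟨fun x _ => (G.nodupA x).map fun y y' h => (Prod.mk.inj h).2, ?_⟩
  refine (List.nodup_finRange a).imp fun {x x'} hne => ?_
  simp only [Function.onFun, List.disjoint_left, List.mem_map]
  rintro _ ⟨y, -, rfl⟩ ⟨y', -, h⟩
  exact hne (Prod.mk.inj h).1.symm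

theorem Instance.length_entries : G.entries.length = G.edges.card := by
  rw [← List.length_map (fun p : Fin a × ℕ × Fin b => (p.1, p.2.2)),
    ← List.toFinset_card_of_nodup G.nodup_entries]
  congr 1
  ext ⟨x, y⟩
  rw [List.mem_toFinset, List.mem_map]
  constructor
  · rintro ⟨⟨x', t, y'⟩, h, h'⟩
    obtain ⟨rfl, rfl⟩ := Prod.mk.inj h'
    exact (G.mem_entries.1 h).1
  · exact fun h => ⟨(x, G.rankA x y, y), G.mem_entries.2 ⟨h, rfl⟩, rfl⟩

theorem Instance.pairwise_entries :
    G.entries.Pairwise fun p q => p.1 < q.1 ∨ p.1 = q.1 ∧ p.2.1 ≤ q.2.1 := by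
  rw [Instance.entries, blocks, List.pairwise_flatMap]
  refine ⟨fun x _ => List.pairwise_map.2 ((pairwise_ranked _).imp fun h => Or.inr ⟨rfl, h⟩), ?_⟩
  refine (List.pairwise_lt_finRange a).imp fun {x x'} hlt p hp q hq => ?_
  obtain ⟨p, -, rfl⟩ := List.mem_map.1 hp
  obtain ⟨q, -, rfl⟩ := List.mem_map.1 hq
  exact Or.inl hlt

/-- The number of the edge `(x, y)`. -/
def Instance.number (x : Fin a) (y : Fin b) : ℕ := G.entries.findIdx fun p => p.1 = x ∧ p.2.2 = y

/-- No pair occurs twice among the entries, so the first position of an edge is its only position,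
and the rank stored there is forced. -/
theorem Instance.number_eq_iff {x : Fin a} {y : Fin b} (h : (x, y) ∈ G.edges) {e : ℕ} :
    G.number x y = e ↔ G.entries[e]? = some (x, G.rankA x y, y) := by
  have hlt : G.number x y < G.entries.length :=
    List.findIdx_lt_length_of_exists ⟨_, G.mem_entries.2 ⟨h, rfl⟩, by simp⟩
  have hget : G.entries[G.number x y]? = some (x, G.rankA x y, y) := by
    rw [List.getElem?_eq_getElem hlt, Option.some.injEq]
    obtain ⟨h1, h2⟩ : (G.entries[G.number x y]).1 = x ∧ (G.entries[G.number x y]).2.2 = y := by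
      simpa [Instance.number] using List.findIdx_getElem (w := hlt)
    have h3 := List.getElem_mem hlt
    rcases hp : G.entries[G.number x y] with ⟨x', t, y'⟩
    rw [hp] at h1 h2 h3
    simp only at h1 h2
    subst h1 h2
    rw [(G.mem_entries.1 h3).2]
  constructor
  · rintro rfl
    exact hget
  · intro he
    obtain ⟨he', hx⟩ := List.getElem?_eq_some_iff.1 he
    obtain ⟨_, hx'⟩ := List.getElem?_eq_some_iff.1 hget
    refine (G.nodup_entries.getElem_inj_iff (hi := by simpa) (hj := by simpa)).1 ?_
    simp [hx, hx']

theorem Instance.number_eq {x : Fin a} {y : Fin b} {t e : ℕ} (h : G.entries[e]? = some (x, t, y)) :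
    (x, y) ∈ G.edges ∧ t = G.rankA x y ∧ G.number x y = e := by
  obtain ⟨h1, rfl⟩ := G.mem_entries.1 (List.mem_of_getElem? h)
  exact ⟨h1, rfl, (G.number_eq_iff h1).2 h⟩

theorem Instance.card_edges_swap : G.swap.edges.card = G.edges.card := by
  rw [← card_flip (M := G.edges)]
  congr 1
  ext ⟨y, x⟩
  rw [mem_edges_swap, mem_flip]

theorem length_le_length_flatten {α : Type*} {L : List (List α)} (h : [] ∉ L) :
    L.length ≤ L.flatten.length := by
  induction L with
  | nil => simp
  | cons tie L ih =>
    simp only [List.mem_cons, not_or] at h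
    have h1 := ih h.2
    have h2 := List.length_pos_iff.2 (Ne.symm h.1)
    rw [List.flatten_cons, List.length_append, List.length_cons]
    omega

theorem Instance.length_flatten_le (x : Fin a) : (G.prefA x).flatten.length ≤ G.edges.card := by
  have h := (G.nodupA x).map (f := fun y => (x, y)) fun y y' h => (Prod.mk.inj h).2
  rw [← List.length_map (fun y => (x, y)), ← List.toFinset_card_of_nodup h]
  refine Finset.card_le_card fun e he => ?_
  obtain ⟨y, hy, rfl⟩ := List.mem_map.1 (List.mem_toFinset.1 he)
  exact G.mem_edges.2 hy

theorem Instance.rankA_lt {x : Fin a} {y : Fin b} (h : (x, y) ∈ G.edges) :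
    G.rankA x y < G.edges.card := by
  have h1 := G.length_flatten_le x
  have h2 := length_le_length_flatten (G.nonemptyA x)
  obtain ⟨tie, h3, h4⟩ := List.mem_flatten.1 (G.mem_edges.1 h)
  have h5 : G.rankA x y < (G.prefA x).length :=
    List.findIdx_lt_length_of_exists ⟨tie, h3, by simpa⟩
  omega

theorem Instance.rankB_lt {x : Fin a} {y : Fin b} (h : (x, y) ∈ G.edges) :
    G.rankB y x < G.edges.card := by
  rw [← G.card_edges_swap]
  exact G.swap.rankA_lt (mem_edges_swap.2 h)

theorem length_encodeTies_le {d d' : ℕ} (prefs : Fin d' → List (List (Fin d)))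
    (hne : ∀ x, (prefs x).length ≤ (prefs x).flatten.length) (l : List (Fin d')) :
    (l.flatMap fun x => encodeTies (prefs x)).length ≤ l.length + 2 * (blocks prefs l).length := by
  have h1 : ∀ L : List (List (Fin d)), (encodeTies L).length = 1 + L.length + L.flatten.length := by
    intro L
    rw [encodeTies_eq]
    induction L with
    | nil => rfl
    | cons tie L ih =>
      simp only [List.length_cons, List.flatMap_cons, List.length_append, encodeTie, List.length_map,
        List.flatten_cons] at ih ⊢
      omega
  induction l with
  | nil => simp
  | cons x l ih =>
    have h2 : (blocks prefs (x :: l)).length =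
        (prefs x).flatten.length + (blocks prefs l).length := by
      rw [← length_ranked]
      simp [blocks]
    have := hne x
    rw [List.flatMap_cons, List.length_append, h1, h2, List.length_cons]
    omega

theorem Instance.mem_encodeTies_le {x : Fin a} {v : ℕ} (h : v ∈ encodeTies (G.prefA x)) :
    v ≤ G.edges.card ∨ v < b := by
  have h1 := G.length_flatten_le x
  have h2 := length_le_length_flatten (G.nonemptyA x)
  rw [encodeTies_eq, List.mem_cons, List.mem_flatMap] at h
  rcases h with rfl | ⟨tie, h3, h4⟩
  · exact Or.inl (h2.trans h1)
  · rw [encodeTie, List.mem_cons, List.mem_map] at h4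
    rcases h4 with rfl | ⟨y, -, rfl⟩
    · exact Or.inl ((List.sublist_flatten_of_mem h3).length_le.trans h1)
    · exact Or.inr y.2

theorem mem_encodeInstance_lt {v : ℕ} (h : v ∈ encodeInstance G) :
    v < G.edges.card + (a + b) + 2 := by
  simp only [encodeInstance, List.mem_append, List.mem_cons, List.not_mem_nil, or_false,
    List.mem_flatMap] at h
  rcases h with (h | ⟨x, -, h⟩) | ⟨y, -, h⟩
  · omega
  · have := G.mem_encodeTies_le h
    omega
  · have := G.swap.mem_encodeTies_le h
    rw [G.card_edges_swap] at this
    omega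

end Blocks

end SuperStable

/-! ### Parsing of the whole input -/

namespace SuperStable

open FlatInstance

variable {a b : ℕ} {G : Instance (Fin a) (Fin b)} {W : ℕ}

/-- An entry of the list of the man in register `11` is stored. -/
def manEntryCode : Cmd :=
  .store 2 (vr 25) (vr 11) ;;
  .store 3 (vr 25) (vr 5) ;;
  .store 4 (vr 25) (vr 15) ;;
  25 ::= vr 25 +. cst 1 ;;
  .store 7 (vr 11 *. vr 1 +. vr 5) (vr 25)

/-- The rank of an entry of the list of the woman in register `11` is stored. -/
def womanEntryCode : Cmd := .store 5 (rd 7 (vr 5 *. vr 1 +. vr 11) -. cst 1) (vr 15)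

/-- The input is read. -/
def parseCode : Cmd :=
  0 ::= rd 0 (cst 0) ;;
  1 ::= rd 0 (cst 1) ;;
  2 ::= rd 0 (cst 2) ;;
  24 ::= cst 3 ;;
  listsCode 0 (.store 6 (vr 11) (vr 25)) manEntryCode ;;
  .store 6 (vr 0) (vr 25) ;;
  listsCode 1 .skip womanEntryCode

/-- The lists of `j` men have been started, and the entries in `l` have been stored. -/
structure MenRead (j : ℕ) (l : List (Fin a × ℕ × Fin b)) (s : State) : Prop where
  cnt : s.reg 25 = l.length
  val : ∀ e x t y, l[e]? = some (x, t, y) → s.arr 2 e = x.val ∧ s.arr 3 e = y.val ∧ s.arr 4 e = t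
  idx : ∀ (x : Fin a) (y : Fin b), (s.arr 7 (x * b + y) = 0 ∧ ∀ t, (x, t, y) ∉ l) ∨
    ∃ t v, s.arr 7 (x * b + y) = v + 1 ∧ l[v]? = some (x, t, y)
  fst : ∀ x < j, s.arr 6 x = l.countP fun p => decide (p.1.val < x)
  lt : ∀ p ∈ l, p.1.val < j

theorem MenRead.congr {j : ℕ} {l : List (Fin a × ℕ × Fin b)} {s s' : State} (h : MenRead j l s)
    (hreg : s'.reg 25 = s.reg 25) (harr : ∀ i ∈ [2, 3, 4, 6, 7], s'.arr i = s.arr i) :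
    MenRead j l s' := by
  obtain ⟨h1, h2, h3, h4, h5⟩ := h
  refine ⟨hreg.trans h1, ?_, ?_, ?_, h5⟩
  · simpa only [harr 2 (by simp), harr 3 (by simp), harr 4 (by simp)]
  · simpa only [harr 7 (by simp)]
  · simpa only [harr 6 (by simp)]

/-- Division by b recovers the man, so the pairs occupy distinct cells of the look-up table. -/
theorem index_inj {x x' : Fin a} {y y' : Fin b} (h : x.val * b + y = x' * b + y') :
    x = x' ∧ y = y' := by
  have hx : x.val = x' := by
    have h1 : ∀ (u : ℕ) (v : Fin b), (u * b + v) / b = u := fun u v => by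
      rw [Nat.mul_comm, Nat.mul_add_div (by have := v.2; omega), Nat.div_eq_of_lt v.2, Nat.add_zero]
    rw [← h1 x y, h, h1]
  refine ⟨Fin.ext hx, Fin.ext ?_⟩
  rw [hx] at h
  omega

theorem MenRead.push {l : List (Fin a × ℕ × Fin b)} {s s' : State} {x : Fin a} {t : ℕ} {y : Fin b}
    (h : MenRead (x + 1) l s) (h25 : s'.reg 25 = s.reg 25 + 1)
    (h2 : s'.arr 2 = Function.update (s.arr 2) (s.reg 25) x)
    (h3 : s'.arr 3 = Function.update (s.arr 3) (s.reg 25) y)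
    (h4 : s'.arr 4 = Function.update (s.arr 4) (s.reg 25) t) (h6 : s'.arr 6 = s.arr 6)
    (h7 : s'.arr 7 = Function.update (s.arr 7) (x * b + y) (s.reg 25 + 1)) :
    MenRead (x + 1) (l ++ [(x, t, y)]) s' := by
  have hc := h.cnt
  refine ⟨by simp [h25, hc], fun e x' t' y' he => ?_, fun x' y' => ?_, fun x' hx' => ?_,
    fun p hp => ?_⟩
  · rw [h2, h3, h4, hc]
    rw [List.getElem?_append] at he
    split_ifs at he with hlt
    · rw [Function.update_of_ne (by omega), Function.update_of_ne (by omega),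
        Function.update_of_ne (by omega)]
      exact h.val _ _ _ _ he
    · obtain ⟨h5, h5'⟩ := List.getElem?_eq_some_iff.1 he
      simp at h5
      obtain rfl : e = l.length := by omega
      simp at h5'
      simp [h5']
  · rw [h7, hc]
    by_cases heq : x' = x ∧ y' = y
    · obtain ⟨rfl, rfl⟩ := heq
      exact Or.inr ⟨t, l.length, by simp, by simp⟩
    · have hne : x'.val * b + y' ≠ x * b + y := fun hh => heq (index_inj hh)
      rw [Function.update_of_ne hne]
      rcases h.idx x' y' with ⟨h8, h9⟩ | ⟨t', v, h8, h9⟩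
      · refine Or.inl ⟨h8, fun t' ht => ?_⟩
        rcases List.mem_append.1 ht with ht | ht
        · exact h9 t' ht
        · simp at ht
          exact heq ⟨ht.1, ht.2.2⟩
      · refine Or.inr ⟨t', v, h8, ?_⟩
        rw [List.getElem?_append_left (List.getElem?_eq_some_iff.1 h9).1]
        exact h9
  · rw [h6, h.fst x' hx', List.countP_append]
    have : ¬ x.val < x' := by omega
    simp [this]
  · rcases List.mem_append.1 hp with hp | hp
    · exact h.lt p hp
    · simp at hp
      simp [hp]

/-- The instance in the arrays. -/
def FlatInstance.ofState (G : Instance (Fin a) (Fin b)) (s : State) : FlatInstance :=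
  ⟨a, b, G.edges.card, s.arr 2, s.arr 3, s.arr 4, s.arr 5, s.arr 6⟩

theorem MenRead.indexed {s : State} (h : MenRead a G.entries s) :
    Indexed G G.number (s.arr 7) := by
  intro x y
  rcases h.idx x y with ⟨h1, h2⟩ | ⟨t, v, h1, h2⟩
  · exact Or.inl ⟨h1, fun h3 => h2 _ (G.mem_entries.2 ⟨h3, rfl⟩)⟩
  · obtain ⟨h3, -, rfl⟩ := G.number_eq h2
    exact Or.inr ⟨h1, h3⟩

/-- The entries are sorted by men and then by ranks. Their blocks are therefore delimited by the
counts of smaller men, and ranks are monotone within a block. -/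
theorem MenRead.represents {s : State} (h : MenRead a G.entries s)
    (ha : s.arr 6 a = G.entries.length)
    (hB : ∀ {x y}, (x, y) ∈ G.edges → s.arr 5 (G.number x y) = G.rankB y x) :
    Represents (FlatInstance.ofState G s) G G.number := by
  have hget : ∀ {x y}, (x, y) ∈ G.edges → G.entries[G.number x y]? = some (x, G.rankA x y, y) :=
    fun hxy => (G.number_eq_iff hxy).1 rfl
  have hedge : ∀ e < G.edges.card, ∃ x y, (x, y) ∈ G.edges ∧ G.number x y = e := by
    intro e he
    rw [← G.length_entries] at he
    rcases hp : G.entries[e] with ⟨x, t, y⟩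
    have h1 : G.entries[e]? = some (x, t, y) := by rw [List.getElem?_eq_getElem he, hp]
    exact ⟨x, y, (G.number_eq h1).1, (G.number_eq h1).2.2⟩
  have hlt : ∀ {x y}, (x, y) ∈ G.edges → G.number x y < G.edges.card := fun hxy => by
    rw [← G.length_entries]
    exact (List.getElem?_eq_some_iff.1 (hget hxy)).1
  have hpw : G.entries.Pairwise fun p q => p.1.val ≤ q.1.val :=
    G.pairwise_entries.imp fun h => h.elim (fun h => h.le) fun h => h.1.le
  have hfi : ∀ x ≤ a, s.arr 6 x = G.entries.countP fun p => decide (p.1.val < x) := by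
    intro x hx
    rcases hx.lt_or_eq with hx | rfl
    · exact h.fst x hx
    · rw [ha, eq_comm, List.countP_eq_length]
      exact fun p _ => by simp
  have hlow : ∀ e (he : e < G.edges.card), ∀ x ≤ a, (e < s.arr 6 x ↔ s.arr 2 e < x) := by
    intro e he x hx
    obtain ⟨x', y, hxy, rfl⟩ := hedge e he
    obtain ⟨h1, h2⟩ := List.getElem?_eq_some_iff.1 (hget hxy)
    rw [hfi x hx, lt_countP_iff hpw h1, h2, (h.val _ _ _ _ (hget hxy)).1]
  refine ⟨⟨?_, ?_, ?_, ?_, ?_, ?_, ?_, ?_⟩, rfl, rfl, rfl, hlt, fun hxy => (h.val _ _ _ _ (hget hxy)).1,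
    fun hxy => (h.val _ _ _ _ (hget hxy)).2.1, fun hxy => (h.val _ _ _ _ (hget hxy)).2.2, hB, hedge⟩
  · intro e he
    obtain ⟨x, y, hxy, rfl⟩ := hedge e he
    exact (h.val _ _ _ _ (hget hxy)).1.trans_lt x.2
  · intro e he
    obtain ⟨x, y, hxy, rfl⟩ := hedge e he
    exact (h.val _ _ _ _ (hget hxy)).2.1.trans_lt y.2
  · intro e he
    obtain ⟨x, y, hxy, rfl⟩ := hedge e he
    exact (hB hxy).trans_lt (G.rankB_lt hxy)
  · intro e he e' he' h1 h2
    obtain ⟨x, y, hxy, rfl⟩ := hedge e he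
    obtain ⟨x', y', hxy', rfl⟩ := hedge e' he'
    have h3 : x = x' := Fin.ext (((h.val _ _ _ _ (hget hxy)).1.symm.trans h1).trans (h.val _ _ _ _ (hget hxy')).1)
    have h4 : y = y' :=
      Fin.ext (((h.val _ _ _ _ (hget hxy)).2.1.symm.trans h2).trans (h.val _ _ _ _ (hget hxy')).2.1)
    rw [h3, h4]
  · intro x hx e he
    have h1 := hlow e he x (show x < a from hx).le
    have h2 := hlow e he (x + 1) hx
    change s.arr 2 e = x ↔ s.arr 6 x ≤ e ∧ e < s.arr 6 (x + 1)
    omega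
  · intro x hx
    change s.arr 6 x ≤ G.edges.card
    rw [hfi x hx, ← G.length_entries]
    exact List.countP_le_length
  · intro x hx
    change s.arr 6 x ≤ s.arr 6 (x + 1)
    rw [hfi x (show x < a from hx).le, hfi (x + 1) hx]
    refine List.countP_mono_left fun p _ hp => ?_
    simp at hp ⊢
    omega
  · intro e e' hee he' hx
    rcases hee.lt_or_eq with hee | rfl
    · obtain ⟨x, y, hxy, rfl⟩ := hedge e (hee.trans he')
      obtain ⟨x', y', hxy', rfl⟩ := hedge e' he'
      obtain ⟨g1, g2⟩ := List.getElem?_eq_some_iff.1 (hget hxy)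
      obtain ⟨g3, g4⟩ := List.getElem?_eq_some_iff.1 (hget hxy')
      have h1 := List.pairwise_iff_getElem.1 G.pairwise_entries _ _ g1 g3 hee
      rw [g2, g4] at h1
      have h3 : x = x' := Fin.ext (((h.val _ _ _ _ (hget hxy)).1.symm.trans hx).trans (h.val _ _ _ _ (hget hxy')).1)
      change s.arr 4 _ ≤ s.arr 4 _
      rw [(h.val _ _ _ _ (hget hxy)).2.2, (h.val _ _ _ _ (hget hxy')).2.2]
      rcases h1 with h1 | h1
      · exact absurd h3 h1.ne
      · exact h1.2
    · exact le_rfl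

/-- The lists of the men fix the numbering and fill the look-up table, through which each entry of a
woman's list finds its edge in constant time. The table has ab cells, but memory is zero at the
start, so no time is spent on clearing it. -/
theorem wp_parseCode {n : ℕ} (hn : n = a + b + G.edges.card + 2) (hW : n ^ 2 * 32 ≤ W) {k K : ℕ}
    (hk : K + 80 * (a + b) + 200 * G.edges.card + 100 ≤ k) :
    wp W parseCode (fun k' s => K ≤ k' ∧
      Represents (FlatInstance.ofState G s) G G.number ∧ Loaded (FlatInstance.ofState G s) s ∧
      Indexed G G.number (s.arr 7) ∧ ∀ i, i = 1 ∨ 7 < i → s.arr i = 0) k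
      (initialState (encodeInstance G)) := by
  have hn2 : n ≤ n ^ 2 := Nat.le_self_pow (by omega) n
  set m := G.edges.card with hm
  have hl := length_encodeTies_le G.prefA (fun x => length_le_length_flatten (G.nonemptyA x))
    (List.finRange a)
  have hl' := length_encodeTies_le G.prefB (fun x => length_le_length_flatten (G.nonemptyB x))
    (List.finRange b)
  have he : (blocks G.prefA (List.finRange a)).length = m := G.length_entries
  have he' : (blocks G.prefB (List.finRange b)).length = m :=
    G.swap.length_entries.trans G.card_edges_swap
  rw [he, List.length_finRange] at hl
  rw [he', List.length_finRange] at hl'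
  set T := ((List.finRange a).flatMap fun x => encodeTies (G.prefA x)).length with hT
  obtain ⟨f, hf⟩ : ∃ f, f = fun i => (encodeInstance G).getD i 0 := ⟨_, rfl⟩
  have hin : ReadsAt f 0 (encodeInstance G) := fun i hi => by simp [hf, hi]
  rw [encodeInstance, readsAt_append, readsAt_append, readsAt_cons, readsAt_cons, readsAt_cons] at hin
  obtain ⟨⟨⟨i0, i1, i2, -⟩, i3⟩, i4⟩ := hin
  have hmul : ∀ (x : Fin a) (y : Fin b), x.val * b + y < W := by
    intro x y
    have h1 : x * b + b ≤ a * b := by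
      calc x * b + b = (x + 1) * b := by ring
        _ ≤ a * b := Nat.mul_le_mul_right _ x.2
    have h2 : a * b ≤ n ^ 2 := by
      rw [sq]
      exact Nat.mul_le_mul (by omega) (by omega)
    have := y.2
    omega
  refine ⟨by simp; omega, by simp; omega, by simp; omega, by simp; omega, by simp; omega,
    by simp; omega, by simp; omega, by simp; omega, ?_⟩
  set s₁ : State := _
  change wp W _ _ _ s₁
  have r0 : s₁.reg 0 = a := by simpa [s₁, initialState, hf] using i0
  have r1 : s₁.reg 1 = b := by simpa [s₁, initialState, hf] using i1
  have r2 : s₁.reg 2 = m := by simpa [s₁, initialState, hf] using i2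
  have r24 : s₁.reg 24 = 3 := by simp [s₁]
  have a0 : s₁.arr 0 = f := by
    simp [s₁, initialState, hf]
  have az : ∀ i, i ≠ 0 → s₁.arr i = 0 := fun i hi => by
    funext j
    simp [s₁, initialState, hi]
  refine wp_seq_frame (wp_listsCode (c := 40) (p := 3) (K := K + 80 * b + 80 * m + 60)
    (prefs := G.prefA) (fun j l s => MenRead j l s) (by decide) (by decide) (by decide) rfl rfl r0
    r24 (by rw [a0]; exact i3) (by omega) (fun x => length_le_length_flatten (G.nonemptyA x)) ?_ ?_
    ?_ ?_ ?_) ?_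
  · exact fun j l s s' h harr hreg => h.congr hreg fun i _ => by rw [harr]
  · exact ⟨by simp [s₁, initialState], fun _ _ _ _ h => by simp at h,
      fun x y => Or.inl ⟨by rw [az 7 (by decide)]; rfl, by simp⟩, fun x hx => by omega, by simp⟩
  · intro k₂ s K' x l hf h11 hI hk'
    refine ⟨trivial, trivial, by simp; omega, by simp; omega, ?_⟩
    obtain ⟨h1, h2, h3, h4, h5⟩ := hI
    refine ⟨by simpa using h1, by simpa using h2, by simpa using h3, fun x' hx' => ?_,
      fun p hp => (h5 p hp).trans (Nat.lt_succ_self _)⟩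
    simp [h11, h1]
    by_cases hxx : x' = x
    · subst hxx
      rw [Function.update_self, eq_comm, List.countP_eq_length]
      exact fun p hp => by simpa using h5 p hp
    · rw [Function.update_of_ne hxx]
      exact h4 x' (by omega)
  · intro k₂ s K' l x t y hpre hf h11 h15 h5 hI hk'
    have hlen := hpre.length_le
    rw [he] at hlen
    simp at hlen
    have h1 : s.reg 1 = b := (hf.reg 1 rfl).trans r1
    have hc := hI.cnt
    have := hmul x y
    refine ⟨trivial, trivial, by simp; omega, trivial, trivial, by simp; omega, trivial, trivial,
      by simp; omega, ⟨trivial, by simp; omega, by simp; omega⟩, by simp; omega, ⟨⟨trivial, trivial,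
      ?_⟩, trivial, ?_⟩, trivial, by simp; omega, by simp; omega, ?_⟩
    · simp [h11, h1]
      omega
    · simp [h11, h1, h5]
      omega
    · refine hI.push ?_ ?_ ?_ ?_ ?_ ?_ <;> simp [h11, h1, h5, h15]
  · rw [he]
    simp
    omega
  rintro k₂ s₂ hf₂ ⟨g1, g2, g3⟩
  refine ⟨trivial, trivial, by simp; omega, ?_⟩
  set s₃ : State := _
  change wp W _ _ _ s₃
  -- The end of the last block is stored at position a, which lies outside the positions the
  -- invariant speaks of.
  have g3' : MenRead a G.entries s₃ := by
    obtain ⟨h1, h2, h3, h4, h5⟩ := g3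
    refine ⟨h1, h2, h3, fun x hx => ?_, h5⟩
    have hxa : x ≠ a := hx.ne
    simp only [s₃, State.setArr_arr, if_true, Exp.eval, hf₂.reg 0 rfl, r0]
    rw [Function.update_of_ne hxa]
    exact h4 x hx
  have hFI : s₃.arr 6 a = G.entries.length := by
    simp [s₃, hf₂.reg 0 rfl, r0, g3.cnt, Instance.entries]
  have hidx := g3'.indexed
  refine wp_frame (wp_listsCode (c := 20) (p := 3 + T) (K := K) (prefs := G.prefB)
    (fun j l s => ∀ y t x, (y, t, x) ∈ l → s.arr 5 (G.number x y) = t)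
    (by decide) (by decide) (by decide) rfl rfl ((hf₂.reg 1 rfl).trans r1) g2 ?_ (by omega)
    (fun x => length_le_length_flatten (G.nonemptyB x)) ?_ ?_ ?_ ?_ ?_) ?_
  · have : s₃.arr 0 = s₁.arr 0 := (hf₂.arr 0 rfl)
    rw [this, a0]
    have h4 : ReadsAt f (T + 1 + 1 + 1)
        ((List.finRange b).flatMap fun y => encodeTies (G.prefB y)) := by simpa [← hT, ← Nat.add_assoc] using i4
    rwa [show T + 1 + 1 + 1 = 3 + T by omega] at h4
  · intro j l s s' h harr _
    rwa [harr]
  · simp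
  · intro k₄ s K' x l hf h11 hI hk'
    exact ⟨by omega, by omega, hI⟩
  · intro k₄ s K' l y t x hpre hf h11 h15 h5 hI hk'
    have key : ∀ {y t x}, (y, t, x) ∈ blocks G.prefB (List.finRange b) →
        (x, y) ∈ G.edges ∧ t = G.rankB y x := fun h => by
      obtain ⟨h1, h2⟩ := G.swap.mem_entries.1 h
      exact ⟨mem_edges_swap.1 h1, h2⟩
    obtain ⟨hxy, ht⟩ := key (hpre.subset (List.mem_append_right _ (List.mem_singleton_self _)))
    have h1 : s.reg 1 = b := (hf.reg 1 rfl).trans ((hf₂.reg 1 rfl).trans r1)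
    have h7 : s.arr 7 = s₃.arr 7 := hf.arr 7 rfl
    have := hmul x y
    have hv : s₃.arr 7 (x * b + y) = G.number x y + 1 := by
      rcases hidx x y with ⟨-, h⟩ | ⟨h, -⟩
      · exact absurd hxy h
      · exact h
    refine ⟨⟨⟨⟨trivial, trivial, ?_⟩, trivial, ?_⟩, by simp; omega⟩, trivial, by simp; omega,
      by simp; omega, fun y' t' x' hm => ?_⟩
    · simp [h5, h1]
      omega
    · simp [h11, h1, h5]
      omega
    · simp [h11, h1, h5, h7, hv]
      obtain ⟨hxy', ht'⟩ := key (hpre.subset hm)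
      by_cases heq : G.number x' y' = G.number x y
      · have h8 := (G.number_eq_iff hxy').1 heq
        obtain ⟨_, h9⟩ := List.getElem?_eq_some_iff.1 h8
        obtain ⟨_, h10⟩ := List.getElem?_eq_some_iff.1 ((G.number_eq_iff hxy).1 rfl)
        simp only [h9, Prod.mk.injEq] at h10
        obtain ⟨rfl, -, rfl⟩ := h10
        rw [Function.update_self, h15, ht, ht']
      · rw [Function.update_of_ne heq]
        rcases List.mem_append.1 hm with hm | hm
        · exact hI _ _ _ hm
        · simp at hm
          obtain ⟨rfl, -, rfl⟩ := hm
          exact absurd rfl heq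
  · rw [he']
    simp
    omega
  rintro k₄ s₄ hf₄ ⟨q1, -, q2⟩
  have q3 : MenRead a G.entries s₄ := by
    refine g3'.congr (hf₄.reg 25 rfl) fun i hi => hf₄.arr i ?_
    fin_cases hi <;> rfl
  refine ⟨q1, q3.represents (by rw [hf₄.arr 6 rfl, hFI]) fun {x y} hxy => ?_, ?_, q3.indexed, ?_⟩
  · exact q2 y _ x (G.swap.mem_entries.2 ⟨mem_edges_swap.2 hxy, rfl⟩)
  · exact ⟨(hf₄.reg 0 rfl).trans ((hf₂.reg 0 rfl).trans r0),
      (hf₄.reg 1 rfl).trans ((hf₂.reg 1 rfl).trans r1),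
      (hf₄.reg 2 rfl).trans ((hf₂.reg 2 rfl).trans r2), rfl, rfl, rfl, rfl, rfl⟩
  · intro i hi
    have h1 : ∀ {c : ℕ}, c = 0 ∨ 2 ≤ c ∧ c ≤ 7 → i ≠ c := by omega
    rw [hf₄.arr i, State.setArr_arr, if_neg (h1 (by omega)), hf₂.arr i, az i (h1 (by omega))] <;>
    simp [listsCode, tiesCode, forLoop, Cmd.writesArr, manEntryCode, womanEntryCode, h1]

end SuperStable

/-! ### Correctness of the output, word size and running time -/

namespace SuperStable

open FlatInstance

variable {D : FlatInstance} {a b : ℕ} {G : Instance (Fin a) (Fin b)} {num : Fin a → Fin b → ℕ}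
  {W : ℕ}

/-- The symmetric differences telescope. -/
theorem scanl_symmDiff {α : Type*} [DecidableEq α] (L : List (Finset α)) (Ms : ℕ → Finset α)
    (h : ∀ i (hi : i < L.length), L[i] = Ms i ∆ Ms (i + 1)) :
    L.scanl (· ∆ ·) (Ms 0) = (List.range (L.length + 1)).map Ms := by
  induction L generalizing Ms with
  | nil => rfl
  | cons ρ L ih =>
    have h0 : ρ = Ms 0 ∆ Ms 1 := h 0 (by simp)
    rw [List.scanl_cons, List.length_cons, List.range_succ_eq_map, List.map_cons, List.map_map, h0,
      symmDiff_symmDiff_cancel_left]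
    congr 1
    exact ih (fun i => Ms (i + 1)) fun i hi => h (i + 1) (by simpa using hi)

variable {z : ℕ} {Ms : ℕ → Finset (Fin a × Fin b)}

theorem SuccChain.isMaximalSequence (hc : SuccChain G z Ms)
    (hlast : ∀ N, IsSuperStable G N → ∀ x, height G N x ≤ height G (Ms z) x) :
    IsMaximalSequence G ((List.range (z + 1)).map Ms) := by
  refine ⟨⟨Ms 0, ?_, isManOptimal_iff.2 hc.zero⟩, ⟨Ms z, ?_,
    isWomanOptimal_iff.2 ⟨hc.stable le_rfl, hlast⟩⟩, List.isChain_iff_getElem.2 fun i hi => ?_⟩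
  · simp [List.range_succ_eq_map]
  · simp [List.range_succ]
  · simp at hi ⊢
    exact hc.succ i hi

theorem SuccChain.isCorrect (hc : SuccChain G z Ms)
    (hlast : ∀ N, IsSuperStable G N → ∀ x, height G N x ≤ height G (Ms z) x)
    {R : RotationPoset a b} (h₁ : R.start.Nodup) (h₂ : R.start.toFinset = Ms 0)
    (hlen : R.rotations.length = z) (hrot : ∀ i (hi : i < R.rotations.length),
      R.rotations[i].Nodup ∧ R.rotations[i].toFinset = Ms i ∆ Ms (i + 1))
    (harcs : ∀ l r, (l, r) ∈ R.arcs ↔ ∃ x y, (x, y) ∈ G.edges ∧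
      (PassedOn z Ms l r x y ∨ Overtaken G z Ms l r x y)) : R.IsCorrect G := by
  have hseq := hc.isMaximalSequence hlast
  have hget : ∀ i (hi : i < R.rotationSets.length), R.rotationSets[i] = Ms i ∆ Ms (i + 1) := by
    intro i hi
    simp only [RotationPoset.rotationSets, List.length_map] at hi
    simp only [RotationPoset.rotationSets, List.getElem_map]
    exact (hrot i hi).2
  have hlen' : R.rotationSets.length = z := by simp [RotationPoset.rotationSets, hlen]
  have hdiff : R.rotationSets = differences ((List.range (z + 1)).map Ms) := by
    refine List.ext_getElem (by simp [length_differences, hlen']) fun i h h' => ?_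
    rw [hget i h, getElem_differences h' (by simp; omega)]
    simp
  refine ⟨h₁, fun ρ hρ => ?_, ?_, ?_, ?_, ?_, fun i j => ?_⟩
  · obtain ⟨i, hi, rfl⟩ := List.mem_iff_getElem.1 hρ
    exact (hrot i hi).1
  · rw [h₂]
    exact isManOptimal_iff.2 hc.zero
  · rw [h₂, scanl_symmDiff _ Ms hget, hlen']
    exact hseq
  · rw [hdiff]
    exact hseq.nodup_differences
  · rw [hdiff]
    exact fun ρ => hseq.mem_differences_iff
  · rw [harcs]
    simp only [Option.mem_def, List.getElem?_eq_some_iff]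
    constructor
    · intro h
      have hz : i < z ∧ j < z := by
        obtain ⟨x, y, -, h | h⟩ := h
        · exact ⟨h.1.1, h.2.1⟩
        · exact ⟨h.1.1, h.2.2.1⟩
      refine ⟨_, ⟨hlen'.symm ▸ hz.1, hget i _⟩, _, ⟨hlen'.symm ▸ hz.2, hget j _⟩, ?_⟩
      exact (hc.labelEdge_iff hz.1 hz.2).2 h
    · rintro ⟨ρ', ⟨hi, rfl⟩, ρ, ⟨hj, rfl⟩, h⟩
      rw [hget, hget] at h
      exact (hc.labelEdge_iff (hlen' ▸ hi) (hlen' ▸ hj)).1 h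

/-- The rotation poset is computed from the best matching. -/
def posetCode : Cmd :=
  rowsCode ;; startOutputCode ;; sequenceCode ;; .store 1 (vr 23) (vr 16) ;; arcsCode

/-- The bound B on the output length consists of the start matching, 4a + 1 words for each of at
most m rotations, and two words for each of at most m(b + 1) arcs. It is small enough for all output
addresses to be words. -/
theorem wp_posetCode (hR : Represents D G num) {n : ℕ} (hn : n = D.a + D.b + D.m + 2)
    (hW : n ^ 2 * 32 ≤ W) {k K B : ℕ} {M : Finset (Fin a × Fin b)} {s : State} (hL : Loaded D s)
    (hi : Indexed G num (s.arr 7)) (hM : IsBest G M) (hrow : IsRowOf num M (s.arr 13))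
    (h18 : s.arr 18 = 0) (h19 : s.arr 19 = 0) (hB : B + 8 < W)
    (hlen : 3 + 2 * D.a + D.m * (4 * D.a + 1) + 2 * (D.m * (D.b + 1)) + 2 ≤ B)
    (hk : K + D.a * (450 * D.m + 40) + D.m * (6 * (40 * (D.a + D.b) + 340)) + 160 * D.a +
      D.m * (300 * D.a + 160) + D.m * (60 * D.a + 80 * D.b + 120) + 400 ≤ k) :
    wp W posetCode (fun k' s' => K ≤ k' ∧ ∃ R : RotationPoset a b, R.IsCorrect G ∧
      HasOutput s' (1 :: R.encode)) k s := by
  have haa := hR.ha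
  refine wp_seq_frame (wp_rowsCode (K := K + 160 * D.a + D.m * (300 * D.a + 160) +
    D.m * (60 * D.a + 80 * D.b + 120) + 370) hR hn hW hL hM hrow le_rfl (by omega)) ?_
  rintro k₁ s₁ hf₁ ⟨g1, g2, g3⟩
  have hL₁ := hL.of_frame hf₁ (by decide) (by decide)
  refine wp_seq_frame (wp_startOutputCode (K := K + 20 * D.a + D.m * (300 * D.a + 160) +
    D.m * (60 * D.a + 80 * D.b + 120) + 270) hR hn hW hL₁ hM g2 g3 ((hf₁.arr 18 rfl).trans h18)
    ((hf₁.arr 19 rfl).trans h19) (by omega)) ?_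
  rintro k₂ s₂ hf₂ ⟨j1, l, j2, j3, j4, j5, j6⟩
  have hL₂ := hL₁.of_frame hf₂ (by decide) (by decide)
  have hworse : (worse G M).card ≤ D.m := by
    rw [hR.hm]
    exact Finset.card_filter_le _ _
  have hw1 := Nat.mul_le_mul_right (4 * a + 1) hworse
  have hw2 := Nat.mul_le_mul_right (300 * D.a + 160) hworse
  have hlenL : (1 :: encodeEdges l ++ [0]).length = 3 + 2 * l.length := by
    simp [encodeEdges_eq, length_flatEdges]
    omega
  rw [haa] at hlen
  refine wp_seq_frame (wp_sequenceCode (K := K + D.m * (60 * D.a + 80 * D.b + 120) + 200)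
    (B := 3 + 2 * a + D.m * (4 * a + 1)) hR hn hW hL₂ j6 ⟨?_, by omega⟩ (by omega) le_rfl
    (by omega)) ?_
  · rw [List.flatMap_nil, List.append_nil, hlenL]
    omega
  rintro k₃ s₃ hf₃ ⟨p1, rs, z, Ms, p2, p3, p4⟩
  have hL₃ := hL₂.of_frame hf₃ (by decide) (by decide)
  refine ⟨trivial, trivial, by simp; omega, ?_⟩
  set s₄ : State := _
  change wp W _ _ _ s₄
  have hL₄ : Loaded D s₄ := ⟨hL₃.a, hL₃.b, hL₃.m, hL₃.ex, hL₃.ey, hL₃.er, hL₃.eb, hL₃.fi⟩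
  have e23 : s₃.reg 23 = (1 :: encodeEdges l).length := (hf₃.reg 23 rfl).trans j5
  have hout : OutAt (s₄.arr 1) (s₄.reg 18) (1 :: encodeEdges l ++ z :: rs.flatMap encodeEdges) := by
    have := OutAt.set (L := 1 :: encodeEdges l) (L' := rs.flatMap encodeEdges) (v := 0)
      (by simpa using p2.out) z
    simpa [s₄, e23, p2.reg] using this
  have hi₄ : Indexed G num (s₄.arr 7) := by
    have : s₄.arr 7 = s.arr 7 :=
      (hf₃.arr 7 rfl).trans ((hf₂.arr 7 rfl).trans (hf₁.arr 7 rfl))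
    rwa [this]
  have hbl := p3.1
  refine wp_mono (wp_arcsCode (K := K) (B := B) hR hn hW hL₄ p2.chain p2.recd hi₄ hB ?_ hout
    (by simp; omega)) ?_
  · have : (1 :: encodeEdges l ++ z :: rs.flatMap encodeEdges).length =
        ((1 :: encodeEdges l ++ [0]) ++ rs.flatMap encodeEdges).length := by
      simp [-List.length_flatMap]
    rw [this]
    omega
  · rintro k₅ s₅ ⟨q1, arcs, q2, q3⟩
    refine ⟨q1, ⟨l, rs, arcs⟩, ?_, ?_⟩
    · refine p2.chain.isCorrect p4 j2 ?_ p2.len p2.rots q3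
      rw [j3]
      exact hM.unique p2.chain.zero
    · have : 1 :: (RotationPoset.mk l rs arcs).encode =
          1 :: encodeEdges l ++ z :: rs.flatMap encodeEdges ++ encodePairs arcs := by
        rw [← p2.len]
        simp [RotationPoset.encode, encodeEdges]
        rfl
      rw [this]
      exact q2.2

/-- The whole program. -/
def rotationPosetCode : Cmd :=
  .cond (rd 0 (cst 2))
    (parseCode ;; firstCode ;; .cond (vr 9) posetCode .skip)
    (.store 1 (cst 0) (cst 1))

theorem isCorrect_of_edges_eq_empty (h : G.edges = ∅) :
    (RotationPoset.mk [] [] [] : RotationPoset a b).IsCorrect G := by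
  have hM : ∀ M, IsSuperStable G M → M = ∅ := fun M hM => by
    have := hM.1.1
    rwa [h, Finset.subset_empty] at this
  have h0 : IsSuperStable G ∅ :=
    ⟨⟨Finset.empty_subset _, by simp⟩, fun x y hb => by simpa [h] using hb.1⟩
  have hc : SuccChain G 0 fun _ => ∅ :=
    ⟨⟨h0, fun N hN z => by rw [hM N hN]⟩, fun i hi => absurd hi (Nat.not_lt_zero i)⟩
  refine hc.isCorrect (fun N hN x => by rw [hM N hN]) (by simp) rfl rfl
    (fun i hi => absurd hi (Nat.not_lt_zero i)) fun l r => ?_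
  simp [h]

theorem exists_run (G : Instance (Fin a) (Fin b)) : ∃ (t : ℕ) (s : State),
    t ≤ 20000 * (G.edges.card * (a + b) + 1) ∧
    Exec ((G.edges.card + (a + b) + 2) ^ 7) rotationPosetCode (initialState (encodeInstance G)) t s ∧
    ((¬ (∃ M, IsSuperStable G M) ∧ HasOutput s [0]) ∨
      ∃ R : RotationPoset a b, R.IsCorrect G ∧ HasOutput s (1 :: R.encode)) := by
  set m := G.edges.card with hm
  obtain ⟨n, hn⟩ : ∃ n, n = a + b + m + 2 := ⟨_, rfl⟩
  obtain ⟨W, hW⟩ : ∃ W, W = n ^ 7 := ⟨_, rfl⟩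
  have hnW : n ≤ W := hW ▸ Nat.le_self_pow (by omega) n
  have h2W : 2 < W := by
    rw [hW]
    exact lt_of_lt_of_le (by norm_num : 2 < 2 ^ 7) (Nat.pow_le_pow_left (by omega) 7)
  rw [show m + (a + b) + 2 = n by omega, ← hW]
  have hbd : (initialState (encodeInstance G)).Bounded W := by
    refine ⟨fun r => by simp [initialState]; omega, fun k i => ?_⟩
    simp only [initialState]
    split_ifs
    · rw [List.getD_eq_getElem?_getD]
      rcases hv : (encodeInstance G)[i]? with _ | v
      · simp
        omega
      · have := mem_encodeInstance_lt G (List.mem_of_getElem? hv)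
        simp
        omega
    · omega
  suffices h : wp W rotationPosetCode (fun _ s =>
      (¬ (∃ M, IsSuperStable G M) ∧ HasOutput s [0]) ∨
      ∃ R : RotationPoset a b, R.IsCorrect G ∧ HasOutput s (1 :: R.encode))
      (20000 * (m * (a + b) + 1)) (initialState (encodeInstance G)) by
    obtain ⟨t, s, h1, h2, -, h3⟩ := wp_sound h hbd
    exact ⟨t, s, h2, h1, h3⟩
  have hval : (rd 0 (cst 2)).eval (initialState (encodeInstance G)) = m := by
    simp [initialState, encodeInstance, hm]
  refine ⟨h2W, by simp; omega, fun hne => ?_, fun h0 => ?_⟩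
  swap
  -- Without edges the time bound is a constant, so not even the vertices may be scanned. The answer
  -- 1, 0, 0, 0 needs a single store, the rest being zero already.
  · rw [hval, hm, Finset.card_eq_zero] at h0
    refine ⟨by simp; omega, by simp; omega, by simp; omega, Or.inr ⟨_, isCorrect_of_edges_eq_empty h0, ?_⟩⟩
    intro i hi
    simp [RotationPoset.encode, encodePairs] at hi
    have : i = 0 ∨ i = 1 ∨ i = 2 ∨ i = 3 := by omega
    rcases this with rfl | rfl | rfl | rfl <;>
    simp [RotationPoset.encode, encodePairs, initialState]
  rw [hval] at hne
  obtain ⟨⟨x, y⟩, -⟩ := Finset.card_pos.1 (Nat.pos_of_ne_zero hne)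
  have ha := x.2
  have hb := y.2
  -- The exponent 7 = 2 + 5: the addresses are of order n², and the factor 32 = 2⁵ is absorbed since
  -- n ≥ 2.
  have h32 : n ^ 2 * 32 ≤ W := by
    rw [hW, show 7 = 2 + 5 from rfl, pow_add]
    refine Nat.mul_le_mul_left _ ?_
    calc 32 = 2 ^ 5 := rfl
      _ ≤ n ^ 5 := Nat.pow_le_pow_left (by omega) 5
  have hn5 : 5 ≤ n := by omega
  obtain ⟨P, hP⟩ : ∃ P, P = m * a := ⟨_, rfl⟩
  obtain ⟨Q, hQ⟩ : ∃ Q, Q = m * b := ⟨_, rfl⟩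
  -- From here on a, b and m are positive, so all linear terms are absorbed by ma and mb. These
  -- products are abstracted to P and Q to keep the arithmetic linear.
  have hPa : a ≤ P := hP ▸ Nat.le_mul_of_pos_left a (Nat.pos_of_ne_zero hne)
  have hQb : b ≤ Q := hQ ▸ Nat.le_mul_of_pos_left b (Nat.pos_of_ne_zero hne)
  have hPm : m ≤ P := hP ▸ Nat.le_mul_of_pos_right m (by omega)
  have hQm : m ≤ Q := hQ ▸ Nat.le_mul_of_pos_right m (by omega)
  have hPQ : m * (a + b) = P + Q := by rw [hP, hQ, Nat.mul_add]
  rw [hPQ]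
  refine wp_seq_frame (wp_parseCode (K := 10000 * (P + Q)) hn h32 (by simp; omega)) ?_
  rintro k₁ s₁ hf₁ ⟨g1, hR, hL, g4, g5⟩
  set D := FlatInstance.ofState G s₁
  have hDa : D.a = a := rfl
  have hDb : D.b = b := rfl
  have hDm : D.m = m := rfl
  have hn2 : n ≤ n ^ 2 := Nat.le_self_pow (by omega) n
  refine wp_seq_frame (wp_firstCode (K := 8000 * (P + Q)) hR (by omega) hL (by omega)) ?_
  rintro k₂ s₂ hf₂ ⟨q1, q2⟩
  have hL₂ := hL.of_frame hf₂ (by decide) (by decide)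
  refine ⟨trivial, by simp; omega, fun h => ?_, fun h => ⟨by simp; omega, ?_⟩⟩
  · rcases q2 with ⟨h9, -⟩ | ⟨-, M, q3, q4⟩
    · exact absurd h9 h
    obtain ⟨B, hBdef⟩ : ∃ B, B = 5 + 2 * a + 4 * P + 2 * Q + 3 * m := ⟨_, rfl⟩
    refine wp_mono (wp_posetCode (K := 0) (B := B) hR hn h32 hL₂ ?_ q3 q4 ?_ ?_ ?_ ?_ ?_)
      fun k' s' h' => Or.inr h'.2
    · rwa [hf₂.arr 7 rfl]
    · exact (hf₂.arr 18 rfl).trans (g5 18 (by omega))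
    · exact (hf₂.arr 19 rfl).trans (g5 19 (by omega))
    · have h1 : P ≤ n ^ 2 := by
        rw [hP, sq]
        exact Nat.mul_le_mul (by omega) (by omega)
      have h2 : Q ≤ n ^ 2 := by
        rw [hQ, sq]
        exact Nat.mul_le_mul (by omega) (by omega)
      omega
    · rw [hDa, hDb, hDm]
      have : 3 + 2 * a + m * (4 * a + 1) + 2 * (m * (b + 1)) + 2 = B := by
        rw [hBdef, hP, hQ]
        ring
      omega
    · rw [hDa, hDb, hDm]
      have : 0 + a * (450 * m + 40) + m * (6 * (40 * (a + b) + 340)) + 160 * a +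
          m * (300 * a + 160) + m * (60 * a + 80 * b + 120) + 400 =
          1050 * P + 320 * Q + 200 * a + 2320 * m + 400 := by
        rw [hP, hQ]
        ring
      rw [this]
      simp
      omega
  · rcases q2 with ⟨-, q3⟩ | ⟨h9, -⟩
    -- The answer 0 is not written: the output array is still zero.
    · refine Or.inl ⟨q3, fun i hi => ?_⟩
      obtain rfl : i = 0 := by simpa using hi
      rw [hf₂.arr 1 rfl, g5 1 (Or.inl rfl)]
      rfl
    · exact absurd h h9

end SuperStable

theorem mainTheorem6 :
    -- the structure of the set of super-stable matchings
    (∀ (A B : Type*) [Fintype A] [Fintype B] [DecidableEq A] [DecidableEq B] (G : Instance A B),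
      -- if there is a super-stable matching, there is a maximal sequence of them
      ((∃ M, IsSuperStable G M) → ∃ L, IsMaximalSequence G L) ∧
      -- each maximal sequence contains every rotation exactly once
      (∀ L, IsMaximalSequence G L →
        (differences L).Nodup ∧ ∀ ρ, ρ ∈ differences L ↔ IsRotation G ρ) ∧
      -- precedence is a strict partial order
      (∀ ρ, ¬ Precedes G ρ ρ) ∧
      (∀ ρ₁ ρ₂ ρ₃, Precedes G ρ₁ ρ₂ → Precedes G ρ₂ ρ₃ → Precedes G ρ₁ ρ₃) ∧
      -- closed sets of rotations represent the super-stable matchings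
      (∀ M₀, IsManOptimal G M₀ →
        Set.BijOn (eliminate M₀) {S | IsClosedSet G S} {M | IsSuperStable G M} ∧
        ∀ S S', IsClosedSet G S → IsClosedSet G S' →
          (Dominates G (eliminate M₀ S) (eliminate M₀ S') ↔ S ⊆ S')) ∧
      -- precedence is the transitive closure of the digraph given by the two types of labels
      (∀ ρ' ρ, Relation.TransGen (LabelEdge G) ρ' ρ ↔ Precedes G ρ' ρ)) ∧
    -- construction in time `O(mn)` on a RAM with words of `O(log (m + n))` bits
    (∃ (p : Cmd) (C k : ℕ), ∀ (a b : ℕ) (G : Instance (Fin a) (Fin b)),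
      ∃ (t : ℕ) (s : State),
        t ≤ C * (G.edges.card * (a + b) + 1) ∧
        Exec ((G.edges.card + (a + b) + 2) ^ k) p (initialState (encodeInstance G)) t s ∧
        ((¬ (∃ M, IsSuperStable G M) ∧ HasOutput s [0]) ∨
          ∃ R : RotationPoset a b, R.IsCorrect G ∧ HasOutput s (1 :: R.encode))) := ⟨fun _ _ _ _ _ _ G => rotation_structure G, rotationPosetCode, 20000, 7, fun _ _ G => exists_run G⟩
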